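/- Let $T>0$, let $d,d',m$ be nonnegative integers, and let $\mu$ be a signed $d\times d'$-matrix valued measure on $\mathbb R_+=[0,\infty)$ (countably additive on bounded Borel sets) whose total variation $|\mu|$ satisfies $$\int_{\mathbb R_+}\bigl(1\wedge\theta^{-1/2}\bigr)\,|\mu|(d\theta)<\infty .$$ Let $B,D\in\mathbb R^{d'\times d}$, $C,F\in\mathbb R^{d'\times m}$, $L\in\mathbb R^d$, let $g_0:[0,T]\to\mathbb R^d$ and $\beta,\gamma:[0,T]\to\mathbb R^{d'}$ be bounded measurable functions, and put $\tilde\beta=\beta+Bg_0$, $\tilde\gamma=\gamma+Dg_0$. Let $Q\in\mathbb R^{d\times d}$ be symmetric nonnegative and let $N\in\mathbb R^{m\times m}$ be such that $N-\lambda I_m$ is symmetric nonnegative for some $\lambda>0$. Let $L^1(\mu\otimes\mu)$ be the space of ($|\mu|\otimes|\mu|$-a.e. classes of) $|\mu|\otimes|\mu|$-integrable functions $\mathbb R_+^2\to\mathbb R^{d\times d}$, $L^\infty(\mu\otimes\mu)$ its essentially bounded analogue, $L^1(\mu)$ the space of $|\mu|$-integrable functions $\mathbb R_+\to\mathbb R^{d'}$,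 and $L^1(\mu^\top)$ the space of $|\mu|$-integrable functions $\mathbb R_+\to\mathbb R^{d}$. Let $\mathbb S^d_+(\mu\otimes\mu)$ be the set of $\Gamma\in L^\infty(\mu\otimes\mu)$ such that $\Gamma(\theta,\tau)=\Gamma(\tau,\theta)^\top$ for $\mu\otimes\mu$-a.e. $(\theta,\tau)$ and $\int_{\mathbb R_+^2}\varphi(\theta)^\top\mu(d\theta)^\top\Gamma(\theta,\tau)\mu(d\tau)\varphi(\tau)\ge 0$ for all $\varphi\in L^1(\mu)$. Writing $I(\Gamma)=\int_{\mathbb R_+^2}\mu(d\theta)^\top\Gamma(\theta,\tau)\mu(d\tau)$, define \begin{align*} S(\Gamma)(\tau)&=C^\top\int_{\mathbb R_+}\mu(d\theta)^\top\Gamma(\theta,\tau)+F^\top I(\Gamma)D,\qquad \hat N(\Gamma)=N+F^\top I(\Gamma)F,\\ h(t,\Gamma,\Lambda)&=C^\top\int_{\mathbb R_+}\mu(d\theta)^\top\Lambda(\theta)+F^\top I(\Gamma)\tilde\gamma(t),\\ \mathcal R_1(\Gamma)(\theta,\tau)&=Q+D^\top I(\Gamma)D+B^\top\int_{\mathbb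 R_+}\mu(d\theta')^\top\Gamma(\theta',\tau)+\int_{\mathbb R_+}\Gamma(\theta,\tau')\mu(d\tau')B-S(\Gamma)(\theta)^\top\hat N(\Gamma)^{-1}S(\Gamma)(\tau),\\ \mathcal R_2(t,\Gamma,\Lambda)(\theta)&=L+Qg_0(t)+B^\top\int_{\mathbb R_+}\mu(d\theta')^\top\Lambda(\theta')+\int_{\mathbb R_+}\Gamma(\theta,\tau')\mu(d\tau')\tilde\beta(t)+D^\top I(\Gamma)\tilde\gamma(t)-S(\Gamma)(\theta)^\top\hat N(\Gamma)^{-1}h(t,\Gamma,\Lambda),\\ \mathcal R_3(t,\Gamma,\Lambda)&=g_0(t)^\top Qg_0(t)+2L^\top g_0(t)+\tilde\gamma(t)^\top I(\Gamma)\tilde\gamma(t)+2\tilde\beta(t)^\top\int_{\mathbb R_+}\mu(d\theta')^\top\Lambda(\theta')-h(t,\Gamma,\Lambda)^\top\hat N(\Gamma)^{-1}h(t,\Gamma,\Lambda). \end{align*} Then there is a unique triplet $(\Gamma,\Lambda,\chi)\in C([0,T],L^1(\mu\otimes\mu))\times C([0,T],L^1(\mu^\top))\times C([0,T],\mathbb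 R)$ such that $\Gamma_t\in\mathbb S^d_+(\mu\otimes\mu)$ and $\hat N(\Gamma_t)$ is invertible for all $t\in[0,T]$, and for all $t\in[0,T]$ \begin{align*} \Gamma_t(\theta,\tau)&=\int_t^Te^{-(\theta+\tau)(s-t)}\mathcal R_1(\Gamma_s)(\theta,\tau)\,ds &&\text{for }\mu\otimes\mu\text{-a.e. }(\theta,\tau),\\ \Lambda_t(\theta)&=\int_t^Te^{-\theta(s-t)}\mathcal R_2(s,\Gamma_s,\Lambda_s)(\theta)\,ds &&\text{for }\mu\text{-a.e. }\theta,\\ \chi_t&=\int_t^T\mathcal R_3(s,\Gamma_s,\Lambda_s)\,ds, \end{align*} where the integrands are integrable in $s$ and $\Gamma,\Lambda$ are evaluated through versions that are jointly measurable in time and space. Furthermore, there is a constant $M>0$ such that, for every $t\in[0,T]$, $$\int_{\mathbb R_+}|\mu|(d\tau)\,|\Gamma_t(\theta,\tau)|\le M\qquad\text{for }\mu\text{-a.e. }\theta .$$ -/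

import Mathlib

open MeasureTheory Set
open scoped Matrix NNReal ENNReal

noncomputable section

/-- The normed space of `a × b`-matrices with the Frobenius norm `|A| = (∑ A_ij²)^(1/2)`. -/
abbrev FrobMatrix (a b : ℕ) : Type := EuclideanSpace ℝ (Fin a × Fin b)

/-- A (signed) `d × d'`-matrix valued measure on `ℝ₊`, defined on the bounded Borel sets, where it
is countably additive; its total variation on `ℝ₊` may be infinite. The values of `toFun` on other
sets are never used. -/
structure MatrixMeasure (d d' : ℕ) where
  /-- the mass of a bounded Borel set -/
  toFun : Set ℝ≥0 → Matrix (Fin d) (Fin d') ℝ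
  hasSum_iUnion : ∀ E : ℕ → Set ℝ≥0, (∀ n, MeasurableSet (E n)) →
    Pairwise (Function.onFun Disjoint E) → Bornology.IsBounded (⋃ n, E n) →
    HasSum (fun n => toFun (E n)) (toFun (⋃ n, E n))

namespace MatrixMeasure

variable {d d' k : ℕ} (μ : MatrixMeasure d d')

theorem toFun_empty : μ.toFun ∅ = 0 := by
  have h := μ.hasSum_iUnion (fun _ => ∅) (fun _ => MeasurableSet.empty)
    (fun _ _ _ => by simp [Function.onFun]) (by simp)
  simp only [iUnion_empty] at h
  exact tendsto_nhds_unique tendsto_const_nhds h.summable.tendsto_atTop_zero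

open scoped Classical in
/-- The restriction `E ↦ μ (E ∩ [n, n + 1))`, a finite matrix valued vector measure. -/
def piece (n : ℕ) : VectorMeasure ℝ≥0 (FrobMatrix d d') where
  measureOf' E := if MeasurableSet E then
    WithLp.toLp 2 fun p => μ.toFun (E ∩ Ico (n : ℝ≥0) (n + 1)) p.1 p.2 else 0
  empty' := by simp [toFun_empty]; rfl
  not_measurable' E hE := by simp [hE]
  m_iUnion' E hE hd := by
    have hb : Bornology.IsBounded (⋃ i, E i ∩ Ico (n : ℝ≥0) (n + 1)) :=
      (Metric.isBounded_Ico (n : ℝ≥0) (n + 1)).subset (iUnion_subset fun _ => inter_subset_right)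
    have h := μ.hasSum_iUnion (fun i => E i ∩ Ico (n : ℝ≥0) (n + 1))
      (fun i => (hE i).inter measurableSet_Ico)
      (fun i j hij => (hd hij).mono inter_subset_left inter_subset_left) hb
    have hc : Continuous fun A : Matrix (Fin d) (Fin d') ℝ =>
        (WithLp.toLp 2 fun p => A p.1 p.2 : FrobMatrix d d') := by
      refine (PiLp.continuous_toLp 2 _).comp (continuous_pi fun p => ?_)
      exact continuous_id.matrix_elem p.1 p.2
    have h' := h.map ({ toFun := fun A => WithLp.toLp 2 fun p => A p.1 p.2
                        map_zero' := rfl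
                        map_add' := fun _ _ => rfl } :
      Matrix (Fin d) (Fin d') ℝ →+ FrobMatrix d d') hc
    simp only [hE, MeasurableSet.iUnion hE, iUnion_inter, if_true]
    exact h'

/-- The total variation `|μ|`, a nonnegative measure on `ℝ₊`. -/
def totalVar : Measure ℝ≥0 := Measure.sum fun n => (μ.piece n).variation

/-- The entry `μ_ij`, restricted to `[n, n + 1)`. -/
def entryPiece (n : ℕ) (i : Fin d) (j : Fin d') : SignedMeasure ℝ≥0 where
  measureOf' E := μ.piece n E (i, j)
  empty' := by simp
  not_measurable' E hE := by simp [(μ.piece n).not_measurable hE]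
  m_iUnion' E hE hd :=
    ((μ.piece n).m_iUnion hE hd).map (EuclideanSpace.proj (𝕜 := ℝ) (i, j))
      (EuclideanSpace.proj (𝕜 := ℝ) (i, j)).continuous

/-- The positive part of the Jordan decomposition of the entry `μ_ij`. -/
def posPart (i : Fin d) (j : Fin d') : Measure ℝ≥0 :=
  Measure.sum fun n => (μ.entryPiece n i j).toJordanDecomposition.posPart

/-- The negative part of the Jordan decomposition of the entry `μ_ij`. -/
def negPart (i : Fin d) (j : Fin d') : Measure ℝ≥0 :=
  Measure.sum fun n => (μ.entryPiece n i j).toJordanDecomposition.negPart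

/-- The scalar integral `∫ f(θ) μ_ij(dθ)`. -/
def entryIntegral (i : Fin d) (j : Fin d') (f : ℝ≥0 → ℝ) : ℝ :=
  (∫ θ, f θ ∂(μ.posPart i j)) - ∫ θ, f θ ∂(μ.negPart i j)

/-- `∫ μ(dθ)ᵀ Φ(θ)` for a matrix valued function `Φ`. -/
def leftIntegral (Φ : ℝ≥0 → Matrix (Fin d) (Fin k) ℝ) : Matrix (Fin d') (Fin k) ℝ :=
  Matrix.of fun i j => ∑ l, μ.entryIntegral l i fun θ => Φ θ l j

/-- `∫ Φ(τ) μ(dτ)` for a matrix valued function `Φ`. -/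
def rightIntegral (Φ : ℝ≥0 → Matrix (Fin k) (Fin d) ℝ) : Matrix (Fin k) (Fin d') ℝ :=
  Matrix.of fun i j => ∑ l, μ.entryIntegral l j fun τ => Φ τ i l

/-- `∫ μ(dθ)ᵀ f(θ)` for a vector valued function `f`. -/
def vecIntegral (f : ℝ≥0 → Fin d → ℝ) : Fin d' → ℝ :=
  fun i => ∑ l, μ.entryIntegral l i fun θ => f θ l

/-- `∫ f(θ)ᵀ μ(dθ) φ(θ)`. -/
def pairing (f : ℝ≥0 → Fin d → ℝ) (φ : ℝ≥0 → Fin d' → ℝ) : ℝ :=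
  ∑ l, ∑ i, μ.entryIntegral l i fun θ => f θ l * φ θ i

/-- `∬ μ(dθ)ᵀ G(θ,τ) μ(dτ)`, as an iterated integral. -/
def doubleIntegral (G : ℝ≥0 → ℝ≥0 → Matrix (Fin d) (Fin d) ℝ) : Matrix (Fin d') (Fin d') ℝ :=
  μ.leftIntegral fun θ => μ.rightIntegral fun τ => G θ τ

/-- The space `L¹(μ ⊗ μ)` of `d × d`-matrix valued kernels. -/
abbrev KernelL1 : Type :=
  Lp (FrobMatrix d d) 1 (μ.totalVar.prod μ.totalVar)

/-- The space `L¹(μᵀ)` of `ℝᵈ`-valued functions (note `|μᵀ| = |μ|`). -/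
abbrev VecL1 : Type := Lp (EuclideanSpace ℝ (Fin d)) 1 μ.totalVar

/-- Membership in `S₊ᵈ(μ ⊗ μ)`: essentially bounded, symmetric and nonnegative kernels. The last
field is `∬ φ(θ)ᵀ μ(dθ)ᵀ Γ(θ,τ) μ(dτ) φ(τ) ≥ 0` for all `φ ∈ L¹(μ)`. -/
structure IsSymmNonneg (Γ : ℝ≥0 × ℝ≥0 → FrobMatrix d d) : Prop where
  memLp_top : MemLp Γ ∞ (μ.totalVar.prod μ.totalVar)
  symm : ∀ᵐ q ∂(μ.totalVar.prod μ.totalVar), ∀ i j,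
    Γ (q.1, q.2) (i, j) = Γ (q.2, q.1) (j, i)
  nonneg : ∀ φ : ℝ≥0 → Fin d' → ℝ, Integrable φ μ.totalVar →
    0 ≤ μ.pairing (fun θ l => μ.pairing (fun τ j => Γ (θ, τ) (l, j)) φ) φ

end MatrixMeasure

/-- The data of the linear-quadratic Volterra control problem. -/
structure LQData (d d' m : ℕ) where
  μ : MatrixMeasure d d'
  B : Matrix (Fin d') (Fin d) ℝ
  C : Matrix (Fin d') (Fin m) ℝ
  D : Matrix (Fin d') (Fin d) ℝ
  F : Matrix (Fin d') (Fin m) ℝ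
  Q : Matrix (Fin d) (Fin d) ℝ
  N : Matrix (Fin m) (Fin m) ℝ
  L : Fin d → ℝ
  g₀ : ℝ → Fin d → ℝ
  β : ℝ → Fin d' → ℝ
  γ : ℝ → Fin d' → ℝ

namespace LQData

variable {d d' m : ℕ} (P : LQData d d' m)

/-- `β̃ = β + B g₀`. -/
def βt (t : ℝ) : Fin d' → ℝ := P.β t + P.B *ᵥ P.g₀ t

/-- `γ̃ = γ + D g₀`. -/
def γt (t : ℝ) : Fin d' → ℝ := P.γ t + P.D *ᵥ P.g₀ t

/-- `S(Γ)(τ) = Cᵀ ∫ μ(dθ)ᵀ Γ(θ,τ) + Fᵀ ∬ μ(dθ')ᵀ Γ(θ',τ') μ(dτ') D`. -/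
def S (G : ℝ≥0 → ℝ≥0 → Matrix (Fin d) (Fin d) ℝ) (τ : ℝ≥0) : Matrix (Fin m) (Fin d) ℝ :=
  P.Cᵀ * P.μ.leftIntegral (fun θ => G θ τ) + P.Fᵀ * P.μ.doubleIntegral G * P.D

/-- `N̂(Γ) = N + Fᵀ ∬ μ(dθ)ᵀ Γ(θ,τ) μ(dτ) F`. -/
def Nhat (G : ℝ≥0 → ℝ≥0 → Matrix (Fin d) (Fin d) ℝ) : Matrix (Fin m) (Fin m) ℝ :=
  P.N + P.Fᵀ * P.μ.doubleIntegral G * P.F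

/-- `h(t,Γ,Λ) = Cᵀ ∫ μ(dθ)ᵀ Λ(θ) + Fᵀ ∬ μ(dθ)ᵀ Γ(θ,τ) μ(dτ) γ̃(t)`. -/
def h (t : ℝ) (G : ℝ≥0 → ℝ≥0 → Matrix (Fin d) (Fin d) ℝ) (l : ℝ≥0 → Fin d → ℝ) : Fin m → ℝ :=
  P.Cᵀ *ᵥ P.μ.vecIntegral l + (P.Fᵀ * P.μ.doubleIntegral G) *ᵥ P.γt t

/-- The right-hand side `R₁(Γ)(θ,τ)` of the Riccati equation for `Γ`. -/
def R₁ (G : ℝ≥0 → ℝ≥0 → Matrix (Fin d) (Fin d) ℝ) (θ τ : ℝ≥0) : Matrix (Fin d) (Fin d) ℝ :=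
  P.Q + P.Dᵀ * P.μ.doubleIntegral G * P.D
    + P.Bᵀ * P.μ.leftIntegral (fun θ' => G θ' τ)
    + P.μ.rightIntegral (fun τ' => G θ τ') * P.B
    - (P.S G θ)ᵀ * (P.Nhat G)⁻¹ * P.S G τ

/-- The right-hand side `R₂(t,Γ,Λ)(θ)` of the equation for `Λ`. -/
def R₂ (t : ℝ) (G : ℝ≥0 → ℝ≥0 → Matrix (Fin d) (Fin d) ℝ) (l : ℝ≥0 → Fin d → ℝ) (θ : ℝ≥0) :
    Fin d → ℝ :=
  P.L + P.Q *ᵥ P.g₀ t + P.Bᵀ *ᵥ P.μ.vecIntegral l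
    + P.μ.rightIntegral (fun τ' => G θ τ') *ᵥ P.βt t
    + (P.Dᵀ * P.μ.doubleIntegral G) *ᵥ P.γt t
    - ((P.S G θ)ᵀ * (P.Nhat G)⁻¹) *ᵥ P.h t G l

/-- The right-hand side `R₃(t,Γ,Λ)` of the equation for `χ`. -/
def R₃ (t : ℝ) (G : ℝ≥0 → ℝ≥0 → Matrix (Fin d) (Fin d) ℝ) (l : ℝ≥0 → Fin d → ℝ) : ℝ :=
  P.g₀ t ⬝ᵥ (P.Q *ᵥ P.g₀ t) + 2 * (P.L ⬝ᵥ P.g₀ t)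
    + P.γt t ⬝ᵥ (P.μ.doubleIntegral G *ᵥ P.γt t)
    + 2 * (P.βt t ⬝ᵥ P.μ.vecIntegral l)
    - P.h t G l ⬝ᵥ ((P.Nhat G)⁻¹ *ᵥ P.h t G l)

/-- `(Γ, Λ, χ) ∈ C([0,T], L¹(μ⊗μ)) × C([0,T], L¹(μᵀ)) × C([0,T])` is a mild solution of the
Riccati system. The curves `t ↦ Γ_t`, `t ↦ Λ_t` are evaluated at points through versions `G`, `l`
that are jointly measurable in time and space; two such versions of the same curves satisfy the
same equations almost everywhere. -/
def IsMildSolution (T : ℝ) (Γ : C(Icc (0 : ℝ) T, P.μ.KernelL1))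
    (Λ : C(Icc (0 : ℝ) T, P.μ.VecL1)) (χ : C(Icc (0 : ℝ) T, ℝ)) : Prop :=
  ∃ (G : ℝ → ℝ≥0 → ℝ≥0 → Matrix (Fin d) (Fin d) ℝ) (l : ℝ → ℝ≥0 → Fin d → ℝ),
    (∀ i j, Measurable fun q : ℝ × ℝ≥0 × ℝ≥0 => G q.1 q.2.1 q.2.2 i j) ∧
    (∀ i, Measurable fun q : ℝ × ℝ≥0 => l q.1 q.2 i) ∧
    (∀ t : Icc (0 : ℝ) T, ∀ᵐ q ∂(P.μ.totalVar.prod P.μ.totalVar), ∀ i j,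
      Γ t q (i, j) = G t q.1 q.2 i j) ∧
    (∀ t : Icc (0 : ℝ) T, ∀ᵐ θ ∂P.μ.totalVar, ∀ i, Λ t θ i = l t θ i) ∧
    (∀ t : Icc (0 : ℝ) T, IsUnit (P.Nhat (G t))) ∧
    (∀ t : Icc (0 : ℝ) T, ∀ᵐ q ∂(P.μ.totalVar.prod P.μ.totalVar), ∀ i j,
      IntervalIntegrable
        (fun s => Real.exp (-((q.1 : ℝ) + q.2) * (s - t)) * P.R₁ (G s) q.1 q.2 i j) volume t T ∧
      Γ t q (i, j) =
        ∫ s in (t : ℝ)..T, Real.exp (-((q.1 : ℝ) + q.2) * (s - t)) * P.R₁ (G s) q.1 q.2 i j) ∧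
    (∀ t : Icc (0 : ℝ) T, ∀ᵐ θ : ℝ≥0 ∂P.μ.totalVar, ∀ i,
      IntervalIntegrable
        (fun s => Real.exp (-(θ : ℝ) * (s - t)) * P.R₂ s (G s) (l s) θ i) volume t T ∧
      Λ t θ i = ∫ s in (t : ℝ)..T, Real.exp (-(θ : ℝ) * (s - t)) * P.R₂ s (G s) (l s) θ i) ∧
    (∀ t : Icc (0 : ℝ) T,
      IntervalIntegrable (fun s => P.R₃ s (G s) (l s)) volume t T ∧
      χ t = ∫ s in (t : ℝ)..T, P.R₃ s (G s) (l s))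

end LQData

end

/-!
Existence and uniqueness for the infinite-dimensional Riccati system.

*Reduction to scalar kernels.* The entries of `μ` have bounded densities with respect to the total
variation, and the total variation has `∫ min 1 θ^(-1/2) < ∞`. A matrix kernel on `ℝ₊ × ℝ₊` is
flattened to a scalar kernel on `Y × Y`, with `Y = ℝ₊ × {1, …, d}` (`FactorModel`,
`MatrixMeasure.factorModel`, `MatrixMeasure.flat`). Its integral in one variable against `μ` gives
a vector for each point of `Y` (`avec`), and its double integral is the matrix `I = imat`. The
right-hand side `R₁` at a pair of points is then a function `LQData.Phi` of these
finite-dimensional quantities only, the inverse of `N + Fᵀ I F` being the sole nonlinearity that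
is not polynomial.

*The weight.* Put `wt l ϑ = (ϑ + l)^(-1/2)`. Since `1 / (ϑ + ϑ' + 2 l) ≤ wt l ϑ * wt l ϑ'`, the
integral operator `mild` with rate `ϑ + ϑ' + 2 l` maps bounded right-hand sides to kernels bounded
by a multiple of `wt ⊗ wt`, and these are integrable against `μ ⊗ μ`. The norm of the resulting
map is controlled by `kap l = ∫ wt l`, which tends to `0` as `l → ∞` by dominated convergence
(`FactorModel.exists_kap_le`). So a change of the exponential rate in time, by a factor `e^{2 l (T
- s)}`, turns the equations into contractions on all of `[0, T]`.

*Existence.* The contraction needs an a priori bound on `avec`, and coercivity of `N + Fᵀ I F`.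
Both come from nonnegativity of the kernels, as in the finite-dimensional linear-quadratic
problem, but nonnegativity is not visibly preserved by the Riccati map. It is preserved after the
equation has been regularized with a time step `h`: with the additional rate `1 / h` the
right-hand side becomes `Γ / h + R₁`, and a correction of order `h` in `R₁` makes this sum a
minimum over controls of nonnegative quadratic expressions, hence nonnegative (`rker_nonneg`);
taking the control to be zero bounds it from above (`bil_rker_le`). The class of kernels given by
these two bounds is invariant and closed (`Invariant`, `Invariant.map_step`). A nonnegative kernel
whose quadratic form is bounded has almost everywhere bounded `avec` (`PSD.ae_abs_avec_le`), so
that the truncation `clampVec`, which makes the right-hand side globally Lipschitz, is not active.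
This solves the regularized equation (`exists_regularized`); the additional rate is undone by
`mild_change_rate`, and the solutions for `h = 2^(-n)` form a geometric Cauchy sequence whose
limit solves the Riccati equation (`exists_riccati`). The equation for `Λ` is linear and has a
solution by the contraction argument alone (`exists_linear`), and `χ` is an integral.

*Uniqueness.* Solutions are only assumed integrable. For a solution in `L¹`, nonnegativity tested
on truncated constant functions gives `I ≥ 0` (`IsSymmNonneg.imat_nonneg`), whence coercivity of
`N + Fᵀ I F`, and continuity in time bounds the integrals of the solution. The integrated
difference to the solution constructed above then satisfies a Volterra inequality whose kernel is
a product of Laplace transforms of the total variation. With the additional rate `2 l` the time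
integral of this kernel is a double integral of `1 / (ϑ + ϑ' + 2 l)`, at most `kap l ^ 2` up to
lower-order terms, hence small for large `l`, and a Gronwall argument gives zero
(`eq_zero_of_le_lintegral`, `L1Solution.ae_eq`, `L1LinSolution.ae_eq`).

*Null sets.* `R₁` contains integrals over the first variable and over the second, taken of two
different sections of the kernel. They agree for almost every time and almost every point by
symmetry and Fubini (`ae_ae_R₁_eq`), and this passes between the equation for the classes and that
for the jointly measurable versions. The bound `|Γ| ≤ C wt ⊗ wt` gives essential boundedness and
the constant in the last assertion.
-/

noncomputable section

set_option linter.unusedSectionVars false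

open Filter Topology
open scoped Matrix.Norms.Operator

/-! ### Picard iteration in weighted supremum norms -/

/-- A sequence of functions whose increments decay geometrically relative to a weight converges
at a geometric rate relative to that weight. -/
theorem exists_limit_of_geometric {Z : Type*} {W : Z → ℝ} {f : ℕ → Z → ℝ} {C : ℝ}
    (h : ∀ n z, |f (n + 1) z - f n z| ≤ C * (1 / 2) ^ n * W z) :
    ∃ g : Z → ℝ, ∀ n z, |f n z - g z| ≤ 2 * C * (1 / 2) ^ n * W z := by
  have h2 : ∀ z n, dist (f n z) (f (n + 1) z) ≤ (2 * C * W z) / 2 / 2 ^ n := fun z n => by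
    rw [dist_comm, Real.dist_eq]
    refine (h n z).trans (le_of_eq ?_)
    rw [one_div, inv_pow]; field_simp
  have hc : ∀ z, ∃ a, Tendsto (fun n => f n z) atTop (𝓝 a) := fun z =>
    cauchySeq_tendsto_of_complete (cauchySeq_of_le_geometric_two (h2 z))
  choose g hg using hc
  refine ⟨g, fun n z => ?_⟩
  have := dist_le_of_le_geometric_two_of_tendsto (h2 z) (hg z) n
  rw [Real.dist_eq] at this
  refine this.trans (le_of_eq ?_)
  rw [one_div, inv_pow]; field_simp

theorem tendsto_of_geometric {f : ℕ → ℝ} {g C : ℝ} (h : ∀ n, |f n - g| ≤ C * (1 / 2) ^ n) :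
    Tendsto f atTop (𝓝 g) := by
  rw [tendsto_iff_dist_tendsto_zero]
  refine squeeze_zero (fun _ => dist_nonneg) (fun n => h n) ?_
  simpa using (tendsto_pow_atTop_nhds_zero_of_lt_one (by norm_num : (0 : ℝ) ≤ 1 / 2)
    (by norm_num)).const_mul C

/-- Banach's fixed point theorem for a map that contracts by `1/2` with respect to a weighted
supremum norm on a closed class of real functions. -/
theorem exists_fixedPoint_of_weighted {Z : Type*} {W : Z → ℝ} (P : (Z → ℝ) → Prop)
    (Ψ : (Z → ℝ) → Z → ℝ) (hmaps : ∀ f, P f → P (Ψ f))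
    (hclosed : ∀ (f : ℕ → Z → ℝ) (g : Z → ℝ) (C : ℝ), (∀ n, P (f n)) →
      (∀ n z, |f n z - g z| ≤ C * (1 / 2) ^ n * W z) → P g)
    (hcontr : ∀ f g δ, P f → P g → 0 ≤ δ → (∀ z, |f z - g z| ≤ δ * W z) →
      ∀ z, |Ψ f z - Ψ g z| ≤ δ / 2 * W z)
    {f₀ : Z → ℝ} (hf₀ : P f₀) {C : ℝ} (hC0 : 0 ≤ C) (hC : ∀ z, |Ψ f₀ z - f₀ z| ≤ C * W z) :
    ∃ f, P f ∧ Ψ f = f := by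
  have hP : ∀ n, P (Ψ^[n] f₀) := fun n => by
    induction n with
    | zero => exact hf₀
    | succ n ih => rw [Function.iterate_succ_apply']; exact hmaps _ ih
  have hinc : ∀ n z, |Ψ^[n + 1] f₀ z - Ψ^[n] f₀ z| ≤ C * (1 / 2) ^ n * W z := fun n => by
    induction n with
    | zero => simpa using hC
    | succ n ih =>
      intro z
      have key := hcontr _ _ (C * (1 / 2) ^ n) (hP _) (hP _) (by positivity) ih z
      rw [← Function.iterate_succ_apply' Ψ, ← Function.iterate_succ_apply' Ψ] at key
      refine key.trans (le_of_eq ?_)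
      rw [pow_succ]; ring
  obtain ⟨g, hg⟩ := exists_limit_of_geometric (f := fun n => Ψ^[n] f₀) hinc
  have hPg : P g := hclosed _ g _ hP hg
  refine ⟨g, hPg, funext fun z => ?_⟩
  have h1 : Tendsto (fun n => Ψ^[n] f₀ z) atTop (𝓝 (g z)) :=
    tendsto_of_geometric (C := 2 * C * W z) fun n => (hg n z).trans (le_of_eq (by ring))
  have h2 : Tendsto (fun n => Ψ^[n + 1] f₀ z) atTop (𝓝 (Ψ g z)) := by
    refine tendsto_of_geometric (C := C * W z) fun n => ?_
    rw [Function.iterate_succ_apply']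
    refine (hcontr _ _ (2 * C * (1 / 2) ^ n) (hP n) hPg (by positivity) (hg n) z).trans
      (le_of_eq (by ring))
  exact tendsto_nhds_unique h2 (h1.comp (tendsto_add_atTop_nat 1))

/-- A quantity whose weighted bound can be improved from `δ` to `δ / 2 + c` is bounded by
`2 * c`. -/
theorem le_two_mul_of_forall_improve {Z : Type*} {D W : Z → ℝ} {c δ₀ : ℝ}
    (h0 : ∀ z, D z ≤ δ₀ * W z) (hδ₀ : 0 ≤ δ₀) (hc : 0 ≤ c)
    (h : ∀ δ, 0 ≤ δ → (∀ z, D z ≤ δ * W z) → ∀ z, D z ≤ (δ / 2 + c) * W z) (z : Z) :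
    D z ≤ 2 * c * W z := by
  have key : ∀ n : ℕ, ∀ z, D z ≤ (δ₀ * (1 / 2) ^ n + 2 * c * (1 - (1 / 2) ^ n)) * W z := by
    intro n
    induction n with
    | zero => simpa using h0
    | succ n ih =>
      have hp : (1 / 2 : ℝ) ^ n ≤ 1 := pow_le_one₀ (by norm_num) (by norm_num)
      intro z
      refine (h _ ?_ ih z).trans (le_of_eq ?_)
      · have : 0 ≤ 1 - (1 / 2 : ℝ) ^ n := by linarith
        positivity
      · rw [pow_succ]; ring
  have hpow := tendsto_pow_atTop_nhds_zero_of_lt_one (by norm_num : (0 : ℝ) ≤ 1 / 2)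
    (by norm_num)
  have hl : Tendsto (fun n : ℕ => (δ₀ * (1 / 2) ^ n + 2 * c * (1 - (1 / 2) ^ n)) * W z) atTop
      (𝓝 ((δ₀ * 0 + 2 * c * (1 - 0)) * W z)) :=
    (((hpow.const_mul δ₀).add ((tendsto_const_nhds.sub hpow).const_mul (2 * c)))).mul_const _
  have := ge_of_tendsto' hl fun n => key n z
  simpa using this

/-! ### Backward exponential integrals -/

/-- The backward convolution `∫_t^T e^{-c(s-t)} r(s) ds`, equal to zero for `t ≥ T`. -/
def back (T c : ℝ) (r : ℝ → ℝ) (t : ℝ) : ℝ :=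
  ∫ s in Ioc t T, Real.exp (-c * (s - t)) * r s

section Back

variable {T c : ℝ} {r : ℝ → ℝ}

theorem integral_exp_sub_eq {a : ℝ} (ha : a ≠ 0) (t v : ℝ) :
    ∫ s in t..v, Real.exp (-a * (s - t)) = (1 - Real.exp (-a * (v - t))) / a := by
  have h : ∀ s ∈ uIcc t v, HasDerivAt (fun s => -Real.exp (-a * (s - t)) / a)
      (Real.exp (-a * (s - t))) s := fun s _ => by
    have h1 : HasDerivAt (fun s : ℝ => -a * (s - t)) (-a * 1) s :=
      ((hasDerivAt_id s).sub_const t).const_mul (-a)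
    exact ((h1.exp.neg).div_const a).congr_deriv (by field_simp)
  rw [intervalIntegral.integral_eq_sub_of_hasDerivAt h
    (Continuous.intervalIntegrable (by fun_prop) _ _)]
  simp
  ring

theorem integrableOn_exp_mul (hr : Measurable r) {C : ℝ} (hC : ∀ s, |r s| ≤ C) (t : ℝ) :
    IntegrableOn (fun s => Real.exp (-c * (s - t)) * r s) (Ioc t T) := by
  refine Integrable.mul_bdd (c := C) ?_ hr.aestronglyMeasurable (ae_of_all _ hC)
  exact (Continuous.integrableOn_Icc (by fun_prop)).mono_set Ioc_subset_Icc_self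

theorem back_of_le {t : ℝ} (h : T ≤ t) : back T c r t = 0 := by
  simp [back, Ioc_eq_empty (not_lt.2 h)]

theorem back_eq_intervalIntegral {t : ℝ} (h : t ≤ T) :
    back T c r t = ∫ s in t..T, Real.exp (-c * (s - t)) * r s := by
  rw [back, intervalIntegral.integral_of_le h]

/-- Against the weight `e^{l(T-s)}`, the backward integral with rate `c` gains the factor
`1 / (c + l)`. -/
theorem abs_back_le {l δ t : ℝ} (hδ : 0 ≤ δ) (hl : 0 < c + l)
    (h : ∀ s ∈ Ioc t T, |r s| ≤ δ * Real.exp (l * (T - s))) :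
    |back T c r t| ≤ δ * Real.exp (l * (T - t)) / (c + l) := by
  rcases le_or_gt T t with ht | ht
  · rw [back_of_le ht, abs_zero]
    exact div_nonneg (mul_nonneg hδ (Real.exp_pos _).le) hl.le
  have hint : IntegrableOn (fun s => δ * Real.exp (l * (T - t)) * Real.exp (-(c + l) * (s - t)))
      (Ioc t T) :=
    (Continuous.integrableOn_Icc (by fun_prop)).mono_set Ioc_subset_Icc_self
  have h1 := norm_integral_le_of_norm_le (μ := volume.restrict (Ioc t T))
    (f := fun s => Real.exp (-c * (s - t)) * r s) hint ?_
  · rw [Real.norm_eq_abs] at h1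
    refine h1.trans ?_
    rw [← intervalIntegral.integral_of_le ht.le, intervalIntegral.integral_const_mul,
      integral_exp_sub_eq hl.ne']
    refine (mul_le_mul_of_nonneg_left ?_ (mul_nonneg hδ (Real.exp_pos _).le)).trans_eq
      (mul_one_div _ _)
    gcongr
    linarith [Real.exp_pos (-(c + l) * (T - t))]
  · refine (ae_restrict_mem measurableSet_Ioc).mono fun s hs => ?_
    rw [Real.norm_eq_abs, abs_mul, Real.abs_exp]
    refine (mul_le_mul_of_nonneg_left (h s hs) (Real.exp_pos _).le).trans (le_of_eq ?_)
    rw [mul_left_comm, ← Real.exp_add, mul_assoc, ← Real.exp_add]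
    ring_nf

theorem back_sub {r' : ℝ → ℝ} (hr : Measurable r) (hr' : Measurable r') {C C' : ℝ}
    (hC : ∀ s, |r s| ≤ C) (hC' : ∀ s, |r' s| ≤ C') (t : ℝ) :
    back T c (fun s => r s - r' s) t = back T c r t - back T c r' t := by
  rw [back, back, back,
    ← integral_sub (integrableOn_exp_mul hr hC t) (integrableOn_exp_mul hr' hC' t)]
  simp only [mul_sub]

theorem measurable_back {Z : Type*} [MeasurableSpace Z] {p : Z → ℝ} (hp : Measurable p)
    {r : ℝ × Z → ℝ} (hr : Measurable r) :
    Measurable fun q : ℝ × Z => back T (p q.2) (fun s => r (s, q.2)) q.1 := by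
  have h : ∀ q : ℝ × Z, back T (p q.2) (fun s => r (s, q.2)) q.1 =
      ∫ s, {x : (ℝ × Z) × ℝ | x.1.1 < x.2 ∧ x.2 ≤ T}.indicator
        (fun x => Real.exp (-p x.1.2 * (x.2 - x.1.1)) * r (x.2, x.1.2)) (q, s) := fun q => by
    rw [back, ← integral_indicator measurableSet_Ioc]
    rfl
  simp_rw [h]
  refine (StronglyMeasurable.integral_prod_right' (Measurable.stronglyMeasurable ?_)).measurable
  refine Measurable.indicator (by fun_prop) ?_
  have h1 : Measurable fun x : (ℝ × Z) × ℝ => x.1.1 := by fun_prop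
  exact (measurableSet_lt h1 measurable_snd).inter
    (measurableSet_le measurable_snd measurable_const)

/-- Changing the exponential rate: the backward integral with rate `c'` is the backward integral
with rate `c` of a modified integrand (variation of constants). -/
theorem back_change_rate (hr : Measurable r) {C : ℝ} (hC : ∀ s, |r s| ≤ C) (c c' t : ℝ) :
    back T c (fun s => r s - (c' - c) * back T c' r s) t = back T c' r t := by
  rcases le_or_gt T t with ht | ht
  · rw [back_of_le ht, back_of_le ht]
  have hC0 : 0 ≤ C := (abs_nonneg _).trans (hC 0)
  set ν := (volume : Measure ℝ).restrict (Ioc t T) with hν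
  have : IsFiniteMeasure ν := ⟨by rw [hν]; simp⟩
  -- The nested integral of `F` over `t < s < v ≤ T` is computed in both orders. The inner integral
  -- over `s` is elementary: `(c' - c) e^{-c(s-t) - c'(v-s)}` is a derivative in `s`.
  let F : ℝ → ℝ → ℝ := fun s v =>
    (Ioi s).indicator (fun v => Real.exp (-c * (s - t) - c' * (v - s)) * r v) v
  have hFm : Measurable (Function.uncurry F) := by
    have : Function.uncurry F = {x : ℝ × ℝ | x.1 < x.2}.indicator
        fun x => Real.exp (-c * (x.1 - t) - c' * (x.2 - x.1)) * r x.2 := by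
      ext ⟨s, v⟩; rfl
    rw [this]
    exact Measurable.indicator (by fun_prop) (measurableSet_lt measurable_fst measurable_snd)
  have hFb : ∀ s ∈ Ioc t T, ∀ v ∈ Ioc t T, ‖F s v‖ ≤
      Real.exp (|c| * (T - t) + |c'| * (T - t)) * C := by
    intro s hs v hv
    refine (norm_indicator_le_norm_self _ _).trans ?_
    rw [norm_mul, Real.norm_eq_abs, Real.abs_exp]
    by_cases hsv : s ≤ v
    · refine mul_le_mul (Real.exp_le_exp.2 ?_) (hC v) (norm_nonneg _) (Real.exp_pos _).le
      have h1 : -c * (s - t) ≤ |c| * (T - t) :=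
        mul_le_mul (neg_le_abs c) (by linarith [hs.2]) (by linarith [hs.1]) (abs_nonneg _)
      have h2 : -c' * (v - s) ≤ |c'| * (T - t) :=
        mul_le_mul (neg_le_abs c') (by linarith [hv.2, hs.1]) (by linarith) (abs_nonneg _)
      linarith
    · refine mul_le_mul (Real.exp_le_exp.2 ?_) (hC v) (norm_nonneg _) (Real.exp_pos _).le
      have h1 : -c * (s - t) ≤ |c| * (T - t) :=
        mul_le_mul (neg_le_abs c) (by linarith [hs.2]) (by linarith [hs.1]) (abs_nonneg _)
      have h2 : c' * (s - v) ≤ |c'| * (T - t) :=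
        mul_le_mul (le_abs_self c') (by linarith [hs.2, hv.1]) (by linarith) (abs_nonneg _)
      linarith
  have hFi : Integrable (Function.uncurry F) (ν.prod ν) := by
    refine Integrable.of_bound hFm.aestronglyMeasurable
      (Real.exp (|c| * (T - t) + |c'| * (T - t)) * C) ?_
    have : ∀ᵐ x ∂(ν.prod ν), x ∈ Ioc t T ×ˢ Ioc t T := by
      rw [hν, Measure.prod_restrict]
      exact ae_restrict_mem (measurableSet_Ioc.prod measurableSet_Ioc)
    exact this.mono fun x hx => hFb _ hx.1 _ hx.2
  have hswap : ∫ s, ∫ v, F s v ∂ν ∂ν = ∫ v, ∫ s, F s v ∂ν ∂ν := integral_integral_swap hFi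
  have hleft : ∀ s ∈ Ioc t T, ∫ v, F s v ∂ν = Real.exp (-c * (s - t)) * back T c' r s := by
    intro s hs
    have : Ioi s ∩ Ioc t T = Ioc s T := by
      ext v; simp only [mem_inter_iff, mem_Ioi, mem_Ioc]
      exact ⟨fun h => ⟨h.1, h.2.2⟩, fun h => ⟨h.1, hs.1.trans h.1, h.2⟩⟩
    rw [integral_indicator measurableSet_Ioi, hν, Measure.restrict_restrict measurableSet_Ioi,
      this, back, ← integral_const_mul]
    congr 1; ext v
    rw [← mul_assoc, ← Real.exp_add]; ring_nf
  have hright : ∀ v ∈ Ioc t T, (c' - c) * ∫ s, F s v ∂ν =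
      Real.exp (-c * (v - t)) * r v - Real.exp (-c' * (v - t)) * r v := by
    intro v hv
    have h1 : (fun s => F s v) = (Iio v).indicator
        fun s => Real.exp (-c * (s - t) - c' * (v - s)) * r v := by
      ext s; simp only [F, indicator, mem_Ioi, mem_Iio]
    have h2 : Iio v ∩ Ioc t T = Ioo t v := by
      ext s; simp only [mem_inter_iff, mem_Iio, mem_Ioc, mem_Ioo]
      exact ⟨fun h => ⟨h.2.1, h.1⟩, fun h => ⟨h.2, h.1, h.2.le.trans hv.2⟩⟩
    rw [h1, integral_indicator measurableSet_Iio, hν, Measure.restrict_restrict measurableSet_Iio,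
      h2, ← integral_Ioc_eq_integral_Ioo, ← intervalIntegral.integral_of_le hv.1.le,
      intervalIntegral.integral_mul_const, ← mul_assoc, ← intervalIntegral.integral_const_mul]
    have hd : ∀ s ∈ uIcc t v, HasDerivAt (fun s => Real.exp (-c * (s - t) - c' * (v - s)))
        ((c' - c) * Real.exp (-c * (s - t) - c' * (v - s))) s := fun s _ => by
      have h3 : HasDerivAt (fun s : ℝ => -c * (s - t) - c' * (v - s)) (-c * 1 - c' * (-1)) s :=
        (((hasDerivAt_id s).sub_const t).const_mul (-c)).sub
          (((hasDerivAt_id s).const_sub v).const_mul c')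
      convert h3.exp using 1
      ring
    rw [intervalIntegral.integral_eq_sub_of_hasDerivAt hd
      (Continuous.intervalIntegrable (by fun_prop) _ _)]
    simp only [sub_self, mul_zero, sub_zero, zero_sub]
    ring_nf
  have hi1 := integrableOn_exp_mul (c := c) (T := T) hr hC t
  have hi2 := integrableOn_exp_mul (c := c') (T := T) hr hC t
  have hi3 : IntegrableOn (fun s => Real.exp (-c * (s - t)) * back T c' r s) (Ioc t T) := by
    refine (hFi.integral_prod_left).congr ?_
    rw [hν]
    exact (ae_restrict_mem measurableSet_Ioc).mono fun s hs => hleft s hs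
  have hsplit : back T c (fun s => r s - (c' - c) * back T c' r s) t =
      back T c r t - (c' - c) * ∫ s, Real.exp (-c * (s - t)) * back T c' r s ∂ν := by
    rw [back, back, ← integral_const_mul, ← integral_sub hi1 (hi3.const_mul _)]
    congr 1; ext s; ring
  have hl : ∫ s, Real.exp (-c * (s - t)) * back T c' r s ∂ν = ∫ s, ∫ v, F s v ∂ν ∂ν :=
    setIntegral_congr_fun measurableSet_Ioc fun s hs => (hleft s hs).symm
  rw [hsplit, hl, hswap, ← integral_const_mul]
  have hr' : ∫ v, (c' - c) * ∫ s, F s v ∂ν ∂ν = back T c r t - back T c' r t := by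
    rw [back, back, ← integral_sub hi1 hi2]
    exact setIntegral_congr_fun measurableSet_Ioc fun v hv => hright v hv
  rw [hr']; ring

theorem continuousOn_back (hr : Measurable r) {C : ℝ} (hC : ∀ s, |r s| ≤ C) :
    ContinuousOn (back T c r) (Iic T) := by
  have hi : ∀ a b, IntervalIntegrable (fun s => Real.exp (-c * s) * r s) volume a b := fun a b =>
    intervalIntegrable_iff.2 <| Integrable.mul_bdd (c := C)
      (intervalIntegrable_iff.1 (Continuous.intervalIntegrable (by fun_prop) _ _))
      hr.aestronglyMeasurable (ae_of_all _ fun s => hC s)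
  have h1 : Continuous fun t => ∫ s in T..t, Real.exp (-c * s) * r s :=
    intervalIntegral.continuous_primitive hi T
  have h2 : Continuous fun t => Real.exp (c * t) * -∫ s in T..t, Real.exp (-c * s) * r s := by
    fun_prop
  refine h2.continuousOn.congr fun t ht => ?_
  beta_reduce
  rw [back_eq_intervalIntegral ht, ← intervalIntegral.integral_symm,
    ← intervalIntegral.integral_const_mul]
  refine intervalIntegral.integral_congr fun s _ => ?_
  rw [← mul_assoc, ← Real.exp_add]
  ring_nf

end Back

/-! ### The decay weight -/

section Weight

variable {Y : Type*} {ϑ : Y → ℝ}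

/-- The weight `(ϑ + l)^{-1/2}`. Kernels of size `wt ϑ l y * wt ϑ l y'` are integrable, and the
integral of `wt ϑ l` becomes small as `l` grows; this is where the contraction constants come
from. -/
def wt (ϑ : Y → ℝ) (l : ℝ) (y : Y) : ℝ := 1 / √(ϑ y + l)

theorem wt_pos (hϑ : ∀ y, 0 ≤ ϑ y) {l : ℝ} (hl : 1 ≤ l) (y : Y) : 0 < wt ϑ l y :=
  one_div_pos.2 (Real.sqrt_pos.2 (by linarith [hϑ y]))

theorem wt_anti (hϑ : ∀ y, 0 ≤ ϑ y) {l l' : ℝ} (hl : 1 ≤ l) (h : l ≤ l') (y : Y) :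
    wt ϑ l' y ≤ wt ϑ l y :=
  one_div_le_one_div_of_le (Real.sqrt_pos.2 (by linarith [hϑ y]))
    (Real.sqrt_le_sqrt (by linarith))

theorem wt_le_one (hϑ : ∀ y, 0 ≤ ϑ y) {l : ℝ} (hl : 1 ≤ l) (y : Y) : wt ϑ l y ≤ 1 := by
  rw [wt, div_le_one (Real.sqrt_pos.2 (by linarith [hϑ y]))]
  exact Real.one_le_sqrt.2 (by linarith [hϑ y])

theorem one_div_add_le_wt_mul_wt (hϑ : ∀ y, 0 ≤ ϑ y) {l : ℝ} (hl : 1 ≤ l) (y y' : Y) :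
    1 / (ϑ y + ϑ y' + 2 * l) ≤ wt ϑ l y * wt ϑ l y' := by
  have h1 : 0 < √(ϑ y + l) := Real.sqrt_pos.2 (by linarith [hϑ y])
  have h2 : 0 < √(ϑ y' + l) := Real.sqrt_pos.2 (by linarith [hϑ y'])
  rw [wt, wt, one_div_mul_one_div]
  refine one_div_le_one_div_of_le (mul_pos h1 h2) ?_
  nlinarith [Real.sq_sqrt (show 0 ≤ ϑ y + l by linarith [hϑ y]),
    Real.sq_sqrt (show 0 ≤ ϑ y' + l by linarith [hϑ y']), sq_nonneg (√(ϑ y + l) - √(ϑ y' + l))]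

theorem one_div_add_le_wt (hϑ : ∀ y, 0 ≤ ϑ y) {l : ℝ} (hl : 1 ≤ l) (y : Y) :
    1 / (ϑ y + l) ≤ wt ϑ l y := by
  have h0 : 0 < ϑ y + l := by linarith [hϑ y]
  refine one_div_le_one_div_of_le (Real.sqrt_pos.2 h0) ?_
  exact Real.sqrt_le_iff.2 ⟨h0.le, by nlinarith [hϑ y]⟩

/-- After a positive time, exponential decay turns a weighted test function into an integrable one. -/
theorem exp_neg_mul_le_wt (hϑ : ∀ y, 0 ≤ ϑ y) {v : ℝ} (hv : 0 < v) (y : Y) :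
    Real.exp (-ϑ y * v) ≤ (1 + 1 / v) * wt ϑ 1 y := by
  have h0 : 0 < ϑ y + 1 := by linarith [hϑ y]
  have h1 : 1 / (ϑ y + 1) ≤ wt ϑ 1 y := one_div_add_le_wt hϑ le_rfl y
  refine le_trans ?_ (mul_le_mul_of_nonneg_left h1 (by positivity))
  have h2 : 1 + ϑ y * v ≤ Real.exp (ϑ y * v) := by linarith [Real.add_one_le_exp (ϑ y * v)]
  have h3 : 0 < 1 + ϑ y * v := by have := hϑ y; positivity
  rw [neg_mul, Real.exp_neg, inv_eq_one_div]
  refine (one_div_le_one_div_of_le h3 h2).trans ?_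
  rw [mul_one_div, div_le_div_iff₀ h3 h0]
  have : (1 + 1 / v) * (1 + ϑ y * v) = 1 + ϑ y * v + 1 / v + ϑ y := by field_simp; ring
  rw [this]
  have h4 : 0 ≤ ϑ y * v := mul_nonneg (hϑ y) hv.le
  have : 0 < 1 / v := by positivity
  linarith

variable [MeasurableSpace Y] {ν : Measure Y}

theorem measurable_wt (hm : Measurable ϑ) (l : ℝ) : Measurable (wt ϑ l) := by
  unfold wt; fun_prop

theorem integrable_wt (hm : Measurable ϑ) (hϑ : ∀ y, 0 ≤ ϑ y) (hw : Integrable (wt ϑ 1) ν)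
    {l : ℝ} (hl : 1 ≤ l) : Integrable (wt ϑ l) ν := by
  refine hw.mono' (measurable_wt hm l).aestronglyMeasurable (ae_of_all _ fun y => ?_)
  rw [Real.norm_of_nonneg (wt_pos hϑ hl y).le]
  exact wt_anti hϑ le_rfl hl y

theorem eventually_integral_wt_le (hm : Measurable ϑ) (hϑ : ∀ y, 0 ≤ ϑ y)
    (hw : Integrable (wt ϑ 1) ν) {ε : ℝ} (hε : 0 < ε) :
    ∀ᶠ l in atTop, ∫ y, wt ϑ l y ∂ν ≤ ε := by
  have h : Tendsto (fun l => ∫ y, wt ϑ l y ∂ν) atTop (𝓝 (∫ _, (0 : ℝ) ∂ν)) := by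
    refine tendsto_integral_filter_of_dominated_convergence (wt ϑ 1) ?_ ?_ hw ?_
    · exact Eventually.of_forall fun l => (measurable_wt hm l).aestronglyMeasurable
    · filter_upwards [eventually_ge_atTop 1] with l hl
      refine ae_of_all _ fun y => ?_
      rw [Real.norm_of_nonneg (wt_pos hϑ hl y).le]
      exact wt_anti hϑ le_rfl hl y
    · refine ae_of_all _ fun y => ?_
      have h1 : Tendsto (fun l => √(ϑ y + l)) atTop atTop :=
        Real.tendsto_sqrt_atTop.comp (tendsto_atTop_add_const_left _ _ tendsto_id)
      simpa [wt, Function.comp_def] using tendsto_inv_atTop_zero.comp h1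
  rw [integral_zero] at h
  exact (h.eventually (gt_mem_nhds hε)).mono fun l hl => hl.le

end Weight

/-! ### Quadratic forms of kernels -/

section Kernels

variable {Y : Type*} [MeasurableSpace Y] {ν : Measure Y}

/-- The bilinear form `∬ f(y) K(y,y') g(y')` of a scalar kernel. -/
def bil (ν : Measure Y) (K : Y × Y → ℝ) (f g : Y → ℝ) : ℝ :=
  ∫ p, f p.1 * K p * g p.2 ∂ν.prod ν

variable [SFinite ν]

/-- A kernel dominated by `ω(y) ω(y')` pairs with functions that are integrable against `ω`. -/
theorem integrable_bil {K : Y × Y → ℝ} (hK : Measurable K) {ω f g : Y → ℝ} {C : ℝ}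
    (hω : ∀ y, 0 ≤ ω y) (hC : ∀ p, |K p| ≤ C * (ω p.1 * ω p.2))
    (hfm : AEStronglyMeasurable f ν) (hgm : AEStronglyMeasurable g ν)
    (hf : Integrable (fun y => ω y * f y) ν) (hg : Integrable (fun y => ω y * g y) ν) :
    Integrable (fun p => f p.1 * K p * g p.2) (ν.prod ν) := by
  refine ((hf.norm.mul_prod hg.norm).const_mul C).mono'
    ((hfm.comp_fst.mul hK.aestronglyMeasurable).mul hgm.comp_snd) (ae_of_all _ fun p => ?_)
  simp only [norm_mul, Real.norm_eq_abs, abs_of_nonneg (hω _)]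
  refine (mul_le_mul_of_nonneg_right (mul_le_mul_of_nonneg_left (hC p) (abs_nonneg _))
    (abs_nonneg _)).trans (le_of_eq (by ring))

theorem abs_bil_le {K : Y × Y → ℝ} {ω f g : Y → ℝ} {C : ℝ}
    (hω : ∀ y, 0 ≤ ω y) (hC : ∀ p, |K p| ≤ C * (ω p.1 * ω p.2))
    (hf : Integrable (fun y => ω y * f y) ν) (hg : Integrable (fun y => ω y * g y) ν) :
    |bil ν K f g| ≤ C * ((∫ y, ω y * |f y| ∂ν) * ∫ y, ω y * |g y| ∂ν) := by
  have h := norm_integral_le_of_norm_le (f := fun p : Y × Y => f p.1 * K p * g p.2)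
    ((hf.norm.mul_prod hg.norm).const_mul C) (ae_of_all _ fun p => by
      simp only [norm_mul, Real.norm_eq_abs, abs_of_nonneg (hω _)]
      exact (mul_le_mul_of_nonneg_right (mul_le_mul_of_nonneg_left (hC p) (abs_nonneg _))
        (abs_nonneg _)).trans (le_of_eq (by ring)))
  rw [integral_const_mul, integral_prod_mul (fun y => ‖ω y * f y‖) fun y => ‖ω y * g y‖] at h
  simpa [bil, abs_mul, abs_of_nonneg (hω _)] using h

theorem bil_swap {K : Y × Y → ℝ} (hs : ∀ p, K p.swap = K p) (f g : Y → ℝ) :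
    bil ν K f g = bil ν K g f := by
  rw [bil, ← integral_prod_swap]
  refine integral_congr_ae (ae_of_all _ fun p => ?_)
  simp only [Prod.fst_swap, Prod.snd_swap, hs]
  ring

/-- `bil` as an iterated integral, the kernel being integrated against `f` first. -/
theorem bil_eq_integral {K : Y × Y → ℝ} {f g : Y → ℝ}
    (hi : Integrable (fun p => f p.1 * K p * g p.2) (ν.prod ν)) :
    bil ν K f g = ∫ y', (∫ y, f y * K (y, y') ∂ν) * g y' ∂ν := by
  rw [bil, integral_prod_symm _ hi]
  simp only [integral_mul_const]

theorem bil_sub_kernel {K K' : Y × Y → ℝ} {f g : Y → ℝ}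
    (hi : Integrable (fun p => f p.1 * K p * g p.2) (ν.prod ν))
    (hi' : Integrable (fun p => f p.1 * K' p * g p.2) (ν.prod ν)) :
    bil ν (fun p => K p - K' p) f g = bil ν K f g - bil ν K' f g := by
  rw [bil, bil, bil, ← integral_sub hi hi']
  congr 1; ext p; ring

theorem bil_add_kernel {K K' : Y × Y → ℝ} {f g : Y → ℝ}
    (hi : Integrable (fun p => f p.1 * K p * g p.2) (ν.prod ν))
    (hi' : Integrable (fun p => f p.1 * K' p * g p.2) (ν.prod ν)) :
    bil ν (fun p => K p + K' p) f g = bil ν K f g + bil ν K' f g := by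
  rw [bil, bil, bil, ← integral_add hi hi']
  congr 1; ext p; ring

theorem bil_const_mul_kernel (a : ℝ) {K : Y × Y → ℝ} {f g : Y → ℝ} :
    bil ν (fun p => a * K p) f g = a * bil ν K f g := by
  rw [bil, bil, ← integral_const_mul]
  congr 1; ext p; ring

end Kernels

/-! ### The mild operator on kernels -/

section Mild

variable {Y : Type*} [MeasurableSpace Y] {ν : Measure Y} [SFinite ν] {ϑ : Y → ℝ} {T κ : ℝ}

/-- Membership of `f` in the weighted space `L¹(ν)` with weight `(ϑ + 1)^{-1/2}`. -/
def IsTest (ν : Measure Y) (ϑ : Y → ℝ) (f : Y → ℝ) : Prop :=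
  Integrable (fun y => wt ϑ 1 y * f y) ν

/-- The kernel `∫_t^T e^{-(ϑ(y)+ϑ(y')+κ)(s-t)} R_s(y,y') ds`. -/
def mild (ϑ : Y → ℝ) (T κ : ℝ) (R : ℝ × Y × Y → ℝ) (q : ℝ × Y × Y) : ℝ :=
  back T (ϑ q.2.1 + ϑ q.2.2 + κ) (fun s => R (s, q.2)) q.1

theorem IsTest.aestronglyMeasurable (hm : Measurable ϑ) (hϑ : ∀ y, 0 ≤ ϑ y) {f : Y → ℝ}
    (hf : IsTest ν ϑ f) : AEStronglyMeasurable f ν := by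
  have : f = fun y => (wt ϑ 1 y)⁻¹ * (wt ϑ 1 y * f y) := by
    ext y; rw [← mul_assoc, inv_mul_cancel₀ (wt_pos hϑ le_rfl y).ne', one_mul]
  rw [this]
  exact (measurable_wt hm 1).inv.aestronglyMeasurable.mul hf.1

theorem isTest_of_integrable (hm : Measurable ϑ) (hϑ : ∀ y, 0 ≤ ϑ y) {f : Y → ℝ}
    (hf : Integrable f ν) : IsTest ν ϑ f :=
  hf.bdd_mul (c := 1) (measurable_wt hm 1).aestronglyMeasurable (ae_of_all _ fun y => by
    rw [Real.norm_of_nonneg (wt_pos hϑ le_rfl y).le]; exact wt_le_one hϑ le_rfl y)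

theorem IsTest.integrable_wt_mul (hm : Measurable ϑ) (hϑ : ∀ y, 0 ≤ ϑ y) {f : Y → ℝ}
    (hf : IsTest ν ϑ f) {l : ℝ} (hl : 1 ≤ l) : Integrable (fun y => wt ϑ l y * f y) ν := by
  refine hf.norm.mono' ((measurable_wt hm l).aestronglyMeasurable.mul
    (hf.aestronglyMeasurable hm hϑ)) (ae_of_all _ fun y => ?_)
  rw [norm_mul, norm_mul, Real.norm_of_nonneg (wt_pos hϑ hl y).le,
    Real.norm_of_nonneg (wt_pos hϑ le_rfl y).le]
  exact mul_le_mul_of_nonneg_right (wt_anti hϑ le_rfl hl y) (norm_nonneg _)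

theorem isTest_of_bounded (hw : Integrable (wt ϑ 1) ν) {f : Y → ℝ}
    (hf : Measurable f) {C : ℝ} (hC : ∀ y, |f y| ≤ C) : IsTest ν ϑ f :=
  hw.mul_bdd (c := C) hf.aestronglyMeasurable (ae_of_all _ hC)

theorem IsTest.add {f g : Y → ℝ} (hf : IsTest ν ϑ f) (hg : IsTest ν ϑ g) :
    IsTest ν ϑ (fun y => f y + g y) :=
  (Integrable.add hf hg).congr (ae_of_all _ fun _ => (mul_add _ _ _).symm)

theorem IsTest.abs {f : Y → ℝ} (hϑ : ∀ y, 0 ≤ ϑ y) (hf : IsTest ν ϑ f) :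
    IsTest ν ϑ (fun y => |f y|) := by
  refine (Integrable.abs hf).congr (ae_of_all _ fun y => ?_)
  simp only [abs_mul, abs_of_pos (wt_pos hϑ le_rfl y)]

theorem IsTest.integrable_exp_mul (hm : Measurable ϑ) (hϑ : ∀ y, 0 ≤ ϑ y) {f : Y → ℝ}
    (hf : IsTest ν ϑ f) {v : ℝ} (hv : 0 < v) :
    Integrable (fun y => Real.exp (-ϑ y * v) * f y) ν := by
  have hem : Measurable fun y => Real.exp (-ϑ y * v) := by fun_prop
  refine (hf.norm.const_mul (1 + 1 / v)).mono' (hem.aestronglyMeasurable.mul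
    (hf.aestronglyMeasurable hm hϑ)) (ae_of_all _ fun y => ?_)
  rw [norm_mul, norm_mul, Real.norm_of_nonneg (wt_pos hϑ le_rfl y).le,
    Real.norm_of_nonneg (Real.exp_pos _).le, ← mul_assoc]
  exact mul_le_mul_of_nonneg_right (exp_neg_mul_le_wt hϑ hv y) (norm_nonneg _)

theorem measurable_mild (hm : Measurable ϑ) {R : ℝ × Y × Y → ℝ} (hR : Measurable R) :
    Measurable (mild ϑ T κ R) :=
  measurable_back (Z := Y × Y) (p := fun p => ϑ p.1 + ϑ p.2 + κ) (by fun_prop) hR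

theorem abs_mild_le_div (hϑ : ∀ y, 0 ≤ ϑ y) (hκ : 0 ≤ κ) {R : ℝ × Y × Y → ℝ} {l δ : ℝ}
    (hl : 1 ≤ l) (hδ : 0 ≤ δ) (h : ∀ q, q.1 ≤ T → |R q| ≤ δ * Real.exp (2 * l * (T - q.1)))
    (q : ℝ × Y × Y) :
    |mild ϑ T κ R q| ≤ δ * Real.exp (2 * l * (T - q.1)) / (ϑ q.2.1 + ϑ q.2.2 + κ + 2 * l) :=
  abs_back_le hδ (by linarith [hϑ q.2.1, hϑ q.2.2]) fun s hs => h (s, q.2) hs.2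

/-- The time integral of `e^{-(ϑ + ϑ' + 2l)(s-t)}` is at most the product of the weights, so that a
bound on the integrand with the time weight `e^{2l(T-s)}` gives decay of the kernel in space. -/
theorem abs_mild_le (hϑ : ∀ y, 0 ≤ ϑ y) (hκ : 0 ≤ κ) {R : ℝ × Y × Y → ℝ} {l δ : ℝ}
    (hl : 1 ≤ l) (hδ : 0 ≤ δ) (h : ∀ q, q.1 ≤ T → |R q| ≤ δ * Real.exp (2 * l * (T - q.1)))
    (q : ℝ × Y × Y) :
    |mild ϑ T κ R q| ≤ δ * Real.exp (2 * l * (T - q.1)) * (wt ϑ l q.2.1 * wt ϑ l q.2.2) := by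
  refine (abs_mild_le_div hϑ hκ hl hδ h q).trans ?_
  rw [div_eq_mul_one_div]
  refine mul_le_mul_of_nonneg_left (le_trans ?_ (one_div_add_le_wt_mul_wt hϑ hl _ _))
    (by positivity)
  exact one_div_le_one_div_of_le (by linarith [hϑ q.2.1, hϑ q.2.2]) (by linarith)

/-- A bounded integrand yields a kernel dominated by the product of the weights. -/
theorem abs_mild_le_of_bounded (hϑ : ∀ y, 0 ≤ ϑ y) (hκ : 0 ≤ κ) {R : ℝ × Y × Y → ℝ} {C : ℝ}
    (hC : ∀ q, |R q| ≤ C) (q : ℝ × Y × Y) :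
    |mild ϑ T κ R q| ≤ C * Real.exp (2 * (T - q.1)) * (wt ϑ 1 q.2.1 * wt ϑ 1 q.2.2) := by
  have hC0 : 0 ≤ C := (abs_nonneg _).trans (hC q)
  have := abs_mild_le (T := T) hϑ hκ le_rfl hC0 (fun q hq => (hC q).trans ?_) q
  · simpa using this
  · exact le_mul_of_one_le_right hC0 (Real.one_le_exp (by linarith))

/-- The bilinear form of a mild kernel disintegrates over time. -/
theorem bil_mild (hm : Measurable ϑ) (hϑ : ∀ y, 0 ≤ ϑ y) (hκ : 0 ≤ κ)
    {R : ℝ × Y × Y → ℝ} (hR : Measurable R) {C : ℝ} (hC : ∀ q, |R q| ≤ C)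
    {f g : Y → ℝ} (hf : IsTest ν ϑ f) (hg : IsTest ν ϑ g) (t : ℝ) :
    IntegrableOn (fun s => Real.exp (-κ * (s - t)) * bil ν (fun p => R (s, p))
      (fun y => Real.exp (-ϑ y * (s - t)) * f y) (fun y => Real.exp (-ϑ y * (s - t)) * g y))
      (Ioc t T) ∧
    bil ν (fun p => mild ϑ T κ R (t, p)) f g = ∫ s in Ioc t T, Real.exp (-κ * (s - t)) *
      bil ν (fun p => R (s, p))
        (fun y => Real.exp (-ϑ y * (s - t)) * f y) (fun y => Real.exp (-ϑ y * (s - t)) * g y) := by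
  have hfm := hf.aestronglyMeasurable hm hϑ
  have hgm := hg.aestronglyMeasurable hm hϑ
  let F : (Y × Y) → ℝ → ℝ := fun p s =>
    f p.1 * (Real.exp (-(ϑ p.1 + ϑ p.2 + κ) * (s - t)) * R (s, p)) * g p.2
  set τ := (volume : Measure ℝ).restrict (Ioc t T) with hτ
  have hFm : AEStronglyMeasurable (Function.uncurry F) ((ν.prod ν).prod τ) := by
    refine (hfm.comp_fst.comp_fst.mul ?_).mul hgm.comp_snd.comp_fst
    refine Measurable.aestronglyMeasurable (Measurable.mul (by fun_prop) ?_)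
    exact hR.comp (by fun_prop : Measurable fun x : (Y × Y) × ℝ => (x.2, x.1))
  have hRp : ∀ p, Measurable fun s => R (s, p) := fun p => hR.comp (by fun_prop)
  have hdom : Integrable (fun p : Y × Y => C * Real.exp (2 * (T - t)) *
      (‖wt ϑ 1 p.1 * f p.1‖ * ‖wt ϑ 1 p.2 * g p.2‖)) (ν.prod ν) :=
    (Integrable.mul_prod (Integrable.norm hf) (Integrable.norm hg)).const_mul _
  have hFi : Integrable (Function.uncurry F) ((ν.prod ν).prod τ) := by
    rw [integrable_prod_iff hFm]
    refine ⟨ae_of_all _ fun p => ?_, ?_⟩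
    · exact ((integrableOn_exp_mul (T := T) (c := ϑ p.1 + ϑ p.2 + κ) (hRp p)
        (fun s => hC (s, p)) t).const_mul (f p.1)).mul_const (g p.2)
    · refine hdom.mono' hFm.norm.integral_prod_right' (ae_of_all _ fun p => ?_)
      have h1 : ∫ s, ‖F p s‖ ∂τ = ‖f p.1‖ * mild ϑ T κ (fun q => |R q|) (t, p) * ‖g p.2‖ := by
        rw [mild, back, ← integral_const_mul, ← integral_mul_const]
        refine integral_congr_ae (ae_of_all _ fun s => ?_)
        simp only [F, norm_mul, Real.norm_eq_abs, Real.abs_exp]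
      have h2 := abs_mild_le_of_bounded (T := T) (R := fun q => |R q|) hϑ hκ
        (fun q => (abs_abs _).trans_le (hC q)) (t, p)
      simp only [Function.uncurry] at h1 ⊢
      rw [h1, norm_mul, norm_mul, norm_norm, norm_norm, norm_mul, norm_mul, Real.norm_eq_abs
        (mild _ _ _ _ _), Real.norm_of_nonneg (wt_pos hϑ le_rfl _).le,
        Real.norm_of_nonneg (wt_pos hϑ le_rfl _).le]
      refine (mul_le_mul_of_nonneg_right (mul_le_mul_of_nonneg_left h2 (norm_nonneg _))
        (norm_nonneg _)).trans (le_of_eq (by ring))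
  have hin : ∀ s, ∫ p, F p s ∂ν.prod ν = Real.exp (-κ * (s - t)) * bil ν (fun p => R (s, p))
      (fun y => Real.exp (-ϑ y * (s - t)) * f y)
      (fun y => Real.exp (-ϑ y * (s - t)) * g y) := fun s => by
    rw [bil, ← integral_const_mul]
    refine integral_congr_ae (ae_of_all _ fun p => ?_)
    simp only [F]
    have : Real.exp (-(ϑ p.1 + ϑ p.2 + κ) * (s - t)) = Real.exp (-κ * (s - t)) *
        Real.exp (-ϑ p.1 * (s - t)) * Real.exp (-ϑ p.2 * (s - t)) := by
      rw [← Real.exp_add, ← Real.exp_add]; ring_nf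
    rw [this]; ring
  constructor
  · exact hFi.integral_prod_right.congr (ae_of_all _ hin)
  · have h1 : bil ν (fun p => mild ϑ T κ R (t, p)) f g = ∫ p, ∫ s, F p s ∂τ ∂ν.prod ν := by
      refine integral_congr_ae (ae_of_all _ fun p => ?_)
      simp only [F, integral_mul_const, integral_const_mul]
      rfl
    rw [h1, integral_integral_swap hFi]
    exact integral_congr_ae (ae_of_all _ hin)

/-- Comparison of quadratic forms passes through the mild operator. -/
theorem bil_mild_mono (hm : Measurable ϑ) (hϑ : ∀ y, 0 ≤ ϑ y) (hκ : 0 ≤ κ)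
    {R R' : ℝ × Y × Y → ℝ} (hR : Measurable R) (hR' : Measurable R') {C C' : ℝ}
    (hC : ∀ q, |R q| ≤ C) (hC' : ∀ q, |R' q| ≤ C')
    {f f' : Y → ℝ} (hf : IsTest ν ϑ f) (hf' : IsTest ν ϑ f') (t : ℝ)
    (h : ∀ s ∈ Ioc t T, bil ν (fun p => R (s, p)) (fun y => Real.exp (-ϑ y * (s - t)) * f y)
        (fun y => Real.exp (-ϑ y * (s - t)) * f y) ≤
      bil ν (fun p => R' (s, p)) (fun y => Real.exp (-ϑ y * (s - t)) * f' y)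
        (fun y => Real.exp (-ϑ y * (s - t)) * f' y)) :
    bil ν (fun p => mild ϑ T κ R (t, p)) f f ≤ bil ν (fun p => mild ϑ T κ R' (t, p)) f' f' := by
  obtain ⟨h1, h2⟩ := bil_mild (T := T) hm hϑ hκ hR hC hf hf t
  obtain ⟨h3, h4⟩ := bil_mild (T := T) hm hϑ hκ hR' hC' hf' hf' t
  rw [h2, h4]
  exact setIntegral_mono_on h1 h3 measurableSet_Ioc fun s hs =>
    mul_le_mul_of_nonneg_left (h s hs) (Real.exp_pos _).le

end Mild

/-! ### The Riccati nonlinearity as a bilinear form -/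


/-- `N` is bounded below by `lam` as a quadratic form (no symmetry is required). -/
def Coercive {m : ℕ} (lam : ℝ) (N : Matrix (Fin m) (Fin m) ℝ) : Prop :=
  ∀ x : Fin m → ℝ, lam * (x ⬝ᵥ x) ≤ x ⬝ᵥ (N *ᵥ x)

theorem abs_dotProduct_le {n : ℕ} (u v : Fin n → ℝ) : |u ⬝ᵥ v| ≤ n * (‖u‖ * ‖v‖) := by
  refine (Finset.abs_sum_le_sum_abs _ _).trans ?_
  refine (Finset.sum_le_card_nsmul _ _ (‖u‖ * ‖v‖) fun i _ => ?_).trans_eq (by simp)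
  rw [abs_mul]
  exact mul_le_mul (norm_le_pi_norm u i) (norm_le_pi_norm v i) (abs_nonneg _) (norm_nonneg _)

theorem norm_sq_le_dotProduct {n : ℕ} (u : Fin n → ℝ) : ‖u‖ ^ 2 ≤ u ⬝ᵥ u := by
  have h0 : 0 ≤ u ⬝ᵥ u := Finset.sum_nonneg fun i _ => mul_self_nonneg _
  have : ‖u‖ ≤ √(u ⬝ᵥ u) := by
    refine (pi_norm_le_iff_of_nonneg (Real.sqrt_nonneg _)).2 fun i => ?_
    refine Real.le_sqrt_of_sq_le ?_
    rw [Real.norm_eq_abs, sq_abs, sq]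
    exact Finset.single_le_sum (f := fun i => u i * u i) (fun i _ => mul_self_nonneg _)
      (Finset.mem_univ i)
  calc ‖u‖ ^ 2 ≤ √(u ⬝ᵥ u) ^ 2 := by gcongr
    _ = _ := Real.sq_sqrt h0

section Coercive

variable {m : ℕ} {lam : ℝ} {N N' : Matrix (Fin m) (Fin m) ℝ}

theorem Coercive.norm_le (hl : 0 < lam) (h : Coercive lam N) (x : Fin m → ℝ) :
    ‖x‖ ≤ m / lam * ‖N *ᵥ x‖ := by
  have h1 : lam * ‖x‖ ^ 2 ≤ m * (‖x‖ * ‖N *ᵥ x‖) :=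
    (mul_le_mul_of_nonneg_left (norm_sq_le_dotProduct x) hl.le).trans
      ((h x).trans ((le_abs_self _).trans (abs_dotProduct_le _ _)))
  rcases eq_or_lt_of_le (norm_nonneg x) with h0 | h0
  · rw [← h0]; positivity
  · rw [div_mul_eq_mul_div, le_div_iff₀ hl]
    refine le_of_mul_le_mul_right ?_ h0
    nlinarith

theorem Coercive.isUnit (hl : 0 < lam) (h : Coercive lam N) : IsUnit N := by
  rw [← Matrix.mulVec_injective_iff_isUnit]
  intro x y hxy
  have h1 := h.norm_le hl (x - y)
  have h2 : N *ᵥ (x - y) = 0 := by rw [Matrix.mulVec_sub]; exact sub_eq_zero.2 hxy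
  rw [h2, norm_zero, mul_zero] at h1
  exact sub_eq_zero.1 (norm_le_zero_iff.1 h1)

theorem Coercive.mul_inv (hl : 0 < lam) (h : Coercive lam N) (b : Fin m → ℝ) :
    N *ᵥ (N⁻¹ *ᵥ b) = b := by
  rw [Matrix.mulVec_mulVec, Matrix.mul_nonsing_inv _ ((Matrix.isUnit_iff_isUnit_det _).1
    (h.isUnit hl)), Matrix.one_mulVec]

theorem Coercive.norm_inv_le (hl : 0 < lam) (h : Coercive lam N) (b : Fin m → ℝ) :
    ‖N⁻¹ *ᵥ b‖ ≤ m / lam * ‖b‖ := by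
  have := h.norm_le hl (N⁻¹ *ᵥ b)
  rwa [h.mul_inv hl] at this

/-- The resolvent identity, as an estimate. -/
theorem Coercive.norm_inv_sub_le (hl : 0 < lam) (h : Coercive lam N) (h' : Coercive lam N')
    (b : Fin m → ℝ) :
    ‖N⁻¹ *ᵥ b - N'⁻¹ *ᵥ b‖ ≤ m / lam * (‖N - N'‖ * (m / lam * ‖b‖)) := by
  refine (h.norm_le hl _).trans (mul_le_mul_of_nonneg_left ?_ (by positivity))
  have h1 : N *ᵥ (N⁻¹ *ᵥ b - N'⁻¹ *ᵥ b) = -((N - N') *ᵥ (N'⁻¹ *ᵥ b)) := by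
    rw [Matrix.mulVec_sub, h.mul_inv hl, Matrix.sub_mulVec, h'.mul_inv hl, neg_sub]
  rw [h1, norm_neg]
  exact (Matrix.linfty_opNorm_mulVec _ _).trans
    (mul_le_mul_of_nonneg_left (h'.norm_inv_le hl b) (norm_nonneg _))

theorem Coercive.inv_nonneg (hl : 0 < lam) (h : Coercive lam N) (b : Fin m → ℝ) :
    0 ≤ b ⬝ᵥ (N⁻¹ *ᵥ b) := by
  have h1 := h (N⁻¹ *ᵥ b)
  rw [h.mul_inv hl, dotProduct_comm] at h1
  rw [dotProduct_comm]
  refine le_trans (mul_nonneg hl.le ?_) h1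
  exact Finset.sum_nonneg fun i _ => mul_self_nonneg _

end Coercive

namespace LQData

variable {d d' m : ℕ} (P : LQData d d' m)

/-- The matrix `N + Fᵀ I F + h Cᵀ I C`. For `h = 0` it is `N̂`; the parameter `h` is the time step
of the regularization that preserves positivity. -/
def Nh (h : ℝ) (I : Matrix (Fin d') (Fin d') ℝ) : Matrix (Fin m) (Fin m) ℝ :=
  P.N + (P.Fᵀ * I * P.F + h • (P.Cᵀ * I * P.C))

/-- The vector `Cᵀ a + (Fᵀ I D + h Cᵀ I B) e`. -/
def Sv (h : ℝ) (I : Matrix (Fin d') (Fin d') ℝ) (u : (Fin d → ℝ) × (Fin d' → ℝ)) : Fin m → ℝ :=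
  P.Cᵀ *ᵥ u.2 + (P.Fᵀ * I * P.D + h • (P.Cᵀ * I * P.B)) *ᵥ u.1

/-- The Riccati right-hand side as a bilinear form in the pairs `(e, a)`, where `e` is a unit
vector and `a` the integrated kernel; the terms with `h` belong to the regularization. -/
def Phi (h : ℝ) (I : Matrix (Fin d') (Fin d') ℝ) (u v : (Fin d → ℝ) × (Fin d' → ℝ)) : ℝ :=
  u.1 ⬝ᵥ (P.Q *ᵥ v.1) + u.1 ⬝ᵥ ((P.Dᵀ * I * P.D + h • (P.Bᵀ * I * P.B)) *ᵥ v.1)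
    + (P.B *ᵥ u.1) ⬝ᵥ v.2 + u.2 ⬝ᵥ (P.B *ᵥ v.1)
    - P.Sv h I u ⬝ᵥ ((P.Nh h I)⁻¹ *ᵥ P.Sv h I v)

variable {P} {h h' lam : ℝ} {I I' : Matrix (Fin d') (Fin d') ℝ}

theorem dotProduct_sandwich {k l : ℕ} (M : Matrix (Fin d') (Fin k) ℝ)
    (M' : Matrix (Fin d') (Fin l) ℝ) (x : Fin k → ℝ) (y : Fin l → ℝ) :
    x ⬝ᵥ ((Mᵀ * I * M') *ᵥ y) = (M *ᵥ x) ⬝ᵥ (I *ᵥ (M' *ᵥ y)) := by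
  rw [Matrix.mul_assoc, ← Matrix.mulVec_mulVec, ← Matrix.mulVec_mulVec, Matrix.dotProduct_mulVec,
    Matrix.vecMul_transpose]

theorem dotProduct_mulVec_symm {n : ℕ} {M : Matrix (Fin n) (Fin n) ℝ} (hM : Mᵀ = M)
    (x y : Fin n → ℝ) : x ⬝ᵥ (M *ᵥ y) = y ⬝ᵥ (M *ᵥ x) := by
  rw [Matrix.dotProduct_mulVec, ← Matrix.mulVec_transpose, hM, dotProduct_comm]

theorem coercive_Nh (hh : 0 ≤ h)
    (hN : (P.N - lam • (1 : Matrix (Fin m) (Fin m) ℝ)).PosSemidef)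
    (hI : ∀ w, 0 ≤ w ⬝ᵥ (I *ᵥ w)) : Coercive lam (P.Nh h I) := by
  intro x
  have h1 := hN.dotProduct_mulVec_nonneg x
  rw [star_trivial, Matrix.sub_mulVec, Matrix.smul_mulVec, Matrix.one_mulVec, dotProduct_sub,
    dotProduct_smul, smul_eq_mul] at h1
  rw [Nh, Matrix.add_mulVec, Matrix.add_mulVec, Matrix.smul_mulVec, dotProduct_add,
    dotProduct_add, dotProduct_smul, dotProduct_sandwich, dotProduct_sandwich, smul_eq_mul]
  have h2 := hI (P.F *ᵥ x)
  have h3 := mul_nonneg hh (hI (P.C *ᵥ x))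
  linarith

/-- Completion of the square: the Riccati form is attained at the optimal feedback `u`. -/
theorem Phi_self_eq (hl : 0 < lam) (hN : Coercive lam (P.Nh h I)) (hI : Iᵀ = I)
    (x : Fin d → ℝ) (z : Fin d' → ℝ) :
    ∃ u : Fin m → ℝ, P.Phi h I (x, z) (x, z) = x ⬝ᵥ (P.Q *ᵥ x)
      + (P.D *ᵥ x + P.F *ᵥ u) ⬝ᵥ (I *ᵥ (P.D *ᵥ x + P.F *ᵥ u))
      + h * ((P.B *ᵥ x + P.C *ᵥ u) ⬝ᵥ (I *ᵥ (P.B *ᵥ x + P.C *ᵥ u)))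
      + 2 * ((P.B *ᵥ x + P.C *ᵥ u) ⬝ᵥ z) + u ⬝ᵥ (P.N *ᵥ u) := by
  set S := P.Sv h I (x, z) with hS
  set u : Fin m → ℝ := -((P.Nh h I)⁻¹ *ᵥ S) with hu
  refine ⟨u, ?_⟩
  have h1 : u ⬝ᵥ (P.Nh h I *ᵥ u) = -(u ⬝ᵥ S) := by
    rw [hu, Matrix.mulVec_neg, hN.mul_inv hl, dotProduct_neg]
  have h2 : S ⬝ᵥ ((P.Nh h I)⁻¹ *ᵥ S) = -(u ⬝ᵥ S) := by
    rw [hu, neg_dotProduct, neg_neg, dotProduct_comm]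
  have h3 : u ⬝ᵥ S = (P.C *ᵥ u) ⬝ᵥ z + (P.F *ᵥ u) ⬝ᵥ (I *ᵥ (P.D *ᵥ x))
      + h * ((P.C *ᵥ u) ⬝ᵥ (I *ᵥ (P.B *ᵥ x))) := by
    rw [hS, Sv, dotProduct_add, Matrix.add_mulVec, dotProduct_add, Matrix.smul_mulVec,
      dotProduct_smul, dotProduct_sandwich, dotProduct_sandwich, Matrix.dotProduct_mulVec u P.Cᵀ,
      Matrix.vecMul_transpose, smul_eq_mul, add_assoc]
  have h4 : u ⬝ᵥ (P.Nh h I *ᵥ u) = u ⬝ᵥ (P.N *ᵥ u) + (P.F *ᵥ u) ⬝ᵥ (I *ᵥ (P.F *ᵥ u))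
      + h * ((P.C *ᵥ u) ⬝ᵥ (I *ᵥ (P.C *ᵥ u))) := by
    rw [Nh, Matrix.add_mulVec, Matrix.add_mulVec, Matrix.smul_mulVec, dotProduct_add,
      dotProduct_add, dotProduct_smul, dotProduct_sandwich, dotProduct_sandwich, smul_eq_mul,
      add_assoc]
  have h5 := dotProduct_mulVec_symm hI (P.D *ᵥ x) (P.F *ᵥ u)
  have h6 := dotProduct_mulVec_symm hI (P.B *ᵥ x) (P.C *ᵥ u)
  rw [Phi, ← hS, h2]
  simp only [Matrix.add_mulVec, Matrix.smul_mulVec, dotProduct_add, dotProduct_smul,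
    dotProduct_sandwich, smul_eq_mul, add_dotProduct, Matrix.mulVec_add]
  rw [h5, h6, dotProduct_comm z]
  linear_combination h4 - h1 + 2 * h3

/-- The upper bound by the value of the zero control. -/
theorem Phi_self_le (hl : 0 < lam) (hN : Coercive lam (P.Nh h I))
    (x : Fin d → ℝ) (z : Fin d' → ℝ) :
    P.Phi h I (x, z) (x, z) ≤ x ⬝ᵥ (P.Q *ᵥ x) + (P.D *ᵥ x) ⬝ᵥ (I *ᵥ (P.D *ᵥ x))
      + h * ((P.B *ᵥ x) ⬝ᵥ (I *ᵥ (P.B *ᵥ x))) + 2 * ((P.B *ᵥ x) ⬝ᵥ z) := by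
  have h2 := hN.inv_nonneg hl (P.Sv h I (x, z))
  rw [Phi]
  simp only [Matrix.add_mulVec, Matrix.smul_mulVec, dotProduct_add, dotProduct_smul,
    dotProduct_sandwich, smul_eq_mul]
  rw [dotProduct_comm z]
  linarith

theorem Phi_comm (hQ : P.Qᵀ = P.Q) (hN : P.Nᵀ = P.N) (hI : Iᵀ = I)
    (u v : (Fin d → ℝ) × (Fin d' → ℝ)) : P.Phi h I u v = P.Phi h I v u := by
  have h1 : ((P.Nh h I)⁻¹)ᵀ = (P.Nh h I)⁻¹ := by
    rw [Matrix.transpose_nonsing_inv]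
    congr 1
    simp only [Nh, Matrix.transpose_add, Matrix.transpose_smul, Matrix.transpose_mul, hN, hI,
      Matrix.transpose_transpose, Matrix.mul_assoc]
  have h2 : (P.Dᵀ * I * P.D + h • (P.Bᵀ * I * P.B))ᵀ = P.Dᵀ * I * P.D + h • (P.Bᵀ * I * P.B) := by
    simp only [Matrix.transpose_add, Matrix.transpose_smul, Matrix.transpose_mul, hI,
      Matrix.transpose_transpose, Matrix.mul_assoc]
  rw [Phi, Phi, dotProduct_mulVec_symm hQ, dotProduct_mulVec_symm h2, dotProduct_mulVec_symm h1,
    dotProduct_comm (P.B *ᵥ u.1), dotProduct_comm u.2]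
  ring

variable (P)

/-- `Phi` as a bilinear map. -/
def PhiLin (h : ℝ) (I : Matrix (Fin d') (Fin d') ℝ) :
    ((Fin d → ℝ) × (Fin d' → ℝ)) →ₗ[ℝ] ((Fin d → ℝ) × (Fin d' → ℝ)) →ₗ[ℝ] ℝ :=
  LinearMap.mk₂ ℝ (P.Phi h I)
    (fun u u' v => by
      simp only [Phi, Sv, Prod.fst_add, Prod.snd_add, Matrix.mulVec_add, add_dotProduct]; ring)
    (fun c u v => by
      simp only [Phi, Sv, Prod.smul_fst, Prod.smul_snd, Matrix.mulVec_smul, smul_dotProduct,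
        add_dotProduct, smul_eq_mul]; ring)
    (fun u v v' => by
      simp only [Phi, Sv, Prod.fst_add, Prod.snd_add, Matrix.mulVec_add, dotProduct_add,
        add_dotProduct]; ring)
    (fun c u v => by
      simp only [Phi, Sv, Prod.smul_fst, Prod.smul_snd, Matrix.mulVec_smul, dotProduct_smul,
        Matrix.mulVec_add, dotProduct_add, add_dotProduct, smul_eq_mul]; ring)

theorem norm_mul_mul_le {k l : ℕ} {X : Matrix (Fin k) (Fin d') ℝ} {Z : Matrix (Fin d') (Fin l) ℝ}
    {K : ℝ} (hX : ‖X‖ ≤ K) (hZ : ‖Z‖ ≤ K) (J : Matrix (Fin d') (Fin d') ℝ) :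
    ‖X * J * Z‖ ≤ K ^ 2 * ‖J‖ := by
  have hK := (norm_nonneg X).trans hX
  calc ‖X * J * Z‖ ≤ ‖X * J‖ * ‖Z‖ := Matrix.linfty_opNorm_mul _ _
    _ ≤ (‖X‖ * ‖J‖) * ‖Z‖ := by gcongr; exact Matrix.linfty_opNorm_mul _ _
    _ ≤ (K * ‖J‖) * K := by gcongr
    _ = _ := by ring

/-- Lipschitz dependence of `M₁ I M₂ + h M₃ I M₄` on `(I, h)`; all the coefficients of `Phi`, `Sv` and
`Nh` have this form. -/
theorem norm_sandwich_sub_le {k l : ℕ} (M₁ : Matrix (Fin k) (Fin d') ℝ)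
    (M₂ : Matrix (Fin d') (Fin l) ℝ) (M₃ : Matrix (Fin k) (Fin d') ℝ)
    (M₄ : Matrix (Fin d') (Fin l) ℝ) {K : ℝ} (hK : 1 ≤ K) (h1 : ‖M₁‖ ≤ K) (h2 : ‖M₂‖ ≤ K)
    (h3 : ‖M₃‖ ≤ K) (h4 : ‖M₄‖ ≤ K) (hI' : ‖I'‖ ≤ K) (hh : |h| ≤ 1) :
    ‖(M₁ * I * M₂ + h • (M₃ * I * M₄)) - (M₁ * I' * M₂ + h' • (M₃ * I' * M₄))‖ ≤
      2 * K ^ 3 * (‖I - I'‖ + |h - h'|) := by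
  have e : (M₁ * I * M₂ + h • (M₃ * I * M₄)) - (M₁ * I' * M₂ + h' • (M₃ * I' * M₄)) =
      M₁ * (I - I') * M₂ + h • (M₃ * (I - I') * M₄) + (h - h') • (M₃ * I' * M₄) := by
    simp only [Matrix.mul_sub, Matrix.sub_mul, smul_sub, sub_smul]; abel
  have a1 := norm_mul_mul_le h1 h2 (I - I')
  have a2 := norm_mul_mul_le h3 h4 (I - I')
  have a3 := norm_mul_mul_le h3 h4 I'
  rw [e]
  calc _ ≤ ‖M₁ * (I - I') * M₂‖ + ‖h • (M₃ * (I - I') * M₄)‖ + ‖(h - h') • (M₃ * I' * M₄)‖ :=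
        norm_add₃_le
    _ = ‖M₁ * (I - I') * M₂‖ + |h| * ‖M₃ * (I - I') * M₄‖ + |h - h'| * ‖M₃ * I' * M₄‖ := by
        rw [norm_smul, norm_smul, Real.norm_eq_abs, Real.norm_eq_abs]
    _ ≤ K ^ 2 * ‖I - I'‖ + 1 * (K ^ 2 * ‖I - I'‖) + |h - h'| * (K ^ 2 * K) := by
        have : K ^ 2 * ‖I'‖ ≤ K ^ 2 * K := by gcongr
        gcongr
        exact a3.trans this
    _ ≤ _ := by
        have h5 : K ^ 2 ≤ K ^ 3 := pow_le_pow_right₀ hK (by norm_num)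
        have h6 : K ^ 2 * ‖I - I'‖ ≤ K ^ 3 * ‖I - I'‖ := by gcongr
        have h7 : 0 ≤ K ^ 3 * |h - h'| := by positivity
        nlinarith

theorem norm_sandwich_le {k l : ℕ} (M₁ : Matrix (Fin k) (Fin d') ℝ)
    (M₂ : Matrix (Fin d') (Fin l) ℝ) (M₃ : Matrix (Fin k) (Fin d') ℝ)
    (M₄ : Matrix (Fin d') (Fin l) ℝ) {K : ℝ} (hK : 1 ≤ K) (h1 : ‖M₁‖ ≤ K) (h2 : ‖M₂‖ ≤ K)
    (h3 : ‖M₃‖ ≤ K) (h4 : ‖M₄‖ ≤ K) (hI : ‖I‖ ≤ K) (hh : |h| ≤ 1) :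
    ‖M₁ * I * M₂ + h • (M₃ * I * M₄)‖ ≤ 2 * K ^ 3 := by
  calc _ ≤ ‖M₁ * I * M₂‖ + ‖h • (M₃ * I * M₄)‖ := norm_add_le _ _
    _ = ‖M₁ * I * M₂‖ + |h| * ‖M₃ * I * M₄‖ := by rw [norm_smul, Real.norm_eq_abs]
    _ ≤ K ^ 2 * ‖I‖ + 1 * (K ^ 2 * ‖I‖) := by
      gcongr
      · exact norm_mul_mul_le h1 h2 I
      · exact norm_mul_mul_le h3 h4 I
    _ ≤ K ^ 2 * K + 1 * (K ^ 2 * K) := by gcongr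
    _ = _ := by ring

/-- A common bound for all coefficients, for the size `A` of `I` and for `1 / lam`. -/
theorem exists_coeff_bound (A lam : ℝ) : ∃ K : ℝ, 1 ≤ K ∧ A ≤ K ∧ 1 / lam ≤ K ∧ d ≤ K ∧ d' ≤ K ∧
    m ≤ K ∧ ‖P.B‖ ≤ K ∧ ‖P.C‖ ≤ K ∧ ‖P.D‖ ≤ K ∧ ‖P.F‖ ≤ K ∧ ‖P.Bᵀ‖ ≤ K ∧ ‖P.Cᵀ‖ ≤ K ∧
    ‖P.Dᵀ‖ ≤ K ∧ ‖P.Fᵀ‖ ≤ K ∧ ‖P.Q‖ ≤ K := by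
  refine ⟨1 + |A| + |1 / lam| + d + d' + m + ‖P.B‖ + ‖P.C‖ + ‖P.D‖ + ‖P.F‖ + ‖P.Bᵀ‖ + ‖P.Cᵀ‖
    + ‖P.Dᵀ‖ + ‖P.Fᵀ‖ + ‖P.Q‖, ?_⟩
  have := abs_nonneg A
  have := abs_nonneg (1 / lam)
  have := le_abs_self A
  have := le_abs_self (1 / lam)
  have := norm_nonneg P.B
  have := norm_nonneg P.C
  have := norm_nonneg P.D
  have := norm_nonneg P.F
  have := norm_nonneg P.Bᵀ
  have := norm_nonneg P.Cᵀ
  have := norm_nonneg P.Dᵀ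
  have := norm_nonneg P.Fᵀ
  have := norm_nonneg P.Q
  have : (0 : ℝ) ≤ d := by positivity
  have : (0 : ℝ) ≤ d' := by positivity
  have : (0 : ℝ) ≤ m := by positivity
  refine ⟨?_, ?_, ?_, ?_, ?_, ?_, ?_, ?_, ?_, ?_, ?_, ?_, ?_, ?_, ?_⟩ <;> linarith

theorem norm_mulVec_le {k l : ℕ} {M : Matrix (Fin k) (Fin l) ℝ} {x : Fin l → ℝ} {K X : ℝ}
    (hM : ‖M‖ ≤ K) (hx : ‖x‖ ≤ X) : ‖M *ᵥ x‖ ≤ K * X :=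
  (Matrix.linfty_opNorm_mulVec _ _).trans
    (mul_le_mul hM hx (norm_nonneg _) ((norm_nonneg _).trans hM))

theorem abs_dotProduct_le_of_le {n : ℕ} {u v : Fin n → ℝ} {K X Z : ℝ} (hn : n ≤ K) (hu : ‖u‖ ≤ X)
    (hv : ‖v‖ ≤ Z) : |u ⬝ᵥ v| ≤ K * (X * Z) := by
  refine (abs_dotProduct_le u v).trans (mul_le_mul hn ?_ (by positivity)
    ((Nat.cast_nonneg n).trans hn))
  exact mul_le_mul hu hv (norm_nonneg _) ((norm_nonneg _).trans hu)

theorem exists_norm_Sv_le (A : ℝ) : ∃ L : ℝ, 0 < L ∧ ∀ (h : ℝ) (I : Matrix (Fin d') (Fin d') ℝ)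
    (u : (Fin d → ℝ) × (Fin d' → ℝ)), |h| ≤ 1 → ‖I‖ ≤ A → ‖u.1‖ ≤ 1 →
      ‖P.Sv h I u‖ ≤ L * (1 + ‖u.2‖) := by
  obtain ⟨K, hK, hA, -, -, -, -, hB, hC, hD, hF, hBt, hCt, hDt, hFt, -⟩ := P.exists_coeff_bound A 1
  refine ⟨3 * K ^ 3, by positivity, fun h I u hh hI hu => ?_⟩
  have h1 : ‖P.Cᵀ *ᵥ u.2‖ ≤ K * ‖u.2‖ := norm_mulVec_le hCt le_rfl
  have h2 := norm_mulVec_le (x := u.1) (norm_sandwich_le (h := h) P.Fᵀ P.D P.Cᵀ P.B hK hFt hD hCt hB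
    (hI.trans hA) hh) hu
  have h3 : K ≤ K ^ 3 := le_self_pow₀ hK (by norm_num)
  calc _ ≤ _ := norm_add_le _ _
    _ ≤ K * ‖u.2‖ + 2 * K ^ 3 * 1 := add_le_add h1 h2
    _ ≤ K ^ 3 * ‖u.2‖ + 2 * K ^ 3 * 1 := by gcongr
    _ ≤ _ := by nlinarith [norm_nonneg u.2, pow_pos (zero_lt_one.trans_le hK) 3]

/-- Growth of the Riccati form on bounded coercive `I`: at most linear in each of the integrated
kernels. -/
theorem exists_abs_Phi_le (A : ℝ) (hl : 0 < lam) : ∃ L : ℝ, 0 < L ∧ ∀ (h : ℝ)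
    (I : Matrix (Fin d') (Fin d') ℝ) (u v : (Fin d → ℝ) × (Fin d' → ℝ)), |h| ≤ 1 → ‖I‖ ≤ A →
      Coercive lam (P.Nh h I) → ‖u.1‖ ≤ 1 → ‖v.1‖ ≤ 1 →
      |P.Phi h I u v| ≤ L * ((1 + ‖u.2‖) * (1 + ‖v.2‖)) := by
  obtain ⟨K, hK, hA, hlK, hd, hd', hm, hB, hC, hD, hF, hBt, hCt, hDt, hFt, hQ⟩ :=
    P.exists_coeff_bound A lam
  obtain ⟨L, hL, hS⟩ := P.exists_norm_Sv_le A
  have hK0 : 0 < K := by linarith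
  refine ⟨K * K + K * (2 * K ^ 3) + K * K + K * K + K * (L * (m / lam * L)), by positivity,
    fun h I u v hh hI hN hu hv => ?_⟩
  have a0 : |u.1 ⬝ᵥ (P.Q *ᵥ v.1)| ≤ K * (1 * (K * 1)) :=
    abs_dotProduct_le_of_le hd hu (norm_mulVec_le hQ hv)
  have a1 := abs_dotProduct_le_of_le hd hu (norm_mulVec_le (x := v.1)
    (norm_sandwich_le (h := h) P.Dᵀ P.D P.Bᵀ P.B hK hDt hD hBt hB (hI.trans hA) hh) hv)
  have a2 : |(P.B *ᵥ u.1) ⬝ᵥ v.2| ≤ K * (K * 1 * ‖v.2‖) :=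
    abs_dotProduct_le_of_le hd' (norm_mulVec_le hB hu) le_rfl
  have a3 : |u.2 ⬝ᵥ (P.B *ᵥ v.1)| ≤ K * (‖u.2‖ * (K * 1)) :=
    abs_dotProduct_le_of_le hd' le_rfl (norm_mulVec_le hB hv)
  have a4 : |P.Sv h I u ⬝ᵥ ((P.Nh h I)⁻¹ *ᵥ P.Sv h I v)| ≤
      K * ((L * (1 + ‖u.2‖)) * (m / lam * (L * (1 + ‖v.2‖)))) :=
    abs_dotProduct_le_of_le hm (hS h I u hh hI hu) ((hN.norm_inv_le hl _).trans
      (mul_le_mul_of_nonneg_left (hS h I v hh hI hv) (by positivity)))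
  have hx := norm_nonneg u.2
  have hy := norm_nonneg v.2
  set x := ‖u.2‖
  set y := ‖v.2‖
  have e1 : (1 : ℝ) ≤ (1 + x) * (1 + y) := by nlinarith [mul_nonneg hx hy]
  have e2 : x ≤ (1 + x) * (1 + y) := by nlinarith [mul_nonneg hx hy]
  have e3 : y ≤ (1 + x) * (1 + y) := by nlinarith [mul_nonneg hx hy]
  have b : |P.Phi h I u v| ≤ K * (1 * (K * 1)) + K * (1 * (2 * K ^ 3 * 1)) + K * (K * 1 * y) +
      K * (x * (K * 1)) + K * ((L * (1 + x)) * (m / lam * (L * (1 + y)))) := by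
    rw [Phi]
    refine (abs_sub _ _).trans (add_le_add ?_ a4)
    refine (abs_add_le _ _).trans (add_le_add ?_ a3)
    refine (abs_add_le _ _).trans (add_le_add ?_ a2)
    exact (abs_add_le _ _).trans (add_le_add a0 a1)
  refine b.trans ?_
  have f0 := mul_le_mul_of_nonneg_left e1 (by positivity : 0 ≤ K * K)
  have f1 := mul_le_mul_of_nonneg_left e1 (by positivity : 0 ≤ K * (2 * K ^ 3))
  have f2 := mul_le_mul_of_nonneg_left e3 (by positivity : 0 ≤ K * K)
  have f3 := mul_le_mul_of_nonneg_left e2 (by positivity : 0 ≤ K * K)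
  linarith

set_option maxHeartbeats 1000000 in
/-- Lipschitz estimate for the Riccati form on bounded coercive `I`, in a shape that is integrable
when the integrated kernels `a` are merely integrable. -/
theorem exists_abs_Phi_sub_le (A : ℝ) (hl : 0 < lam) : ∃ L : ℝ, 0 < L ∧ ∀ (h h' : ℝ)
    (I I' : Matrix (Fin d') (Fin d') ℝ) (u v u' v' : (Fin d → ℝ) × (Fin d' → ℝ)) (α β η : ℝ),
      |h| ≤ 1 → |h'| ≤ 1 → ‖I‖ ≤ A → ‖I'‖ ≤ A →
      Coercive lam (P.Nh h I) → Coercive lam (P.Nh h' I') → ‖u.1‖ ≤ 1 → ‖v.1‖ ≤ 1 →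
      u'.1 = u.1 → v'.1 = v.1 → 1 + ‖u.2‖ ≤ α → 1 + ‖u'.2‖ ≤ α → 1 + ‖v.2‖ ≤ β →
      1 + ‖v'.2‖ ≤ β → ‖I - I'‖ + |h - h'| ≤ η →
      |P.Phi h I u v - P.Phi h' I' u' v'| ≤
        L * ((‖u.2 - u'.2‖ + η * α) * β + α * (‖v.2 - v'.2‖ + η * β)) := by
  obtain ⟨K, hK, hA, hlK, hd, hd', hm, hB, hC, hD, hF, hBt, hCt, hDt, hFt, hQ⟩ :=
    P.exists_coeff_bound A lam
  obtain ⟨L, hL, hS⟩ := P.exists_norm_Sv_le A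
  have hK0 : 0 < K := by linarith
  set G : ℝ := m / lam with hG
  have hG0 : 0 ≤ G := by positivity
  refine ⟨K * (2 * K ^ 3) + K * K + K * K + K * (2 * K ^ 3 * (G * L)) +
    K * (L * (G * (2 * K ^ 3 * (G * L)))) + K * (L * (G * (2 * K ^ 3))), by positivity, ?_⟩
  intro h h' I I' u v u' v' α β η hh hh' hI hI' hN hN' hu hv hu' hv' hα hα' hβ hβ' hη
  have hη0 : 0 ≤ η := le_trans (by positivity) hη
  have hα1 : 1 ≤ α := by linarith [norm_nonneg u.2]
  have hβ1 : 1 ≤ β := by linarith [norm_nonneg v.2]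
  have hJ : ∀ {k l : ℕ} (M₁ : Matrix (Fin k) (Fin d') ℝ) (M₂ : Matrix (Fin d') (Fin l) ℝ)
      (M₃ : Matrix (Fin k) (Fin d') ℝ) (M₄ : Matrix (Fin d') (Fin l) ℝ),
      ‖M₁‖ ≤ K → ‖M₂‖ ≤ K → ‖M₃‖ ≤ K → ‖M₄‖ ≤ K →
      ‖(M₁ * I * M₂ + h • (M₃ * I * M₄)) - (M₁ * I' * M₂ + h' • (M₃ * I' * M₄))‖ ≤
      2 * K ^ 3 * η := fun M₁ M₂ M₃ M₄ h1 h2 h3 h4 =>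
    (norm_sandwich_sub_le M₁ M₂ M₃ M₄ hK h1 h2 h3 h4 (hI'.trans hA) hh).trans
      (mul_le_mul_of_nonneg_left hη (by positivity))
  have hSd : ∀ w w' : (Fin d → ℝ) × (Fin d' → ℝ), w'.1 = w.1 → ‖w.1‖ ≤ 1 →
      ‖P.Sv h I w - P.Sv h' I' w'‖ ≤ 2 * K ^ 3 * (‖w.2 - w'.2‖ + η) := by
    intro w w' hw hw1
    have e : P.Sv h I w - P.Sv h' I' w' = P.Cᵀ *ᵥ (w.2 - w'.2) +
        ((P.Fᵀ * I * P.D + h • (P.Cᵀ * I * P.B)) - (P.Fᵀ * I' * P.D + h' • (P.Cᵀ * I' * P.B)))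
          *ᵥ w.1 := by
      rw [Sv, Sv, hw, Matrix.mulVec_sub, Matrix.sub_mulVec]; abel
    rw [e]
    have b1 : ‖P.Cᵀ *ᵥ (w.2 - w'.2)‖ ≤ K * ‖w.2 - w'.2‖ := norm_mulVec_le hCt le_rfl
    have b2 := norm_mulVec_le (hJ P.Fᵀ P.D P.Cᵀ P.B hFt hD hCt hB) hw1
    have h3 : K ≤ 2 * K ^ 3 := (le_self_pow₀ hK (by norm_num : 3 ≠ 0)).trans
      (by linarith [pow_pos hK0 3])
    calc _ ≤ _ := norm_add_le _ _
      _ ≤ K * ‖w.2 - w'.2‖ + 2 * K ^ 3 * η * 1 := add_le_add b1 b2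
      _ ≤ 2 * K ^ 3 * ‖w.2 - w'.2‖ + 2 * K ^ 3 * η * 1 := by gcongr
      _ = _ := by ring
  have hSu := hS h I u hh hI hu
  have hSv := hS h I v hh hI hv
  have hSu' : ‖P.Sv h' I' u'‖ ≤ L * α :=
    (hS h' I' u' hh' hI' (by rw [hu']; exact hu)).trans (mul_le_mul_of_nonneg_left hα' hL.le)
  have hSv1 : ‖P.Sv h I v‖ ≤ L * β := hSv.trans (mul_le_mul_of_nonneg_left hβ hL.le)
  have hdN : ‖P.Nh h I - P.Nh h' I'‖ ≤ 2 * K ^ 3 * η := by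
    rw [Nh, Nh, add_sub_add_left_eq_sub]
    exact hJ P.Fᵀ P.F P.Cᵀ P.C hFt hF hCt hC
  set x := ‖u.2 - u'.2‖ with hx
  set y := ‖v.2 - v'.2‖ with hy
  have hx0 : 0 ≤ x := norm_nonneg _
  have hy0 : 0 ≤ y := norm_nonneg _
  have a1 := abs_dotProduct_le_of_le hd hu (norm_mulVec_le (hJ P.Dᵀ P.D P.Bᵀ P.B hDt hD hBt hB) hv)
  have a2 : |(P.B *ᵥ u.1) ⬝ᵥ (v.2 - v'.2)| ≤ K * (K * 1 * y) :=
    abs_dotProduct_le_of_le hd' (norm_mulVec_le hB hu) le_rfl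
  have a3 : |(u.2 - u'.2) ⬝ᵥ (P.B *ᵥ v.1)| ≤ K * (x * (K * 1)) :=
    abs_dotProduct_le_of_le hd' le_rfl (norm_mulVec_le hB hv)
  have a4 : |(P.Sv h I u - P.Sv h' I' u') ⬝ᵥ ((P.Nh h I)⁻¹ *ᵥ P.Sv h I v)| ≤
      K * (2 * K ^ 3 * (x + η) * (G * (L * β))) :=
    abs_dotProduct_le_of_le hm (hSd u u' hu' hu) ((hN.norm_inv_le hl _).trans
      (mul_le_mul_of_nonneg_left hSv1 hG0))
  have a5 : |P.Sv h' I' u' ⬝ᵥ ((P.Nh h I)⁻¹ *ᵥ P.Sv h I v - (P.Nh h' I')⁻¹ *ᵥ P.Sv h I v)| ≤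
      K * (L * α * (G * (2 * K ^ 3 * η * (G * (L * β))))) := by
    refine abs_dotProduct_le_of_le hm hSu' ((hN.norm_inv_sub_le hl hN' _).trans ?_)
    gcongr
  have a6 : |P.Sv h' I' u' ⬝ᵥ ((P.Nh h' I')⁻¹ *ᵥ (P.Sv h I v - P.Sv h' I' v'))| ≤
      K * (L * α * (G * (2 * K ^ 3 * (y + η)))) :=
    abs_dotProduct_le_of_le hm hSu' ((hN'.norm_inv_le hl _).trans
      (mul_le_mul_of_nonneg_left (hSd v v' hv' hv) hG0))
  -- telescoping in the order: coefficients of the quadratic part, linear part, left factor,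
  -- inverse and right factor of the last term
  have e : P.Phi h I u v - P.Phi h' I' u' v' =
      u.1 ⬝ᵥ (((P.Dᵀ * I * P.D + h • (P.Bᵀ * I * P.B)) -
        (P.Dᵀ * I' * P.D + h' • (P.Bᵀ * I' * P.B))) *ᵥ v.1)
      + (P.B *ᵥ u.1) ⬝ᵥ (v.2 - v'.2) + (u.2 - u'.2) ⬝ᵥ (P.B *ᵥ v.1)
      - ((P.Sv h I u - P.Sv h' I' u') ⬝ᵥ ((P.Nh h I)⁻¹ *ᵥ P.Sv h I v)
        + P.Sv h' I' u' ⬝ᵥ ((P.Nh h I)⁻¹ *ᵥ P.Sv h I v - (P.Nh h' I')⁻¹ *ᵥ P.Sv h I v)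
        + P.Sv h' I' u' ⬝ᵥ ((P.Nh h' I')⁻¹ *ᵥ (P.Sv h I v - P.Sv h' I' v'))) := by
    rw [Phi, Phi, hu', hv', Matrix.sub_mulVec, Matrix.mulVec_sub]
    simp only [dotProduct_sub, sub_dotProduct]
    ring
  have b : |P.Phi h I u v - P.Phi h' I' u' v'| ≤ K * (1 * (2 * K ^ 3 * η * 1)) + K * (K * 1 * y)
      + K * (x * (K * 1)) + (K * (2 * K ^ 3 * (x + η) * (G * (L * β)))
      + K * (L * α * (G * (2 * K ^ 3 * η * (G * (L * β)))))
      + K * (L * α * (G * (2 * K ^ 3 * (y + η))))) := by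
    rw [e]
    refine (abs_sub _ _).trans (add_le_add ?_ ?_)
    · refine (abs_add_le _ _).trans (add_le_add ?_ a3)
      exact (abs_add_le _ _).trans (add_le_add a1 a2)
    · refine (abs_add_le _ _).trans (add_le_add ?_ a6)
      exact (abs_add_le _ _).trans (add_le_add a4 a5)
  set X := (x + η * α) * β + α * (y + η * β) with hX
  have hαβ : 1 ≤ α * β := by nlinarith
  have g0 : η * (α * β) ≤ X := by
    have j1 : 0 ≤ x * β := by positivity
    have j2 : 0 ≤ α * y := by positivity
    have j3 : 0 ≤ η * (α * β) := by positivity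
    rw [hX]; linarith only [j1, j2, j3]
  have g1 : η ≤ X := (le_mul_of_one_le_right hη0 hαβ).trans g0
  have g2 : y ≤ X := by
    have j1 : 0 ≤ (x + η * α) * β := by positivity
    have j2 : 0 ≤ α * (η * β) := by positivity
    have j3 : y ≤ α * y := le_mul_of_one_le_left hy0 hα1
    rw [hX]; linarith only [j1, j2, j3]
  have g3 : x ≤ X := by
    have j1 : 0 ≤ α * (y + η * β) := by positivity
    have j2 : 0 ≤ η * α * β := by positivity
    have j3 : x ≤ x * β := le_mul_of_one_le_right hx0 hβ1
    rw [hX]; linarith only [j1, j2, j3]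
  have g4 : (x + η) * β ≤ X := by
    have j1 : 0 ≤ α * (y + η * β) := by positivity
    have j2 : η * β ≤ η * α * β := by
      rw [mul_assoc]
      exact mul_le_mul_of_nonneg_left
        (le_mul_of_one_le_left (zero_le_one.trans hβ1) hα1) hη0
    rw [hX]; linarith only [j1, j2]
  have g5 : α * (y + η) ≤ X := by
    have j1 : 0 ≤ (x + η * α) * β := by positivity
    have j2 : α * η ≤ α * (η * β) :=
      mul_le_mul_of_nonneg_left (le_mul_of_one_le_right hη0 hβ1) (zero_le_one.trans hα1)
    rw [hX]; linarith only [j1, j2]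
  refine b.trans ?_
  have f0 := mul_le_mul_of_nonneg_left g1 (by positivity : 0 ≤ K * (2 * K ^ 3))
  have f1 := mul_le_mul_of_nonneg_left g2 (by positivity : 0 ≤ K * K)
  have f2 := mul_le_mul_of_nonneg_left g3 (by positivity : 0 ≤ K * K)
  have f3 := mul_le_mul_of_nonneg_left g4 (by positivity : 0 ≤ K * (2 * K ^ 3 * (G * L)))
  have f4 := mul_le_mul_of_nonneg_left g0
    (by positivity : 0 ≤ K * (L * (G * (2 * K ^ 3 * (G * L)))))
  have f5 := mul_le_mul_of_nonneg_left g5 (by positivity : 0 ≤ K * (L * (G * (2 * K ^ 3))))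
  linarith only [f0, f1, f2, f3, f4, f5]

end LQData

/-! ### Measurability of matrix expressions -/

section MatrixMeasurability

variable {Z : Type*} [MeasurableSpace Z] {k l n : ℕ}

theorem measurable_dotProduct {u v : Z → Fin n → ℝ} (hu : Measurable u) (hv : Measurable v) :
    Measurable fun z => u z ⬝ᵥ v z :=
  Finset.measurable_sum _ fun i _ =>
    ((measurable_pi_apply i).comp hu).mul ((measurable_pi_apply i).comp hv)

theorem measurable_mulVec {A : Z → Matrix (Fin k) (Fin n) ℝ} {v : Z → Fin n → ℝ}
    (hA : ∀ i j, Measurable fun z => A z i j) (hv : Measurable v) :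
    Measurable fun z => A z *ᵥ v z :=
  measurable_pi_lambda _ fun i =>
    measurable_dotProduct (measurable_pi_lambda _ fun j => hA i j) hv

theorem measurable_matrix_mul {A : Z → Matrix (Fin k) (Fin n) ℝ}
    {A' : Z → Matrix (Fin n) (Fin l) ℝ} (hA : ∀ i j, Measurable fun z => A z i j)
    (hA' : ∀ i j, Measurable fun z => A' z i j) (i : Fin k) (j : Fin l) :
    Measurable fun z => (A z * A' z) i j := by
  simp only [Matrix.mul_apply]
  exact Finset.measurable_sum _ fun c _ => (hA i c).mul (hA' c j)

theorem measurable_matrix_det {A : Z → Matrix (Fin n) (Fin n) ℝ}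
    (hA : ∀ i j, Measurable fun z => A z i j) : Measurable fun z => (A z).det := by
  simp only [Matrix.det_apply]
  exact Finset.measurable_sum _ fun σ _ =>
    (Finset.measurable_prod _ fun i _ => hA _ _).const_smul _

theorem measurable_matrix_inv {A : Z → Matrix (Fin n) (Fin n) ℝ}
    (hA : ∀ i j, Measurable fun z => A z i j) (i j : Fin n) :
    Measurable fun z => (A z)⁻¹ i j := by
  simp only [Matrix.inv_def, Ring.inverse_eq_inv', Matrix.smul_apply, Matrix.adjugate_apply,
    smul_eq_mul]
  refine (measurable_matrix_det hA).inv.mul (measurable_matrix_det fun a b => ?_)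
  simp only [Matrix.updateRow_apply]
  split_ifs
  · exact measurable_const
  · exact hA a b

variable {d d' m : ℕ} (P : LQData d d' m) {h : ℝ} {I : Z → Matrix (Fin d') (Fin d') ℝ}

theorem measurable_sandwich {M₁ : Matrix (Fin k) (Fin d') ℝ} {M₂ : Matrix (Fin d') (Fin l) ℝ}
    (hI : ∀ i j, Measurable fun z => I z i j) (i : Fin k) (j : Fin l) :
    Measurable fun z => (M₁ * I z * M₂) i j :=
  measurable_matrix_mul (A := fun z => M₁ * I z) (A' := fun _ => M₂)
    (measurable_matrix_mul (A := fun _ => M₁) (fun _ _ => measurable_const) hI)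
    (fun _ _ => measurable_const) i j

theorem LQData.measurable_Nh (hI : ∀ i j, Measurable fun z => I z i j) (i j : Fin m) :
    Measurable fun z => P.Nh h (I z) i j := by
  simp only [LQData.Nh, Matrix.add_apply, Matrix.smul_apply]
  exact measurable_const.add ((measurable_sandwich hI i j).add
    ((measurable_sandwich hI i j).const_smul h))

theorem LQData.measurable_Sv (hI : ∀ i j, Measurable fun z => I z i j)
    {u : Z → (Fin d → ℝ) × (Fin d' → ℝ)} (hu : Measurable u) :
    Measurable fun z => P.Sv h (I z) (u z) := by
  refine (measurable_mulVec (A := fun _ => P.Cᵀ) (fun _ _ => measurable_const) hu.snd).add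
    (measurable_mulVec (A := fun z => P.Fᵀ * I z * P.D + h • (P.Cᵀ * I z * P.B))
      (fun i j => ?_) hu.fst)
  simp only [Matrix.add_apply, Matrix.smul_apply]
  exact (measurable_sandwich hI i j).add ((measurable_sandwich hI i j).const_smul h)

theorem LQData.measurable_Phi (hI : ∀ i j, Measurable fun z => I z i j)
    {u v : Z → (Fin d → ℝ) × (Fin d' → ℝ)} (hu : Measurable u) (hv : Measurable v) :
    Measurable fun z => P.Phi h (I z) (u z) (v z) := by
  have hc : ∀ {a b : ℕ} (M : Matrix (Fin a) (Fin b) ℝ) {w : Z → Fin b → ℝ}, Measurable w →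
      Measurable fun z => M *ᵥ w z := fun M w hw =>
    measurable_mulVec (A := fun _ => M) (fun _ _ => measurable_const) hw
  refine ((((measurable_dotProduct hu.fst (hc _ hv.fst)).add
    (measurable_dotProduct hu.fst (measurable_mulVec
      (A := fun z => P.Dᵀ * I z * P.D + h • (P.Bᵀ * I z * P.B)) (fun i j => ?_) hv.fst))).add
    (measurable_dotProduct (hc _ hu.fst) hv.snd)).add
    (measurable_dotProduct hu.snd (hc _ hv.fst))).sub
    (measurable_dotProduct (P.measurable_Sv hI hu) (measurable_mulVec
      (measurable_matrix_inv fun i j => P.measurable_Nh hI i j) (P.measurable_Sv hI hv)))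
  simp only [Matrix.add_apply, Matrix.smul_apply]
  exact (measurable_sandwich hI i j).add ((measurable_sandwich hI i j).const_smul h)

end MatrixMeasurability

theorem matrix_norm_le_of_entry_le {k l : ℕ} {A : Matrix (Fin k) (Fin l) ℝ} {c : ℝ}
    (hc : 0 ≤ c) (h : ∀ i j, |A i j| ≤ c) : ‖A‖ ≤ l * c := by
  rw [Matrix.linfty_opNorm_def]
  have : (Finset.univ : Finset (Fin k)).sup (fun i => ∑ j, ‖A i j‖₊) ≤ l * c.toNNReal := by
    refine Finset.sup_le fun i _ => (Finset.sum_le_card_nsmul _ _ c.toNNReal fun j _ => ?_).trans_eq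
      (by simp)
    rw [← NNReal.coe_le_coe, Real.coe_toNNReal _ hc]
    exact h i j
  refine (NNReal.coe_le_coe.2 this).trans_eq ?_
  simp [hc]

/-! ### Integrated kernels -/

/-- A scalar form of the factor space `ℝ₊ × {1, …, d}` of a Volterra system: a measure `ν` with
mean reversion speeds `ϑ` for which `(ϑ + 1)^{-1/2}` is integrable, bounded vectors `e` (reading
off the state) and the bounded density `σ` of the matrix measure. -/
structure FactorModel (d d' : ℕ) (Y : Type*) [MeasurableSpace Y] where
  ν : Measure Y
  sigmaFinite : SigmaFinite ν
  ϑ : Y → ℝ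
  measurable_ϑ : Measurable ϑ
  ϑ_nonneg : ∀ y, 0 ≤ ϑ y
  integrable_wt_one : Integrable (wt ϑ 1) ν
  e : Y → Fin d → ℝ
  measurable_e : Measurable e
  norm_e_le : ∀ y, ‖e y‖ ≤ 1
  σ : Y → Fin d' → ℝ
  measurable_σ : Measurable σ
  norm_σ_le : ∀ y, ‖σ y‖ ≤ 1

namespace FactorModel

variable {d d' m : ℕ} {Y : Type*} [MeasurableSpace Y] (M : FactorModel d d' Y)

instance : SigmaFinite M.ν := M.sigmaFinite

/-- The integrated kernel `a(y) = ∫ σ(y') K(y', y) ν(dy')`. -/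
def avec (K : Y × Y → ℝ) (y : Y) : Fin d' → ℝ := fun k => ∫ y', M.σ y' k * K (y', y) ∂M.ν

/-- The doubly integrated kernel `∬ σ(y) K(y, y') σ(y')ᵀ`. -/
def imat (K : Y × Y → ℝ) : Matrix (Fin d') (Fin d') ℝ :=
  Matrix.of fun k l => bil M.ν K (fun y => M.σ y k) fun y => M.σ y l

/-- The integral of the weight `(ϑ + l)^{-1/2}`, which tends to zero as `l → ∞`. -/
def kap (l : ℝ) : ℝ := ∫ y, wt M.ϑ l y ∂M.ν

/-- Membership in the weighted test space. -/
abbrev Test (f : Y → ℝ) : Prop := IsTest M.ν M.ϑ f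

/-- Symmetric kernels whose quadratic form is nonnegative on the test space. -/
structure PSD (K : Y × Y → ℝ) : Prop where
  symm : ∀ p, K p.swap = K p
  nonneg : ∀ f, M.Test f → 0 ≤ bil M.ν K f f

/-- Measurable kernels dominated by `C` times the product of the weights. -/
structure Decay (K : Y × Y → ℝ) (l C : ℝ) : Prop where
  meas : Measurable K
  one_le : 1 ≤ l
  bound : ∀ p, |K p| ≤ C * (wt M.ϑ l p.1 * wt M.ϑ l p.2)

variable {M} {K K' : Y × Y → ℝ} {l C : ℝ}

theorem abs_σ_le (y : Y) (k : Fin d') : |M.σ y k| ≤ 1 := (norm_le_pi_norm _ k).trans (M.norm_σ_le y)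

theorem measurable_σ_apply (k : Fin d') : Measurable fun y => M.σ y k :=
  (measurable_pi_apply k).comp M.measurable_σ

theorem wt_nonneg (hl : 1 ≤ l) (y : Y) : 0 ≤ wt M.ϑ l y := (wt_pos M.ϑ_nonneg hl y).le

theorem integrable_wt (hl : 1 ≤ l) : Integrable (wt M.ϑ l) M.ν :=
  _root_.integrable_wt M.measurable_ϑ M.ϑ_nonneg M.integrable_wt_one hl

theorem kap_nonneg (hl : 1 ≤ l) : 0 ≤ M.kap l := integral_nonneg fun y => wt_nonneg hl y

theorem test_bounded {f : Y → ℝ} (hf : Measurable f) {C : ℝ} (hC : ∀ y, |f y| ≤ C) : M.Test f :=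
  isTest_of_bounded M.integrable_wt_one hf hC

theorem abs_dotProduct_σ_le (w : Fin d' → ℝ) (y : Y) : |M.σ y ⬝ᵥ w| ≤ d' * ‖w‖ := by
  simpa using LQData.abs_dotProduct_le_of_le (le_refl (d' : ℝ)) (M.norm_σ_le y) (le_refl ‖w‖)

theorem measurable_dotProduct_σ (w : Fin d' → ℝ) : Measurable fun y => M.σ y ⬝ᵥ w :=
  measurable_dotProduct M.measurable_σ measurable_const

theorem test_dotProduct_σ (w : Fin d' → ℝ) : M.Test fun y => M.σ y ⬝ᵥ w :=
  test_bounded (measurable_dotProduct_σ w) (abs_dotProduct_σ_le w)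

theorem test_σ (k : Fin d') : M.Test fun y => M.σ y k :=
  test_bounded (measurable_σ_apply k) fun y => abs_σ_le y k

theorem test_of_integrable {f : Y → ℝ} (hf : Integrable f M.ν) : M.Test f :=
  isTest_of_integrable M.measurable_ϑ M.ϑ_nonneg hf

theorem Decay.C_nonneg (hK : M.Decay K l C) (y : Y) : 0 ≤ C := by
  have h := (abs_nonneg _).trans (hK.bound (y, y))
  have := wt_pos M.ϑ_nonneg hK.one_le y
  exact nonneg_of_mul_nonneg_left h (by positivity)

theorem Decay.integrable_bil (hK : M.Decay K l C) {f g : Y → ℝ} (hf : M.Test f) (hg : M.Test g) :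
    Integrable (fun p => f p.1 * K p * g p.2) (M.ν.prod M.ν) :=
  _root_.integrable_bil hK.meas (fun y => wt_nonneg hK.one_le y) hK.bound
    (hf.aestronglyMeasurable M.measurable_ϑ M.ϑ_nonneg)
    (hg.aestronglyMeasurable M.measurable_ϑ M.ϑ_nonneg)
    (hf.integrable_wt_mul M.measurable_ϑ M.ϑ_nonneg hK.one_le)
    (hg.integrable_wt_mul M.measurable_ϑ M.ϑ_nonneg hK.one_le)

theorem Decay.abs_bil_le (hK : M.Decay K l C) {f g : Y → ℝ} (hf : M.Test f) (hg : M.Test g) :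
    |bil M.ν K f g| ≤ C * ((∫ y, wt M.ϑ l y * |f y| ∂M.ν) * ∫ y, wt M.ϑ l y * |g y| ∂M.ν) :=
  _root_.abs_bil_le (fun y => wt_nonneg hK.one_le y) hK.bound
    (hf.integrable_wt_mul M.measurable_ϑ M.ϑ_nonneg hK.one_le)
    (hg.integrable_wt_mul M.measurable_ϑ M.ϑ_nonneg hK.one_le)

theorem integral_wt_mul_abs_le (hl : 1 ≤ l) {f : Y → ℝ} {c : ℝ} (hc : ∀ y, |f y| ≤ c) :
    ∫ y, wt M.ϑ l y * |f y| ∂M.ν ≤ c * M.kap l := by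
  rw [kap, ← integral_const_mul]
  refine integral_mono_of_nonneg (ae_of_all _ fun y => mul_nonneg (wt_nonneg hl y) (abs_nonneg _))
    ((integrable_wt hl).const_mul c) (ae_of_all _ fun y => ?_)
  dsimp only
  rw [mul_comm]
  exact mul_le_mul_of_nonneg_right (hc y) (wt_nonneg hl y)

theorem Decay.integrable_avec (hK : M.Decay K l C) (y : Y) (k : Fin d') :
    Integrable (fun y' => M.σ y' k * K (y', y)) M.ν := by
  have hC := hK.C_nonneg y
  refine ((integrable_wt (M := M) hK.one_le).const_mul (C * wt M.ϑ l y)).mono'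
    ((measurable_σ_apply k).mul (hK.meas.comp (by fun_prop))).aestronglyMeasurable
    (ae_of_all _ fun y' => ?_)
  rw [norm_mul]
  refine (mul_le_mul (abs_σ_le y' k) (hK.bound (y', y)) (abs_nonneg _) zero_le_one).trans
    (le_of_eq ?_)
  ring

theorem Decay.norm_avec_le (hK : M.Decay K l C) (y : Y) :
    ‖M.avec K y‖ ≤ C * M.kap l * wt M.ϑ l y := by
  have hC := hK.C_nonneg y
  have hw := wt_nonneg (M := M) hK.one_le y
  have hk := kap_nonneg (M := M) hK.one_le
  refine (pi_norm_le_iff_of_nonneg (by positivity)).2 fun k => ?_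
  have h := norm_integral_le_of_norm_le (f := fun y' => M.σ y' k * K (y', y))
    ((integrable_wt (M := M) hK.one_le).const_mul (C * wt M.ϑ l y)) (ae_of_all _ fun y' => by
      rw [norm_mul]
      exact (mul_le_mul (abs_σ_le y' k) (hK.bound (y', y)) (abs_nonneg _) zero_le_one).trans
        (le_of_eq (by ring)))
  rw [integral_const_mul] at h
  exact h.trans (le_of_eq (by rw [kap]; ring))

theorem Decay.norm_imat_le (hK : M.Decay K l C) (hC : 0 ≤ C) :
    ‖M.imat K‖ ≤ d' * (C * M.kap l ^ 2) := by
  have hk := kap_nonneg (M := M) hK.one_le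
  refine matrix_norm_le_of_entry_le (by positivity) fun i j => ?_
  refine (hK.abs_bil_le (test_σ i) (test_σ j)).trans ?_
  have h : ∀ k, ∫ y, wt M.ϑ l y * |M.σ y k| ∂M.ν ≤ M.kap l := fun k => by
    simpa using integral_wt_mul_abs_le hK.one_le fun y => abs_σ_le (M := M) y k
  have h0 : ∀ k, 0 ≤ ∫ y, wt M.ϑ l y * |M.σ y k| ∂M.ν := fun k =>
    integral_nonneg fun y => mul_nonneg (wt_nonneg hK.one_le y) (abs_nonneg _)
  rw [sq]
  exact mul_le_mul_of_nonneg_left (mul_le_mul (h i) (h j) (h0 j) hk) hC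

theorem Decay.avec_sub {C' l' : ℝ} (hK : M.Decay K l C) (hK' : M.Decay K' l' C') (y : Y) :
    M.avec (fun p => K p - K' p) y = M.avec K y - M.avec K' y := by
  ext k
  simp only [avec, Pi.sub_apply]
  rw [← integral_sub (hK.integrable_avec y k) (hK'.integrable_avec y k)]
  simp only [mul_sub]

theorem Decay.imat_sub {C' l' : ℝ} (hK : M.Decay K l C) (hK' : M.Decay K' l' C') :
    M.imat (fun p => K p - K' p) = M.imat K - M.imat K' := by
  ext i j
  simp only [imat, Matrix.of_apply, Matrix.sub_apply]
  exact bil_sub_kernel (hK.integrable_bil (test_σ i) (test_σ j))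
    (hK'.integrable_bil (test_σ i) (test_σ j))

theorem measurable_avec {Z : Type*} [MeasurableSpace Z] {R : Z × Y × Y → ℝ} (hR : Measurable R) :
    Measurable fun q : Z × Y => M.avec (fun p => R (q.1, p)) q.2 := by
  refine measurable_pi_lambda _ fun k => ?_
  refine (StronglyMeasurable.integral_prod_right' (ν := M.ν)
    (f := fun x : (Z × Y) × Y => M.σ x.2 k * R (x.1.1, x.2, x.1.2))
    (Measurable.stronglyMeasurable ?_)).measurable
  exact ((measurable_σ_apply k).comp measurable_snd).mul (hR.comp (by fun_prop))

theorem measurable_imat {Z : Type*} [MeasurableSpace Z] {R : Z × Y × Y → ℝ} (hR : Measurable R)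
    (i j : Fin d') : Measurable fun z : Z => M.imat (fun p => R (z, p)) i j := by
  refine (StronglyMeasurable.integral_prod_right' (ν := M.ν.prod M.ν)
    (f := fun x : Z × (Y × Y) => M.σ x.2.1 i * R (x.1, x.2) * M.σ x.2.2 j)
    (Measurable.stronglyMeasurable ?_)).measurable
  exact (((measurable_σ_apply i).comp (by fun_prop)).mul (hR.comp (by fun_prop))).mul
    ((measurable_σ_apply j).comp (by fun_prop))

theorem imat_transpose (hs : ∀ p, K p.swap = K p) : (M.imat K)ᵀ = M.imat K := by
  ext i j
  exact bil_swap (ν := M.ν) hs (fun y => M.σ y j) fun y => M.σ y i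

theorem dotProduct_imat
    (hK : ∀ i j, Integrable (fun p => M.σ p.1 i * K p * M.σ p.2 j) (M.ν.prod M.ν))
    (w v : Fin d' → ℝ) :
    w ⬝ᵥ (M.imat K *ᵥ v) = bil M.ν K (fun y => M.σ y ⬝ᵥ w) fun y => M.σ y ⬝ᵥ v := by
  have h1 : (fun p : Y × Y => (M.σ p.1 ⬝ᵥ w) * K p * (M.σ p.2 ⬝ᵥ v)) = fun p =>
      ∑ i, ∑ j, w i * v j * (M.σ p.1 i * K p * M.σ p.2 j) := by
    ext p
    simp only [dotProduct, Finset.sum_mul, Finset.mul_sum]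
    rw [Finset.sum_comm]
    refine Finset.sum_congr rfl fun i _ => Finset.sum_congr rfl fun j _ => by ring
  rw [bil, h1, integral_finsetSum]
  · simp only [dotProduct, Matrix.mulVec, imat, Matrix.of_apply, Finset.mul_sum]
    refine Finset.sum_congr rfl fun i _ => ?_
    rw [integral_finsetSum]
    · refine Finset.sum_congr rfl fun j _ => ?_
      rw [integral_const_mul, bil]; ring
    · exact fun j _ => (hK i j).const_mul _
  · exact fun i _ => integrable_finsetSum _ fun j _ => (hK i j).const_mul _

theorem Decay.dotProduct_imat (hK : M.Decay K l C) (w v : Fin d' → ℝ) :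
    w ⬝ᵥ (M.imat K *ᵥ v) = bil M.ν K (fun y => M.σ y ⬝ᵥ w) fun y => M.σ y ⬝ᵥ v :=
  FactorModel.dotProduct_imat (fun i j => hK.integrable_bil (test_σ i) (test_σ j)) w v

/-- Pairing one argument of a symmetric kernel with `σ · w` integrates that argument out. -/
theorem Decay.bil_dotProduct_σ (hK : M.Decay K l C) (hs : ∀ p, K p.swap = K p) {f : Y → ℝ}
    (hf : M.Test f) (w : Fin d' → ℝ) :
    bil M.ν K f (fun y => M.σ y ⬝ᵥ w) = ∫ y, (M.avec K y ⬝ᵥ w) * f y ∂M.ν := by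
  rw [bil_swap hs, bil_eq_integral (hK.integrable_bil (test_dotProduct_σ w) hf)]
  refine integral_congr_ae (ae_of_all _ fun y => ?_)
  dsimp only
  congr 1
  simp only [avec, dotProduct, Finset.sum_mul]
  rw [integral_finsetSum]
  · refine Finset.sum_congr rfl fun k _ => ?_
    rw [← integral_mul_const]
    congr 1; ext y'; ring
  · intro k _
    exact ((hK.integrable_avec y k).mul_const (w k)).congr (ae_of_all _ fun y' => by
      dsimp only; ring)

theorem Decay.bil_add_smul (hK : M.Decay K l C) (hs : ∀ p, K p.swap = K p) {f g : Y → ℝ}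
    (hf : M.Test f) (hg : M.Test g) (c : ℝ) :
    bil M.ν K (fun y => f y + c * g y) (fun y => f y + c * g y) =
      bil M.ν K f f + 2 * c * bil M.ν K f g + c ^ 2 * bil M.ν K g g := by
  have h1 : (fun p : Y × Y => (f p.1 + c * g p.1) * K p * (f p.2 + c * g p.2)) = fun p =>
      (f p.1 * K p * f p.2 + c * (f p.1 * K p * g p.2)) + (c * (g p.1 * K p * f p.2) +
        c ^ 2 * (g p.1 * K p * g p.2)) := by
    ext p; ring
  have i1 := hK.integrable_bil hf hf
  have i2 := hK.integrable_bil hf hg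
  have i3 := hK.integrable_bil hg hf
  have i4 := hK.integrable_bil hg hg
  have e : bil M.ν K (fun y => f y + c * g y) (fun y => f y + c * g y) =
      bil M.ν K f f + c * bil M.ν K f g + (c * bil M.ν K g f + c ^ 2 * bil M.ν K g g) := by
    rw [bil, h1]
    refine (integral_add (i1.add (i2.const_mul c))
      ((i3.const_mul c).add (i4.const_mul (c ^ 2)))).trans ?_
    congr 1
    · refine (integral_add i1 (i2.const_mul c)).trans ?_
      rw [integral_const_mul]; rfl
    · refine (integral_add (i3.const_mul c) (i4.const_mul (c ^ 2))).trans ?_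
      rw [integral_const_mul, integral_const_mul]; rfl
  rw [e, bil_swap hs g f]; ring

theorem PSD.imat_nonneg (hp : M.PSD K) (hK : M.Decay K l C) (w : Fin d' → ℝ) :
    0 ≤ w ⬝ᵥ (M.imat K *ᵥ w) := by
  rw [hK.dotProduct_imat]
  exact hp.nonneg _ (test_dotProduct_σ w)

/-- Twice a mixed term of a nonnegative form is at most the sum of the diagonal terms. -/
theorem PSD.two_mul_bil_le (hp : M.PSD K) (hK : M.Decay K l C) {f g : Y → ℝ}
    (hf : M.Test f) (hg : M.Test g) :
    2 * bil M.ν K f g ≤ bil M.ν K f f + bil M.ν K g g := by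
  have h := hK.bil_add_smul hp.symm hf hg (-1)
  have h2 : M.Test fun y => f y + -1 * g y :=
    hf.add ((Integrable.const_mul hg (-1)).congr (ae_of_all _ fun y => by dsimp only; ring))
  have h3 := hp.nonneg _ h2
  rw [h] at h3
  linarith

/-- The entries of the doubly integrated kernel are controlled by the quadratic form. -/
theorem PSD.abs_imat_le (hp : M.PSD K) (hK : M.Decay K l C) {ι : ℝ}
    (hι : ∀ k, bil M.ν K (fun y => M.σ y k) (fun y => M.σ y k) ≤ ι) (i j : Fin d') :
    |M.imat K i j| ≤ ι := by
  have h1 := hp.two_mul_bil_le hK (test_σ i) (test_σ j)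
  -- reversing the sign of one argument turns the upper bound into a lower bound
  have hn : M.Test fun y => -M.σ y j := (test_σ j).neg.congr (ae_of_all _ fun y => by simp)
  have h2 := hp.two_mul_bil_le hK (test_σ i) hn
  have e1 : bil M.ν K (fun y => M.σ y i) (fun y => -M.σ y j) = -M.imat K i j := by
    simp [imat, bil, integral_neg]
  have e2 : bil M.ν K (fun y => -M.σ y j) (fun y => -M.σ y j) =
      bil M.ν K (fun y => M.σ y j) (fun y => M.σ y j) := by
    simp [bil]
  rw [e1, e2] at h2
  have e3 : bil M.ν K (fun y => M.σ y i) (fun y => M.σ y j) = M.imat K i j := rfl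
  rw [e3] at h1
  have := hι i
  have := hι j
  exact abs_le.2 ⟨by linarith, by linarith⟩

/-- A nonnegative kernel whose quadratic form is bounded by `γ (∫ |f|)²` has an essentially bounded
integrated kernel: test the form on `σ` perturbed by indicator functions. -/
theorem PSD.ae_abs_avec_le (hp : M.PSD K) (hK : M.Decay K l C) {ι γ : ℝ}
    (hι : ∀ k, bil M.ν K (fun y => M.σ y k) (fun y => M.σ y k) ≤ ι)
    (hγ : ∀ f, Integrable f M.ν → bil M.ν K f f ≤ γ * (∫ y, |f y| ∂M.ν) ^ 2) :
    ∀ᵐ y ∂M.ν, ∀ k, |M.avec K y k| ≤ (ι + γ) / 2 := by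
  have ham : ∀ k, Measurable fun y => M.avec K y k := fun k =>
    (measurable_pi_apply k).comp ((measurable_avec (M := M) (Z := Unit) (R := fun q => K q.2)
      (hK.meas.comp measurable_snd)).comp (by fun_prop : Measurable fun y : Y => ((), y)))
  -- `s = ±1` is a sign
  have key : ∀ (k : Fin d') (s : ℝ), s ^ 2 = 1 → ∀ᵐ y ∂M.ν, s * M.avec K y k ≤ (ι + γ) / 2 := by
    intro k s hs
    have hint : ∀ E, MeasurableSet E → M.ν E < ∞ →
        IntegrableOn (fun y => s * M.avec K y k) E M.ν := fun E hE hEf => by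
      refine Measure.integrableOn_of_bounded (M := |s| * (C * M.kap l)) hEf.ne
        ((ham k).const_mul s).aestronglyMeasurable (ae_of_all _ fun y => ?_)
      rw [norm_mul]
      have hC := hK.C_nonneg y
      have hk := kap_nonneg (M := M) hK.one_le
      have hw := wt_le_one M.ϑ_nonneg hK.one_le y
      refine mul_le_mul_of_nonneg_left ?_ (abs_nonneg s)
      refine (norm_le_pi_norm _ k).trans ((hK.norm_avec_le y).trans ?_)
      exact mul_le_of_le_one_right (by positivity) hw
    have h0 : 0 ≤ᵐ[M.ν] fun y => (ι + γ) / 2 - s * M.avec K y k := by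
      have hci : ∀ E, M.ν E < ∞ → IntegrableOn (fun _ => (ι + γ) / 2) E M.ν := fun E hEf =>
        integrableOn_const hEf.ne
      refine ae_nonneg_of_forall_setIntegral_nonneg_of_sigmaFinite
        (fun E hE hEf => (hci E hEf).sub (hint E hE hEf)) fun E hE hEf => ?_
      rw [integral_sub (hci E hEf) (hint E hE hEf), setIntegral_const, smul_eq_mul]
      set r := M.ν.real E with hr
      rcases eq_or_lt_of_le (measureReal_nonneg : 0 ≤ M.ν.real E) with h | h
      · have hz : M.ν E = 0 := (measureReal_eq_zero_iff hEf.ne).1 h.symm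
        rw [setIntegral_measure_zero _ hz, hr, ← h]; simp
      · rw [← hr] at h
        -- the test function is `±1_E / ν(E)`, of unit mass, so that its mixed term with `σ_k` is the
        -- mean of `±a_k` over `E`
        have hfi : Integrable (E.indicator fun _ => s * r⁻¹) M.ν :=
          (integrable_indicator_iff hE).2 (integrableOn_const hEf.ne)
        have h1 := hp.two_mul_bil_le hK (test_of_integrable hfi) (test_σ k)
        have h2 := hγ _ hfi
        have habs : |s| = 1 := by
          rw [← abs_one, ← sq_eq_sq_iff_abs_eq_abs, hs, one_pow]
        have h3 : ∫ y, |E.indicator (fun _ => s * r⁻¹) y| ∂M.ν = 1 := by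
          have : (fun y => |E.indicator (fun _ => s * r⁻¹) y|) =
              E.indicator fun _ => |s * r⁻¹| := by
            ext y; by_cases hy : y ∈ E <;> simp [hy]
          rw [this, integral_indicator hE, setIntegral_const, ← hr, smul_eq_mul, abs_mul,
            abs_of_pos (inv_pos.2 h), habs, one_mul, mul_inv_cancel₀ h.ne']
        rw [h3, one_pow, mul_one] at h2
        have h4 : bil M.ν K (E.indicator fun _ => s * r⁻¹) (fun y => M.σ y k) =
            r⁻¹ * ∫ y in E, s * M.avec K y k ∂M.ν := by
          have hσk : (fun y => M.σ y k) = fun y => M.σ y ⬝ᵥ Pi.single k 1 := by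
            ext y; simp
          rw [hσk, hK.bil_dotProduct_σ hp.symm (test_of_integrable hfi), ← integral_const_mul,
            ← integral_indicator hE]
          refine integral_congr_ae (ae_of_all _ fun y => ?_)
          by_cases hy : y ∈ E
          · simp [hy]; ring
          · simp [hy]
        rw [h4] at h1
        have h5 : r⁻¹ * ∫ y in E, s * M.avec K y k ∂M.ν ≤ (ι + γ) / 2 := by linarith [hι k]
        rw [inv_mul_le_iff₀ h] at h5
        linarith
    exact h0.mono fun y hy => by simpa using hy
  have h1 : ∀ᵐ y ∂M.ν, ∀ k, M.avec K y k ≤ (ι + γ) / 2 ∧ -M.avec K y k ≤ (ι + γ) / 2 := by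
    refine ae_all_iff.2 fun k => ?_
    filter_upwards [key k 1 (by norm_num), key k (-1) (by norm_num)] with y h1 h2
    exact ⟨by simpa using h1, by simpa using h2⟩
  exact h1.mono fun y hy k => abs_le.2 ⟨by linarith [(hy k).2], (hy k).1⟩

end FactorModel

/-! ### The truncated Riccati kernel -/

/-- Componentwise truncation of a vector to `[-A, A]`. Applied to the integrated kernel it makes the
Riccati right-hand side globally bounded and Lipschitz; for the solutions it is inactive almost
everywhere. -/
def clampVec {n : ℕ} (A : ℝ) (a : Fin n → ℝ) : Fin n → ℝ := fun k => max (-A) (min (a k) A)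

section ClampVec

variable {n : ℕ} {A : ℝ}

theorem norm_clampVec_le (hA : 0 ≤ A) (a : Fin n → ℝ) : ‖clampVec A a‖ ≤ A :=
  (pi_norm_le_iff_of_nonneg hA).2 fun _ =>
    abs_le.2 ⟨le_max_left _ _, max_le (by linarith) (min_le_right _ _)⟩

theorem norm_clampVec_sub_le (a b : Fin n → ℝ) : ‖clampVec A a - clampVec A b‖ ≤ ‖a - b‖ := by
  refine (pi_norm_le_iff_of_nonneg (norm_nonneg _)).2 fun k => ?_
  refine le_trans ?_ (norm_le_pi_norm (a - b) k)
  simp only [Pi.sub_apply, clampVec, Real.norm_eq_abs]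
  calc _ ≤ max |(-A) - (-A)| |min (a k) A - min (b k) A| := abs_max_sub_max_le_max _ _ _ _
    _ = |min (a k) A - min (b k) A| := by simp
    _ ≤ max |a k - b k| |A - A| := abs_min_sub_min_le_max _ _ _ _
    _ = _ := by simp

theorem clampVec_eq_self {a : Fin n → ℝ} (h : ∀ k, |a k| ≤ A) : clampVec A a = a := by
  ext k
  have := abs_le.1 (h k)
  simp only [clampVec]
  rw [min_eq_left this.2, max_eq_right this.1]

theorem measurable_clampVec {Z : Type*} [MeasurableSpace Z] {a : Z → Fin n → ℝ}
    (ha : Measurable a) : Measurable fun z => clampVec A (a z) :=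
  measurable_pi_lambda _ fun k => measurable_const.max
    (((measurable_pi_apply k).comp ha).min measurable_const)

end ClampVec

theorem LQData.dotProduct_N_nonneg {d d' m : ℕ} {P : LQData d d' m} {lam : ℝ} (hl : 0 < lam)
    (hN : (P.N - lam • (1 : Matrix (Fin m) (Fin m) ℝ)).PosSemidef) (u : Fin m → ℝ) :
    0 ≤ u ⬝ᵥ (P.N *ᵥ u) := by
  have h1 := hN.dotProduct_mulVec_nonneg u
  rw [star_trivial, Matrix.sub_mulVec, Matrix.smul_mulVec, Matrix.one_mulVec, dotProduct_sub,
    dotProduct_smul, smul_eq_mul] at h1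
  have : 0 ≤ lam * (u ⬝ᵥ u) := mul_nonneg hl.le (Finset.sum_nonneg fun i _ => mul_self_nonneg _)
  linarith

theorem LQData.N_transpose {d d' m : ℕ} {P : LQData d d' m} {lam : ℝ}
    (hN : (P.N - lam • (1 : Matrix (Fin m) (Fin m) ℝ)).PosSemidef) : P.Nᵀ = P.N := by
  have h := hN.isHermitian
  rw [Matrix.IsHermitian, Matrix.conjTranspose_eq_transpose_of_trivial, Matrix.transpose_sub,
    Matrix.transpose_smul, Matrix.transpose_one] at h
  exact sub_left_injective h

namespace FactorModel

variable {d d' m : ℕ} {Y : Type*} [MeasurableSpace Y] {M : FactorModel d d' Y}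
  {P : LQData d d' m} {K K' : Y × Y → ℝ} {l C h h' A lam : ℝ}

/-- The quadratic form of the kernel `Phi(u(y), u(y'))` is `Phi` at the integrated vector. -/
theorem bil_Phi {u : Y → (Fin d → ℝ) × (Fin d' → ℝ)} {f : Y → ℝ}
    (I : Matrix (Fin d') (Fin d') ℝ) (hi : Integrable (fun y => f y • u y) M.ν) :
    bil M.ν (fun p => P.Phi h I (u p.1) (u p.2)) f f =
      P.Phi h I (∫ y, f y • u y ∂M.ν) (∫ y, f y • u y ∂M.ν) := by
  obtain ⟨B, hB⟩ : ∃ B : ((Fin d → ℝ) × (Fin d' → ℝ)) →L[ℝ] ((Fin d → ℝ) × (Fin d' → ℝ)) →L[ℝ] ℝ,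
      ∀ v w, B v w = P.Phi h I v w :=
    ⟨(P.PhiLin h I).toContinuousBilinearMap, fun v w => by
      rw [LinearMap.toContinuousBilinearMap_apply, LQData.PhiLin, LinearMap.mk₂_apply]⟩
  rw [← hB, ← integral_prod_bilin B hi hi]
  refine integral_congr_ae (ae_of_all _ fun p => ?_)
  simp only [map_smul, smul_apply, smul_eq_mul, hB]
  ring

variable (M P) in
/-- The state vector paired with the truncated integrated kernel. -/
def upair (A : ℝ) (K : Y × Y → ℝ) (y : Y) : (Fin d → ℝ) × (Fin d' → ℝ) :=
  (M.e y, clampVec A (M.avec K y))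

variable (M P) in
/-- The (regularized, truncated) Riccati right-hand side as a kernel. -/
def rker (h A : ℝ) (K : Y × Y → ℝ) (p : Y × Y) : ℝ :=
  P.Phi h (M.imat K) (M.upair A K p.1) (M.upair A K p.2)

theorem measurable_upair {Z : Type*} [MeasurableSpace Z] {R : Z × Y × Y → ℝ} (hR : Measurable R) :
    Measurable fun q : Z × Y => M.upair A (fun p => R (q.1, p)) q.2 :=
  (M.measurable_e.comp measurable_snd).prodMk (measurable_clampVec (measurable_avec hR))

theorem measurable_upair_kernel (hK : Measurable K) : Measurable (M.upair A K) :=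
  (measurable_upair (Z := Unit) (R := fun q => K q.2) (hK.comp measurable_snd)).comp
    (by fun_prop : Measurable fun y : Y => ((), y))

theorem measurable_rker {Z : Type*} [MeasurableSpace Z] {R : Z × Y × Y → ℝ} (hR : Measurable R) :
    Measurable fun q : Z × Y × Y => M.rker P h A (fun p => R (q.1, p)) q.2 := by
  refine P.measurable_Phi (fun i j => (measurable_imat hR i j).comp measurable_fst) ?_ ?_
  · exact (measurable_upair hR).comp (by fun_prop : Measurable fun q : Z × Y × Y => (q.1, q.2.1))
  · exact (measurable_upair hR).comp (by fun_prop : Measurable fun q : Z × Y × Y => (q.1, q.2.2))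

theorem norm_upair_le (hA : 0 ≤ A) (y : Y) : ‖M.upair A K y‖ ≤ 1 + A :=
  max_le ((M.norm_e_le y).trans (by linarith)) ((norm_clampVec_le hA _).trans (by linarith))

theorem integrable_smul_upair (hK : Measurable K) (hA : 0 ≤ A) {f : Y → ℝ}
    (hf : Integrable f M.ν) : Integrable (fun y => f y • M.upair A K y) M.ν :=
  hf.smul_bdd (1 + A) (measurable_upair_kernel hK).aestronglyMeasurable
    (ae_of_all _ fun y => norm_upair_le hA y)

/-- Integrating `f` against the integrated kernel is pairing `f` with `σ` in the form of the kernel,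
where the truncation is inactive. -/
theorem dotProduct_integral_upair (hK : M.Decay K l C) (hs : ∀ p, K p.swap = K p) (hA : 0 ≤ A)
    (hc : ∀ᵐ y ∂M.ν, clampVec A (M.avec K y) = M.avec K y) {f : Y → ℝ} (hf : Integrable f M.ν)
    (w : Fin d' → ℝ) :
    w ⬝ᵥ (∫ y, f y • M.upair A K y ∂M.ν).2 = bil M.ν K f fun y => M.σ y ⬝ᵥ w := by
  rw [hK.bil_dotProduct_σ hs (test_of_integrable hf)]
  let Lw : ((Fin d → ℝ) × (Fin d' → ℝ)) →ₗ[ℝ] ℝ :=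
    { toFun := fun v => w ⬝ᵥ v.2
      map_add' := fun v v' => by simp [dotProduct_add]
      map_smul' := fun c v => by simp [dotProduct_smul] }
  obtain ⟨B, hB⟩ : ∃ B : ((Fin d → ℝ) × (Fin d' → ℝ)) →L[ℝ] ℝ, ∀ v, B v = w ⬝ᵥ v.2 :=
    ⟨LinearMap.toContinuousLinearMap Lw, fun _ => rfl⟩
  rw [← hB, ← B.integral_comp_comm (integrable_smul_upair hK.meas hA hf)]
  refine integral_congr_ae (hc.mono fun y hy => ?_)
  dsimp only
  rw [hB, upair, Prod.smul_snd, hy, dotProduct_smul, smul_eq_mul, dotProduct_comm, mul_comm]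

theorem norm_integral_upair_fst_le (hK : Measurable K) (hA : 0 ≤ A) {f : Y → ℝ}
    (hf : Integrable f M.ν) : ‖(∫ y, f y • M.upair A K y ∂M.ν).1‖ ≤ ∫ y, |f y| ∂M.ν := by
  have h1 := ContinuousLinearMap.integral_comp_comm
    (ContinuousLinearMap.fst ℝ (Fin d → ℝ) (Fin d' → ℝ)) (integrable_smul_upair hK hA hf)
  rw [ContinuousLinearMap.coe_fst'] at h1
  rw [← h1]
  refine norm_integral_le_of_norm_le hf.abs (ae_of_all _ fun y => ?_)
  change ‖f y • M.e y‖ ≤ _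
  rw [norm_smul]
  exact mul_le_of_le_one_right (norm_nonneg _) (M.norm_e_le y)

theorem rker_symm (hQ : P.Qᵀ = P.Q) (hN : P.Nᵀ = P.N) (hs : ∀ p, K p.swap = K p) (p : Y × Y) :
    M.rker P h A K p.swap = M.rker P h A K p :=
  LQData.Phi_comm hQ hN (imat_transpose hs) _ _

/-- Positivity of one regularized time step: `Γ / h` plus the regularized Riccati kernel is a
nonnegative form, being the minimum over controls `u` of nonnegative quadratic expressions. -/
theorem rker_nonneg (hl : 0 < lam) (hQ : P.Q.PosSemidef)
    (hN : (P.N - lam • (1 : Matrix (Fin m) (Fin m) ℝ)).PosSemidef) (hh : 0 < h) (hA : 0 ≤ A)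
    (hK : M.Decay K l C) (hp : M.PSD K)
    (hc : ∀ᵐ y ∂M.ν, clampVec A (M.avec K y) = M.avec K y) {f : Y → ℝ} (hf : Integrable f M.ν) :
    0 ≤ h⁻¹ * bil M.ν K f f + bil M.ν (M.rker P h A K) f f := by
  have hI := hp.imat_nonneg hK
  have e0 : bil M.ν (M.rker P h A K) f f = _ :=
    bil_Phi (M.imat K) (integrable_smul_upair hK.meas hA hf)
  obtain ⟨u, hu⟩ := LQData.Phi_self_eq hl (LQData.coercive_Nh hh.le hN hI)
    (imat_transpose hp.symm) (∫ y, f y • M.upair A K y ∂M.ν).1 (∫ y, f y • M.upair A K y ∂M.ν).2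
  rw [e0, hu]
  set x := (∫ y, f y • M.upair A K y ∂M.ν).1
  set w := P.B *ᵥ x + P.C *ᵥ u
  rw [dotProduct_integral_upair hK hp.symm hA hc hf]
  have ht := test_of_integrable hf
  have h1 := hK.bil_add_smul hp.symm ht (test_dotProduct_σ w) h
  have h2 : M.Test fun y => f y + h * (M.σ y ⬝ᵥ w) :=
    ht.add ((Integrable.const_mul (test_dotProduct_σ w) h).congr
      (ae_of_all _ fun y => by dsimp only; ring))
  have h3 := hp.nonneg _ h2
  rw [h1, ← hK.dotProduct_imat] at h3
  have h4 := hI (P.D *ᵥ x + P.F *ᵥ u)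
  have h5 : 0 ≤ x ⬝ᵥ (P.Q *ᵥ x) := by simpa using hQ.dotProduct_mulVec_nonneg x
  have h6 := LQData.dotProduct_N_nonneg hl hN u
  have h7 := mul_nonneg (inv_pos.2 hh).le h3
  -- the form of `K` at `f + h σ · w`, with `w = B x + C u` the controlled drift, divided by `h`
  have e : h⁻¹ * (bil M.ν K f f + 2 * h * bil M.ν K f (fun y => M.σ y ⬝ᵥ w) +
      h ^ 2 * (w ⬝ᵥ (M.imat K *ᵥ w))) = h⁻¹ * bil M.ν K f f +
      2 * bil M.ν K f (fun y => M.σ y ⬝ᵥ w) + h * (w ⬝ᵥ (M.imat K *ᵥ w)) := by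
    field_simp
  rw [e] at h7
  linarith

/-- Upper bound on the Riccati kernel, obtained by dropping the control term. -/
theorem bil_rker_le (hl : 0 < lam)
    (hN : (P.N - lam • (1 : Matrix (Fin m) (Fin m) ℝ)).PosSemidef) (hh : 0 ≤ h) (hh1 : h ≤ 1)
    (hA : 0 ≤ A) (hK : M.Decay K l C) (hp : M.PSD K)
    (hc : ∀ᵐ y ∂M.ν, clampVec A (M.avec K y) = M.avec K y) {f : Y → ℝ} (hf : Integrable f M.ν)
    {ι γ : ℝ} (hι0 : 0 ≤ ι)
    (hι : ∀ w, bil M.ν K (fun y => M.σ y ⬝ᵥ w) (fun y => M.σ y ⬝ᵥ w) ≤ ι * ‖w‖ ^ 2)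
    (hγ : bil M.ν K f f ≤ γ * (∫ y, |f y| ∂M.ν) ^ 2) :
    bil M.ν (M.rker P h A K) f f ≤
      (d * ‖P.Q‖ + ι * (‖P.D‖ ^ 2 + 2 * ‖P.B‖ ^ 2) + γ) * (∫ y, |f y| ∂M.ν) ^ 2 := by
  have hI := hp.imat_nonneg hK
  have e0 : bil M.ν (M.rker P h A K) f f = _ :=
    bil_Phi (M.imat K) (integrable_smul_upair hK.meas hA hf)
  rw [e0]
  refine (LQData.Phi_self_le hl (LQData.coercive_Nh hh hN hI)
    (∫ y, f y • M.upair A K y ∂M.ν).1 (∫ y, f y • M.upair A K y ∂M.ν).2).trans ?_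
  have hx := norm_integral_upair_fst_le hK.meas hA hf
  set x := (∫ y, f y • M.upair A K y ∂M.ν).1
  rw [dotProduct_integral_upair hK hp.symm hA hc hf]
  set X := ∫ y, |f y| ∂M.ν
  have hX : ‖x‖ ^ 2 ≤ X ^ 2 := by gcongr
  have h1 := hp.two_mul_bil_le hK (test_of_integrable hf) (test_dotProduct_σ (P.B *ᵥ x))
  have hb : ∀ G : Matrix (Fin d') (Fin d) ℝ, (G *ᵥ x) ⬝ᵥ (M.imat K *ᵥ (G *ᵥ x)) ≤
      ι * ‖G‖ ^ 2 * X ^ 2 := by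
    intro G
    rw [hK.dotProduct_imat]
    refine (hι _).trans ?_
    have : ‖G *ᵥ x‖ ≤ ‖G‖ * X := LQData.norm_mulVec_le le_rfl hx
    calc ι * ‖G *ᵥ x‖ ^ 2 ≤ ι * (‖G‖ * X) ^ 2 := by gcongr
      _ = _ := by ring
  have hq : x ⬝ᵥ (P.Q *ᵥ x) ≤ d * ‖P.Q‖ * X ^ 2 := by
    refine (le_abs_self _).trans ((LQData.abs_dotProduct_le_of_le (le_refl (d : ℝ)) hx
      (LQData.norm_mulVec_le le_rfl hx)).trans (le_of_eq ?_))
    ring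
  have hD := hb P.D
  have hB := hb P.B
  have hB0 := hI (P.B *ᵥ x)
  have hB' : h * ((P.B *ᵥ x) ⬝ᵥ (M.imat K *ᵥ (P.B *ᵥ x))) ≤ ι * ‖P.B‖ ^ 2 * X ^ 2 :=
    (mul_le_of_le_one_left hB0 hh1).trans hB
  rw [← hK.dotProduct_imat] at h1
  linarith

/-- A bound on the truncated Riccati kernel that does not depend on the time step. -/
theorem exists_abs_rker_le (P : LQData d d' m) (hl : 0 < lam)
    (hN : (P.N - lam • (1 : Matrix (Fin m) (Fin m) ℝ)).PosSemidef) (hA : 0 ≤ A) :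
    ∃ L : ℝ, 0 < L ∧ ∀ (M : FactorModel d d' Y) (h : ℝ) (K : Y × Y → ℝ) (l C : ℝ), 0 ≤ h → h ≤ 1 →
      M.Decay K l C → M.PSD K → ‖M.imat K‖ ≤ d' * A → ∀ p, |M.rker P h A K p| ≤ L := by
  obtain ⟨L, hL, hb⟩ := P.exists_abs_Phi_le (d' * A) hl
  refine ⟨L * ((1 + A) * (1 + A)), by positivity, fun M h K l C hh hh1 hK hp hI p => ?_⟩
  refine (hb h _ _ _ (abs_le.2 ⟨by linarith, hh1⟩) hI
    (LQData.coercive_Nh hh hN (hp.imat_nonneg hK)) (M.norm_e_le p.1) (M.norm_e_le p.2)).trans ?_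
  have h1 : ∀ y, 1 + ‖(M.upair A K y).2‖ ≤ 1 + A := fun y =>
    add_le_add le_rfl (norm_clampVec_le hA _)
  exact mul_le_mul_of_nonneg_left (mul_le_mul (h1 p.1) (h1 p.2) (by positivity) (by positivity))
    hL.le

/-- Lipschitz estimate for the truncated Riccati kernel. The factor `kap l + kap l ^ 2` is small for
large `l`, which makes the fixed point map contracting. -/
theorem exists_abs_rker_sub_le (P : LQData d d' m) (hl : 0 < lam)
    (hN : (P.N - lam • (1 : Matrix (Fin m) (Fin m) ℝ)).PosSemidef) (hA : 0 ≤ A) :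
    ∃ L : ℝ, 0 < L ∧ ∀ (M : FactorModel d d' Y) (h h' : ℝ) (K K' : Y × Y → ℝ) (C C' l δ : ℝ),
      0 ≤ h → h ≤ 1 → 0 ≤ h' → h' ≤ 1 → M.Decay K 1 C → M.Decay K' 1 C' → M.PSD K → M.PSD K' →
      ‖M.imat K‖ ≤ d' * A → ‖M.imat K'‖ ≤ d' * A → 0 ≤ δ →
      M.Decay (fun p => K p - K' p) l δ → ∀ p,
      |M.rker P h A K p - M.rker P h' A K' p| ≤
        L * (δ * (M.kap l + M.kap l ^ 2) + |h - h'|) := by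
  obtain ⟨L, hL, hb⟩ := P.exists_abs_Phi_sub_le (d' * A) hl
  refine ⟨L * (2 * (1 + A) * (1 + A) * (1 + d')), by positivity, ?_⟩
  intro M h h' K K' C C' l δ hh hh1 hh' hh1' hK hK' hp hp' hI hI' hδ hd p
  have h1 : ∀ (K : Y × Y → ℝ) y, 1 + ‖(M.upair A K y).2‖ ≤ 1 + A := fun K y =>
    add_le_add le_rfl (norm_clampVec_le hA _)
  have hk := kap_nonneg (M := M) hd.one_le
  have hav : ∀ y, ‖(M.upair A K y).2 - (M.upair A K' y).2‖ ≤ δ * M.kap l := fun y => by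
    refine (norm_clampVec_sub_le _ _).trans ?_
    rw [← hK.avec_sub hK']
    refine (hd.norm_avec_le y).trans ?_
    exact mul_le_of_le_one_right (by positivity) (wt_le_one M.ϑ_nonneg hd.one_le y)
  have him : ‖M.imat K - M.imat K'‖ ≤ d' * (δ * M.kap l ^ 2) := by
    rw [← hK.imat_sub hK']
    exact hd.norm_imat_le hδ
  refine (hb h h' _ _ (M.upair A K p.1) (M.upair A K p.2) (M.upair A K' p.1) (M.upair A K' p.2)
    (1 + A) (1 + A) (d' * (δ * M.kap l ^ 2) + |h - h'|)
    (abs_le.2 ⟨by linarith, hh1⟩) (abs_le.2 ⟨by linarith, hh1'⟩) hI hI'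
    (LQData.coercive_Nh hh hN (hp.imat_nonneg hK)) (LQData.coercive_Nh hh' hN (hp'.imat_nonneg hK'))
    (M.norm_e_le p.1) (M.norm_e_le p.2) rfl rfl (h1 _ _) (h1 _ _) (h1 _ _) (h1 _ _)
    (add_le_add him le_rfl)).trans ?_
  rw [mul_assoc L]
  refine mul_le_mul_of_nonneg_left ?_ hL.le
  have a1 := hav p.1
  have a2 := hav p.2
  set X := δ * M.kap l
  set Z := δ * M.kap l ^ 2
  set E := |h - h'|
  have hX : 0 ≤ X := by positivity
  have hZ : 0 ≤ Z := by positivity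
  have hE : 0 ≤ E := abs_nonneg _
  have hd0 : (0 : ℝ) ≤ d' := by positivity
  have e1 : (X + (d' * Z + E) * (1 + A)) ≤ (1 + A) * (1 + d') * (X + Z + E) := by
    have j1 : 0 ≤ (A + d' + A * d') * X := by positivity
    have j2 : 0 ≤ (1 + A) * Z := by positivity
    have j3 : 0 ≤ (1 + A) * d' * E := by positivity
    nlinarith only [j1, j2, j3]
  calc _ ≤ (X + (d' * Z + E) * (1 + A)) * (1 + A) + (1 + A) * (X + (d' * Z + E) * (1 + A)) := by
        gcongr
    _ ≤ ((1 + A) * (1 + d') * (X + Z + E)) * (1 + A)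
        + (1 + A) * ((1 + A) * (1 + d') * (X + Z + E)) := by gcongr
    _ = _ := by ring

end FactorModel

/-! ### Existence of the Riccati kernel -/

section MildCalculus

variable {Y : Type*} {ϑ : Y → ℝ} {T κ κ' C C' : ℝ} {R R' : ℝ × Y × Y → ℝ}

/-- Restriction of a time dependent kernel to times in `[0, T]`. -/
def cut (T : ℝ) (R : ℝ × Y × Y → ℝ) (q : ℝ × Y × Y) : ℝ :=
  (Icc 0 T).indicator (fun s => R (s, q.2)) q.1

theorem cut_of_mem {s : ℝ} (hs : s ∈ Icc 0 T) (p : Y × Y) : cut T R (s, p) = R (s, p) :=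
  indicator_of_mem (f := fun s => R (s, p)) hs

theorem cut_of_notMem {s : ℝ} (hs : s ∉ Icc 0 T) (p : Y × Y) : cut T R (s, p) = 0 :=
  indicator_of_notMem (f := fun s => R (s, p)) hs

theorem abs_cut_le (hC : 0 ≤ C) (h : ∀ s ∈ Icc 0 T, ∀ p, |R (s, p)| ≤ C) (q : ℝ × Y × Y) :
    |cut T R q| ≤ C := by
  obtain ⟨s, p⟩ := q
  by_cases hs : s ∈ Icc 0 T
  · rw [cut_of_mem hs]; exact h s hs p
  · rw [cut_of_notMem hs, abs_zero]; exact hC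

theorem mild_congr {t : ℝ} {p : Y × Y} (h : ∀ s ∈ Ioc t T, R (s, p) = R' (s, p)) :
    mild ϑ T κ R (t, p) = mild ϑ T κ R' (t, p) :=
  setIntegral_congr_fun measurableSet_Ioc fun s hs => by
    dsimp only
    rw [h s hs]

theorem mild_cut {t : ℝ} (ht : 0 ≤ t) (p : Y × Y) :
    mild ϑ T κ (cut T R) (t, p) = mild ϑ T κ R (t, p) :=
  mild_congr fun _ hs => cut_of_mem ⟨ht.trans hs.1.le, hs.2⟩ p

theorem mild_swap (hs : ∀ s p, R (s, Prod.swap p) = R (s, p)) (t : ℝ) (p : Y × Y) :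
    mild ϑ T κ R (t, p.swap) = mild ϑ T κ R (t, p) := by
  simp only [mild, hs, Prod.fst_swap, Prod.snd_swap, add_comm (ϑ p.2)]

variable [MeasurableSpace Y]

theorem measurable_cut (hR : Measurable R) : Measurable (cut T R) := by
  have : cut T R = (Prod.fst ⁻¹' Icc 0 T).indicator R := by
    ext ⟨s, p⟩
    by_cases hs : s ∈ Icc 0 T
    · rw [cut_of_mem hs, indicator_of_mem (by exact hs)]
    · rw [cut_of_notMem hs, indicator_of_notMem (by exact hs)]
  rw [this]
  exact hR.indicator (measurable_fst measurableSet_Icc)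

theorem mild_sub (hR : Measurable R) (hR' : Measurable R') (hC : ∀ q, |R q| ≤ C)
    (hC' : ∀ q, |R' q| ≤ C') (q : ℝ × Y × Y) :
    mild ϑ T κ (fun q => R q - R' q) q = mild ϑ T κ R q - mild ϑ T κ R' q :=
  back_sub (hR.comp (by fun_prop : Measurable fun s : ℝ => (s, q.2)))
    (hR'.comp (by fun_prop : Measurable fun s : ℝ => (s, q.2))) (fun s => hC (s, q.2))
    (fun s => hC' (s, q.2)) q.1

/-- A kernel generated with rate `κ'` is also generated with rate `κ`, by a modified integrand. -/
theorem mild_change_rate (hR : Measurable R) (hC : ∀ q, |R q| ≤ C) (κ κ' : ℝ) (q : ℝ × Y × Y) :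
    mild ϑ T κ (fun q => R q - (κ' - κ) * mild ϑ T κ' R q) q = mild ϑ T κ' R q := by
  have h := back_change_rate (T := T) (hR.comp (by fun_prop : Measurable fun s : ℝ => (s, q.2)))
    (fun s => hC (s, q.2)) (ϑ q.2.1 + ϑ q.2.2 + κ) (ϑ q.2.1 + ϑ q.2.2 + κ') q.1
  rw [mild, mild, ← Function.comp_def R, ← h]
  simp only [mild, Function.comp_def, add_sub_add_left_eq_sub]

end MildCalculus

namespace FactorModel

variable {d d' m : ℕ} {Y : Type*} [MeasurableSpace Y] {M : FactorModel d d' Y}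
  {P : LQData d d' m} {K : Y × Y → ℝ} {R R' : ℝ × Y × Y → ℝ} {l C C' h A lam T κ E : ℝ}

theorem decay_mild (hκ : 0 ≤ κ) (hR : Measurable R) (hC : ∀ q, |R q| ≤ C) (t : ℝ) :
    M.Decay (fun p => mild M.ϑ T κ R (t, p)) 1 (C * Real.exp (2 * (T - t))) where
  meas := (measurable_mild M.measurable_ϑ hR).comp (by fun_prop)
  one_le := le_rfl
  bound p := abs_mild_le_of_bounded M.ϑ_nonneg hκ hC (t, p)

theorem decay_mild_sub (hκ : 0 ≤ κ) (hR : Measurable R) (hR' : Measurable R')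
    (hC : ∀ q, |R q| ≤ C) (hC' : ∀ q, |R' q| ≤ C') {δ : ℝ} (hl : 1 ≤ l) (hδ : 0 ≤ δ)
    (h : ∀ q, |R q - R' q| ≤ δ * Real.exp (2 * l * (T - q.1))) (t : ℝ) :
    M.Decay (fun p => mild M.ϑ T κ R (t, p) - mild M.ϑ T κ R' (t, p)) l
      (δ * Real.exp (2 * l * (T - t))) where
  meas := ((measurable_mild M.measurable_ϑ hR).comp (by fun_prop)).sub
    ((measurable_mild M.measurable_ϑ hR').comp (by fun_prop))
  one_le := hl
  bound p := by
    rw [← mild_sub hR hR' hC hC']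
    exact abs_mild_le M.ϑ_nonneg hκ hl hδ (fun q _ => h q) (t, p)

theorem Decay.abs_bil_sub_le {K' : Y × Y → ℝ} {l' l'' C'' : ℝ} (hK : M.Decay K l C)
    (hK' : M.Decay K' l' C') (hd : M.Decay (fun p => K p - K' p) l'' C'') {f : Y → ℝ}
    (hf : M.Test f) :
    |bil M.ν K f f - bil M.ν K' f f| ≤ C'' * (∫ y, wt M.ϑ l'' y * |f y| ∂M.ν) ^ 2 := by
  rw [← bil_sub_kernel (hK.integrable_bil hf hf) (hK'.integrable_bil hf hf), sq]
  exact hd.abs_bil_le hf hf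

variable (M) in
/-- Nonnegative kernels whose quadratic form at `f` is at most `E (∫ (ϑ + l)^{-1/2} |f|)²`. -/
structure Controlled (K : Y × Y → ℝ) (l E : ℝ) : Prop where
  one_le : 1 ≤ l
  nonneg : 0 ≤ E
  decay : ∃ C, M.Decay K 1 C
  psd : M.PSD K
  le : ∀ f, M.Test f → bil M.ν K f f ≤ E * (∫ y, wt M.ϑ l y * |f y| ∂M.ν) ^ 2

theorem wt_le_one_div_sqrt (hl : 1 ≤ l) (y : Y) : wt M.ϑ l y ≤ 1 / √l :=
  one_div_le_one_div_of_le (Real.sqrt_pos.2 (by linarith))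
    (Real.sqrt_le_sqrt (by linarith [M.ϑ_nonneg y]))

theorem Controlled.le_integral (hK : M.Controlled K l E) {f : Y → ℝ} (hf : Integrable f M.ν) :
    bil M.ν K f f ≤ E / l * (∫ y, |f y| ∂M.ν) ^ 2 := by
  refine (hK.le f (test_of_integrable hf)).trans ?_
  have hl : 0 < l := by linarith [hK.one_le]
  have h1 : ∫ y, wt M.ϑ l y * |f y| ∂M.ν ≤ 1 / √l * ∫ y, |f y| ∂M.ν := by
    rw [← integral_const_mul]
    exact integral_mono_of_nonneg
      (ae_of_all _ fun y => mul_nonneg (wt_nonneg hK.one_le y) (abs_nonneg _))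
      (hf.abs.const_mul _) (ae_of_all _ fun y =>
        mul_le_mul_of_nonneg_right (wt_le_one_div_sqrt hK.one_le y) (abs_nonneg _))
  have h0 : 0 ≤ ∫ y, wt M.ϑ l y * |f y| ∂M.ν :=
    integral_nonneg fun y => mul_nonneg (wt_nonneg hK.one_le y) (abs_nonneg _)
  calc E * (∫ y, wt M.ϑ l y * |f y| ∂M.ν) ^ 2 ≤ E * (1 / √l * ∫ y, |f y| ∂M.ν) ^ 2 :=
        mul_le_mul_of_nonneg_left (pow_le_pow_left₀ h0 h1 2) hK.nonneg
    _ = _ := by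
      rw [mul_pow, div_pow, Real.sq_sqrt hl.le]; ring

theorem Controlled.le_of_abs_le (hK : M.Controlled K l E) {f : Y → ℝ} (hf : Measurable f) {c : ℝ}
    (hc : ∀ y, |f y| ≤ c) : bil M.ν K f f ≤ E * M.kap l ^ 2 * c ^ 2 := by
  refine (hK.le f (test_bounded hf hc)).trans ?_
  have h0 : 0 ≤ ∫ y, wt M.ϑ l y * |f y| ∂M.ν :=
    integral_nonneg fun y => mul_nonneg (wt_nonneg hK.one_le y) (abs_nonneg _)
  calc E * (∫ y, wt M.ϑ l y * |f y| ∂M.ν) ^ 2 ≤ E * (c * M.kap l) ^ 2 :=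
        mul_le_mul_of_nonneg_left (pow_le_pow_left₀ h0 (integral_wt_mul_abs_le hK.one_le hc) 2)
          hK.nonneg
    _ = _ := by ring

theorem Controlled.bil_σ_le (hK : M.Controlled K l E) (k : Fin d') :
    bil M.ν K (fun y => M.σ y k) (fun y => M.σ y k) ≤ E * M.kap l ^ 2 := by
  simpa using hK.le_of_abs_le (measurable_σ_apply k) (fun y => abs_σ_le y k)

theorem Controlled.norm_imat_le (hK : M.Controlled K l E) (hA : E * (M.kap l ^ 2 + 1) ≤ A) :
    ‖M.imat K‖ ≤ d' * A := by
  obtain ⟨C, hC⟩ := hK.decay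
  have h1 : E * M.kap l ^ 2 ≤ A := by nlinarith [hK.nonneg]
  have h2 : 0 ≤ A := le_trans (by have := hK.nonneg; positivity) h1
  exact matrix_norm_le_of_entry_le h2 fun i j =>
    hK.psd.abs_imat_le hC (fun k => (hK.bil_σ_le k).trans h1) i j

/-- The truncation at level `A` is inactive on controlled kernels. -/
theorem Controlled.ae_clampVec_eq (hK : M.Controlled K l E) (hA : E * (M.kap l ^ 2 + 1) ≤ A) :
    ∀ᵐ y ∂M.ν, clampVec A (M.avec K y) = M.avec K y := by
  obtain ⟨C, hC⟩ := hK.decay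
  refine (hK.psd.ae_abs_avec_le hC hK.bil_σ_le fun f hf => hK.le_integral hf).mono fun y hy => ?_
  refine clampVec_eq_self fun k => (hy k).trans (le_trans ?_ hA)
  have h1 : E / l ≤ E := div_le_self hK.nonneg hK.one_le
  have h2 : 0 ≤ E * M.kap l ^ 2 := by have := hK.nonneg; positivity
  have := hK.nonneg
  linarith

/-- The controlled kernels are closed under weighted uniform limits. -/
theorem Controlled.of_tendsto {Kn : ℕ → Y × Y → ℝ} {l' C' : ℝ} (hK : ∀ n, M.Controlled (Kn n) l E)
    {C : ℝ} (hd : M.Decay K 1 C)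
    (h : ∀ n, M.Decay (fun p => Kn n p - K p) l' (C' * (1 / 2) ^ n)) : M.Controlled K l E := by
  have hlim : ∀ f, M.Test f → Tendsto (fun n => bil M.ν (Kn n) f f) atTop (𝓝 (bil M.ν K f f)) := by
    intro f hf
    refine tendsto_of_geometric (C := C' * (∫ y, wt M.ϑ l' y * |f y| ∂M.ν) ^ 2) fun n => ?_
    obtain ⟨D, hD⟩ := (hK n).decay
    refine (hD.abs_bil_sub_le hd (h n) hf).trans (le_of_eq ?_)
    ring
  have hpt : ∀ p, Tendsto (fun n => Kn n p) atTop (𝓝 (K p)) := fun p => by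
    refine tendsto_of_geometric (C := C' * (wt M.ϑ l' p.1 * wt M.ϑ l' p.2)) fun n => ?_
    refine ((h n).bound p).trans (le_of_eq ?_)
    ring
  refine ⟨(hK 0).one_le, (hK 0).nonneg, ⟨C, hd⟩, ⟨fun p => ?_, fun f hf => ?_⟩, fun f hf => ?_⟩
  · exact tendsto_nhds_unique (hpt p.swap)
      ((hpt p).congr fun n => ((hK n).psd.symm p).symm)
  · exact ge_of_tendsto' (hlim f hf) fun n => (hK n).psd.nonneg f hf
  · exact le_of_tendsto' (hlim f hf) fun n => (hK n).le f hf

/-- The dominating time dependent kernel `ρ e^{2 l (T - s)}` on `[0, T]`. -/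
def dom (T ρ l : ℝ) : ℝ × Y × Y → ℝ := cut T fun q => ρ * Real.exp (2 * l * (T - q.1))

variable (M) in
/-- The class of right-hand sides invariant under one regularized Riccati step with rate `κ`:
the form at each time lies between zero and that of `dom + κ * mild dom`. The second bound is chosen
such that the kernel which it generates with rate `κ` is the one which `dom` generates with rate
zero, see `mild_change_rate`; in particular it does not depend on `κ`. -/
structure Invariant (T ρ l κ : ℝ) (R : ℝ × Y × Y → ℝ) : Prop where
  meas : Measurable R
  bdd : ∃ C, ∀ q, |R q| ≤ C
  supp : ∀ s, s ∉ Icc 0 T → ∀ p, R (s, p) = 0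
  symm : ∀ s p, R (s, Prod.swap p) = R (s, p)
  nonneg : ∀ s ∈ Icc 0 T, ∀ f, Integrable f M.ν → 0 ≤ bil M.ν (fun p => R (s, p)) f f
  le : ∀ s ∈ Icc 0 T, ∀ f, Integrable f M.ν → bil M.ν (fun p => R (s, p)) f f ≤
    bil M.ν (fun p => dom T ρ l (s, p) + κ * mild M.ϑ T 0 (dom T ρ l) (s, p))
      (fun y => |f y|) fun y => |f y|

variable {ρ : ℝ}

theorem measurable_dom : Measurable (dom T ρ l : ℝ × Y × Y → ℝ) :=
  measurable_cut (by fun_prop)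

theorem abs_dom_le_exp (hρ : 0 ≤ ρ) (q : ℝ × Y × Y) :
    |dom T ρ l q| ≤ ρ * Real.exp (2 * l * (T - q.1)) := by
  obtain ⟨s, p⟩ := q
  have h0 : 0 ≤ ρ * Real.exp (2 * l * (T - s)) := by positivity
  by_cases hs : s ∈ Icc 0 T
  · rw [dom, cut_of_mem hs]; exact (abs_of_nonneg h0).le
  · rw [dom, cut_of_notMem hs, abs_zero]; exact h0

theorem abs_dom_le (hρ : 0 ≤ ρ) (hl : 0 ≤ l) (q : ℝ × Y × Y) :
    |dom T ρ l q| ≤ ρ * Real.exp (2 * l * T) := by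
  refine abs_cut_le (by positivity) (fun s hs p => ?_) q
  rw [abs_of_nonneg (by positivity)]
  gcongr
  linarith [hs.1]

theorem bil_dom {s : ℝ} (hs : s ∈ Icc 0 T) (f : Y → ℝ) :
    bil M.ν (fun p => dom T ρ l (s, p)) (fun y => |f y|) (fun y => |f y|) =
      ρ * Real.exp (2 * l * (T - s)) * (∫ y, |f y| ∂M.ν) ^ 2 := by
  simp only [dom, cut_of_mem hs, bil]
  rw [sq, ← integral_prod_mul, ← integral_const_mul]
  congr 1; ext p; ring

/-- Uniform control of the regularized kernel generated by an invariant right-hand side. -/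
theorem Invariant.controlled (hR : M.Invariant T ρ l κ R) (hκ : 0 ≤ κ) (hρ : 0 ≤ ρ) (hl : 1 ≤ l)
    {t : ℝ} (ht : t ∈ Icc 0 T) :
    M.Controlled (fun p => mild M.ϑ T κ R (t, p)) l (ρ * Real.exp (2 * l * (T - t))) ∧
    ∀ f, Integrable f M.ν → bil M.ν (fun p => mild M.ϑ T κ R (t, p)) f f ≤
      bil M.ν (fun p => mild M.ϑ T 0 (dom T ρ l) (t, p)) (fun y => |f y|) fun y => |f y| := by
  obtain ⟨C, hC⟩ := hR.bdd
  have hl0 : 0 ≤ l := by linarith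
  set Rc : ℝ × Y × Y → ℝ := fun q => dom T ρ l q + κ * mild M.ϑ T 0 (dom T ρ l) q with hRc
  have hRcm : Measurable Rc :=
    measurable_dom.add ((measurable_mild M.measurable_ϑ measurable_dom).const_mul κ)
  have hdd : ∀ q, |mild M.ϑ T 0 (dom T ρ l) q| ≤
      ρ * Real.exp (2 * l * (T - q.1)) * (wt M.ϑ l q.2.1 * wt M.ϑ l q.2.2) :=
    abs_mild_le M.ϑ_nonneg le_rfl hl hρ fun q _ => abs_dom_le_exp hρ q
  obtain ⟨C', hC'⟩ : ∃ C', ∀ q, |cut T Rc q| ≤ C' := by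
    refine ⟨ρ * Real.exp (2 * l * T) + κ * (ρ * Real.exp (2 * l * T)),
      abs_cut_le (by positivity) fun s hs p => ?_⟩
    refine (abs_add_le _ _).trans (add_le_add (abs_dom_le hρ hl0 _) ?_)
    rw [abs_mul, abs_of_nonneg hκ]
    refine mul_le_mul_of_nonneg_left ((hdd _).trans ?_) hκ
    have h1 : Real.exp (2 * l * (T - s)) ≤ Real.exp (2 * l * T) :=
      Real.exp_le_exp.2 (mul_le_mul_of_nonneg_left (by linarith [hs.1]) (by linarith))
    have h2 : wt M.ϑ l p.1 * wt M.ϑ l p.2 ≤ 1 :=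
      mul_le_one₀ (wt_le_one M.ϑ_nonneg hl _) (wt_nonneg hl _) (wt_le_one M.ϑ_nonneg hl _)
    have h3 : 0 ≤ wt M.ϑ l p.1 * wt M.ϑ l p.2 := mul_nonneg (wt_nonneg hl _) (wt_nonneg hl _)
    calc _ ≤ ρ * Real.exp (2 * l * T) * 1 :=
          mul_le_mul (mul_le_mul_of_nonneg_left h1 hρ) h2 h3 (by positivity)
      _ = _ := mul_one _
  -- the rate `κ` is absorbed by the term `κ * mild dom` of the upper bound
  have hrate : ∀ p, mild M.ϑ T κ (cut T Rc) (t, p) = mild M.ϑ T 0 (dom T ρ l) (t, p) := fun p => by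
    rw [mild_cut ht.1, ← mild_change_rate measurable_dom (abs_dom_le hρ hl0) κ 0 (t, p)]
    simp only [hRc, zero_sub, neg_mul, sub_neg_eq_add]
  have hint : ∀ f, M.Test f → ∀ s ∈ Ioc t T,
      Integrable (fun y => Real.exp (-M.ϑ y * (s - t)) * f y) M.ν := fun f hf s hs =>
    hf.integrable_exp_mul M.measurable_ϑ M.ϑ_nonneg (sub_pos.2 hs.1)
  have hmem : ∀ s ∈ Ioc t T, s ∈ Icc 0 T := fun s hs => ⟨ht.1.trans hs.1.le, hs.2⟩
  have hup : ∀ f, M.Test f → bil M.ν (fun p => mild M.ϑ T κ R (t, p)) f f ≤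
      bil M.ν (fun p => mild M.ϑ T 0 (dom T ρ l) (t, p)) (fun y => |f y|) fun y => |f y| := by
    intro f hf
    refine (bil_mild_mono (ν := M.ν) (T := T) (R' := cut T Rc) (f' := fun y => |f y|)
      M.measurable_ϑ M.ϑ_nonneg hκ hR.meas (measurable_cut hRcm) hC hC' hf
      (hf.abs M.ϑ_nonneg) t fun s hs => ?_).trans (le_of_eq ?_)
    · refine (hR.le s (hmem s hs) _ (hint f hf s hs)).trans (le_of_eq ?_)
      simp only [cut_of_mem (hmem s hs), abs_mul, Real.abs_exp, hRc]
    · simp only [hrate]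
  refine ⟨⟨hl, by positivity, ⟨_, decay_mild hκ hR.meas hC t⟩, ⟨fun p => ?_, fun f hf => ?_⟩,
    fun f hf => (hup f hf).trans ?_⟩, fun f hf => hup f (test_of_integrable hf)⟩
  · exact mild_swap hR.symm t p
  · rw [(bil_mild (T := T) M.measurable_ϑ M.ϑ_nonneg hκ hR.meas hC hf hf t).2]
    exact setIntegral_nonneg measurableSet_Ioc fun s hs => mul_nonneg (Real.exp_pos _).le
      (hR.nonneg s (hmem s hs) _ (hint f hf s hs))
  · have hw : Integrable (fun y => wt M.ϑ l y * |f y|) M.ν :=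
      (hf.abs M.ϑ_nonneg).integrable_wt_mul M.measurable_ϑ M.ϑ_nonneg hl
    refine (le_abs_self _).trans ((_root_.abs_bil_le (ω := wt M.ϑ l)
      (C := ρ * Real.exp (2 * l * (T - t))) (fun y => wt_nonneg hl y)
      (fun p => hdd (t, p)) hw hw).trans (le_of_eq ?_))
    simp only [abs_abs]
    ring

theorem integrable_bil_of_bdd {R : Y × Y → ℝ} {C : ℝ} (hR : Measurable R) (hC : ∀ q, |R q| ≤ C)
    {f : Y → ℝ} (hf : Integrable f M.ν) :
    Integrable (fun p => f p.1 * R p * f p.2) (M.ν.prod M.ν) := by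
  have h1 : Integrable (fun y => (1 : ℝ) * f y) M.ν := by simpa using hf
  exact _root_.integrable_bil (ω := fun _ => 1) hR (fun _ => zero_le_one)
    (fun p => by simpa using hC p) hf.aestronglyMeasurable hf.aestronglyMeasurable h1 h1

/-- The invariant class is closed under weighted uniform limits. -/
theorem Invariant.of_tendsto {Rn : ℕ → ℝ × Y × Y → ℝ} {l' : ℝ}
    (hl' : 0 ≤ l') (hR : ∀ n, M.Invariant T ρ l κ (Rn n))
    (h : ∀ n q, |Rn n q - R q| ≤ C * (1 / 2) ^ n * Real.exp (2 * l' * (T - q.1))) :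
    M.Invariant T ρ l κ R := by
  have hpt : ∀ q, Tendsto (fun n => Rn n q) atTop (𝓝 (R q)) := fun q =>
    tendsto_of_geometric (C := C * Real.exp (2 * l' * (T - q.1))) fun n =>
      (h n q).trans (le_of_eq (by ring))
  have hm : Measurable R := measurable_of_tendsto_metrizable (fun n => (hR n).meas)
    (tendsto_pi_nhds.2 hpt)
  have hsupp : ∀ s, s ∉ Icc 0 T → ∀ p, R (s, p) = 0 := fun s hs p =>
    tendsto_nhds_unique (hpt (s, p))
      (tendsto_const_nhds.congr fun n => ((hR n).supp s hs p).symm)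
  obtain ⟨C₀, hC₀⟩ := (hR 0).bdd
  have hb : ∀ q, |R q| ≤ C₀ + |C| * Real.exp (2 * l' * T) := by
    rintro ⟨s, p⟩
    have hC0 : 0 ≤ C₀ := (abs_nonneg _).trans (hC₀ (s, p))
    by_cases hs : s ∈ Icc 0 T
    · have h1 := h 0 (s, p)
      have h2 : Real.exp (2 * l' * (T - s)) ≤ Real.exp (2 * l' * T) :=
        Real.exp_le_exp.2 (mul_le_mul_of_nonneg_left (by linarith [hs.1]) (by linarith))
      have h3 : C * (1 / 2) ^ 0 * Real.exp (2 * l' * (T - s)) ≤ |C| * Real.exp (2 * l' * T) := by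
        rw [pow_zero, mul_one]
        exact mul_le_mul (le_abs_self C) h2 (Real.exp_pos _).le (abs_nonneg _)
      have h4 := hC₀ (s, p)
      have h5 : |R (s, p)| ≤ |Rn 0 (s, p)| + |Rn 0 (s, p) - R (s, p)| := by
        have := abs_sub (Rn 0 (s, p)) (Rn 0 (s, p) - R (s, p))
        rwa [sub_sub_cancel] at this
      linarith
    · rw [hsupp s hs p, abs_zero]; positivity
  have hlim : ∀ s f, Integrable f M.ν → Tendsto (fun n => bil M.ν (fun p => Rn n (s, p)) f f) atTop
      (𝓝 (bil M.ν (fun p => R (s, p)) f f)) := by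
    intro s f hf
    have h1 : Integrable (fun y => (1 : ℝ) * f y) M.ν := by simpa using hf
    have hib : ∀ {R : ℝ × Y × Y → ℝ} {C : ℝ}, Measurable R → (∀ q, |R q| ≤ C) →
        Integrable (fun p => f p.1 * R (s, p) * f p.2) (M.ν.prod M.ν) := fun hR hC =>
      integrable_bil_of_bdd (hR.comp (by fun_prop)) (fun p => hC (s, p)) hf
    refine tendsto_of_geometric (C := C * Real.exp (2 * l' * (T - s)) * (∫ y, |f y| ∂M.ν) ^ 2)
      fun n => ?_
    obtain ⟨Cn, hCn⟩ := (hR n).bdd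
    rw [← bil_sub_kernel (hib (hR n).meas hCn) (hib hm hb)]
    refine (_root_.abs_bil_le (ω := fun _ => 1)
      (C := C * (1 / 2) ^ n * Real.exp (2 * l' * (T - s))) (fun _ => zero_le_one)
      (fun p => by simpa using h n (s, p)) h1 h1).trans (le_of_eq ?_)
    simp only [one_mul]
    ring
  exact ⟨hm, ⟨_, hb⟩, hsupp, fun s p => tendsto_nhds_unique (hpt (s, p.swap))
      ((hpt (s, p)).congr fun n => ((hR n).symm s p).symm),
    fun s hs f hf => ge_of_tendsto' (hlim s f hf) fun n => (hR n).nonneg s hs f hf,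
    fun s hs f hf => le_of_tendsto' (hlim s f hf) fun n => (hR n).le s hs f hf⟩

end FactorModel

namespace FactorModel

variable {d d' m : ℕ} {Y : Type*} [MeasurableSpace Y] {M : FactorModel d d' Y}
  {P : LQData d d' m} {K : Y × Y → ℝ} {R R' : ℝ × Y × Y → ℝ} {l C C' h A lam T κ E ρ : ℝ}

/-- The integral of the weight is arbitrarily small for a large rate. -/
theorem exists_kap_le (M : FactorModel d d' Y) {η : ℝ} (hη : 0 < η) (l₀ : ℝ) :
    ∃ l, l₀ ≤ l ∧ 1 ≤ l ∧ M.kap l + M.kap l ^ 2 ≤ η := by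
  have h := eventually_integral_wt_le M.measurable_ϑ M.ϑ_nonneg M.integrable_wt_one
    (lt_min one_pos (half_pos hη))
  obtain ⟨l, h1, h2, h3⟩ :=
    (h.and ((eventually_ge_atTop l₀).and (eventually_ge_atTop 1))).exists
  refine ⟨l, h2, h3, ?_⟩
  have h4 : M.kap l ≤ 1 := h1.trans (min_le_left _ _)
  have h5 : M.kap l ≤ η / 2 := h1.trans (min_le_right _ _)
  have h6 := kap_nonneg (M := M) h3
  nlinarith

/-- One step of the regularized Riccati iteration. The term `h⁻¹ * Γ`, with `Γ = mild R` of rate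
`h⁻¹`, is compensated by the additional rate, and it is what makes the right-hand side
nonnegative. -/
def riccatiStep (M : FactorModel d d' Y) (P : LQData d d' m) (T h A : ℝ) (R : ℝ × Y × Y → ℝ) :
    ℝ × Y × Y → ℝ :=
  cut T fun q => h⁻¹ * mild M.ϑ T h⁻¹ R q +
    M.rker P h A (fun p => mild M.ϑ T h⁻¹ R (q.1, p)) q.2

theorem measurable_rker_kernel (hK : Measurable K) : Measurable (M.rker P h A K) := by
  have hu := measurable_upair_kernel (M := M) (A := A) hK
  exact P.measurable_Phi (I := fun _ => M.imat K) (fun _ _ => measurable_const)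
    (hu.comp measurable_fst) (hu.comp measurable_snd)

theorem measurable_riccatiStep (hR : Measurable R) : Measurable (M.riccatiStep P T h A R) :=
  measurable_cut (((measurable_mild M.measurable_ϑ hR).const_mul _).add
    (measurable_rker (Z := ℝ) (measurable_mild M.measurable_ϑ hR)))

theorem Decay.abs_le (hK : M.Decay K l C) (p : Y × Y) : |K p| ≤ C := by
  refine (hK.bound p).trans (mul_le_of_le_one_right (hK.C_nonneg p.1) ?_)
  exact mul_le_one₀ (wt_le_one M.ϑ_nonneg hK.one_le _) (wt_nonneg hK.one_le _)
    (wt_le_one M.ϑ_nonneg hK.one_le _)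

theorem exp_two_mul_le {l t : ℝ} (hl : 0 ≤ l) (ht : 0 ≤ t) :
    Real.exp (2 * l * (T - t)) ≤ Real.exp (2 * l * T) :=
  Real.exp_le_exp.2 (mul_le_mul_of_nonneg_left (by linarith) (by linarith))

/-- The invariant class is mapped to itself: the lower bound is `rker_nonneg`, the upper bound is
`bil_rker_le` together with the choice of the rate `l`. -/
theorem Invariant.map_step (hlam : 0 < lam) (hQ : P.Q.PosSemidef)
    (hN : (P.N - lam • (1 : Matrix (Fin m) (Fin m) ℝ)).PosSemidef) (hh : 0 < h) (hh1 : h ≤ 1)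
    (hl : 1 ≤ l) (hρ : 2 * (d * ‖P.Q‖) ≤ ρ)
    (hl2 : (‖P.D‖ ^ 2 + 2 * ‖P.B‖ ^ 2) * (d' ^ 2 * M.kap l ^ 2) + 1 / l ≤ 1 / 2)
    (hA : ρ * Real.exp (2 * l * T) * (M.kap l ^ 2 + 1) ≤ A)
    (hR : M.Invariant T ρ l h⁻¹ R) : M.Invariant T ρ l h⁻¹ (M.riccatiStep P T h A R) := by
  have hl0 : 0 ≤ l := by linarith
  have hκ : 0 ≤ h⁻¹ := (inv_pos.2 hh).le
  have hρ0 : 0 ≤ ρ := le_trans (by positivity) hρ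
  have hA0 : 0 ≤ A := le_trans (by positivity) hA
  obtain ⟨C, hC⟩ := hR.bdd
  have hQs : P.Qᵀ = P.Q := by
    simpa [Matrix.IsHermitian, Matrix.conjTranspose_eq_transpose_of_trivial] using hQ.isHermitian
  have hAt : ∀ t ∈ Icc 0 T, ρ * Real.exp (2 * l * (T - t)) * (M.kap l ^ 2 + 1) ≤ A :=
    fun t ht => le_trans (mul_le_mul_of_nonneg_right
      (mul_le_mul_of_nonneg_left (exp_two_mul_le hl0 ht.1) hρ0) (by positivity)) hA
  obtain ⟨L, hL, hLb⟩ := exists_abs_rker_le (Y := Y) P hlam hN hA0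
  have hd : ∀ t, M.Decay (fun p => mild M.ϑ T h⁻¹ R (t, p)) 1 (C * Real.exp (2 * (T - t))) :=
    decay_mild hκ hR.meas hC
  have hrb : ∀ t ∈ Icc 0 T, ∀ p,
      |M.rker P h A (fun p => mild M.ϑ T h⁻¹ R (t, p)) p| ≤ L := fun t ht p =>
    hLb M h _ 1 _ hh.le hh1 (hd t) (hR.controlled hκ hρ0 hl ht).1.psd
      ((hR.controlled hκ hρ0 hl ht).1.norm_imat_le (hAt t ht)) p
  have hrm : ∀ t, Measurable fun p => M.rker P h A (fun p => mild M.ϑ T h⁻¹ R (t, p)) p :=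
    fun t => measurable_rker_kernel (hd t).meas
  have hform : ∀ s ∈ Icc 0 T, ∀ f, Integrable f M.ν →
      bil M.ν (fun p => M.riccatiStep P T h A R (s, p)) f f =
      h⁻¹ * bil M.ν (fun p => mild M.ϑ T h⁻¹ R (s, p)) f f +
        bil M.ν (M.rker P h A fun p => mild M.ϑ T h⁻¹ R (s, p)) f f := by
    intro s hs f hf
    have e : (fun p => M.riccatiStep P T h A R (s, p)) = fun p =>
        h⁻¹ * mild M.ϑ T h⁻¹ R (s, p) + M.rker P h A (fun p => mild M.ϑ T h⁻¹ R (s, p)) p := by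
      ext p; rw [FactorModel.riccatiStep, cut_of_mem hs]
    rw [e, bil_add_kernel _ (integrable_bil_of_bdd (hrm s) (hrb s hs) hf), bil_const_mul_kernel]
    refine integrable_bil_of_bdd (C := h⁻¹ * (C * Real.exp (2 * (T - s))))
      ((hd s).meas.const_mul _) (fun p => ?_) hf
    rw [abs_mul, abs_of_nonneg hκ]
    exact mul_le_mul_of_nonneg_left ((hd s).abs_le p) hκ
  have hbdd : ∀ q, |M.riccatiStep P T h A R q| ≤ h⁻¹ * (C * Real.exp (2 * T)) + L := by
    have hC0 : ∀ p : Y × Y, 0 ≤ C := fun p => (abs_nonneg _).trans (hC (0, p))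
    rintro ⟨s, p⟩
    have := hC0 p
    refine abs_cut_le (by positivity) (fun s hs p => (abs_add_le _ _).trans
      (add_le_add ?_ (hrb s hs p))) _
    rw [abs_mul, abs_of_nonneg hκ]
    refine mul_le_mul_of_nonneg_left (((hd s).abs_le p).trans ?_) hκ
    exact mul_le_mul_of_nonneg_left (Real.exp_le_exp.2 (by linarith [hs.1])) (hC0 p)
  refine ⟨measurable_riccatiStep hR.meas, ⟨_, hbdd⟩, fun s hs p => cut_of_notMem hs p, ?_, ?_, ?_⟩
  · intro s p
    by_cases hs : s ∈ Icc 0 T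
    · rw [FactorModel.riccatiStep, cut_of_mem hs, cut_of_mem hs, mild_swap hR.symm,
        rker_symm hQs (LQData.N_transpose hN) (fun p => mild_swap hR.symm s p)]
    · rw [FactorModel.riccatiStep, cut_of_notMem hs, cut_of_notMem hs]
  · intro s hs f hf
    have hc := (hR.controlled hκ hρ0 hl hs).1
    rw [hform s hs f hf]
    exact rker_nonneg hlam hQ hN hh hA0 (hd s) hc.psd (hc.ae_clampVec_eq (hAt s hs)) hf
  · intro s hs f hf
    obtain ⟨hc, hcm⟩ := hR.controlled hκ hρ0 hl hs
    -- half of `ε` pays for `Q`, and the other half, by the choice of `l`, for the terms in `Γ`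
    set ε := ρ * Real.exp (2 * l * (T - s)) with hε
    have hε0 : 0 ≤ ε := by positivity
    have hερ : ρ ≤ ε := le_mul_of_one_le_right hρ0
      (Real.one_le_exp (mul_nonneg (by linarith) (by linarith [hs.2])))
    have h1 := bil_rker_le (P := P) hlam hN hh.le hh1 hA0 (hd s) hc.psd
      (hc.ae_clampVec_eq (hAt s hs)) hf (ι := ε * M.kap l ^ 2 * d' ^ 2) (γ := ε / l)
      (by positivity) (fun w => (hc.le_of_abs_le (measurable_dotProduct_σ w)
        (abs_dotProduct_σ_le w)).trans (le_of_eq (by ring))) (hc.le_integral hf)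
    have hfa : Integrable (fun y => |f y|) M.ν := hf.abs
    have hm0 : ∀ p, |mild M.ϑ T 0 (dom T ρ l) (s, p)| ≤ _ :=
      (decay_mild (M := M) le_rfl measurable_dom (abs_dom_le hρ0 hl0) s).abs_le
    have i1 := integrable_bil_of_bdd (R := fun p => dom T ρ l (s, p))
      (measurable_dom.comp (by fun_prop)) (fun p => abs_dom_le hρ0 hl0 (s, p)) hfa
    have i2 := integrable_bil_of_bdd (R := fun p => h⁻¹ * mild M.ϑ T 0 (dom T ρ l) (s, p))
      (((measurable_mild M.measurable_ϑ measurable_dom).comp (by fun_prop)).const_mul _)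
      (fun p => by
        rw [abs_mul, abs_of_nonneg hκ]; exact mul_le_mul_of_nonneg_left (hm0 p) hκ) hfa
    rw [hform s hs f hf, bil_add_kernel i1 i2, bil_const_mul_kernel, bil_dom hs]
    have h2 := mul_le_mul_of_nonneg_left (hcm f hf) hκ
    have h3 : d * ‖P.Q‖ + ε * M.kap l ^ 2 * d' ^ 2 * (‖P.D‖ ^ 2 + 2 * ‖P.B‖ ^ 2) + ε / l ≤ ε := by
      have h4 := mul_le_mul_of_nonneg_left hl2 hε0
      have h5 : ε * ((‖P.D‖ ^ 2 + 2 * ‖P.B‖ ^ 2) * (d' ^ 2 * M.kap l ^ 2) + 1 / l) =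
        ε * M.kap l ^ 2 * d' ^ 2 * (‖P.D‖ ^ 2 + 2 * ‖P.B‖ ^ 2) + ε / l := by ring
      linarith
    have h6 := mul_le_mul_of_nonneg_right h3 (sq_nonneg (∫ y, |f y| ∂M.ν))
    linarith

/-- The regularized Riccati equation has a solution, with bounds that do not depend on `h`. -/
theorem exists_regularized (hlam : 0 < lam) (hQ : P.Q.PosSemidef)
    (hN : (P.N - lam • (1 : Matrix (Fin m) (Fin m) ℝ)).PosSemidef) (hh : 0 < h) (hh1 : h ≤ 1)
    (hl : 1 ≤ l) (hρ : 2 * (d * ‖P.Q‖) ≤ ρ)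
    (hl2 : (‖P.D‖ ^ 2 + 2 * ‖P.B‖ ^ 2) * (d' ^ 2 * M.kap l ^ 2) + 1 / l ≤ 1 / 2)
    (hA : ρ * Real.exp (2 * l * T) * (M.kap l ^ 2 + 1) ≤ A) :
    ∃ R : ℝ × Y × Y → ℝ, Measurable R ∧ (∃ C, ∀ q, |R q| ≤ C) ∧
      (∀ s, s ∉ Icc 0 T → ∀ p, R (s, p) = 0) ∧
      (∀ s ∈ Icc 0 T, ∀ p, R (s, p) = M.rker P h A (fun p => mild M.ϑ T 0 R (s, p)) p) ∧
      ∀ s ∈ Icc 0 T, M.Controlled (fun p => mild M.ϑ T 0 R (s, p)) l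
        (ρ * Real.exp (2 * l * T)) := by
  have hl0 : 0 ≤ l := by linarith
  have hκ : 0 ≤ h⁻¹ := (inv_pos.2 hh).le
  have hρ0 : 0 ≤ ρ := le_trans (by positivity) hρ
  have hA0 : 0 ≤ A := le_trans (by positivity) hA
  have hAt : ∀ t ∈ Icc 0 T, ρ * Real.exp (2 * l * (T - t)) * (M.kap l ^ 2 + 1) ≤ A :=
    fun t ht => le_trans (mul_le_mul_of_nonneg_right
      (mul_le_mul_of_nonneg_left (exp_two_mul_le hl0 ht.1) hρ0) (by positivity)) hA
  obtain ⟨L, hL, hLs⟩ := exists_abs_rker_sub_le (Y := Y) P hlam hN hA0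
  -- `l'` is large enough for the two terms of the step to contract by `1 / 4` each; it depends on `h`
  obtain ⟨l', hl'κ, hl', hkap⟩ := M.exists_kap_le (η := 1 / (4 * L)) (by positivity) (2 * h⁻¹)
  have hl'0 : 0 ≤ l' := by linarith
  have hLk : L * (M.kap l' + M.kap l' ^ 2) ≤ 1 / 4 := by
    have := mul_le_mul_of_nonneg_left hkap hL.le
    rwa [mul_one_div, mul_comm 4 L, div_mul_eq_div_div, div_self hL.ne'] at this
  set W : ℝ × Y × Y → ℝ := fun q => Real.exp (2 * l' * (T - q.1)) with hW
  have hmaps : ∀ R, M.Invariant T ρ l h⁻¹ R → M.Invariant T ρ l h⁻¹ (M.riccatiStep P T h A R) :=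
    fun R hR => hR.map_step hlam hQ hN hh hh1 hl hρ hl2 hA
  have hcontr : ∀ R R' δ, M.Invariant T ρ l h⁻¹ R → M.Invariant T ρ l h⁻¹ R' → 0 ≤ δ →
      (∀ q, |R q - R' q| ≤ δ * W q) →
      ∀ q, |M.riccatiStep P T h A R q - M.riccatiStep P T h A R' q| ≤ δ / 2 * W q := by
    rintro R R' δ hR hR' hδ hd ⟨s, p⟩
    have hW0 : 0 < Real.exp (2 * l' * (T - s)) := Real.exp_pos _
    simp only [hW] at hd ⊢
    by_cases hs : s ∈ Icc 0 T
    swap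
    · rw [FactorModel.riccatiStep, FactorModel.riccatiStep, cut_of_notMem hs, cut_of_notMem hs,
        sub_self, abs_zero]
      positivity
    obtain ⟨C, hC⟩ := hR.bdd
    obtain ⟨C', hC'⟩ := hR'.bdd
    have hc := (hR.controlled hκ hρ0 hl hs).1
    have hc' := (hR'.controlled hκ hρ0 hl hs).1
    rw [FactorModel.riccatiStep, FactorModel.riccatiStep, cut_of_mem hs, cut_of_mem hs]
    have h1 : |mild M.ϑ T h⁻¹ R (s, p) - mild M.ϑ T h⁻¹ R' (s, p)| ≤
        δ * Real.exp (2 * l' * (T - s)) / (h⁻¹ + 2 * l') := by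
      rw [← mild_sub hR.meas hR'.meas hC hC']
      refine (abs_mild_le_div M.ϑ_nonneg hκ hl' hδ (fun q _ => hd q) (s, p)).trans ?_
      exact div_le_div_of_nonneg_left (by positivity) (by positivity)
        (by have h1 := M.ϑ_nonneg p.1; have h2 := M.ϑ_nonneg p.2; dsimp only; linarith)
    have h2 : h⁻¹ * |mild M.ϑ T h⁻¹ R (s, p) - mild M.ϑ T h⁻¹ R' (s, p)| ≤
        δ / 4 * Real.exp (2 * l' * (T - s)) := by
      refine (mul_le_mul_of_nonneg_left h1 hκ).trans ?_
      rw [mul_div_assoc', div_le_iff₀ (by positivity)]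
      have h3 : 0 ≤ δ * Real.exp (2 * l' * (T - s)) := by positivity
      have h4 : h⁻¹ ≤ (h⁻¹ + 2 * l') / 4 := by linarith
      calc _ ≤ (h⁻¹ + 2 * l') / 4 * (δ * Real.exp (2 * l' * (T - s))) :=
            mul_le_mul_of_nonneg_right h4 h3
        _ = _ := by ring
    have h3 := hLs M h h _ _ _ _ l' (δ * Real.exp (2 * l' * (T - s))) hh.le hh1 hh.le hh1
      (decay_mild hκ hR.meas hC s) (decay_mild hκ hR'.meas hC' s) hc.psd hc'.psd
      (hc.norm_imat_le (hAt s hs)) (hc'.norm_imat_le (hAt s hs)) (by positivity)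
      (decay_mild_sub hκ hR.meas hR'.meas hC hC' hl' hδ hd s) p
    have h4 : L * (δ * Real.exp (2 * l' * (T - s)) * (M.kap l' + M.kap l' ^ 2) + |h - h|) ≤
        δ / 4 * Real.exp (2 * l' * (T - s)) := by
      rw [sub_self, abs_zero, add_zero]
      have := mul_le_mul_of_nonneg_left hLk
        (by positivity : 0 ≤ δ * Real.exp (2 * l' * (T - s)))
      linarith
    have h5 : ∀ a b a' b' : ℝ, |h⁻¹ * a + b - (h⁻¹ * a' + b')| ≤ h⁻¹ * |a - a'| + |b - b'| := by
      intro a b a' b'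
      have e : h⁻¹ * a + b - (h⁻¹ * a' + b') = h⁻¹ * (a - a') + (b - b') := by ring
      rw [e]
      refine (abs_add_le _ _).trans (le_of_eq ?_)
      rw [abs_mul, abs_of_nonneg hκ]
    refine (h5 _ _ _ _).trans ?_
    linarith
  have h0 : M.Invariant T ρ l h⁻¹ (fun _ => 0) := by
    refine ⟨measurable_const, ⟨0, fun _ => by simp⟩, fun _ _ _ => rfl, fun _ _ => rfl,
      fun s _ f _ => by simp [bil], fun s hs f _ => ?_⟩
    have h1 : bil M.ν (fun _ => 0) f f = 0 := by simp [bil]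
    rw [h1]
    refine integral_nonneg fun p => ?_
    have h2 : 0 ≤ dom T ρ l (s, p) := by
      rw [dom, cut_of_mem hs]; positivity
    have h3 : 0 ≤ mild M.ϑ T 0 (dom T ρ l) (s, p) := by
      refine setIntegral_nonneg measurableSet_Ioc fun v hv => mul_nonneg (Real.exp_pos _).le ?_
      change 0 ≤ cut T (fun q => ρ * Real.exp (2 * l * (T - q.1))) (v, p)
      rw [cut_of_mem ⟨hs.1.trans hv.1.le, hv.2⟩]; positivity
    dsimp only
    positivity
  obtain ⟨C₀, hC₀⟩ := (hmaps _ h0).bdd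
  obtain ⟨Rt, hRt, hfix⟩ := exists_fixedPoint_of_weighted (W := W) (M.Invariant T ρ l h⁻¹)
    (M.riccatiStep P T h A) hmaps
    (fun f g C hf hfg => Invariant.of_tendsto hl'0 hf hfg) hcontr h0 (C := |C₀|) (abs_nonneg _)
    (by
      rintro ⟨s, p⟩
      simp only [hW, sub_zero]
      by_cases hs : s ∈ Icc 0 T
      · refine ((hC₀ _).trans (le_abs_self _)).trans (le_mul_of_one_le_right (abs_nonneg _) ?_)
        exact Real.one_le_exp (mul_nonneg (by linarith) (by linarith [hs.2]))
      · rw [FactorModel.riccatiStep, cut_of_notMem hs, abs_zero]; positivity)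
  obtain ⟨C, hC⟩ := hRt.bdd
  -- back to rate zero: the term `h⁻¹ * Γ` of the fixed point cancels
  have hm : ∀ s ∈ Icc 0 T, ∀ p, mild M.ϑ T 0 (cut T fun q => Rt q - h⁻¹ * mild M.ϑ T h⁻¹ Rt q)
      (s, p) = mild M.ϑ T h⁻¹ Rt (s, p) := fun s hs p => by
    have := mild_change_rate (ϑ := M.ϑ) (T := T) hRt.meas hC 0 h⁻¹ (s, p)
    rw [sub_zero] at this
    rw [mild_cut hs.1, this]
  refine ⟨cut T fun q => Rt q - h⁻¹ * mild M.ϑ T h⁻¹ Rt q, measurable_cut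
    (hRt.meas.sub ((measurable_mild M.measurable_ϑ hRt.meas).const_mul _)), ?_,
    fun s hs p => cut_of_notMem hs p, fun s hs p => ?_, fun s hs => ?_⟩
  · refine ⟨|C| + h⁻¹ * (|C| * Real.exp (2 * T)), abs_cut_le (by positivity) fun s hs p => ?_⟩
    refine (abs_sub _ _).trans (add_le_add ((hC _).trans (le_abs_self _)) ?_)
    rw [abs_mul, abs_of_nonneg hκ]
    refine mul_le_mul_of_nonneg_left (((decay_mild (M := M) hκ hRt.meas hC s).abs_le p).trans ?_) hκ
    exact mul_le_mul (le_abs_self C) (Real.exp_le_exp.2 (by linarith [hs.1])) (Real.exp_pos _).le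
      (abs_nonneg _)
  · rw [cut_of_mem hs, funext (hm s hs)]
    have h1 := congrFun hfix (s, p)
    rw [FactorModel.riccatiStep, cut_of_mem hs] at h1
    dsimp only at h1 ⊢
    linarith
  · rw [funext (hm s hs)]
    have hc := (hRt.controlled hκ hρ0 hl hs).1
    refine ⟨hc.one_le, by positivity, hc.decay, hc.psd, fun f hf => (hc.le f hf).trans ?_⟩
    exact mul_le_mul_of_nonneg_right (mul_le_mul_of_nonneg_left (exp_two_mul_le hl0 hs.1) hρ0)
      (sq_nonneg _)

/-- Existence for the Riccati equation in the factor model: the right-hand side `R` solves the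
equation pointwise, and the solution `mild R` is nonnegative and bounded. -/
theorem exists_riccati (M : FactorModel d d' Y) (P : LQData d d' m) (T : ℝ) (hlam : 0 < lam)
    (hQ : P.Q.PosSemidef) (hN : (P.N - lam • (1 : Matrix (Fin m) (Fin m) ℝ)).PosSemidef) :
    ∃ (A : ℝ) (R : ℝ × Y × Y → ℝ), 0 ≤ A ∧ Measurable R ∧ (∃ C, ∀ q, |R q| ≤ C) ∧
      (∀ s ∈ Icc 0 T, ∀ p, R (s, p) = M.rker P 0 A (fun p => mild M.ϑ T 0 R (s, p)) p) ∧
      ∀ s ∈ Icc 0 T, M.PSD (fun p => mild M.ϑ T 0 R (s, p)) ∧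
        ‖M.imat fun p => mild M.ϑ T 0 R (s, p)‖ ≤ d' * A ∧
        ∀ᵐ y ∂M.ν, clampVec A (M.avec (fun p => mild M.ϑ T 0 R (s, p)) y) =
          M.avec (fun p => mild M.ϑ T 0 R (s, p)) y := by
  set c := (‖P.D‖ ^ 2 + 2 * ‖P.B‖ ^ 2) * (d' : ℝ) ^ 2 with hc
  have hc0 : 0 ≤ c := by positivity
  -- the two terms in `hl2` are at most `1 / 4` each
  obtain ⟨l, hl4, hl, hk⟩ := M.exists_kap_le (η := 1 / (4 * (c + 1))) (by positivity) 4
  have hl0 : 0 ≤ l := by linarith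
  have hkl := kap_nonneg (M := M) hl
  have hl2 : (‖P.D‖ ^ 2 + 2 * ‖P.B‖ ^ 2) * (d' ^ 2 * M.kap l ^ 2) + 1 / l ≤ 1 / 2 := by
    have h1 : M.kap l ^ 2 ≤ 1 / (4 * (c + 1)) := by linarith
    have h2 : c * M.kap l ^ 2 ≤ 1 / 4 := by
      refine (mul_le_mul_of_nonneg_left h1 hc0).trans ?_
      rw [mul_one_div, div_le_div_iff₀ (by positivity) (by norm_num)]
      linarith
    have h3 : 1 / l ≤ 1 / 4 := one_div_le_one_div_of_le (by norm_num) hl4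
    rw [← mul_assoc]
    linarith
  set ρ := 2 * (d * ‖P.Q‖) with hρ
  have hρ0 : 0 ≤ ρ := by positivity
  set A := ρ * Real.exp (2 * l * T) * (M.kap l ^ 2 + 1) with hA
  have hA0 : 0 ≤ A := by positivity
  have hhn : ∀ n : ℕ, 0 < (1 / 2 : ℝ) ^ n ∧ (1 / 2 : ℝ) ^ n ≤ 1 := fun n =>
    ⟨by positivity, pow_le_one₀ (by norm_num) (by norm_num)⟩
  -- solutions of the regularized equations with time steps `2⁻ⁿ`
  choose Rn hRm hRb hRs hRe hRc using fun n : ℕ =>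
    exists_regularized (M := M) (T := T) hlam hQ hN (hhn n).1 (hhn n).2 hl le_rfl hl2 (le_refl A)
  obtain ⟨L₀, hL₀, hLb⟩ := exists_abs_rker_le (Y := Y) P hlam hN hA0
  obtain ⟨L, hL, hLs⟩ := exists_abs_rker_sub_le (Y := Y) P hlam hN hA0
  have hb : ∀ n q, |Rn n q| ≤ L₀ := by
    rintro n ⟨s, p⟩
    by_cases hs : s ∈ Icc 0 T
    · obtain ⟨C, hC⟩ := (hRc n s hs).decay
      rw [hRe n s hs]
      exact hLb M _ _ _ _ (hhn n).1.le (hhn n).2 hC (hRc n s hs).psd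
        ((hRc n s hs).norm_imat_le le_rfl) p
    · rw [hRs n s hs, abs_zero]; exact hL₀.le
  obtain ⟨l', -, hl', hkap⟩ := M.exists_kap_le (η := 1 / (2 * L)) (by positivity) 1
  have hl'0 : 0 ≤ l' := by linarith
  have hLk : L * (M.kap l' + M.kap l' ^ 2) ≤ 1 / 2 := by
    have := mul_le_mul_of_nonneg_left hkap hL.le
    rwa [mul_one_div, mul_comm 2 L, div_mul_eq_div_div, div_self hL.ne'] at this
  have hW1 : ∀ s ∈ Icc 0 T, 1 ≤ Real.exp (2 * l' * (T - s)) := fun s hs =>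
    Real.one_le_exp (mul_nonneg (by linarith) (by linarith [hs.2]))
  -- consecutive solutions differ by the order of the time step, by the Lipschitz estimate with a
  -- rate `l'` that does not depend on `n`
  have hinc : ∀ n q, |Rn (n + 1) q - Rn n q| ≤
      (2 * L) * (1 / 2) ^ n * Real.exp (2 * l' * (T - q.1)) := by
    intro n q
    have key := le_two_mul_of_forall_improve (D := fun q => |Rn (n + 1) q - Rn n q|)
      (W := fun q : ℝ × Y × Y => Real.exp (2 * l' * (T - q.1))) (c := L * (1 / 2) ^ n)
      (δ₀ := 2 * L₀) ?_ (by positivity) (by positivity) ?_ q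
    · exact key.trans (le_of_eq (by ring))
    · rintro ⟨s, p⟩
      dsimp only
      by_cases hs : s ∈ Icc 0 T
      · refine ((abs_sub _ _).trans (add_le_add (hb _ _) (hb _ _))).trans ?_
        rw [← two_mul]
        exact le_mul_of_one_le_right (by positivity) (hW1 s hs)
      · rw [hRs _ s hs, hRs _ s hs, sub_self, abs_zero]; positivity
    · rintro δ hδ hd ⟨s, p⟩
      dsimp only at hd ⊢
      by_cases hs : s ∈ Icc 0 T
      · rw [hRe _ s hs, hRe _ s hs]
        refine (hLs M _ _ _ _ _ _ l' (δ * Real.exp (2 * l' * (T - s))) (hhn _).1.le (hhn _).2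
          (hhn _).1.le (hhn _).2
          (decay_mild le_rfl (hRm _) (hb _) s) (decay_mild le_rfl (hRm _) (hb _) s)
          (hRc _ s hs).psd (hRc _ s hs).psd
          ((hRc _ s hs).norm_imat_le le_rfl) ((hRc _ s hs).norm_imat_le le_rfl) (by positivity)
          (decay_mild_sub le_rfl (hRm _) (hRm _) (hb _) (hb _) hl' hδ hd s) p).trans ?_
        have h1 := mul_le_mul_of_nonneg_left hLk
          (by positivity : 0 ≤ δ * Real.exp (2 * l' * (T - s)))
        have h2 : |(1 / 2 : ℝ) ^ (n + 1) - (1 / 2) ^ n| ≤ (1 / 2) ^ n := by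
          have h3 := (hhn n).1
          rw [pow_succ, abs_le]
          constructor <;> linarith
        have h3 := mul_le_mul_of_nonneg_left h2 hL.le
        have h4 := mul_le_mul_of_nonneg_left (hW1 s hs)
          (by positivity : 0 ≤ L * (1 / 2 : ℝ) ^ n)
        linarith
      · rw [hRs _ s hs, hRs _ s hs, sub_self, abs_zero]; positivity
  obtain ⟨R, hR⟩ := exists_limit_of_geometric
    (W := fun q : ℝ × Y × Y => Real.exp (2 * l' * (T - q.1))) hinc
  have hpt : ∀ q, Tendsto (fun n => Rn n q) atTop (𝓝 (R q)) := fun q =>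
    tendsto_of_geometric (C := 2 * (2 * L) * Real.exp (2 * l' * (T - q.1))) fun n =>
      (hR n q).trans (le_of_eq (by ring))
  have hRmeas : Measurable R := measurable_of_tendsto_metrizable hRm (tendsto_pi_nhds.2 hpt)
  have hRbd : ∀ q, |R q| ≤ L₀ := fun q => le_of_tendsto' (hpt q).abs fun n => hb n q
  have hdd : ∀ n s, M.Decay (fun p => mild M.ϑ T 0 (Rn n) (s, p) - mild M.ϑ T 0 R (s, p)) l'
      (2 * (2 * L) * (1 / 2) ^ n * Real.exp (2 * l' * (T - s))) := fun n s =>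
    decay_mild_sub le_rfl (hRm n) hRmeas (hb n) hRbd hl' (by positivity) (hR n) s
  have hctl : ∀ s ∈ Icc 0 T, M.Controlled (fun p => mild M.ϑ T 0 R (s, p)) l
      (ρ * Real.exp (2 * l * T)) := fun s hs =>
    Controlled.of_tendsto (C' := 2 * (2 * L) * Real.exp (2 * l' * (T - s)))
      (fun n => hRc n s hs) (decay_mild le_rfl hRmeas hRbd s) fun n => by
        convert hdd n s using 1; ring
  refine ⟨A, R, hA0, hRmeas, ⟨L₀, hRbd⟩, fun s hs p => ?_, fun s hs =>
    ⟨(hctl s hs).psd, (hctl s hs).norm_imat_le le_rfl, (hctl s hs).ae_clampVec_eq le_rfl⟩⟩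
  refine tendsto_nhds_unique (hpt (s, p)) ?_
  refine tendsto_of_geometric (C := L * (2 * (2 * L) * Real.exp (2 * l' * (T - s)) *
    (M.kap l' + M.kap l' ^ 2) + 1)) fun n => ?_
  rw [hRe n s hs]
  refine (hLs M _ 0 _ _ _ _ l' _ (hhn n).1.le (hhn n).2 le_rfl zero_le_one
    (decay_mild le_rfl (hRm n) (hb n) s) (decay_mild le_rfl hRmeas hRbd s)
    (hRc n s hs).psd (hctl s hs).psd
    ((hRc n s hs).norm_imat_le le_rfl) ((hctl s hs).norm_imat_le le_rfl) (by positivity)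
    (hdd n s) p).trans (le_of_eq ?_)
  rw [sub_zero, abs_of_pos (hhn n).1]
  ring

end FactorModel

/-! ### A Gronwall inequality with the squared Laplace transform as kernel -/

namespace FactorModel

variable {d d' m : ℕ} {Y : Type*} [MeasurableSpace Y] {M : FactorModel d d' Y}
  {P : LQData d d' m} {l T lam : ℝ}

/-- The Laplace transform `∫ e^{-ϑ v} dν`; it may be infinite at `v = 0`. -/
def lapl (M : FactorModel d d' Y) (v : ℝ) : ℝ≥0∞ := ∫⁻ y, ENNReal.ofReal (Real.exp (-M.ϑ y * v)) ∂M.ν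

theorem lintegral_exp_le {a : ℝ} (ha : 0 < a) (t T : ℝ) :
    ∫⁻ s in Ioc t T, ENNReal.ofReal (Real.exp (-a * (s - t))) ≤ ENNReal.ofReal (1 / a) := by
  rcases le_or_gt T t with ht | ht
  · simp [Ioc_eq_empty (not_lt.2 ht)]
  have hi : IntegrableOn (fun s => Real.exp (-a * (s - t))) (Ioc t T) :=
    (Continuous.integrableOn_Icc (by fun_prop)).mono_set Ioc_subset_Icc_self
  rw [← ofReal_integral_eq_lintegral_ofReal hi (ae_of_all _ fun s => (Real.exp_pos _).le),
    ← intervalIntegral.integral_of_le ht.le, integral_exp_sub_eq ha.ne']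
  refine ENNReal.ofReal_le_ofReal ?_
  gcongr
  linarith [Real.exp_pos (-a * (T - t))]

theorem measurable_exp_ofReal : Measurable fun q : ℝ × Y =>
    ENNReal.ofReal (Real.exp (-M.ϑ q.2 * q.1)) := by
  have := M.measurable_ϑ
  fun_prop

theorem measurable_lapl : Measurable M.lapl :=
  (measurable_exp_ofReal (M := M)).lintegral_prod_right'

theorem lapl_sq (v : ℝ) : M.lapl v ^ 2 =
    ∫⁻ p, ENNReal.ofReal (Real.exp (-(M.ϑ p.1 + M.ϑ p.2) * v)) ∂M.ν.prod M.ν := by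
  have h1 : Measurable fun y : Y => ENNReal.ofReal (Real.exp (-M.ϑ y * v)) := by
    have := M.measurable_ϑ
    fun_prop
  rw [sq, lapl, ← lintegral_prod_mul h1.aemeasurable h1.aemeasurable]
  refine lintegral_congr fun p => ?_
  rw [← ENNReal.ofReal_mul (Real.exp_pos _).le, ← Real.exp_add]
  ring_nf

/-- The squared Laplace transform is integrable in time near zero, with a small integral against
`e^{-2lv}`, since `∫ e^{-(ϑ+ϑ'+2l)v} dv` is at most the product of the weights. -/
theorem lintegral_exp_mul_lapl_sq_le (hl : 1 ≤ l) (t : ℝ) :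
    ∫⁻ s in Ioc t T, ENNReal.ofReal (Real.exp (-(2 * l) * (s - t))) * M.lapl (s - t) ^ 2 ≤
      ENNReal.ofReal (M.kap l ^ 2) := by
  have hm := M.measurable_ϑ
  have h1 : ∀ s, ENNReal.ofReal (Real.exp (-(2 * l) * (s - t))) * M.lapl (s - t) ^ 2 =
      ∫⁻ p, ENNReal.ofReal (Real.exp (-(M.ϑ p.1 + M.ϑ p.2 + 2 * l) * (s - t))) ∂M.ν.prod M.ν := by
    intro s
    rw [lapl_sq, ← lintegral_const_mul' _ _ ENNReal.ofReal_ne_top]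
    refine lintegral_congr fun p => ?_
    rw [← ENNReal.ofReal_mul (Real.exp_pos _).le, ← Real.exp_add]
    ring_nf
  simp_rw [h1]
  rw [lintegral_lintegral_swap (Measurable.aemeasurable (by fun_prop))]
  have hw : Measurable fun y => ENNReal.ofReal (wt M.ϑ l y) := (measurable_wt hm l).ennreal_ofReal
  calc _ ≤ ∫⁻ p : Y × Y, ENNReal.ofReal (wt M.ϑ l p.1) * ENNReal.ofReal (wt M.ϑ l p.2)
        ∂M.ν.prod M.ν := by
        refine lintegral_mono fun p => (lintegral_exp_le ?_ t T).trans ?_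
        · linarith [M.ϑ_nonneg p.1, M.ϑ_nonneg p.2]
        · rw [← ENNReal.ofReal_mul (wt_nonneg hl _)]
          exact ENNReal.ofReal_le_ofReal (one_div_add_le_wt_mul_wt M.ϑ_nonneg hl p.1 p.2)
    _ = ENNReal.ofReal (M.kap l ^ 2) := by
        rw [lintegral_prod_mul hw.aemeasurable hw.aemeasurable, sq,
          ENNReal.ofReal_mul (kap_nonneg hl), kap, ofReal_integral_eq_lintegral_ofReal
            (integrable_wt hl) (ae_of_all _ fun y => wt_nonneg hl y)]

theorem one_add_sq_le_two_add (k : ℝ≥0∞) : (1 + k) ^ 2 ≤ 2 + 2 * k ^ 2 := by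
  induction k with
  | top => simp
  | coe k =>
    norm_cast
    have := two_mul_le_add_sq 1 k
    have e : (1 + k) ^ 2 = 1 + 2 * 1 * k + k ^ 2 := by ring
    rw [e]
    calc 1 + 2 * 1 * k + k ^ 2 ≤ 1 + (1 ^ 2 + k ^ 2) + k ^ 2 := by gcongr
      _ = _ := by ring

theorem lintegral_exp_mul_one_add_sq_le (hl : 1 ≤ l) (t : ℝ) :
    ∫⁻ s in Ioc t T, ENNReal.ofReal (Real.exp (-(2 * l) * (s - t))) * (1 + M.lapl (s - t)) ^ 2 ≤
      ENNReal.ofReal (1 / l + 2 * M.kap l ^ 2) := by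
  have h1 : Measurable fun s => ENNReal.ofReal (Real.exp (-(2 * l) * (s - t))) := by fun_prop
  have h2 : Measurable fun s => M.lapl (s - t) := measurable_lapl.comp (by fun_prop)
  calc _ ≤ ∫⁻ s in Ioc t T, (2 * ENNReal.ofReal (Real.exp (-(2 * l) * (s - t))) +
        2 * (ENNReal.ofReal (Real.exp (-(2 * l) * (s - t))) * M.lapl (s - t) ^ 2)) := by
        refine lintegral_mono fun s => ?_
        refine (mul_le_mul_right (one_add_sq_le_two_add _) _).trans (le_of_eq ?_)
        ring
    _ ≤ 2 * ENNReal.ofReal (1 / (2 * l)) + 2 * ENNReal.ofReal (M.kap l ^ 2) := by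
        rw [lintegral_add_left (h1.const_mul _), lintegral_const_mul _ h1,
          lintegral_const_mul' _ _ (by norm_num)]
        exact add_le_add (mul_le_mul_right (lintegral_exp_le (by linarith) t T) _)
          (mul_le_mul_right (lintegral_exp_mul_lapl_sq_le hl t) _)
    _ = _ := by
        rw [← ENNReal.ofReal_ofNat 2, ← ENNReal.ofReal_mul (by norm_num),
          ← ENNReal.ofReal_mul (by norm_num), ← ENNReal.ofReal_add (by positivity) (by positivity)]
        congr 1
        field_simp

/-- A bounded function dominated by its own convolution with the kernel `(1 + ∫ e^{-ϑ v} dν)²`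
vanishes; the kernel need not be bounded near `v = 0`, but it is integrable there. -/
theorem eq_zero_of_le_lintegral (M : FactorModel d d' Y) {δ : ℝ → ℝ≥0∞} {c D₀ : ℝ} (hc : 0 ≤ c)
    (hδ : ∀ t ∈ Icc 0 T, δ t ≤ ENNReal.ofReal D₀)
    (h : ∀ t ∈ Icc 0 T, δ t ≤ ∫⁻ s in Ioc t T, ENNReal.ofReal c * δ s * (1 + M.lapl (s - t)) ^ 2) :
    ∀ t ∈ Icc 0 T, δ t = 0 := by
  obtain ⟨l, hlc, hl, hk⟩ := M.exists_kap_le (η := 1 / (8 * (c + 1))) (by positivity) (4 * (c + 1))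
  have hkl := kap_nonneg (M := M) hl
  have hsmall : c * (1 / l + 2 * M.kap l ^ 2) ≤ 1 / 2 := by
    have h1 : 1 / l ≤ 1 / (4 * (c + 1)) := one_div_le_one_div_of_le (by positivity) hlc
    have h2 : 2 * M.kap l ^ 2 ≤ 1 / (4 * (c + 1)) := by
      have : 2 * (1 / (8 * (c + 1))) = 1 / (4 * (c + 1)) := by field_simp; norm_num
      linarith
    have h3 : 1 / l + 2 * M.kap l ^ 2 ≤ 1 / (2 * (c + 1)) := by
      have : 2 * (1 / (4 * (c + 1))) = 1 / (2 * (c + 1)) := by field_simp; norm_num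
      linarith
    refine (mul_le_mul_of_nonneg_left h3 hc).trans ?_
    rw [mul_one_div, div_le_div_iff₀ (by positivity) (by norm_num)]
    linarith
  have htop : ∀ t ∈ Icc 0 T, δ t ≠ ∞ := fun t ht =>
    ne_top_of_le_ne_top ENNReal.ofReal_ne_top (hδ t ht)
  -- a weighted bound by `ε` improves to `ε / 2`, with no error term, so that the bound is zero
  have key : ∀ z : Icc (0 : ℝ) T, (δ z).toReal ≤ 2 * 0 * Real.exp (2 * l * (T - z)) := by
    refine le_two_mul_of_forall_improve (δ₀ := |D₀|) ?_ (abs_nonneg _) le_rfl ?_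
    · rintro ⟨t, ht⟩
      have h1 : (δ t).toReal ≤ |D₀| := ENNReal.toReal_le_of_le_ofReal (abs_nonneg _)
        ((hδ t ht).trans (ENNReal.ofReal_le_ofReal (le_abs_self _)))
      refine h1.trans (le_mul_of_one_le_right (abs_nonneg _) (Real.one_le_exp ?_))
      exact mul_nonneg (by linarith) (by dsimp only; linarith [ht.2])
    · rintro ε hε hb ⟨t, ht⟩
      refine ENNReal.toReal_le_of_le_ofReal (by positivity) ((h t ht).trans ?_)
      set w := ε * Real.exp (2 * l * (T - t)) with hw
      have hw0 : 0 ≤ w := by positivity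
      have hm1 : Measurable fun s => ENNReal.ofReal (Real.exp (-(2 * l) * (s - t))) := by fun_prop
      have hm2 : Measurable fun s => M.lapl (s - t) := measurable_lapl.comp (by fun_prop)
      calc _ ≤ ∫⁻ s in Ioc t T, ENNReal.ofReal (c * w) *
            (ENNReal.ofReal (Real.exp (-(2 * l) * (s - t))) * (1 + M.lapl (s - t)) ^ 2) := by
            refine setLIntegral_mono' measurableSet_Ioc fun s hs => ?_
            have hs' : s ∈ Icc 0 T := ⟨ht.1.trans hs.1.le, hs.2⟩
            rw [← mul_assoc]
            refine mul_le_mul_left ?_ _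
            rw [← ENNReal.ofReal_mul (by positivity), ← ENNReal.ofReal_toReal (htop s hs'),
              ← ENNReal.ofReal_mul hc]
            refine ENNReal.ofReal_le_ofReal ?_
            rw [mul_assoc, hw, mul_assoc ε, ← Real.exp_add]
            refine mul_le_mul_of_nonneg_left ((hb ⟨s, hs'⟩).trans (le_of_eq ?_)) hc
            dsimp only
            ring_nf
        _ = ENNReal.ofReal (c * w) * ∫⁻ s in Ioc t T,
            ENNReal.ofReal (Real.exp (-(2 * l) * (s - t))) * (1 + M.lapl (s - t)) ^ 2 :=
            lintegral_const_mul _ (hm1.mul ((measurable_const.add hm2).pow_const 2))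
        _ ≤ ENNReal.ofReal (c * w) * ENNReal.ofReal (1 / l + 2 * M.kap l ^ 2) :=
            mul_le_mul_right (lintegral_exp_mul_one_add_sq_le hl t) _
        _ ≤ _ := by
            rw [← ENNReal.ofReal_mul (by positivity)]
            refine ENNReal.ofReal_le_ofReal ?_
            have := mul_le_mul_of_nonneg_left hsmall hw0
            dsimp only
            rw [add_zero, div_mul_eq_mul_div, ← hw]
            linarith
  intro t ht
  have h1 := key ⟨t, ht⟩
  simp only [mul_zero, zero_mul] at h1
  have h2 : (δ t).toReal = 0 := le_antisymm h1 ENNReal.toReal_nonneg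
  exact (ENNReal.toReal_eq_zero_iff _).1 h2 |>.resolve_right (htop t ht)

/-! ### Uniqueness of integrable solutions of the Riccati equation -/

variable {K K' : Y × Y → ℝ}

theorem pi_enorm_le {n : ℕ} {a : Fin n → ℝ} {c : ℝ≥0∞} (h : ∀ k, ‖a k‖ₑ ≤ c) : ‖a‖ₑ ≤ c := by
  induction c with
  | top => exact le_top
  | coe c =>
    refine ENNReal.coe_le_coe.2 ?_
    rw [pi_nnnorm_le_iff]
    exact fun k => ENNReal.coe_le_coe.1 (h k)

theorem enorm_avec_le (K : Y × Y → ℝ) (y : Y) : ‖M.avec K y‖ₑ ≤ ∫⁻ y', ‖K (y', y)‖ₑ ∂M.ν := by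
  refine pi_enorm_le fun k => (enorm_integral_le_lintegral_enorm _).trans ?_
  refine lintegral_mono fun y' => ?_
  rw [enorm_mul]
  refine mul_le_of_le_one_left' ?_
  rw [← ofReal_norm, ← ENNReal.ofReal_one]
  exact ENNReal.ofReal_le_ofReal (abs_σ_le y' k)

theorem lintegral_enorm_avec_le (hK : Measurable K) :
    ∫⁻ y, ‖M.avec K y‖ₑ ∂M.ν ≤ ∫⁻ p, ‖K p‖ₑ ∂M.ν.prod M.ν := by
  rw [lintegral_prod_symm' _ hK.enorm]
  exact lintegral_mono fun y => enorm_avec_le K y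

theorem integrable_of_lintegral_le {α : Type*} [MeasurableSpace α] {μ : Measure α} {f : α → ℝ}
    (hf : Measurable f) {C : ℝ} (h : ∫⁻ x, ‖f x‖ₑ ∂μ ≤ ENNReal.ofReal C) : Integrable f μ :=
  ⟨hf.aestronglyMeasurable, h.trans_lt ENNReal.ofReal_lt_top⟩

theorem integrable_σ_mul (hK : Integrable K (M.ν.prod M.ν)) (i j : Fin d') :
    Integrable (fun p : Y × Y => M.σ p.1 i * K p * M.σ p.2 j) (M.ν.prod M.ν) :=
  (hK.bdd_mul (c := 1) ((measurable_σ_apply i).comp measurable_fst).aestronglyMeasurable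
    (ae_of_all _ fun p => abs_σ_le p.1 i)).mul_bdd (c := 1)
    ((measurable_σ_apply j).comp measurable_snd).aestronglyMeasurable
    (ae_of_all _ fun p => abs_σ_le p.2 j)

theorem imat_sub_of_integrable (hK : Integrable K (M.ν.prod M.ν))
    (hK' : Integrable K' (M.ν.prod M.ν)) :
    M.imat (fun p => K p - K' p) = M.imat K - M.imat K' := by
  ext i j
  exact bil_sub_kernel (f := fun y => M.σ y i) (g := fun y => M.σ y j) (integrable_σ_mul hK i j)
    (integrable_σ_mul hK' i j)

theorem abs_imat_le_integral (hK : Integrable K (M.ν.prod M.ν)) (i j : Fin d') :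
    |M.imat K i j| ≤ ∫ p, |K p| ∂M.ν.prod M.ν := by
  refine norm_integral_le_of_norm_le (f := fun p : Y × Y => M.σ p.1 i * K p * M.σ p.2 j) hK.abs
    (ae_of_all _ fun p => ?_)
  rw [norm_mul, norm_mul]
  refine (mul_le_of_le_one_right (by positivity) (abs_σ_le p.2 j)).trans ?_
  exact mul_le_of_le_one_left (norm_nonneg _) (abs_σ_le p.1 i)

theorem norm_imat_le_integral (hK : Integrable K (M.ν.prod M.ν)) :
    ‖M.imat K‖ ≤ d' * ∫ p, |K p| ∂M.ν.prod M.ν :=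
  matrix_norm_le_of_entry_le (integral_nonneg fun _ => abs_nonneg _) fun i j =>
    abs_imat_le_integral hK i j

theorem ae_avec_sub (hK : Integrable K (M.ν.prod M.ν)) (hK' : Integrable K' (M.ν.prod M.ν)) :
    ∀ᵐ y ∂M.ν, M.avec (fun p => K p - K' p) y = M.avec K y - M.avec K' y := by
  have hs : ∀ {K : Y × Y → ℝ}, Integrable K (M.ν.prod M.ν) →
      ∀ᵐ y ∂M.ν, ∀ k, Integrable (fun y' => M.σ y' k * K (y', y)) M.ν := fun hK => by
    filter_upwards [hK.swap.prod_right_ae] with y hy k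
    exact hy.bdd_mul (c := 1) (measurable_σ_apply k).aestronglyMeasurable
      (ae_of_all _ fun y' => abs_σ_le y' k)
  filter_upwards [hs hK, hs hK'] with y h1 h2
  ext k
  simp only [avec, Pi.sub_apply]
  rw [← integral_sub (h1 k) (h2 k)]
  simp only [mul_sub]

theorem avec_congr_ae (h : ∀ᵐ p ∂M.ν.prod M.ν, K p = K' p) :
    ∀ᵐ y ∂M.ν, M.avec K y = M.avec K' y := by
  have h' : ∀ᵐ p ∂M.ν.prod M.ν, K p.swap = K' p.swap :=
    (Measure.measurePreserving_swap (μ := M.ν) (ν := M.ν)).quasiMeasurePreserving.ae h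
  filter_upwards [Measure.ae_ae_of_ae_prod h'] with y hy
  ext l
  exact integral_congr_ae (hy.mono fun y' h => by dsimp only at h ⊢; rw [← Prod.swap_prod_mk, h])

/-- The Riccati right-hand side of a time dependent kernel. -/
def ricc (M : FactorModel d d' Y) (P : LQData d d' m) (K : ℝ × Y × Y → ℝ) (s : ℝ) (p : Y × Y) : ℝ :=
  P.Phi 0 (M.imat fun p => K (s, p)) (M.e p.1, M.avec (fun p => K (s, p)) p.1)
    (M.e p.2, M.avec (fun p => K (s, p)) p.2)

/-- Jointly measurable kernels, bounded in `L¹` and with coercive `N̂`, that solve the Riccati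
equation at every time almost everywhere. -/
structure L1Solution (M : FactorModel d d' Y) (P : LQData d d' m) (lam T : ℝ)
    (K : ℝ × Y × Y → ℝ) : Prop where
  meas : Measurable K
  bdd : ∃ C : ℝ, ∀ t ∈ Icc 0 T, ∫⁻ p, ‖K (t, p)‖ₑ ∂M.ν.prod M.ν ≤ ENNReal.ofReal C
  coercive : ∀ t ∈ Icc 0 T, Coercive lam (P.Nh 0 (M.imat fun p => K (t, p)))
  eq : ∀ t ∈ Icc 0 T, ∀ᵐ p ∂M.ν.prod M.ν,
    IntegrableOn (fun s => Real.exp (-(M.ϑ p.1 + M.ϑ p.2) * (s - t)) * M.ricc P K s p) (Ioc t T) ∧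
    K (t, p) = ∫ s in Ioc t T, Real.exp (-(M.ϑ p.1 + M.ϑ p.2) * (s - t)) * M.ricc P K s p

theorem L1Solution.integrable {K : ℝ × Y × Y → ℝ} (hK : M.L1Solution P lam T K) {t : ℝ}
    (ht : t ∈ Icc 0 T) : Integrable (fun p => K (t, p)) (M.ν.prod M.ν) := by
  obtain ⟨C, hC⟩ := hK.bdd
  exact integrable_of_lintegral_le (hK.meas.comp (by fun_prop)) (hC t ht)

theorem ofReal_norm_imat_le (hK : Integrable K (M.ν.prod M.ν)) :
    ENNReal.ofReal ‖M.imat K‖ ≤ ENNReal.ofReal d' * ∫⁻ p, ‖K p‖ₑ ∂M.ν.prod M.ν := by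
  refine (ENNReal.ofReal_le_ofReal (norm_imat_le_integral hK)).trans ?_
  rw [ENNReal.ofReal_mul (by positivity)]
  refine mul_le_mul_right (le_of_eq ?_) _
  exact ofReal_integral_norm_eq_lintegral_enorm hK

theorem measurable_norm_matrix {Z : Type*} [MeasurableSpace Z] {a b : ℕ}
    {A : Z → Matrix (Fin a) (Fin b) ℝ} (hA : ∀ i j, Measurable fun z => A z i j) :
    Measurable fun z => ‖A z‖ := by
  have h : Continuous fun f : Fin a → Fin b → ℝ => ‖(Matrix.of f : Matrix (Fin a) (Fin b) ℝ)‖ :=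
    Continuous.norm (E := Matrix (Fin a) (Fin b) ℝ) (f := fun f => Matrix.of f) continuous_id
  exact h.measurable.comp (measurable_pi_lambda _ fun i => measurable_pi_lambda _ fun j => hA i j)

/-- Two integrable solutions of the Riccati equation agree. Their `L¹` distance `δ` satisfies the
Gronwall inequality of `eq_zero_of_le_lintegral`: the integrated kernels are only integrable in
space, hence the Lipschitz estimate contains one factor `1 + |a|` for each argument, which integrates
against `e^{-ϑ v}` to at most a multiple of `1 + ∫ e^{-ϑ v} dν`. -/
theorem L1Solution.ae_eq {K K' : ℝ × Y × Y → ℝ} (hlam : 0 < lam) (hK : M.L1Solution P lam T K)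
    (hK' : M.L1Solution P lam T K') :
    ∀ t ∈ Icc 0 T, ∀ᵐ p ∂M.ν.prod M.ν, K (t, p) = K' (t, p) := by
  have hϑm := M.measurable_ϑ
  obtain ⟨C, hC⟩ := hK.bdd
  obtain ⟨C', hC'⟩ := hK'.bdd
  set δ : ℝ → ℝ≥0∞ := fun t => ∫⁻ p, ‖K (t, p) - K' (t, p)‖ₑ ∂M.ν.prod M.ν with hδ
  have hmK : Measurable fun q => K q - K' q := hK.meas.sub hK'.meas
  have hδC : ∀ t ∈ Icc 0 T, δ t ≤ ENNReal.ofReal (|C| + |C'|) := fun t ht => by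
    rw [ENNReal.ofReal_add (abs_nonneg _) (abs_nonneg _)]
    refine le_trans ?_ (add_le_add ((hC t ht).trans (ENNReal.ofReal_le_ofReal (le_abs_self _)))
      ((hC' t ht).trans (ENNReal.ofReal_le_ofReal (le_abs_self _))))
    have hKt : Measurable fun p : Y × Y => ‖K (t, p)‖ₑ := (hK.meas.comp (by fun_prop)).enorm
    rw [← lintegral_add_left hKt]
    exact lintegral_mono fun p => enorm_sub_le
  -- pointwise quantities entering the Lipschitz estimate
  set a : ℝ → Y → Fin d' → ℝ := fun s => M.avec fun p => K (s, p) with ha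
  set a' : ℝ → Y → Fin d' → ℝ := fun s => M.avec fun p => K' (s, p) with ha'
  set J : ℝ → ℝ := fun s => ‖(M.imat fun p => K (s, p)) - M.imat fun p => K' (s, p)‖ with hJ
  set α : ℝ × Y → ℝ := fun q => 1 + ‖a q.1 q.2‖ + ‖a' q.1 q.2‖ with hα
  set g : ℝ × Y → ℝ := fun q => ‖a q.1 q.2 - a' q.1 q.2‖ + J q.1 * α q with hg
  have hα0 : ∀ q, 0 ≤ α q := fun q => by positivity
  have hJ0 : ∀ s, 0 ≤ J s := fun s => norm_nonneg _
  have hg0 : ∀ q, 0 ≤ g q := fun q => add_nonneg (norm_nonneg _) (mul_nonneg (hJ0 _) (hα0 q))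
  have ham : Measurable fun q : ℝ × Y => a q.1 q.2 := measurable_avec hK.meas
  have ham' : Measurable fun q : ℝ × Y => a' q.1 q.2 := measurable_avec hK'.meas
  have hJm : Measurable J := measurable_norm_matrix fun i j =>
    (measurable_imat hK.meas i j).sub (measurable_imat hK'.meas i j)
  have hαm : Measurable α := (measurable_const.add ham.norm).add ham'.norm
  have hgm : Measurable g := (ham.sub ham').norm.add ((hJm.comp measurable_fst).mul hαm)
  set c₁ : ℝ := 1 + |C| + |C'| with hc₁
  have hc₁0 : 0 ≤ c₁ := by positivity
  -- integrals of these quantities against `e^{-ϑ v}`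
  have hexp1 : ∀ (v : ℝ), 0 ≤ v → ∀ y, ENNReal.ofReal (Real.exp (-M.ϑ y * v)) ≤ 1 := fun v hv y => by
    rw [← ENNReal.ofReal_one]
    refine ENNReal.ofReal_le_ofReal (Real.exp_le_one_iff.2 ?_)
    have := mul_nonneg (M.ϑ_nonneg y) hv
    linarith
  have hem : ∀ v : ℝ, Measurable fun y => ENNReal.ofReal (Real.exp (-M.ϑ y * v)) := fun v => by
    fun_prop
  have hZ : ∀ s ∈ Icc 0 T, ∀ v : ℝ, 0 ≤ v →
      ∫⁻ y, ENNReal.ofReal (Real.exp (-M.ϑ y * v)) * ENNReal.ofReal (α (s, y)) ∂M.ν ≤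
        ENNReal.ofReal c₁ * (1 + M.lapl v) := by
    intro s hs v hv
    have h1 : ∀ y, ENNReal.ofReal (Real.exp (-M.ϑ y * v)) * ENNReal.ofReal (α (s, y)) ≤
        ENNReal.ofReal (Real.exp (-M.ϑ y * v)) + (‖a s y‖ₑ + ‖a' s y‖ₑ) := fun y => by
      simp only [hα]
      rw [ENNReal.ofReal_add (by positivity) (norm_nonneg _), ENNReal.ofReal_add zero_le_one
        (norm_nonneg _), ENNReal.ofReal_one, ofReal_norm, ofReal_norm, add_assoc, mul_add, mul_one]
      exact add_le_add le_rfl (mul_le_of_le_one_left' (hexp1 v hv y))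
    have h2 : ∫⁻ y, ‖a s y‖ₑ ∂M.ν ≤ ENNReal.ofReal |C| :=
      (lintegral_enorm_avec_le (hK.meas.comp (by fun_prop))).trans
        ((hC s hs).trans (ENNReal.ofReal_le_ofReal (le_abs_self _)))
    have h3 : ∫⁻ y, ‖a' s y‖ₑ ∂M.ν ≤ ENNReal.ofReal |C'| :=
      (lintegral_enorm_avec_le (hK'.meas.comp (by fun_prop))).trans
        ((hC' s hs).trans (ENNReal.ofReal_le_ofReal (le_abs_self _)))
    have hasm : Measurable fun y => ‖a s y‖ₑ :=
      (ham.comp (by fun_prop : Measurable fun y : Y => (s, y))).enorm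
    calc _ ≤ ∫⁻ y, (ENNReal.ofReal (Real.exp (-M.ϑ y * v)) + (‖a s y‖ₑ + ‖a' s y‖ₑ)) ∂M.ν :=
          lintegral_mono h1
      _ ≤ M.lapl v + (ENNReal.ofReal |C| + ENNReal.ofReal |C'|) := by
          rw [lintegral_add_left (hem v), lintegral_add_left hasm]
          exact add_le_add le_rfl (add_le_add h2 h3)
      _ ≤ ENNReal.ofReal c₁ * M.lapl v + ENNReal.ofReal c₁ := by
          refine add_le_add (le_mul_of_one_le_left' ?_) ?_
          · rw [← ENNReal.ofReal_one]
            exact ENNReal.ofReal_le_ofReal (by rw [hc₁]; linarith [abs_nonneg C, abs_nonneg C'])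
          · rw [← ENNReal.ofReal_add (abs_nonneg _) (abs_nonneg _)]
            exact ENNReal.ofReal_le_ofReal (by linarith)
      _ = _ := by ring
  have hJδ : ∀ s ∈ Icc 0 T, ENNReal.ofReal (J s) ≤ ENNReal.ofReal d' * δ s := fun s hs => by
    simp only [hJ]
    rw [← imat_sub_of_integrable (hK.integrable hs) (hK'.integrable hs)]
    exact ofReal_norm_imat_le ((hK.integrable hs).sub (hK'.integrable hs))
  have hX : ∀ s ∈ Icc 0 T, ∀ v : ℝ, 0 ≤ v →
      ∫⁻ y, ENNReal.ofReal (Real.exp (-M.ϑ y * v)) * ENNReal.ofReal (g (s, y)) ∂M.ν ≤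
        ENNReal.ofReal (1 + d' * c₁) * δ s * (1 + M.lapl v) := by
    intro s hs v hv
    have hαs : Measurable fun y => ENNReal.ofReal (α (s, y)) :=
      (hαm.comp (by fun_prop : Measurable fun y : Y => (s, y))).ennreal_ofReal
    have hds : Measurable fun y => ‖a s y - a' s y‖ₑ :=
      ((ham.sub ham').comp (by fun_prop : Measurable fun y : Y => (s, y))).enorm
    have h1 : ∀ y, ENNReal.ofReal (Real.exp (-M.ϑ y * v)) * ENNReal.ofReal (g (s, y)) ≤
        ‖a s y - a' s y‖ₑ + ENNReal.ofReal (J s) *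
          (ENNReal.ofReal (Real.exp (-M.ϑ y * v)) * ENNReal.ofReal (α (s, y))) := fun y => by
      simp only [hg]
      rw [ENNReal.ofReal_add (norm_nonneg _) (mul_nonneg (hJ0 _) (hα0 _)),
        ENNReal.ofReal_mul (hJ0 _), ofReal_norm, mul_add]
      exact add_le_add (mul_le_of_le_one_left' (hexp1 v hv y)) (le_of_eq (mul_left_comm _ _ _))
    have h2 : ∫⁻ y, ‖a s y - a' s y‖ₑ ∂M.ν ≤ δ s := by
      refine le_trans (le_of_eq ?_) (lintegral_enorm_avec_le
        (hmK.comp (by fun_prop : Measurable fun p : Y × Y => (s, p))))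
      refine lintegral_congr_ae ?_
      filter_upwards [ae_avec_sub (hK.integrable hs) (hK'.integrable hs)] with y hy
      rw [← hy]
    calc _ ≤ _ := lintegral_mono h1
      _ ≤ δ s + ENNReal.ofReal d' * δ s * (ENNReal.ofReal c₁ * (1 + M.lapl v)) := by
          rw [lintegral_add_left hds, lintegral_const_mul' _ _ ENNReal.ofReal_ne_top]
          exact add_le_add h2 (mul_le_mul' (hJδ s hs) (hZ s hs v hv))
      _ ≤ δ s * (1 + M.lapl v) +
          ENNReal.ofReal d' * δ s * (ENNReal.ofReal c₁ * (1 + M.lapl v)) :=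
          add_le_add (le_mul_of_one_le_right' le_self_add) le_rfl
      _ = _ := by
          rw [ENNReal.ofReal_add zero_le_one (by positivity), ENNReal.ofReal_mul (by positivity),
            ENNReal.ofReal_one]
          ring
  -- the Lipschitz estimate
  obtain ⟨L, hL, hLb⟩ := P.exists_abs_Phi_sub_le (d' * (|C| + |C'|)) hlam
  have hI : ∀ {K : ℝ × Y × Y → ℝ} {C : ℝ}, Measurable K → ∀ s ∈ Icc 0 T,
      ∫⁻ p, ‖K (s, p)‖ₑ ∂M.ν.prod M.ν ≤ ENNReal.ofReal C →
      ‖M.imat fun p => K (s, p)‖ ≤ d' * |C| := fun {K C} hKm s hs hb => by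
    have hi := integrable_of_lintegral_le (hKm.comp (by fun_prop)) hb
    refine (norm_imat_le_integral hi).trans (mul_le_mul_of_nonneg_left ?_ (by positivity))
    rw [← ENNReal.ofReal_le_ofReal_iff (abs_nonneg _)]
    refine le_trans (le_of_eq (ofReal_integral_norm_eq_lintegral_enorm hi))
      (hb.trans (ENNReal.ofReal_le_ofReal (le_abs_self _)))
  have hlip : ∀ s ∈ Icc 0 T, ∀ p : Y × Y, |M.ricc P K s p - M.ricc P K' s p| ≤
      L * (g (s, p.1) * α (s, p.2) + α (s, p.1) * g (s, p.2)) := by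
    intro s hs p
    refine hLb 0 0 _ _ _ _ _ _ (α (s, p.1)) (α (s, p.2)) (J s) (by simp) (by simp)
      ((hI hK.meas s hs (hC s hs)).trans ?_) ((hI hK'.meas s hs (hC' s hs)).trans ?_)
      (hK.coercive s hs) (hK'.coercive s hs) (M.norm_e_le _) (M.norm_e_le _) rfl rfl
      ?_ ?_ ?_ ?_ ?_
    · gcongr; linarith [abs_nonneg C']
    · gcongr; linarith [abs_nonneg C]
    · exact le_add_of_nonneg_right (norm_nonneg _)
    · simp only [hα]; linarith [norm_nonneg (a s p.1)]
    · exact le_add_of_nonneg_right (norm_nonneg _)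
    · simp only [hα]; linarith [norm_nonneg (a s p.2)]
    · rw [sub_zero, abs_zero, add_zero]
  have hstep : ∀ t ∈ Icc 0 T, δ t ≤ ∫⁻ s in Ioc t T,
      ENNReal.ofReal (2 * L * (1 + d' * c₁) * c₁) * δ s * (1 + M.lapl (s - t)) ^ 2 := by
    intro t ht
    set F : Y × Y → ℝ → ℝ≥0∞ := fun p s => ENNReal.ofReal L *
      ((ENNReal.ofReal (Real.exp (-M.ϑ p.1 * (s - t))) * ENNReal.ofReal (g (s, p.1))) *
        (ENNReal.ofReal (Real.exp (-M.ϑ p.2 * (s - t))) * ENNReal.ofReal (α (s, p.2))) +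
      (ENNReal.ofReal (Real.exp (-M.ϑ p.1 * (s - t))) * ENNReal.ofReal (α (s, p.1))) *
        (ENNReal.ofReal (Real.exp (-M.ϑ p.2 * (s - t))) * ENNReal.ofReal (g (s, p.2)))) with hF
    have hFm : Measurable (Function.uncurry F) := by
      have e1 : Measurable fun x : (Y × Y) × ℝ => ENNReal.ofReal (Real.exp (-M.ϑ x.1.1 * (x.2 - t))) := by
        fun_prop
      have e2 : Measurable fun x : (Y × Y) × ℝ => ENNReal.ofReal (Real.exp (-M.ϑ x.1.2 * (x.2 - t))) := by
        fun_prop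
      have g1 : Measurable fun x : (Y × Y) × ℝ => ENNReal.ofReal (g (x.2, x.1.1)) :=
        (hgm.comp (by fun_prop)).ennreal_ofReal
      have g2 : Measurable fun x : (Y × Y) × ℝ => ENNReal.ofReal (g (x.2, x.1.2)) :=
        (hgm.comp (by fun_prop)).ennreal_ofReal
      have α1 : Measurable fun x : (Y × Y) × ℝ => ENNReal.ofReal (α (x.2, x.1.1)) :=
        (hαm.comp (by fun_prop)).ennreal_ofReal
      have α2 : Measurable fun x : (Y × Y) × ℝ => ENNReal.ofReal (α (x.2, x.1.2)) :=
        (hαm.comp (by fun_prop)).ennreal_ofReal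
      exact (((e1.mul g1).mul (e2.mul α2)).add ((e1.mul α1).mul (e2.mul g2))).const_mul _
    have hpt : ∀ᵐ p ∂M.ν.prod M.ν, ‖K (t, p) - K' (t, p)‖ₑ ≤ ∫⁻ s in Ioc t T, F p s := by
      filter_upwards [hK.eq t ht, hK'.eq t ht] with p h1 h2
      rw [h1.2, h2.2, ← integral_sub h1.1 h2.1]
      refine (enorm_integral_le_lintegral_enorm _).trans
        (setLIntegral_mono' measurableSet_Ioc fun s hs => ?_)
      have hs' : s ∈ Icc 0 T := ⟨ht.1.trans hs.1.le, hs.2⟩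
      rw [← mul_sub, enorm_mul, ← ofReal_norm, ← ofReal_norm, Real.norm_of_nonneg
        (Real.exp_pos _).le]
      refine (mul_le_mul_right (ENNReal.ofReal_le_ofReal (hlip s hs' p)) _).trans (le_of_eq ?_)
      have e : Real.exp (-(M.ϑ p.1 + M.ϑ p.2) * (s - t)) =
          Real.exp (-M.ϑ p.1 * (s - t)) * Real.exp (-M.ϑ p.2 * (s - t)) := by
        rw [← Real.exp_add]; ring_nf
      rw [e, ENNReal.ofReal_mul (Real.exp_pos _).le, ENNReal.ofReal_mul hL.le, ENNReal.ofReal_add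
        (mul_nonneg (hg0 _) (hα0 _)) (mul_nonneg (hα0 _) (hg0 _)), ENNReal.ofReal_mul (hg0 _),
        ENNReal.ofReal_mul (hα0 _)]
      simp only [hF]
      ring
    calc δ t ≤ ∫⁻ p, (∫⁻ s in Ioc t T, F p s) ∂M.ν.prod M.ν := lintegral_mono_ae hpt
      _ = ∫⁻ s in Ioc t T, (∫⁻ p, F p s ∂M.ν.prod M.ν) :=
          lintegral_lintegral_swap hFm.aemeasurable
      _ ≤ _ := by
          refine setLIntegral_mono' measurableSet_Ioc fun s hs => ?_
          have hs' : s ∈ Icc 0 T := ⟨ht.1.trans hs.1.le, hs.2⟩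
          have hv : 0 ≤ s - t := by linarith [hs.1]
          have m1 : Measurable fun y => ENNReal.ofReal (Real.exp (-M.ϑ y * (s - t))) *
              ENNReal.ofReal (g (s, y)) := (hem _).mul (hgm.comp (by fun_prop)).ennreal_ofReal
          have m2 : Measurable fun y => ENNReal.ofReal (Real.exp (-M.ϑ y * (s - t))) *
              ENNReal.ofReal (α (s, y)) := (hem _).mul (hαm.comp (by fun_prop)).ennreal_ofReal
          have i1 := hX s hs' (s - t) hv
          have i2 := hZ s hs' (s - t) hv
          have m3 : Measurable fun p : Y × Y =>
              ENNReal.ofReal (Real.exp (-M.ϑ p.1 * (s - t))) * ENNReal.ofReal (g (s, p.1)) *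
              (ENNReal.ofReal (Real.exp (-M.ϑ p.2 * (s - t))) * ENNReal.ofReal (α (s, p.2))) :=
            (m1.comp measurable_fst).mul (m2.comp measurable_snd)
          simp only [hF]
          rw [lintegral_const_mul' _ _ ENNReal.ofReal_ne_top, lintegral_add_left m3,
            lintegral_prod_mul m1.aemeasurable m2.aemeasurable,
            lintegral_prod_mul m2.aemeasurable m1.aemeasurable]
          refine (mul_le_mul_right (add_le_add (mul_le_mul' i1 i2) (mul_le_mul' i2 i1)) _).trans
            (le_of_eq ?_)
          rw [ENNReal.ofReal_mul (by positivity), ENNReal.ofReal_mul (by positivity),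
            ENNReal.ofReal_mul (by positivity), ENNReal.ofReal_ofNat]
          ring
  have h0 := M.eq_zero_of_le_lintegral (by positivity) hδC hstep
  intro t ht
  have h1 := (lintegral_eq_zero_iff
    (hmK.comp (by fun_prop : Measurable fun p : Y × Y => (t, p))).enorm).1 (h0 t ht)
  filter_upwards [h1] with p hp
  exact sub_eq_zero.1 (enorm_eq_zero.1 hp)

end FactorModel

/-! ### The linear equation -/

namespace LQData

variable {d d' m : ℕ} (P : LQData d d' m)

/-- The vector `Cᵀ b + Fᵀ I γ̃` entering the affine part of the feedback. -/
def affine (I : Matrix (Fin d') (Fin d') ℝ) (c b : Fin d' → ℝ) : Fin m → ℝ :=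
  P.Cᵀ *ᵥ b + (P.Fᵀ * I) *ᵥ c

/-- The right-hand side of the equation for `Λ`, in terms of the coefficients
`w = (g₀, β̃, γ̃)`, the integral `b` of `Λ` and the pair `u = (e, a)`. -/
def Lin (I : Matrix (Fin d') (Fin d') ℝ) (w : (Fin d → ℝ) × (Fin d' → ℝ) × (Fin d' → ℝ))
    (b : Fin d' → ℝ) (u : (Fin d → ℝ) × (Fin d' → ℝ)) : ℝ :=
  u.1 ⬝ᵥ (P.L + P.Q *ᵥ w.1 + P.Bᵀ *ᵥ b + (P.Dᵀ * I) *ᵥ w.2.2) + u.2 ⬝ᵥ w.2.1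
    - P.Sv 0 I u ⬝ᵥ ((P.Nh 0 I)⁻¹ *ᵥ P.affine I w.2.2 b)

/-- The right-hand side of the equation for `χ`. -/
def Scal (I : Matrix (Fin d') (Fin d') ℝ) (w : (Fin d → ℝ) × (Fin d' → ℝ) × (Fin d' → ℝ))
    (b : Fin d' → ℝ) : ℝ :=
  w.1 ⬝ᵥ (P.Q *ᵥ w.1) + 2 * (P.L ⬝ᵥ w.1) + w.2.2 ⬝ᵥ (I *ᵥ w.2.2) + 2 * (w.2.1 ⬝ᵥ b)
    - P.affine I w.2.2 b ⬝ᵥ ((P.Nh 0 I)⁻¹ *ᵥ P.affine I w.2.2 b)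

variable {P} {lam : ℝ} {I : Matrix (Fin d') (Fin d') ℝ}

/-- The dependence of `Lin` on the integral `b` of `Λ` is linear and does not involve `w`. -/
theorem Lin_sub (w : (Fin d → ℝ) × (Fin d' → ℝ) × (Fin d' → ℝ)) (b b' : Fin d' → ℝ)
    (u : (Fin d → ℝ) × (Fin d' → ℝ)) : P.Lin I w b u - P.Lin I w b' u =
      u.1 ⬝ᵥ (P.Bᵀ *ᵥ (b - b')) - P.Sv 0 I u ⬝ᵥ ((P.Nh 0 I)⁻¹ *ᵥ (P.Cᵀ *ᵥ (b - b'))) := by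
  simp only [Lin, affine, Matrix.mulVec_add, Matrix.mulVec_sub, dotProduct_add, dotProduct_sub]
  ring

variable (P) in
/-- Growth in `u`, and Lipschitz dependence on `b`, of the right-hand side of the linear equation. -/
theorem exists_abs_Lin_le (A c : ℝ) (hl : 0 < lam) : ∃ L : ℝ, 0 < L ∧
    ∀ (I : Matrix (Fin d') (Fin d') ℝ) (w : (Fin d → ℝ) × (Fin d' → ℝ) × (Fin d' → ℝ))
      (b b' : Fin d' → ℝ) (u : (Fin d → ℝ) × (Fin d' → ℝ)), ‖I‖ ≤ A → Coercive lam (P.Nh 0 I) →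
      ‖w‖ ≤ c → ‖u.1‖ ≤ 1 → |P.Lin I w 0 u| ≤ L * (1 + ‖u.2‖) ∧
      |P.Lin I w b u - P.Lin I w b' u| ≤ L * (‖b - b'‖ * (1 + ‖u.2‖)) := by
  obtain ⟨S, hS, hSb⟩ := P.exists_norm_Sv_le A
  set c' := |c| with hc'
  have hc0 : 0 ≤ c' := abs_nonneg c
  set L₁ := d * (1 * (‖P.L‖ + ‖P.Q‖ * c' + ‖P.Dᵀ‖ * |A| * c')) + d' * c' +
    m * (S * (m / lam * (‖P.Fᵀ‖ * |A| * c'))) with hL₁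
  set L₂ := d * (1 * ‖P.Bᵀ‖) + m * (S * (m / lam * ‖P.Cᵀ‖)) with hL₂
  have hL₁0 : 0 ≤ L₁ := by positivity
  have hL₂0 : 0 ≤ L₂ := by positivity
  refine ⟨L₁ + L₂ + 1, by positivity, fun I w b b' u hI hN hw hu => ⟨?_, ?_⟩⟩
  · have hw1 : ‖w.1‖ ≤ c' := (norm_fst_le w).trans (hw.trans (le_abs_self c))
    have hw2 : ‖w.2.1‖ ≤ c' := (norm_fst_le w.2).trans ((norm_snd_le w).trans
      (hw.trans (le_abs_self c)))
    have hw3 : ‖w.2.2‖ ≤ c' := (norm_snd_le w.2).trans ((norm_snd_le w).trans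
      (hw.trans (le_abs_self c)))
    have hI' : ‖I‖ ≤ |A| := hI.trans (le_abs_self A)
    have hm : ∀ {k : ℕ} (G : Matrix (Fin k) (Fin d') ℝ), ‖(G * I) *ᵥ w.2.2‖ ≤ ‖G‖ * |A| * c' :=
      fun G => norm_mulVec_le ((Matrix.linfty_opNorm_mul G I).trans
        (mul_le_mul_of_nonneg_left hI' (norm_nonneg _))) hw3
    have e : P.Lin I w 0 u = u.1 ⬝ᵥ (P.L + P.Q *ᵥ w.1 + (P.Dᵀ * I) *ᵥ w.2.2) + u.2 ⬝ᵥ w.2.1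
        - P.Sv 0 I u ⬝ᵥ ((P.Nh 0 I)⁻¹ *ᵥ ((P.Fᵀ * I) *ᵥ w.2.2)) := by
      simp [Lin, affine]
    have h1 : ‖P.L + P.Q *ᵥ w.1 + (P.Dᵀ * I) *ᵥ w.2.2‖ ≤
        ‖P.L‖ + ‖P.Q‖ * c' + ‖P.Dᵀ‖ * |A| * c' :=
      (norm_add_le _ _).trans (add_le_add ((norm_add_le _ _).trans
        (add_le_add le_rfl (norm_mulVec_le le_rfl hw1))) (hm _))
    have a1 := abs_dotProduct_le_of_le (le_refl (d : ℝ)) hu h1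
    have a2 := abs_dotProduct_le_of_le (le_refl (d' : ℝ)) (le_refl ‖u.2‖) hw2
    have a3 := abs_dotProduct_le_of_le (le_refl (m : ℝ)) (hSb 0 I u (by simp) hI hu)
      ((hN.norm_inv_le hl _).trans (mul_le_mul_of_nonneg_left (hm P.Fᵀ) (by positivity)))
    rw [e]
    refine (abs_sub _ _).trans ((add_le_add ((abs_add_le _ _).trans (add_le_add a1 a2)) a3).trans ?_)
    have hu2 : 0 ≤ ‖u.2‖ := norm_nonneg _
    set X := d * (1 * (‖P.L‖ + ‖P.Q‖ * c' + ‖P.Dᵀ‖ * |A| * c')) with hX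
    set Z := m * (S * (m / lam * (‖P.Fᵀ‖ * |A| * c'))) with hZ
    have hX0 : 0 ≤ X := by positivity
    have e3 : m * (S * (1 + ‖u.2‖) * (m / lam * (‖P.Fᵀ‖ * |A| * c'))) = Z * (1 + ‖u.2‖) := by
      rw [hZ]; ring
    rw [e3]
    have h4 : 0 ≤ X * ‖u.2‖ := by positivity
    have h5 : 0 ≤ (d' : ℝ) * c' := by positivity
    have h6 : 0 ≤ (L₂ + 1) * (1 + ‖u.2‖) := by positivity
    nlinarith only [h4, h5, h6, hL₁]
  · rw [Lin_sub]
    have a1 := abs_dotProduct_le_of_le (le_refl (d : ℝ)) hu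
      (norm_mulVec_le (M := P.Bᵀ) le_rfl (le_refl ‖b - b'‖))
    have a3 := abs_dotProduct_le_of_le (le_refl (m : ℝ)) (hSb 0 I u (by simp) hI hu)
      ((hN.norm_inv_le hl _).trans (mul_le_mul_of_nonneg_left
        (norm_mulVec_le (M := P.Cᵀ) le_rfl (le_refl ‖b - b'‖)) (by positivity)))
    refine (abs_sub _ _).trans ((add_le_add a1 a3).trans ?_)
    have hu2 : 0 ≤ ‖u.2‖ := norm_nonneg _
    have hb : 0 ≤ ‖b - b'‖ := norm_nonneg _
    have h4 : 0 ≤ d * (1 * ‖P.Bᵀ‖) * (‖b - b'‖ * ‖u.2‖) := by positivity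
    have h6 : 0 ≤ (L₁ + 1) * (‖b - b'‖ * (1 + ‖u.2‖)) := by positivity
    nlinarith only [h4, h6, hL₂]

section

variable {Z : Type*} [MeasurableSpace Z] {I : Z → Matrix (Fin d') (Fin d') ℝ}
  {w : Z → (Fin d → ℝ) × (Fin d' → ℝ) × (Fin d' → ℝ)} {b : Z → Fin d' → ℝ}
  {u : Z → (Fin d → ℝ) × (Fin d' → ℝ)}

theorem measurable_const_mulVec {k l : ℕ} (A : Matrix (Fin k) (Fin l) ℝ) {v : Z → Fin l → ℝ}
    (hv : Measurable v) : Measurable fun z => A *ᵥ v z :=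
  measurable_mulVec (A := fun _ => A) (fun _ _ => measurable_const) hv

theorem measurable_const_mul_mulVec {k : ℕ} (A : Matrix (Fin k) (Fin d') ℝ)
    (hI : ∀ i j, Measurable fun z => I z i j) {v : Z → Fin d' → ℝ} (hv : Measurable v) :
    Measurable fun z => (A * I z) *ᵥ v z :=
  measurable_mulVec (A := fun z => A * I z)
    (measurable_matrix_mul (A := fun _ => A) (fun _ _ => measurable_const) hI) hv

theorem measurable_affine (hI : ∀ i j, Measurable fun z => I z i j) {c : Z → Fin d' → ℝ}
    (hc : Measurable c) (hb : Measurable b) : Measurable fun z => P.affine (I z) (c z) (b z) :=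
  (measurable_const_mulVec _ hb).add (measurable_const_mul_mulVec _ hI hc)

theorem measurable_Lin (hI : ∀ i j, Measurable fun z => I z i j) (hw : Measurable w)
    (hb : Measurable b) (hu : Measurable u) : Measurable fun z => P.Lin (I z) (w z) (b z) (u z) :=
  ((measurable_dotProduct hu.fst (((measurable_const.add (measurable_const_mulVec _ hw.fst)).add
    (measurable_const_mulVec _ hb)).add (measurable_const_mul_mulVec _ hI hw.snd.snd))).add
    (measurable_dotProduct hu.snd hw.snd.fst)).sub
    (measurable_dotProduct (P.measurable_Sv hI hu) (measurable_mulVec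
      (measurable_matrix_inv fun i j => P.measurable_Nh hI i j)
      (measurable_affine hI hw.snd.snd hb)))

theorem measurable_Scal (hI : ∀ i j, Measurable fun z => I z i j) (hw : Measurable w)
    (hb : Measurable b) : Measurable fun z => P.Scal (I z) (w z) (b z) :=
  ((((measurable_dotProduct hw.fst (measurable_const_mulVec _ hw.fst)).add
    ((measurable_dotProduct measurable_const hw.fst).const_mul 2)).add
    (measurable_dotProduct hw.snd.snd (measurable_mulVec hI hw.snd.snd))).add
    ((measurable_dotProduct hw.snd.fst hb).const_mul 2)).sub
    (measurable_dotProduct (measurable_affine hI hw.snd.snd hb) (measurable_mulVec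
      (measurable_matrix_inv fun i j => P.measurable_Nh hI i j)
      (measurable_affine hI hw.snd.snd hb)))

end

variable (P) in
theorem exists_abs_Scal_le (A c b₀ : ℝ) (hl : 0 < lam) : ∃ L : ℝ,
    ∀ (I : Matrix (Fin d') (Fin d') ℝ) (w : (Fin d → ℝ) × (Fin d' → ℝ) × (Fin d' → ℝ))
      (b : Fin d' → ℝ), ‖I‖ ≤ A → Coercive lam (P.Nh 0 I) → ‖w‖ ≤ c → ‖b‖ ≤ b₀ →
      |P.Scal I w b| ≤ L := by
  refine ⟨d * (c * (‖P.Q‖ * c)) + 2 * (d * (‖P.L‖ * c)) + d' * (c * (A * c)) + 2 * (d' * (c * b₀)) +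
    m * ((‖P.Cᵀ‖ * b₀ + ‖P.Fᵀ‖ * A * c) * (m / lam * (‖P.Cᵀ‖ * b₀ + ‖P.Fᵀ‖ * A * c))),
    fun I w b hI hN hw hb => ?_⟩
  have hw1 : ‖w.1‖ ≤ c := (norm_fst_le w).trans hw
  have hw2 : ‖w.2.1‖ ≤ c := (norm_fst_le w.2).trans ((norm_snd_le w).trans hw)
  have hw3 : ‖w.2.2‖ ≤ c := (norm_snd_le w.2).trans ((norm_snd_le w).trans hw)
  have hh : ‖P.affine I w.2.2 b‖ ≤ ‖P.Cᵀ‖ * b₀ + ‖P.Fᵀ‖ * A * c :=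
    (norm_add_le _ _).trans (add_le_add (norm_mulVec_le le_rfl hb)
      (norm_mulVec_le ((Matrix.linfty_opNorm_mul _ I).trans
        (mul_le_mul_of_nonneg_left hI (norm_nonneg _))) hw3))
  have a1 := abs_dotProduct_le_of_le (le_refl (d : ℝ)) hw1 (norm_mulVec_le (M := P.Q) le_rfl hw1)
  have a2 := abs_dotProduct_le_of_le (le_refl (d : ℝ)) (le_refl ‖P.L‖) hw1
  have a3 := abs_dotProduct_le_of_le (le_refl (d' : ℝ)) hw3 (norm_mulVec_le hI hw3)
  have a4 := abs_dotProduct_le_of_le (le_refl (d' : ℝ)) hw2 hb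
  have a5 := abs_dotProduct_le_of_le (le_refl (m : ℝ)) hh
    ((hN.norm_inv_le hl _).trans (mul_le_mul_of_nonneg_left hh (by positivity)))
  have h2 : ∀ x : ℝ, |2 * x| = 2 * |x| := fun x => by rw [abs_mul]; norm_num
  refine (abs_sub _ _).trans (add_le_add ((abs_add_le _ _).trans (add_le_add
    ((abs_add_le _ _).trans (add_le_add ((abs_add_le _ _).trans (add_le_add a1 ?_)) a3)) ?_)) a5)
  · rw [h2]; linarith
  · rw [h2]; linarith

end LQData

namespace FactorModel

variable {d d' m : ℕ} {Y : Type*} [MeasurableSpace Y] {M : FactorModel d d' Y}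
  {P : LQData d d' m} {l A T lam C C' : ℝ} {r r' : ℝ × Y → ℝ}

/-- The function `∫_t^T e^{-ϑ(y)(s-t)} r_s(y) ds`. -/
def vmild (M : FactorModel d d' Y) (T : ℝ) (r : ℝ × Y → ℝ) (q : ℝ × Y) : ℝ :=
  back T (M.ϑ q.2) (fun s => r (s, q.2)) q.1

/-- The integral `∫ σ(y) f(y) ν(dy)`. -/
def bvec (M : FactorModel d d' Y) (f : Y → ℝ) : Fin d' → ℝ := fun k => ∫ y, M.σ y k * f y ∂M.ν

theorem measurable_vmild (hr : Measurable r) : Measurable (M.vmild T r) :=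
  measurable_back M.measurable_ϑ hr

theorem abs_vmild_le (hl : 1 ≤ l) {δ : ℝ} (hδ : 0 ≤ δ)
    (h : ∀ q, q.1 ≤ T → |r q| ≤ δ * Real.exp (l * (T - q.1))) (q : ℝ × Y) :
    |M.vmild T r q| ≤ δ * Real.exp (l * (T - q.1)) * wt M.ϑ l q.2 := by
  refine (abs_back_le hδ (by linarith [M.ϑ_nonneg q.2]) fun s hs => h (s, q.2) hs.2).trans ?_
  rw [div_eq_mul_one_div]
  exact mul_le_mul_of_nonneg_left (one_div_add_le_wt M.ϑ_nonneg hl _) (by positivity)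

theorem abs_vmild_le_of_bounded (hC : ∀ q, |r q| ≤ C) (q : ℝ × Y) :
    |M.vmild T r q| ≤ C * Real.exp (T - q.1) * wt M.ϑ 1 q.2 := by
  have hC0 : 0 ≤ C := (abs_nonneg _).trans (hC q)
  have := abs_vmild_le (M := M) (T := T) le_rfl hC0 (fun q hq => (hC q).trans ?_) q
  · simpa using this
  · exact le_mul_of_one_le_right hC0 (Real.one_le_exp (by linarith))

theorem vmild_sub (hr : Measurable r) (hr' : Measurable r') (hC : ∀ q, |r q| ≤ C)
    (hC' : ∀ q, |r' q| ≤ C') (q : ℝ × Y) :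
    M.vmild T (fun q => r q - r' q) q = M.vmild T r q - M.vmild T r' q :=
  back_sub (hr.comp (by fun_prop : Measurable fun s : ℝ => (s, q.2)))
    (hr'.comp (by fun_prop : Measurable fun s : ℝ => (s, q.2))) (fun s => hC (s, q.2))
    (fun s => hC' (s, q.2)) q.1

theorem integrable_of_abs_le_wt {f : Y → ℝ} (hf : Measurable f) (hl : 1 ≤ l)
    (h : ∀ y, |f y| ≤ C * wt M.ϑ l y) : Integrable f M.ν :=
  ((integrable_wt hl).const_mul C).mono' hf.aestronglyMeasurable (ae_of_all _ h)

theorem integrable_σ_mul_vec {f : Y → ℝ} (hf : Integrable f M.ν) (k : Fin d') :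
    Integrable (fun y => M.σ y k * f y) M.ν :=
  hf.bdd_mul (c := 1) (measurable_σ_apply k).aestronglyMeasurable (ae_of_all _ fun y => abs_σ_le y k)

theorem bvec_sub {f f' : Y → ℝ} (hf : Integrable f M.ν) (hf' : Integrable f' M.ν) :
    M.bvec (fun y => f y - f' y) = M.bvec f - M.bvec f' := by
  ext k
  simp only [bvec, Pi.sub_apply]
  rw [← integral_sub (integrable_σ_mul_vec hf k) (integrable_σ_mul_vec hf' k)]
  simp only [mul_sub]

theorem enorm_bvec_le (f : Y → ℝ) : ‖M.bvec f‖ₑ ≤ ∫⁻ y, ‖f y‖ₑ ∂M.ν := by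
  refine pi_enorm_le fun k => (enorm_integral_le_lintegral_enorm _).trans ?_
  refine lintegral_mono fun y => ?_
  rw [enorm_mul]
  refine mul_le_of_le_one_left' ?_
  rw [← ofReal_norm, ← ENNReal.ofReal_one]
  exact ENNReal.ofReal_le_ofReal (abs_σ_le y k)

theorem norm_bvec_le {f : Y → ℝ} (hl : 1 ≤ l) (hC : 0 ≤ C) (h : ∀ y, |f y| ≤ C * wt M.ϑ l y) :
    ‖M.bvec f‖ ≤ C * M.kap l := by
  refine (pi_norm_le_iff_of_nonneg (mul_nonneg hC (kap_nonneg hl))).2 fun k => ?_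
  rw [kap, ← integral_const_mul]
  refine norm_integral_le_of_norm_le (f := fun y => M.σ y k * f y) ((integrable_wt hl).const_mul C)
    (ae_of_all _ fun y => ?_)
  rw [norm_mul]
  exact (mul_le_of_le_one_left (norm_nonneg _) (abs_σ_le y k)).trans (h y)

theorem measurable_bvec {Z : Type*} [MeasurableSpace Z] {f : Z × Y → ℝ} (hf : Measurable f) :
    Measurable fun z => M.bvec fun y => f (z, y) := by
  refine measurable_pi_lambda _ fun k => ?_
  refine (StronglyMeasurable.integral_prod_right' (ν := M.ν)
    (f := fun x : Z × Y => M.σ x.2 k * f x) (Measurable.stronglyMeasurable ?_)).measurable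
  exact ((measurable_σ_apply k).comp measurable_snd).mul hf

/-- Existence for the linear equation, for a given kernel with bounded and coercive coefficients. -/
theorem exists_linear (M : FactorModel d d' Y) (P : LQData d d' m) (hlam : 0 < lam) (hA : 0 ≤ A)
    {K : ℝ × Y × Y → ℝ} (hK : Measurable K)
    (hI : ∀ s ∈ Icc 0 T, ‖M.imat fun p => K (s, p)‖ ≤ d' * A)
    (hN : ∀ s ∈ Icc 0 T, Coercive lam (P.Nh 0 (M.imat fun p => K (s, p))))
    {w : ℝ → (Fin d → ℝ) × (Fin d' → ℝ) × (Fin d' → ℝ)} (hw : Measurable w) {c : ℝ}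
    (hwc : ∀ s, ‖w s‖ ≤ c) :
    ∃ r : ℝ × Y → ℝ, Measurable r ∧ (∃ C, ∀ q, |r q| ≤ C) ∧ ∀ s ∈ Icc 0 T, ∀ y,
      r (s, y) = P.Lin (M.imat fun p => K (s, p)) (w s) (M.bvec fun y => M.vmild T r (s, y))
        (M.upair A (fun p => K (s, p)) y) := by
  obtain ⟨L, hL, hLb⟩ := P.exists_abs_Lin_le (d' * A) c hlam
  obtain ⟨l, -, hl, hk⟩ := M.exists_kap_le (η := 1 / (2 * (L * (1 + A)))) (by positivity) 1
  have hl0 : 0 ≤ l := by linarith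
  have hkl := kap_nonneg (M := M) hl
  have hLk : L * (M.kap l * (1 + A)) ≤ 1 / 2 := by
    have h1 : M.kap l ≤ 1 / (2 * (L * (1 + A))) := by nlinarith
    have h2 := mul_le_mul_of_nonneg_left h1 (by positivity : 0 ≤ L * (1 + A))
    have h3 : L * (1 + A) * (1 / (2 * (L * (1 + A)))) = 1 / 2 := by
      have : L * (1 + A) ≠ 0 := by positivity
      field_simp
    linarith
  -- the fixed point map acts on the bounded right-hand sides, cut off outside of `[0, T]`
  let Ψ : (ℝ × Y → ℝ) → ℝ × Y → ℝ := fun r q => (Icc 0 T).indicator (fun s =>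
    P.Lin (M.imat fun p => K (s, p)) (w s) (M.bvec fun y => M.vmild T r (s, y))
      (M.upair A (fun p => K (s, p)) q.2)) q.1
  have hΨ : ∀ r s y, s ∈ Icc 0 T → Ψ r (s, y) = P.Lin (M.imat fun p => K (s, p)) (w s)
      (M.bvec fun y => M.vmild T r (s, y)) (M.upair A (fun p => K (s, p)) y) :=
    fun r s y hs => indicator_of_mem (f := fun s =>
      P.Lin (M.imat fun p => K (s, p)) (w s) (M.bvec fun y => M.vmild T r (s, y))
        (M.upair A (fun p => K (s, p)) y)) hs
  have hΨ0 : ∀ r s y, s ∉ Icc 0 T → Ψ r (s, y) = 0 := fun r s y hs =>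
    indicator_of_notMem (f := fun s =>
      P.Lin (M.imat fun p => K (s, p)) (w s) (M.bvec fun y => M.vmild T r (s, y))
        (M.upair A (fun p => K (s, p)) y)) hs
  have hu2 : ∀ s y, 1 + ‖(M.upair A (fun p => K (s, p)) y).2‖ ≤ 1 + A := fun s y =>
    add_le_add le_rfl (norm_clampVec_le hA _)
  let Cl : (ℝ × Y → ℝ) → Prop := fun r => Measurable r ∧ (∃ C, ∀ q, |r q| ≤ C) ∧
    ∀ s, s ∉ Icc 0 T → ∀ y, r (s, y) = 0
  have hmaps : ∀ r, Cl r → Cl (Ψ r) := by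
    rintro r ⟨hr, ⟨C, hC⟩, -⟩
    refine ⟨?_, ⟨L * (1 + A) + L * (|C| * Real.exp T * M.kap 1 * (1 + A)), ?_⟩, ?_⟩
    · have h1 : Measurable fun q : ℝ × Y => P.Lin (M.imat fun p => K (q.1, p)) (w q.1)
          (M.bvec fun y => M.vmild T r (q.1, y)) (M.upair A (fun p => K (q.1, p)) q.2) :=
        LQData.measurable_Lin (fun i j => (measurable_imat hK i j).comp measurable_fst)
          (hw.comp measurable_fst) ((measurable_bvec (measurable_vmild hr)).comp measurable_fst)
          (measurable_upair hK)
      have h2 : Ψ r = (Prod.fst ⁻¹' Icc 0 T).indicator fun q : ℝ × Y =>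
          P.Lin (M.imat fun p => K (q.1, p)) (w q.1)
          (M.bvec fun y => M.vmild T r (q.1, y)) (M.upair A (fun p => K (q.1, p)) q.2) := by
        ext ⟨s, y⟩
        by_cases hs : s ∈ Icc 0 T
        · rw [hΨ r s y hs, indicator_of_mem (by exact hs)]
        · rw [hΨ0 r s y hs, indicator_of_notMem (by exact hs)]
      rw [h2]
      exact h1.indicator (measurable_fst measurableSet_Icc)
    · have hk1 := kap_nonneg (M := M) le_rfl
      rintro ⟨s, y⟩
      by_cases hs : s ∈ Icc 0 T
      · rw [hΨ r s y hs]
        obtain ⟨h1, h2⟩ := hLb _ (w s) (M.bvec fun y => M.vmild T r (s, y)) 0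
          (M.upair A (fun p => K (s, p)) y) (hI s hs) (hN s hs) (hwc s) (M.norm_e_le y)
        have h3 : ‖M.bvec fun y => M.vmild T r (s, y)‖ ≤ |C| * Real.exp T * M.kap 1 := by
          refine norm_bvec_le le_rfl (by positivity) fun y =>
            (abs_vmild_le_of_bounded hC (s, y)).trans ?_
          refine mul_le_mul_of_nonneg_right ?_ (wt_nonneg le_rfl y)
          exact mul_le_mul (le_abs_self C) (Real.exp_le_exp.2 (by linarith [hs.1]))
            (Real.exp_pos _).le (abs_nonneg _)
        rw [sub_zero] at h2
        have h4 := abs_sub_abs_le_abs_sub (P.Lin (M.imat fun p => K (s, p)) (w s)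
          (M.bvec fun y => M.vmild T r (s, y)) (M.upair A (fun p => K (s, p)) y))
          (P.Lin (M.imat fun p => K (s, p)) (w s) 0 (M.upair A (fun p => K (s, p)) y))
        have h5 := mul_le_mul_of_nonneg_left (hu2 s y) hL.le
        have h6 := mul_le_mul_of_nonneg_left (mul_le_mul h3 (hu2 s y) (by positivity)
          (by positivity)) hL.le
        linarith
      · rw [hΨ0 r s y hs, abs_zero]; positivity
    · exact fun s hs y => hΨ0 r s y hs
  have hclosed : ∀ (f : ℕ → ℝ × Y → ℝ) (g : ℝ × Y → ℝ) (C : ℝ), (∀ n, Cl (f n)) →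
      (∀ n z, |f n z - g z| ≤ C * (1 / 2) ^ n * Real.exp (l * (T - z.1))) → Cl g := by
    intro f g C hf h
    have hpt : ∀ q, Tendsto (fun n => f n q) atTop (𝓝 (g q)) := fun q =>
      tendsto_of_geometric (C := C * Real.exp (l * (T - q.1))) fun n =>
        (h n q).trans (le_of_eq (by ring))
    have hsupp : ∀ s, s ∉ Icc 0 T → ∀ y, g (s, y) = 0 := fun s hs y =>
      tendsto_nhds_unique (hpt (s, y))
        (tendsto_const_nhds.congr fun n => ((hf n).2.2 s hs y).symm)
    refine ⟨measurable_of_tendsto_metrizable (fun n => (hf n).1) (tendsto_pi_nhds.2 hpt), ?_, hsupp⟩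
    obtain ⟨C₀, hC₀⟩ := (hf 0).2.1
    refine ⟨C₀ + |C| * Real.exp (l * T), ?_⟩
    rintro ⟨s, y⟩
    have hC0 : 0 ≤ C₀ := (abs_nonneg _).trans (hC₀ (s, y))
    by_cases hs : s ∈ Icc 0 T
    · have h1 := h 0 (s, y)
      have h2 : Real.exp (l * (T - s)) ≤ Real.exp (l * T) :=
        Real.exp_le_exp.2 (mul_le_mul_of_nonneg_left (by linarith [hs.1]) hl0)
      have h3 : C * (1 / 2) ^ 0 * Real.exp (l * (T - s)) ≤ |C| * Real.exp (l * T) := by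
        rw [pow_zero, mul_one]
        exact mul_le_mul (le_abs_self C) h2 (Real.exp_pos _).le (abs_nonneg _)
      have h4 := hC₀ (s, y)
      have h5 := abs_sub (f 0 (s, y)) (f 0 (s, y) - g (s, y))
      rw [sub_sub_cancel] at h5
      linarith
    · rw [hsupp s hs y, abs_zero]; positivity
  have hcontr : ∀ f g δ, Cl f → Cl g → 0 ≤ δ →
      (∀ z, |f z - g z| ≤ δ * Real.exp (l * (T - z.1))) →
      ∀ z, |Ψ f z - Ψ g z| ≤ δ / 2 * Real.exp (l * (T - z.1)) := by
    rintro f g δ ⟨hf, ⟨C, hC⟩, -⟩ ⟨hg, ⟨C', hC'⟩, -⟩ hδ hd ⟨s, y⟩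
    by_cases hs : s ∈ Icc 0 T
    · rw [hΨ f s y hs, hΨ g s y hs]
      refine (hLb _ (w s) (M.bvec fun y => M.vmild T f (s, y)) (M.bvec fun y => M.vmild T g (s, y))
        (M.upair A (fun p => K (s, p)) y) (hI s hs) (hN s hs) (hwc s) (M.norm_e_le y)).2.trans ?_
      have hi : ∀ {f : ℝ × Y → ℝ} {C : ℝ}, Measurable f → (∀ q, |f q| ≤ C) →
          Integrable (fun y => M.vmild T f (s, y)) M.ν := fun {f C} hf hC =>
        integrable_of_abs_le_wt (C := C * Real.exp (T - s))
          ((measurable_vmild hf).comp (by fun_prop)) le_rfl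
          fun y => abs_vmild_le_of_bounded hC (s, y)
      have h3 : ‖(M.bvec fun y => M.vmild T f (s, y)) - M.bvec fun y => M.vmild T g (s, y)‖ ≤
          δ * Real.exp (l * (T - s)) * M.kap l := by
        rw [← bvec_sub (hi hf hC) (hi hg hC')]
        refine norm_bvec_le hl (by positivity) fun y => ?_
        rw [← vmild_sub hf hg hC hC']
        exact abs_vmild_le hl hδ (fun q _ => hd q) (s, y)
      have h6 := mul_le_mul_of_nonneg_left (mul_le_mul h3 (hu2 s y) (by positivity)
          (by positivity)) hL.le
      have h7 := mul_le_mul_of_nonneg_left hLk (by positivity : 0 ≤ δ * Real.exp (l * (T - s)))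
      dsimp only
      linarith
    · rw [hΨ0 f s y hs, hΨ0 g s y hs, sub_self, abs_zero]
      positivity
  have h0 : Cl fun _ => 0 := ⟨measurable_const, ⟨0, fun _ => by simp⟩, fun _ _ _ => rfl⟩
  obtain ⟨C₀, hC₀⟩ := (hmaps _ h0).2.1
  obtain ⟨r, hr, hfix⟩ := exists_fixedPoint_of_weighted
    (W := fun q : ℝ × Y => Real.exp (l * (T - q.1))) Cl Ψ hmaps hclosed hcontr h0 (C := |C₀|)
    (abs_nonneg _) (by
      rintro ⟨s, y⟩
      rw [sub_zero]
      by_cases hs : s ∈ Icc 0 T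
      · refine ((hC₀ _).trans (le_abs_self _)).trans (le_mul_of_one_le_right (abs_nonneg _) ?_)
        exact Real.one_le_exp (mul_nonneg hl0 (by linarith [hs.2]))
      · rw [hΨ0 _ s y hs, abs_zero]; positivity)
  exact ⟨r, hr.1, hr.2.1, fun s hs y => by rw [← hΨ r s y hs, hfix]⟩

/-- The right-hand side of the linear equation along given time dependent functions. -/
def linRhs (M : FactorModel d d' Y) (P : LQData d d' m) (K : ℝ × Y × Y → ℝ)
    (w : ℝ → (Fin d → ℝ) × (Fin d' → ℝ) × (Fin d' → ℝ)) (f : ℝ × Y → ℝ) (s : ℝ) (y : Y) : ℝ :=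
  P.Lin (M.imat fun p => K (s, p)) (w s) (M.bvec fun y => f (s, y))
    (M.e y, M.avec (fun p => K (s, p)) y)

/-- Jointly measurable functions, bounded in `L¹`, that solve the linear equation at every time
almost everywhere. -/
structure L1LinSolution (M : FactorModel d d' Y) (P : LQData d d' m) (T : ℝ) (K : ℝ × Y × Y → ℝ)
    (w : ℝ → (Fin d → ℝ) × (Fin d' → ℝ) × (Fin d' → ℝ)) (f : ℝ × Y → ℝ) : Prop where
  meas : Measurable f
  bdd : ∃ C : ℝ, ∀ t ∈ Icc 0 T, ∫⁻ y, ‖f (t, y)‖ₑ ∂M.ν ≤ ENNReal.ofReal C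
  eq : ∀ t ∈ Icc 0 T, ∀ᵐ y ∂M.ν,
    IntegrableOn (fun s => Real.exp (-M.ϑ y * (s - t)) * M.linRhs P K w f s y) (Ioc t T) ∧
    f (t, y) = ∫ s in Ioc t T, Real.exp (-M.ϑ y * (s - t)) * M.linRhs P K w f s y

theorem L1LinSolution.integrable {K : ℝ × Y × Y → ℝ}
    {w : ℝ → (Fin d → ℝ) × (Fin d' → ℝ) × (Fin d' → ℝ)} {f : ℝ × Y → ℝ}
    (hf : M.L1LinSolution P T K w f) {t : ℝ} (ht : t ∈ Icc 0 T) :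
    Integrable (fun y => f (t, y)) M.ν := by
  obtain ⟨C, hC⟩ := hf.bdd
  exact integrable_of_lintegral_le (hf.meas.comp (by fun_prop)) (hC t ht)

/-- Two integrable solutions of the linear equation agree, by the same Gronwall inequality as for the
Riccati equation. -/
theorem L1LinSolution.ae_eq {K : ℝ × Y × Y → ℝ} (hlam : 0 < lam) (hK : M.L1Solution P lam T K)
    {w : ℝ → (Fin d → ℝ) × (Fin d' → ℝ) × (Fin d' → ℝ)} {c : ℝ} (hwc : ∀ s, ‖w s‖ ≤ c)
    {f f' : ℝ × Y → ℝ} (hf : M.L1LinSolution P T K w f) (hf' : M.L1LinSolution P T K w f') :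
    ∀ t ∈ Icc 0 T, ∀ᵐ y ∂M.ν, f (t, y) = f' (t, y) := by
  have hϑm := M.measurable_ϑ
  obtain ⟨CK, hCK⟩ := hK.bdd
  obtain ⟨C, hC⟩ := hf.bdd
  obtain ⟨C', hC'⟩ := hf'.bdd
  set δ : ℝ → ℝ≥0∞ := fun t => ∫⁻ y, ‖f (t, y) - f' (t, y)‖ₑ ∂M.ν with hδ
  have hm : Measurable fun q => f q - f' q := hf.meas.sub hf'.meas
  have hδC : ∀ t ∈ Icc 0 T, δ t ≤ ENNReal.ofReal (|C| + |C'|) := fun t ht => by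
    rw [ENNReal.ofReal_add (abs_nonneg _) (abs_nonneg _)]
    refine le_trans ?_ (add_le_add ((hC t ht).trans (ENNReal.ofReal_le_ofReal (le_abs_self _)))
      ((hC' t ht).trans (ENNReal.ofReal_le_ofReal (le_abs_self _))))
    have hft : Measurable fun y : Y => ‖f (t, y)‖ₑ := (hf.meas.comp (by fun_prop)).enorm
    rw [← lintegral_add_left hft]
    exact lintegral_mono fun p => enorm_sub_le
  set a : ℝ → Y → Fin d' → ℝ := fun s => M.avec fun p => K (s, p) with ha
  have ham : Measurable fun q : ℝ × Y => a q.1 q.2 := measurable_avec hK.meas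
  obtain ⟨L, hL, hLb⟩ := P.exists_abs_Lin_le (d' * |CK|) c hlam
  have hI : ∀ s ∈ Icc 0 T, ‖M.imat fun p => K (s, p)‖ ≤ d' * |CK| := fun s hs => by
    refine (norm_imat_le_integral (hK.integrable hs)).trans
      (mul_le_mul_of_nonneg_left ?_ (by positivity))
    rw [← ENNReal.ofReal_le_ofReal_iff (abs_nonneg _)]
    exact le_trans (le_of_eq (ofReal_integral_norm_eq_lintegral_enorm (hK.integrable hs)))
      ((hCK s hs).trans (ENNReal.ofReal_le_ofReal (le_abs_self _)))
  have hlip : ∀ s ∈ Icc 0 T, ∀ y, ‖M.linRhs P K w f s y - M.linRhs P K w f' s y‖ₑ ≤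
      ENNReal.ofReal L * (δ s * (1 + ‖a s y‖ₑ)) := by
    intro s hs y
    have h1 := (hLb _ (w s) (M.bvec fun y => f (s, y)) (M.bvec fun y => f' (s, y))
      (M.e y, a s y) (hI s hs) (hK.coercive s hs) (hwc s) (M.norm_e_le y)).2
    rw [← bvec_sub (hf.integrable hs) (hf'.integrable hs)] at h1
    rw [← ofReal_norm]
    refine (ENNReal.ofReal_le_ofReal h1).trans ?_
    rw [ENNReal.ofReal_mul hL.le, ENNReal.ofReal_mul (norm_nonneg _), ofReal_norm,
      ENNReal.ofReal_add zero_le_one (norm_nonneg _), ENNReal.ofReal_one, ofReal_norm]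
    exact mul_le_mul_right (mul_le_mul_left (enorm_bvec_le _) _) _
  have hstep : ∀ t ∈ Icc 0 T, δ t ≤ ∫⁻ s in Ioc t T,
      ENNReal.ofReal (L * (1 + |CK|)) * δ s * (1 + M.lapl (s - t)) ^ 2 := by
    intro t ht
    have hδm : Measurable δ := (hm.enorm).lintegral_prod_right'
    set F : Y → ℝ → ℝ≥0∞ := fun y s => ENNReal.ofReal (Real.exp (-M.ϑ y * (s - t))) *
      (ENNReal.ofReal L * (δ s * (1 + ‖a s y‖ₑ))) with hF
    have hFm : Measurable (Function.uncurry F) := by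
      have e1 : Measurable fun x : Y × ℝ => ENNReal.ofReal (Real.exp (-M.ϑ x.1 * (x.2 - t))) := by
        fun_prop
      have e2 : Measurable fun x : Y × ℝ => ‖a x.2 x.1‖ₑ :=
        (ham.comp (by fun_prop : Measurable fun x : Y × ℝ => (x.2, x.1))).enorm
      exact e1.mul (((hδm.comp measurable_snd).mul (measurable_const.add e2)).const_mul _)
    have hpt : ∀ᵐ y ∂M.ν, ‖f (t, y) - f' (t, y)‖ₑ ≤ ∫⁻ s in Ioc t T, F y s := by
      filter_upwards [hf.eq t ht, hf'.eq t ht] with y h1 h2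
      rw [h1.2, h2.2, ← integral_sub h1.1 h2.1]
      refine (enorm_integral_le_lintegral_enorm _).trans
        (setLIntegral_mono' measurableSet_Ioc fun s hs => ?_)
      have hs' : s ∈ Icc 0 T := ⟨ht.1.trans hs.1.le, hs.2⟩
      rw [← mul_sub, enorm_mul, ← ofReal_norm, Real.norm_of_nonneg (Real.exp_pos _).le]
      exact mul_le_mul_right (hlip s hs' y) _
    calc δ t ≤ ∫⁻ y, (∫⁻ s in Ioc t T, F y s) ∂M.ν := lintegral_mono_ae hpt
      _ = ∫⁻ s in Ioc t T, (∫⁻ y, F y s ∂M.ν) := lintegral_lintegral_swap hFm.aemeasurable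
      _ ≤ _ := by
          refine setLIntegral_mono' measurableSet_Ioc fun s hs => ?_
          have hs' : s ∈ Icc 0 T := ⟨ht.1.trans hs.1.le, hs.2⟩
          have hv : 0 ≤ s - t := by linarith [hs.1]
          have hδs : δ s ≠ ∞ := ne_top_of_le_ne_top ENNReal.ofReal_ne_top (hδC s hs')
          have h1 : ∀ y, F y s ≤ ENNReal.ofReal L * (δ s *
              (ENNReal.ofReal (Real.exp (-M.ϑ y * (s - t))) + ‖a s y‖ₑ)) := fun y => by
            have he : ENNReal.ofReal (Real.exp (-M.ϑ y * (s - t))) ≤ 1 := by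
              rw [← ENNReal.ofReal_one]
              refine ENNReal.ofReal_le_ofReal (Real.exp_le_one_iff.2 ?_)
              have := mul_nonneg (M.ϑ_nonneg y) hv
              linarith
            simp only [hF]
            rw [mul_left_comm, mul_left_comm _ (δ s), mul_add, mul_one]
            gcongr
            exact mul_le_of_le_one_left' he
          have hem : Measurable fun y => ENNReal.ofReal (Real.exp (-M.ϑ y * (s - t))) := by fun_prop
          have h2 : ∫⁻ y, ‖a s y‖ₑ ∂M.ν ≤ ENNReal.ofReal |CK| :=
            (lintegral_enorm_avec_le (hK.meas.comp (by fun_prop))).trans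
              ((hCK s hs').trans (ENNReal.ofReal_le_ofReal (le_abs_self _)))
          calc _ ≤ _ := lintegral_mono h1
            _ ≤ ENNReal.ofReal L * (δ s * (M.lapl (s - t) + ENNReal.ofReal |CK|)) := by
                rw [lintegral_const_mul' _ _ ENNReal.ofReal_ne_top, lintegral_const_mul' _ _ hδs,
                  lintegral_add_left hem]
                gcongr
                exact le_rfl
            _ ≤ ENNReal.ofReal L * (δ s * ((1 + ENNReal.ofReal |CK|) * (1 + M.lapl (s - t)))) := by
                gcongr
                calc M.lapl (s - t) + ENNReal.ofReal |CK| ≤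
                    M.lapl (s - t) + ENNReal.ofReal |CK| +
                      (1 + ENNReal.ofReal |CK| * M.lapl (s - t)) := le_self_add
                  _ = _ := by ring
            _ ≤ ENNReal.ofReal L * (δ s * ((1 + ENNReal.ofReal |CK|) *
                (1 + M.lapl (s - t)) ^ 2)) := by
                gcongr
                exact le_self_pow (le_self_add) (by norm_num)
            _ = _ := by
                rw [ENNReal.ofReal_mul hL.le, ENNReal.ofReal_add zero_le_one (abs_nonneg _),
                  ENNReal.ofReal_one]
                ring
  have h0 := M.eq_zero_of_le_lintegral (by positivity) hδC hstep
  intro t ht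
  have h1 := (lintegral_eq_zero_iff
    (hm.comp (by fun_prop : Measurable fun y : Y => (t, y))).enorm).1 (h0 t ht)
  filter_upwards [h1] with y hy
  exact sub_eq_zero.1 (enorm_eq_zero.1 hy)

end FactorModel

/-! ### The density of the matrix measure -/

namespace MatrixMeasure

variable {d d' : ℕ} (μ : MatrixMeasure d d')

theorem posPart_add_negPart_le (i : Fin d) (k : Fin d') :
    μ.posPart i k + μ.negPart i k ≤ μ.totalVar := by
  rw [posPart, negPart, totalVar, Measure.sum_add_sum]
  refine Measure.le_iff.2 fun s hs => ?_
  rw [Measure.sum_apply _ hs, Measure.sum_apply _ hs]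
  refine ENNReal.tsum_le_tsum fun n => ?_
  have h1 : (μ.entryPiece n i k).totalVariation ≤ (μ.piece n).variation := by
    rw [SignedMeasure.totalVariation_eq_variation]
    refine VectorMeasure.variation_le_of_forall_enorm_le fun E _ =>
      le_trans ?_ (VectorMeasure.enorm_measure_le_variation (μ.piece n) E)
    rw [← ofReal_norm, ← ofReal_norm]
    exact ENNReal.ofReal_le_ofReal (PiLp.norm_apply_le (μ.piece n E) (i, k))
  exact h1 s

theorem posPart_le (i : Fin d) (k : Fin d') : μ.posPart i k ≤ μ.totalVar :=
  (Measure.le_add_right le_rfl).trans (μ.posPart_add_negPart_le i k)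

theorem negPart_le (i : Fin d) (k : Fin d') : μ.negPart i k ≤ μ.totalVar :=
  (Measure.le_add_left le_rfl).trans (μ.posPart_add_negPart_le i k)

/-- The density of the entry `μ_ik` with respect to the total variation, as an everywhere defined
function with values in `[-1, 1]`. -/
def density (i : Fin d) (k : Fin d') (θ : ℝ≥0) : ℝ :=
  max (-1) (min (((μ.posPart i k).rnDeriv μ.totalVar θ).toReal -
    ((μ.negPart i k).rnDeriv μ.totalVar θ).toReal) 1)

theorem measurable_density (i : Fin d) (k : Fin d') : Measurable (μ.density i k) :=
  measurable_const.max ((((Measure.measurable_rnDeriv _ _).ennreal_toReal).sub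
    (Measure.measurable_rnDeriv _ _).ennreal_toReal).min measurable_const)

theorem abs_density_le (i : Fin d) (k : Fin d') (θ : ℝ≥0) : |μ.density i k θ| ≤ 1 :=
  abs_le.2 ⟨le_max_left _ _, max_le (by norm_num) (min_le_right _ _)⟩

variable {μ}

/-- The truncation in `density` is inactive almost everywhere, since the Jordan parts are dominated by
the total variation. -/
theorem entryIntegral_eq [SigmaFinite μ.totalVar] (i : Fin d) (k : Fin d') {f : ℝ≥0 → ℝ}
    (hf : Integrable f μ.totalVar) :
    μ.entryIntegral i k f = ∫ θ, μ.density i k θ * f θ ∂μ.totalVar := by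
  have : SigmaFinite (μ.posPart i k) := Measure.sigmaFinite_of_le _ (μ.posPart_le i k)
  have : SigmaFinite (μ.negPart i k) := Measure.sigmaFinite_of_le _ (μ.negPart_le i k)
  have hp := Measure.absolutelyContinuous_of_le (μ.posPart_le i k)
  have hn := Measure.absolutelyContinuous_of_le (μ.negPart_le i k)
  rw [entryIntegral, ← integral_toReal_rnDeriv_mul hp, ← integral_toReal_rnDeriv_mul hn,
    ← integral_sub ((integrable_toReal_rnDeriv_mul_iff hp).2 (hf.mono_measure (μ.posPart_le i k)))
      ((integrable_toReal_rnDeriv_mul_iff hn).2 (hf.mono_measure (μ.negPart_le i k)))]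
  refine integral_congr_ae ?_
  have hle : ∀ {x : ℝ≥0∞}, x ≤ 1 → x.toReal ≤ 1 := fun {x} hx => by
    simpa using ENNReal.toReal_mono ENNReal.one_ne_top hx
  filter_upwards [Measure.rnDeriv_le_one_of_le (μ.posPart_le i k),
    Measure.rnDeriv_le_one_of_le (μ.negPart_le i k)] with θ h1 h2
  have a1 := hle h1
  have a2 := hle h2
  have b1 : 0 ≤ ((μ.posPart i k).rnDeriv μ.totalVar θ).toReal := ENNReal.toReal_nonneg
  have b2 : 0 ≤ ((μ.negPart i k).rnDeriv μ.totalVar θ).toReal := ENNReal.toReal_nonneg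
  rw [density, min_eq_left (by linarith), max_eq_right (by linarith), sub_mul]

theorem entryIntegral_congr [SigmaFinite μ.totalVar] (i : Fin d) (k : Fin d') {f g : ℝ≥0 → ℝ}
    (h : f =ᵐ[μ.totalVar] g) : μ.entryIntegral i k f = μ.entryIntegral i k g := by
  rw [entryIntegral, entryIntegral,
    integral_congr_ae (h.filter_mono (Measure.absolutelyContinuous_of_le (μ.posPart_le i k)).ae_le),
    integral_congr_ae (h.filter_mono (Measure.absolutelyContinuous_of_le (μ.negPart_le i k)).ae_le)]

variable (μ) in
/-- The hypothesis `∫ (1 ∧ θ^{-1/2}) |μ|(dθ) < ∞` gives integrability of `(θ + 1)^{-1/2}`. -/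
theorem integrable_wt_totalVar
    (hμ : ∫⁻ θ : ℝ≥0, min 1 ((θ : ℝ≥0∞) ^ (-(1 / 2) : ℝ)) ∂μ.totalVar < ∞) :
    Integrable (wt (fun θ : ℝ≥0 => (θ : ℝ)) 1) μ.totalVar := by
  refine ⟨(measurable_wt measurable_coe_nnreal_real 1).aestronglyMeasurable, ?_⟩
  refine lt_of_le_of_lt (lintegral_mono fun θ => ?_) hμ
  have h0 : (0 : ℝ) ≤ θ := θ.2
  have hw := wt_pos (ϑ := fun θ : ℝ≥0 => (θ : ℝ)) (fun θ => θ.2) le_rfl θ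
  rw [← ofReal_norm, Real.norm_of_nonneg hw.le]
  refine le_min ?_ ?_
  · rw [← ENNReal.ofReal_one]
    exact ENNReal.ofReal_le_ofReal (wt_le_one (fun θ : ℝ≥0 => θ.2) le_rfl θ)
  -- at `θ = 0` the right-hand side is `∞`
  · rcases eq_or_ne θ 0 with rfl | hθ
    · simp
    have hp : (0 : ℝ) < θ := NNReal.coe_pos.2 (pos_iff_ne_zero.2 hθ)
    rw [← ENNReal.ofReal_coe_nnreal, ENNReal.ofReal_rpow_of_pos hp]
    refine ENNReal.ofReal_le_ofReal ?_
    rw [Real.rpow_neg h0, ← Real.sqrt_eq_rpow, wt, one_div]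
    exact inv_anti₀ (Real.sqrt_pos.2 hp) (Real.sqrt_le_sqrt (by linarith))

theorem totalVar_Iic_lt_top
    (h : Integrable (wt (fun θ : ℝ≥0 => (θ : ℝ)) 1) μ.totalVar) (n : ℝ≥0) :
    μ.totalVar (Iic n) < ∞ := by
  have hp : 0 < wt (fun θ : ℝ≥0 => (θ : ℝ)) 1 n := wt_pos (fun θ => θ.2) le_rfl n
  refine lt_of_le_of_lt (measure_mono (t := {θ |
    wt (fun θ : ℝ≥0 => (θ : ℝ)) 1 n ≤ ‖wt (fun θ : ℝ≥0 => (θ : ℝ)) 1 θ‖}) fun θ hθ => ?_)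
    (h.measure_norm_ge_lt_top hp)
  have h0 : (0 : ℝ) ≤ θ := θ.2
  have h1 : (θ : ℝ) ≤ n := NNReal.coe_le_coe.2 hθ
  refine le_trans ?_ (Real.le_norm_self _)
  exact one_div_le_one_div_of_le (Real.sqrt_pos.2 (by linarith)) (Real.sqrt_le_sqrt (by linarith))

theorem sigmaFinite_totalVar
    (h : Integrable (wt (fun θ : ℝ≥0 => (θ : ℝ)) 1) μ.totalVar) : SigmaFinite μ.totalVar := by
  refine ⟨⟨⟨fun n => Iic (n : ℝ≥0), fun _ => trivial, fun n => totalVar_Iic_lt_top h n, ?_⟩⟩⟩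
  exact iUnion_eq_univ_iff.2 fun θ => (exists_nat_ge θ).imp fun _ hn => hn

end MatrixMeasure

/-! ### Finitely many copies of a measure space -/

section Copies

variable {X : Type*} [MeasurableSpace X] {ν : Measure X} {d : ℕ}

/-- The measure on `X × {1, …, d}` whose restriction to each copy of `X` is `ν`. -/
def copies (ν : Measure X) (d : ℕ) : Measure (X × Fin d) :=
  Measure.sum fun i : Fin d => ν.map fun x => (x, i)

theorem measurableEmbedding_copy (i : Fin d) : MeasurableEmbedding fun x : X => (x, i) :=
  measurableEmbedding_prod_mk_right i

instance [SigmaFinite ν] : SigmaFinite (copies ν d) := by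
  have : ∀ i : Fin d, SigmaFinite (ν.map fun x => (x, i)) := fun i =>
    (measurableEmbedding_copy i).sigmaFinite_map
  rw [copies]; infer_instance

theorem ae_copies {p : X × Fin d → Prop} :
    (∀ᵐ y ∂copies ν d, p y) ↔ ∀ i, ∀ᵐ x ∂ν, p (x, i) := by
  rw [copies, Measure.ae_sum_iff]
  exact forall_congr' fun i => (measurableEmbedding_copy i).ae_map_iff

theorem lintegral_copies (f : X × Fin d → ℝ≥0∞) :
    ∫⁻ y, f y ∂copies ν d = ∑ i, ∫⁻ x, f (x, i) ∂ν := by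
  rw [copies, lintegral_sum_measure, tsum_fintype]
  exact Finset.sum_congr rfl fun i _ => (measurableEmbedding_copy i).lintegral_map _

theorem integrable_copies {f : X × Fin d → ℝ} :
    Integrable f (copies ν d) ↔ ∀ i, Integrable (fun x => f (x, i)) ν := by
  rw [copies, integrable_sum_measure_iff, and_iff_left (hasSum_fintype _).summable]
  exact forall_congr' fun i => (measurableEmbedding_copy i).integrable_map_iff

theorem integral_copies {f : X × Fin d → ℝ} (hf : ∀ i, Integrable (fun x => f (x, i)) ν) :
    ∫ y, f y ∂copies ν d = ∑ i, ∫ x, f (x, i) ∂ν := by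
  have h := integrable_copies.2 hf
  rw [copies] at h ⊢
  rw [integral_sum_measure h, tsum_fintype]
  exact Finset.sum_congr rfl fun i _ => (measurableEmbedding_copy i).integral_map _

theorem prod_copies [SigmaFinite ν] : (copies ν d).prod (copies ν d) =
    Measure.sum fun ij : Fin d × Fin d =>
      (ν.prod ν).map (Prod.map (fun x => (x, ij.1)) fun x => (x, ij.2)) := by
  have : ∀ i : Fin d, SigmaFinite (ν.map fun x => (x, i)) := fun i =>
    (measurableEmbedding_copy i).sigmaFinite_map
  rw [copies, Measure.prod_sum]
  congr 1
  ext1 ij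
  exact Measure.map_prod_map _ _ (measurableEmbedding_copy _).measurable
    (measurableEmbedding_copy _).measurable

theorem measurableEmbedding_copy_pair (i j : Fin d) :
    MeasurableEmbedding (Prod.map (fun x : X => (x, i)) fun x : X => (x, j)) :=
  (measurableEmbedding_copy i).prodMap (measurableEmbedding_copy j)

theorem ae_prod_copies [SigmaFinite ν] {p : (X × Fin d) × (X × Fin d) → Prop} :
    (∀ᵐ y ∂(copies ν d).prod (copies ν d), p y) ↔
      ∀ᵐ q ∂ν.prod ν, ∀ i j, p ((q.1, i), (q.2, j)) := by
  rw [prod_copies, Measure.ae_sum_iff]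
  simp only [ae_all_iff, Prod.forall]
  exact forall_congr' fun i => forall_congr' fun j =>
    (measurableEmbedding_copy_pair i j).ae_map_iff

theorem lintegral_prod_copies [SigmaFinite ν] (f : (X × Fin d) × (X × Fin d) → ℝ≥0∞) :
    ∫⁻ y, f y ∂(copies ν d).prod (copies ν d) =
      ∑ i, ∑ j, ∫⁻ q, f ((q.1, i), (q.2, j)) ∂ν.prod ν := by
  rw [prod_copies, lintegral_sum_measure, tsum_fintype, Fintype.sum_prod_type]
  exact Finset.sum_congr rfl fun i _ => Finset.sum_congr rfl fun j _ =>
    (measurableEmbedding_copy_pair i j).lintegral_map _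

end Copies

/-! ### The factor model of a matrix measure -/

namespace MatrixMeasure

variable {d d' : ℕ}

/-- The factor model on `ℝ₊ × {1, …, d}` whose integrals are those of the matrix measure. -/
def factorModel (μ : MatrixMeasure d d')
    (hμ : Integrable (wt (fun θ : ℝ≥0 => (θ : ℝ)) 1) μ.totalVar) :
    FactorModel d d' (ℝ≥0 × Fin d) where
  ν := copies μ.totalVar d
  sigmaFinite := by
    have := sigmaFinite_totalVar hμ
    infer_instance
  ϑ y := y.1
  measurable_ϑ := by fun_prop
  ϑ_nonneg y := y.1.2
  integrable_wt_one := integrable_copies.2 fun _ => hμ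
  e y := Pi.single y.2 1
  measurable_e := (measurable_of_countable fun i : Fin d => (Pi.single i 1 : Fin d → ℝ)).comp
    measurable_snd
  norm_e_le y := (pi_norm_le_iff_of_nonneg zero_le_one).2 fun i => by
    by_cases h : i = y.2
    · subst h; simp
    · simp [h]
  σ y k := μ.density y.2 k y.1
  measurable_σ := measurable_from_prod_countable_left fun i =>
    measurable_pi_lambda _ fun k => μ.measurable_density i k
  norm_σ_le y := (pi_norm_le_iff_of_nonneg zero_le_one).2 fun k => μ.abs_density_le y.2 k y.1

end MatrixMeasure

/-! ### Matrix integrals as integrals in the factor model -/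

namespace MatrixMeasure

variable {d d' k : ℕ} {μ : MatrixMeasure d d'}
  (hμ : Integrable (wt (fun θ : ℝ≥0 => (θ : ℝ)) 1) μ.totalVar)
  {G : ℝ≥0 → ℝ≥0 → Matrix (Fin d) (Fin d) ℝ} {T : ℝ}

/-- A matrix valued kernel on `ℝ₊` as a scalar kernel on `ℝ₊ × {1, …, d}`. -/
def flat (G : ℝ≥0 → ℝ≥0 → Matrix (Fin d) (Fin d) ℝ) (p : (ℝ≥0 × Fin d) × ℝ≥0 × Fin d) : ℝ :=
  G p.1.1 p.2.1 p.1.2 p.2.2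

theorem sum_entryIntegral (j : Fin d') {f : ℝ≥0 → Fin d → ℝ}
    (hf : ∀ i, Integrable (fun θ => f θ i) μ.totalVar) :
    ∑ i, μ.entryIntegral i j (fun θ => f θ i) =
      ∫ y, (μ.factorModel hμ).σ y j * f y.1 y.2 ∂(μ.factorModel hμ).ν := by
  have := sigmaFinite_totalVar hμ
  refine Eq.trans ?_ (integral_copies fun i => (hf i).bdd_mul (c := 1)
    (μ.measurable_density i j).aestronglyMeasurable (ae_of_all _ fun θ => μ.abs_density_le i j θ)).symm
  exact Finset.sum_congr rfl fun i _ => entryIntegral_eq i j (hf i)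

theorem leftIntegral_eq_avec {τ : ℝ≥0} {j : Fin d}
    (h : ∀ i, Integrable (fun θ => G θ τ i j) μ.totalVar) (l : Fin d') :
    μ.leftIntegral (fun θ => G θ τ) l j = (μ.factorModel hμ).avec (flat G) (τ, j) l :=
  sum_entryIntegral hμ l (f := fun θ i => G θ τ i j) h

theorem rightIntegral_eq_avec {θ : ℝ≥0} {i : Fin d}
    (h : ∀ j, Integrable (fun τ => G θ τ i j) μ.totalVar) (l : Fin d') :
    μ.rightIntegral (fun τ => G θ τ) i l =
      (μ.factorModel hμ).avec (fun p => flat G p.swap) (θ, i) l :=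
  sum_entryIntegral hμ l (f := fun τ j => G θ τ i j) h

theorem vecIntegral_eq_bvec {f : ℝ≥0 → Fin d → ℝ}
    (hf : ∀ i, Integrable (fun θ => f θ i) μ.totalVar) :
    μ.vecIntegral f = (μ.factorModel hμ).bvec fun y => f y.1 y.2 :=
  funext fun l => sum_entryIntegral hμ l hf

theorem pairing_eq_integral {f : ℝ≥0 → Fin d → ℝ} {φ : ℝ≥0 → Fin d' → ℝ}
    (hf : ∀ l i, Integrable (fun θ => f θ l * φ θ i) μ.totalVar) :
    μ.pairing f φ = ∫ y, f y.1 y.2 * ((μ.factorModel hμ).σ y ⬝ᵥ φ y.1) ∂(μ.factorModel hμ).ν := by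
  rw [pairing, Finset.sum_comm]
  simp_rw [fun i => sum_entryIntegral hμ i (f := fun θ l => f θ l * φ θ i) fun l => hf l i]
  rw [← integral_finsetSum]
  · refine integral_congr_ae (ae_of_all _ fun y => ?_)
    simp only [dotProduct, Finset.mul_sum]
    exact Finset.sum_congr rfl fun i _ => by ring
  · exact fun i _ => FactorModel.integrable_σ_mul_vec
      (f := fun y : ℝ≥0 × Fin d => f y.1 y.2 * φ y.1 i) (integrable_copies.2 fun l => hf l i) i

theorem ae_integrable_section
    (hG : Integrable (flat G) ((μ.factorModel hμ).ν.prod (μ.factorModel hμ).ν)) :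
    ∀ᵐ θ ∂μ.totalVar, ∀ i j, Integrable (fun τ => G θ τ i j) μ.totalVar :=
  (ae_all_iff.2 (ae_copies.1 hG.prod_right_ae)).mono fun _ h i => integrable_copies.1 (h i)

theorem ae_integrable_section_swap
    (hG : Integrable (flat G) ((μ.factorModel hμ).ν.prod (μ.factorModel hμ).ν)) :
    ∀ᵐ τ ∂μ.totalVar, ∀ j i, Integrable (fun θ => G θ τ i j) μ.totalVar :=
  (ae_all_iff.2 (ae_copies.1 hG.prod_left_ae)).mono fun _ h j => integrable_copies.1 (h j)

/-- The iterated matrix integral is defined without integrability of every section; the exceptional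
sections form a null set. -/
theorem doubleIntegral_eq_imat
    (hG : Integrable (flat G) ((μ.factorModel hμ).ν.prod (μ.factorModel hμ).ν)) :
    μ.doubleIntegral G = (μ.factorModel hμ).imat (flat G) := by
  have := sigmaFinite_totalVar hμ
  set M := μ.factorModel hμ with hM
  ext a b
  have hb : Integrable (fun p : (ℝ≥0 × Fin d) × ℝ≥0 × Fin d => M.σ p.2 b * flat G p)
      (M.ν.prod M.ν) := hG.bdd_mul (c := 1)
    ((FactorModel.measurable_σ_apply b).comp measurable_snd).aestronglyMeasurable
    (ae_of_all _ fun p => FactorModel.abs_σ_le p.2 b)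
  have h1 : ∀ᵐ θ ∂μ.totalVar, ∀ i, μ.rightIntegral (fun τ => G θ τ) i b =
      M.avec (fun p => flat G p.swap) (θ, i) b :=
    (ae_integrable_section hμ hG).mono fun θ h i => rightIntegral_eq_avec hμ (h i) b
  have h2 : Integrable (fun y => M.avec (fun p => flat G p.swap) y b) M.ν := hb.integral_prod_left
  have h3 := FactorModel.integrable_σ_mul hG a b
  rw [doubleIntegral, leftIntegral, Matrix.of_apply]
  calc _ = ∑ i, μ.entryIntegral i a fun θ => M.avec (fun p => flat G p.swap) (θ, i) b :=
        Finset.sum_congr rfl fun i _ => entryIntegral_congr i a (h1.mono fun θ h => h i)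
    _ = ∫ y, M.σ y a * M.avec (fun p => flat G p.swap) y b ∂M.ν :=
        sum_entryIntegral hμ a (f := fun θ i => M.avec (fun p => flat G p.swap) (θ, i) b)
          (integrable_copies.1 h2)
    _ = _ := by
        rw [FactorModel.imat, Matrix.of_apply, bil, integral_prod _ h3]
        refine integral_congr_ae (ae_of_all _ fun y => ?_)
        dsimp only
        rw [FactorModel.avec, ← integral_const_mul]
        refine integral_congr_ae (ae_of_all _ fun y' => ?_)
        simp only [Prod.swap_prod_mk]
        ring

/-- The points at which the sections of a kernel are integrable and the left and the right
integrals of the kernel agree. -/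
structure Regular (hμ : Integrable (wt (fun θ : ℝ≥0 => (θ : ℝ)) 1) μ.totalVar)
    (G : ℝ≥0 → ℝ≥0 → Matrix (Fin d) (Fin d) ℝ) (θ : ℝ≥0) : Prop where
  left : ∀ i j, Integrable (fun θ' => G θ' θ i j) μ.totalVar
  right : ∀ i j, Integrable (fun τ => G θ τ i j) μ.totalVar
  eq : ∀ i l, (μ.factorModel hμ).avec (fun p => flat G p.swap) (θ, i) l =
    (μ.factorModel hμ).avec (flat G) (θ, i) l

theorem ae_regular (hG : Integrable (flat G) ((μ.factorModel hμ).ν.prod (μ.factorModel hμ).ν))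
    (hs : ∀ᵐ p ∂(μ.factorModel hμ).ν.prod (μ.factorModel hμ).ν, flat G p.swap = flat G p) :
    ∀ᵐ θ ∂μ.totalVar, Regular hμ G θ := by
  filter_upwards [ae_integrable_section hμ hG, ae_integrable_section_swap hμ hG,
    ae_all_iff.2 (ae_copies.1 (FactorModel.avec_congr_ae hs))] with θ h1 h2 h3
  exact ⟨fun i j => h2 j i, h1, fun i l => congrFun (h3 i) l⟩

theorem measurable_flat {G : ℝ → ℝ≥0 → ℝ≥0 → Matrix (Fin d) (Fin d) ℝ}
    (hG : ∀ i j, Measurable fun q : ℝ × ℝ≥0 × ℝ≥0 => G q.1 q.2.1 q.2.2 i j) :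
    Measurable fun q : ℝ × (ℝ≥0 × Fin d) × ℝ≥0 × Fin d => flat (G q.1) q.2 := by
  have h : Measurable fun x : (ℝ × ℝ≥0 × ℝ≥0) × Fin d × Fin d =>
      G x.1.1 x.1.2.1 x.1.2.2 x.2.1 x.2.2 := measurable_from_prod_countable_left fun ij => hG ij.1 ij.2
  exact h.comp (by fun_prop : Measurable fun q : ℝ × (ℝ≥0 × Fin d) × ℝ≥0 × Fin d =>
    ((q.1, q.2.1.1, q.2.2.1), (q.2.1.2, q.2.2.2)))

theorem measurableSet_regular {G : ℝ → ℝ≥0 → ℝ≥0 → Matrix (Fin d) (Fin d) ℝ}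
    (hG : ∀ i j, Measurable fun q : ℝ × ℝ≥0 × ℝ≥0 => G q.1 q.2.1 q.2.2 i j) :
    MeasurableSet {x : ℝ × ℝ≥0 | Regular hμ (G x.1) x.2} := by
  have := sigmaFinite_totalVar hμ
  have hf := measurable_flat hG
  have e : {x : ℝ × ℝ≥0 | Regular hμ (G x.1) x.2} =
      (⋂ i, ⋂ j, {x : ℝ × ℝ≥0 | Integrable (fun θ' => G x.1 θ' x.2 i j) μ.totalVar}) ∩
      (⋂ i, ⋂ j, {x : ℝ × ℝ≥0 | Integrable (fun θ' => G x.1 x.2 θ' i j) μ.totalVar}) ∩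
      ⋂ i, {x : ℝ × ℝ≥0 | (μ.factorModel hμ).avec (fun p => flat (G x.1) p.swap) (x.2, i) =
        (μ.factorModel hμ).avec (flat (G x.1)) (x.2, i)} := by
    ext x
    simp only [mem_inter_iff, mem_iInter, mem_ofPred_eq]
    exact ⟨fun h => ⟨⟨h.left, h.right⟩, fun i => funext (h.eq i)⟩,
      fun h => ⟨h.1.1, h.1.2, fun i l => congrFun (h.2 i) l⟩⟩
  rw [e]
  refine ((MeasurableSet.iInter fun i => MeasurableSet.iInter fun j => ?_).inter
    (MeasurableSet.iInter fun i => MeasurableSet.iInter fun j => ?_)).inter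
    (MeasurableSet.iInter fun i => ?_)
  · exact measurableSet_integrable (f := fun (x : ℝ × ℝ≥0) θ' => G x.1 θ' x.2 i j)
      (((hG i j).comp (by fun_prop : Measurable fun z : (ℝ × ℝ≥0) × ℝ≥0 =>
        (z.1.1, z.2, z.1.2))).stronglyMeasurable)
  · exact measurableSet_integrable (f := fun (x : ℝ × ℝ≥0) θ' => G x.1 x.2 θ' i j)
      (((hG i j).comp (by fun_prop : Measurable fun z : (ℝ × ℝ≥0) × ℝ≥0 =>
        (z.1.1, z.1.2, z.2))).stronglyMeasurable)
  · have hx : Measurable fun x : ℝ × ℝ≥0 => (x.1, (x.2, i)) := by fun_prop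
    exact measurableSet_eq_fun
      ((FactorModel.measurable_avec (M := μ.factorModel hμ)
        (R := fun q : ℝ × (ℝ≥0 × Fin d) × ℝ≥0 × Fin d => flat (G q.1) q.2.swap)
        (hf.comp (measurable_fst.prodMk (measurable_swap.comp measurable_snd)))).comp hx)
      ((FactorModel.measurable_avec (M := μ.factorModel hμ) hf).comp hx)

/-- Fubini's theorem exchanges the quantifiers over time and space: the equations need almost every
point of space first. -/
theorem ae_ae_regular {G : ℝ → ℝ≥0 → ℝ≥0 → Matrix (Fin d) (Fin d) ℝ}
    (hG : ∀ i j, Measurable fun q : ℝ × ℝ≥0 × ℝ≥0 => G q.1 q.2.1 q.2.2 i j)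
    (h : ∀ s ∈ Icc 0 T, ∀ᵐ θ ∂μ.totalVar, Regular hμ (G s) θ) :
    ∀ᵐ θ ∂μ.totalVar, ∀ᵐ s ∂volume.restrict (Icc 0 T), Regular hμ (G s) θ := by
  have := sigmaFinite_totalVar hμ
  refine (Measure.ae_ae_comm (p := fun s θ => Regular hμ (G s) θ)
    (measurableSet_regular hμ hG)).1 ?_
  exact (ae_restrict_iff' measurableSet_Icc).2 (ae_of_all _ h)

end MatrixMeasure

namespace LQData

variable {d d' m : ℕ} {P : LQData d d' m}
  {hμ : Integrable (wt (fun θ : ℝ≥0 => (θ : ℝ)) 1) P.μ.totalVar}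
  {G : ℝ≥0 → ℝ≥0 → Matrix (Fin d) (Fin d) ℝ} {l : ℝ≥0 → Fin d → ℝ} {θ τ : ℝ≥0}
  {I : Matrix (Fin d') (Fin d') ℝ}

theorem Nhat_eq (hI : P.μ.doubleIntegral G = I) : P.Nhat G = P.Nh 0 I := by
  rw [Nhat, Nh, hI, zero_smul, add_zero]

theorem S_apply (hI : P.μ.doubleIntegral G = I) (hθ : MatrixMeasure.Regular hμ G θ) (i : Fin d)
    (a : Fin m) : P.S G θ a i = P.Sv 0 I ((P.μ.factorModel hμ).e (θ, i),
      (P.μ.factorModel hμ).avec (MatrixMeasure.flat G) (θ, i)) a := by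
  have he : (P.μ.factorModel hμ).e (θ, i) = Pi.single i 1 := rfl
  rw [S, Sv, zero_smul, add_zero, hI, he, Matrix.mulVec_single_one, Matrix.add_apply, Pi.add_apply,
    Matrix.mul_apply, Matrix.mulVec, dotProduct]
  congr 1
  exact Finset.sum_congr rfl fun b _ => by
    rw [MatrixMeasure.leftIntegral_eq_avec hμ (fun i' => hθ.left i' i)]

theorem R₁_eq_Phi (hI : P.μ.doubleIntegral G = I) (hθ : MatrixMeasure.Regular hμ G θ)
    (hτ : MatrixMeasure.Regular hμ G τ) (i j : Fin d) :
    P.R₁ G θ τ i j = P.Phi 0 I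
      ((P.μ.factorModel hμ).e (θ, i), (P.μ.factorModel hμ).avec (MatrixMeasure.flat G) (θ, i))
      ((P.μ.factorModel hμ).e (τ, j), (P.μ.factorModel hμ).avec (MatrixMeasure.flat G) (τ, j)) := by
  have hs : ∀ (σ : ℝ≥0) (b : Fin d), MatrixMeasure.Regular hμ G σ → (fun a => P.S G σ a b) =
      P.Sv 0 I ((P.μ.factorModel hμ).e (σ, b),
        (P.μ.factorModel hμ).avec (MatrixMeasure.flat G) (σ, b)) :=
    fun σ b hσ => funext fun a => S_apply hI hσ b a
  have h3 : ((P.S G θ)ᵀ * (P.Nhat G)⁻¹ * P.S G τ) i j =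
      (fun a => P.S G θ a i) ⬝ᵥ ((P.Nhat G)⁻¹ *ᵥ fun a => P.S G τ a j) := by
    rw [Matrix.mul_assoc, Matrix.mul_apply']
    rfl
  rw [R₁, Matrix.sub_apply, h3, hs θ i hθ, hs τ j hτ, Nhat_eq hI, Phi, hI]
  congr 1
  have he : ∀ (σ : ℝ≥0) (b : Fin d), (P.μ.factorModel hμ).e (σ, b) = Pi.single b 1 := fun _ _ => rfl
  simp only [Matrix.add_apply, he, zero_smul, add_zero, Matrix.mulVec_single_one,
    single_one_dotProduct, Matrix.col_apply]
  congr 1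
  · congr 1
    rw [Matrix.mul_apply, dotProduct]
    exact Finset.sum_congr rfl fun b _ => by
      rw [MatrixMeasure.leftIntegral_eq_avec hμ (fun i' => hτ.left i' j)]; rfl
  · rw [Matrix.mul_apply, dotProduct]
    exact Finset.sum_congr rfl fun b _ => by
      rw [MatrixMeasure.rightIntegral_eq_avec hμ (fun i' => hθ.right i i'), hθ.eq]; rfl

theorem h_eq_affine (t : ℝ) (hI : P.μ.doubleIntegral G = I) {b : Fin d' → ℝ}
    (hb : P.μ.vecIntegral l = b) : P.h t G l = P.affine I (P.γt t) b := by
  rw [h, affine, hI, hb]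

theorem R₂_eq_Lin (t : ℝ) (hI : P.μ.doubleIntegral G = I) {b : Fin d' → ℝ}
    (hb : P.μ.vecIntegral l = b) (hθ : MatrixMeasure.Regular hμ G θ) (i : Fin d) :
    P.R₂ t G l θ i = P.Lin I (P.g₀ t, P.βt t, P.γt t) b
      ((P.μ.factorModel hμ).e (θ, i),
        (P.μ.factorModel hμ).avec (MatrixMeasure.flat G) (θ, i)) := by
  have he : (P.μ.factorModel hμ).e (θ, i) = Pi.single i 1 := rfl
  have h3 : (((P.S G θ)ᵀ * (P.Nhat G)⁻¹) *ᵥ P.h t G l) i =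
      (fun a => P.S G θ a i) ⬝ᵥ ((P.Nhat G)⁻¹ *ᵥ P.h t G l) := by
    rw [← Matrix.mulVec_mulVec]
    rfl
  have h4 : (fun a => P.S G θ a i) = P.Sv 0 I ((P.μ.factorModel hμ).e (θ, i),
      (P.μ.factorModel hμ).avec (MatrixMeasure.flat G) (θ, i)) := funext fun a => S_apply hI hθ i a
  rw [R₂, Pi.sub_apply, h3, h4, Nhat_eq hI, h_eq_affine t hI hb, Lin, hI, hb]
  congr 1
  have h5 : (P.μ.rightIntegral (fun τ' => G θ τ') *ᵥ P.βt t) i =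
      (P.μ.factorModel hμ).avec (MatrixMeasure.flat G) (θ, i) ⬝ᵥ P.βt t := by
    rw [Matrix.mulVec, dotProduct, dotProduct]
    exact Finset.sum_congr rfl fun b _ => by
      rw [MatrixMeasure.rightIntegral_eq_avec hμ (fun i' => hθ.right i i'), hθ.eq]
  simp only [he, single_one_dotProduct, Pi.add_apply, h5]
  ring

theorem R₃_eq_Scal (t : ℝ) (hI : P.μ.doubleIntegral G = I) {b : Fin d' → ℝ}
    (hb : P.μ.vecIntegral l = b) :
    P.R₃ t G l = P.Scal I (P.g₀ t, P.βt t, P.γt t) b := by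
  rw [R₃, Scal, Nhat_eq hI, h_eq_affine t hI hb, hI, hb]

end LQData

/-! ### The mild equations in the factor model -/

namespace LQData

variable {d d' m : ℕ} {P : LQData d d' m} {T : ℝ}
  (hμ : Integrable (wt (fun θ : ℝ≥0 => (θ : ℝ)) 1) P.μ.totalVar)
  {G : ℝ → ℝ≥0 → ℝ≥0 → Matrix (Fin d) (Fin d) ℝ} {l : ℝ → ℝ≥0 → Fin d → ℝ}
  {w : ℝ → (Fin d → ℝ) × (Fin d' → ℝ) × (Fin d' → ℝ)}

/-- Integrability and value of an exponential time integral do not change when the integrand changes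
on a null set of times. -/
theorem intervalIntegrable_and_eq_iff {u v : ℝ → ℝ} {c t x : ℝ} (ht : t ∈ Icc 0 T)
    (h : ∀ᵐ s ∂volume.restrict (Icc 0 T), u s = v s) :
    (IntervalIntegrable (fun s => Real.exp (c * (s - t)) * u s) volume t T ∧
      x = ∫ s in t..T, Real.exp (c * (s - t)) * u s) ↔
    (IntegrableOn (fun s => Real.exp (c * (s - t)) * v s) (Ioc t T) ∧
      x = ∫ s in Ioc t T, Real.exp (c * (s - t)) * v s) := by
  have h' : (fun s => Real.exp (c * (s - t)) * u s) =ᵐ[volume.restrict (Ioc t T)]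
      fun s => Real.exp (c * (s - t)) * v s := by
    have hsub : Ioc t T ⊆ Icc 0 T := fun s hs => ⟨ht.1.trans hs.1.le, hs.2⟩
    exact (ae_restrict_of_ae_restrict_of_subset hsub h).mono fun s hs => by dsimp only; rw [hs]
  rw [intervalIntegrable_iff_integrableOn_Ioc_of_le ht.2, intervalIntegral.integral_of_le ht.2,
    IntegrableOn, integrable_congr h', integral_congr_ae h', ← IntegrableOn]

/-- The right-hand side of the Riccati equation agrees with the one of the factor model. The
quantifiers over space and time are in the order needed for the mild equation. -/
theorem ae_ae_R₁_eq (hG : ∀ i j, Measurable fun q : ℝ × ℝ≥0 × ℝ≥0 => G q.1 q.2.1 q.2.2 i j)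
    (hint : ∀ s ∈ Icc 0 T, Integrable (MatrixMeasure.flat (G s))
      ((P.μ.factorModel hμ).ν.prod (P.μ.factorModel hμ).ν))
    (hsym : ∀ s ∈ Icc 0 T, ∀ᵐ p ∂(P.μ.factorModel hμ).ν.prod (P.μ.factorModel hμ).ν,
      MatrixMeasure.flat (G s) p.swap = MatrixMeasure.flat (G s) p) :
    ∀ᵐ q ∂P.μ.totalVar.prod P.μ.totalVar, ∀ i j, ∀ᵐ s ∂volume.restrict (Icc 0 T),
      P.R₁ (G s) q.1 q.2 i j = (P.μ.factorModel hμ).ricc P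
        (fun x => MatrixMeasure.flat (G x.1) x.2) s ((q.1, i), (q.2, j)) := by
  have := MatrixMeasure.sigmaFinite_totalVar hμ
  have h := MatrixMeasure.ae_ae_regular hμ hG fun s hs =>
    MatrixMeasure.ae_regular hμ (hint s hs) (hsym s hs)
  filter_upwards [Measure.quasiMeasurePreserving_fst.ae h, Measure.quasiMeasurePreserving_snd.ae h]
    with q h1 h2 i j
  filter_upwards [h1, h2, ae_restrict_mem measurableSet_Icc] with s g1 g2 hs
  exact R₁_eq_Phi (MatrixMeasure.doubleIntegral_eq_imat hμ (hint s hs)) g1 g2 i j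

theorem ae_ae_R₂_eq (hG : ∀ i j, Measurable fun q : ℝ × ℝ≥0 × ℝ≥0 => G q.1 q.2.1 q.2.2 i j)
    (hint : ∀ s ∈ Icc 0 T, Integrable (MatrixMeasure.flat (G s))
      ((P.μ.factorModel hμ).ν.prod (P.μ.factorModel hμ).ν))
    (hsym : ∀ s ∈ Icc 0 T, ∀ᵐ p ∂(P.μ.factorModel hμ).ν.prod (P.μ.factorModel hμ).ν,
      MatrixMeasure.flat (G s) p.swap = MatrixMeasure.flat (G s) p)
    (hl : ∀ s ∈ Icc 0 T, ∀ i, Integrable (fun θ => l s θ i) P.μ.totalVar)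
    (hw : ∀ s ∈ Icc 0 T, w s = (P.g₀ s, P.βt s, P.γt s)) :
    ∀ᵐ θ ∂P.μ.totalVar, ∀ i, ∀ᵐ s ∂volume.restrict (Icc 0 T),
      P.R₂ s (G s) (l s) θ i = (P.μ.factorModel hμ).linRhs P
        (fun x => MatrixMeasure.flat (G x.1) x.2) w (fun x => l x.1 x.2.1 x.2.2) s (θ, i) := by
  have h := MatrixMeasure.ae_ae_regular hμ hG fun s hs =>
    MatrixMeasure.ae_regular hμ (hint s hs) (hsym s hs)
  filter_upwards [h] with θ h1 i
  filter_upwards [h1, ae_restrict_mem measurableSet_Icc] with s g1 hs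
  rw [R₂_eq_Lin s (MatrixMeasure.doubleIntegral_eq_imat hμ (hint s hs))
    (MatrixMeasure.vecIntegral_eq_bvec hμ (hl s hs)) g1 i, ← hw s hs]
  rfl

theorem R₃_eq {s : ℝ} (hs : s ∈ Icc 0 T) (hint : ∀ s ∈ Icc 0 T, Integrable
      (MatrixMeasure.flat (G s)) ((P.μ.factorModel hμ).ν.prod (P.μ.factorModel hμ).ν))
    (hl : ∀ s ∈ Icc 0 T, ∀ i, Integrable (fun θ => l s θ i) P.μ.totalVar)
    (hw : ∀ s ∈ Icc 0 T, w s = (P.g₀ s, P.βt s, P.γt s)) :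
    P.R₃ s (G s) (l s) = P.Scal ((P.μ.factorModel hμ).imat (MatrixMeasure.flat (G s))) (w s)
      ((P.μ.factorModel hμ).bvec fun y => l s y.1 y.2) := by
  rw [R₃_eq_Scal s (MatrixMeasure.doubleIntegral_eq_imat hμ (hint s hs))
    (MatrixMeasure.vecIntegral_eq_bvec hμ (hl s hs)), ← hw s hs]

end LQData

namespace FactorModel

variable {d d' m : ℕ} {Y : Type*} [MeasurableSpace Y] {M : FactorModel d d' Y}
  {P : LQData d d' m} {l C A T lam : ℝ} {K : Y × Y → ℝ}

theorem integrable_wt_mul_wt (hl : 1 ≤ l) :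
    Integrable (fun p : Y × Y => wt M.ϑ l p.1 * wt M.ϑ l p.2) (M.ν.prod M.ν) :=
  (integrable_wt hl).mul_prod (integrable_wt hl)

theorem Decay.lintegral_enorm_le (hK : M.Decay K l C) :
    ∫⁻ p, ‖K p‖ₑ ∂M.ν.prod M.ν ≤ ENNReal.ofReal (C * M.kap l ^ 2) := by
  have h1 : Integrable (fun p : Y × Y => C * (wt M.ϑ l p.1 * wt M.ϑ l p.2)) (M.ν.prod M.ν) :=
    (integrable_wt_mul_wt hK.one_le).const_mul C
  have h2 : ∫ p : Y × Y, C * (wt M.ϑ l p.1 * wt M.ϑ l p.2) ∂M.ν.prod M.ν = C * M.kap l ^ 2 := by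
    rw [integral_const_mul, integral_prod_mul, sq]; rfl
  rw [← h2, ofReal_integral_eq_lintegral_ofReal h1
    (ae_of_all _ fun p => (abs_nonneg _).trans (hK.bound p))]
  exact lintegral_mono fun p => by
    rw [← ofReal_norm]; exact ENNReal.ofReal_le_ofReal (hK.bound p)

theorem ae_ae_avec_clamp {K : ℝ × Y × Y → ℝ} (hK : Measurable K)
    (h : ∀ s ∈ Icc 0 T, ∀ᵐ y ∂M.ν,
      clampVec A (M.avec (fun p => K (s, p)) y) = M.avec (fun p => K (s, p)) y) :
    ∀ᵐ y ∂M.ν, ∀ᵐ s ∂volume.restrict (Icc 0 T),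
      M.upair A (fun p => K (s, p)) y = (M.e y, M.avec (fun p => K (s, p)) y) := by
  have ha : Measurable fun q : ℝ × Y => M.avec (fun p => K (q.1, p)) q.2 := measurable_avec hK
  have h1 : ∀ᵐ y ∂M.ν, ∀ᵐ s ∂volume.restrict (Icc 0 T),
      clampVec A (M.avec (fun p => K (s, p)) y) = M.avec (fun p => K (s, p)) y := by
    refine (Measure.ae_ae_comm (p := fun s y =>
      clampVec A (M.avec (fun p => K (s, p)) y) = M.avec (fun p => K (s, p)) y)
      (measurableSet_eq_fun (measurable_clampVec ha) ha)).1 ?_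
    exact (ae_restrict_iff' measurableSet_Icc).2 (ae_of_all _ h)
  exact h1.mono fun y hy => hy.mono fun s hs => by rw [upair, hs]

/-- A pointwise solution of the truncated Riccati equation solves the Riccati equation, provided
that the truncation is inactive almost everywhere at every time. -/
theorem l1Solution_mild (hN : (P.N - lam • (1 : Matrix (Fin m) (Fin m) ℝ)).PosSemidef)
    {R : ℝ × Y × Y → ℝ} (hR : Measurable R) (hC : ∀ q, |R q| ≤ C)
    (hfix : ∀ s ∈ Icc 0 T, ∀ p,
      R (s, p) = M.rker P 0 A (fun p => mild M.ϑ T 0 R (s, p)) p)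
    (hpsd : ∀ s ∈ Icc 0 T, M.PSD (fun p => mild M.ϑ T 0 R (s, p)))
    (hcl : ∀ s ∈ Icc 0 T, ∀ᵐ y ∂M.ν, clampVec A (M.avec (fun p => mild M.ϑ T 0 R (s, p)) y) =
      M.avec (fun p => mild M.ϑ T 0 R (s, p)) y) :
    M.L1Solution P lam T (mild M.ϑ T 0 R) := by
  have hm := measurable_mild (T := T) (κ := 0) M.measurable_ϑ hR
  have hdec := fun t => decay_mild (M := M) (T := T) le_rfl hR hC t
  refine ⟨hm, ⟨|C| * Real.exp (2 * T) * M.kap 1 ^ 2, fun t ht => ?_⟩, fun t ht =>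
    LQData.coercive_Nh le_rfl hN ((hpsd t ht).imat_nonneg (hdec t)), fun t ht => ?_⟩
  · refine (hdec t).lintegral_enorm_le.trans (ENNReal.ofReal_le_ofReal ?_)
    refine mul_le_mul_of_nonneg_right ?_ (sq_nonneg _)
    exact mul_le_mul (le_abs_self C) (Real.exp_le_exp.2 (by linarith [ht.1])) (Real.exp_pos _).le
      (abs_nonneg _)
  · have h := ae_ae_avec_clamp hm hcl
    filter_upwards [Measure.quasiMeasurePreserving_fst.ae h,
      Measure.quasiMeasurePreserving_snd.ae h] with p h1 h2
    have hsub : Ioc t T ⊆ Icc 0 T := fun s hs => ⟨ht.1.trans hs.1.le, hs.2⟩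
    have he : (fun s => Real.exp (-(M.ϑ p.1 + M.ϑ p.2) * (s - t)) * R (s, p)) =ᵐ[
        volume.restrict (Ioc t T)] fun s => Real.exp (-(M.ϑ p.1 + M.ϑ p.2) * (s - t)) *
          M.ricc P (mild M.ϑ T 0 R) s p := by
      refine ae_restrict_of_ae_restrict_of_subset hsub ?_
      filter_upwards [h1, h2, ae_restrict_mem measurableSet_Icc] with s g1 g2 hs
      rw [hfix s hs p, rker, g1, g2, ricc]
    refine ⟨(integrable_congr he).1 (integrableOn_exp_mul
      (hR.comp (by fun_prop : Measurable fun s : ℝ => (s, p))) (fun s => hC (s, p)) t), ?_⟩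
    rw [← integral_congr_ae he, mild, back, add_zero]

theorem l1LinSolution_vmild {K : ℝ × Y × Y → ℝ} (hK : Measurable K)
    (hcl : ∀ s ∈ Icc 0 T, ∀ᵐ y ∂M.ν, clampVec A (M.avec (fun p => K (s, p)) y) =
      M.avec (fun p => K (s, p)) y)
    {w : ℝ → (Fin d → ℝ) × (Fin d' → ℝ) × (Fin d' → ℝ)} {r : ℝ × Y → ℝ} (hr : Measurable r)
    (hC : ∀ q, |r q| ≤ C) (hfix : ∀ s ∈ Icc 0 T, ∀ y,
      r (s, y) = P.Lin (M.imat fun p => K (s, p)) (w s) (M.bvec fun y => M.vmild T r (s, y))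
        (M.upair A (fun p => K (s, p)) y)) :
    M.L1LinSolution P T K w (M.vmild T r) := by
  refine ⟨measurable_vmild hr, ⟨|C| * Real.exp T * M.kap 1, fun t ht => ?_⟩, fun t ht => ?_⟩
  · have h1 : Integrable (fun y => |C| * Real.exp T * wt M.ϑ 1 y) M.ν :=
      (integrable_wt le_rfl).const_mul _
    have h2 : ∫ y, |C| * Real.exp T * wt M.ϑ 1 y ∂M.ν = |C| * Real.exp T * M.kap 1 :=
      integral_const_mul _ _
    have h3 : ∀ y, |M.vmild T r (t, y)| ≤ |C| * Real.exp T * wt M.ϑ 1 y := fun y => by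
      refine (abs_vmild_le_of_bounded hC (t, y)).trans
        (mul_le_mul_of_nonneg_right ?_ (wt_nonneg le_rfl y))
      exact mul_le_mul (le_abs_self C) (Real.exp_le_exp.2 (by linarith [ht.1])) (Real.exp_pos _).le
        (abs_nonneg _)
    rw [← h2, ofReal_integral_eq_lintegral_ofReal h1
      (ae_of_all _ fun y => (abs_nonneg _).trans (h3 y))]
    exact lintegral_mono fun y => by
      rw [← ofReal_norm]; exact ENNReal.ofReal_le_ofReal (h3 y)
  · filter_upwards [ae_ae_avec_clamp hK hcl] with y h1
    have hsub : Ioc t T ⊆ Icc 0 T := fun s hs => ⟨ht.1.trans hs.1.le, hs.2⟩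
    have he : (fun s => Real.exp (-M.ϑ y * (s - t)) * r (s, y)) =ᵐ[volume.restrict (Ioc t T)]
        fun s => Real.exp (-M.ϑ y * (s - t)) * M.linRhs P K w (M.vmild T r) s y := by
      refine ae_restrict_of_ae_restrict_of_subset hsub ?_
      filter_upwards [h1, ae_restrict_mem measurableSet_Icc] with s g1 hs
      rw [hfix s hs y, g1, linRhs]
    refine ⟨(integrable_congr he).1 (integrableOn_exp_mul
      (hr.comp (by fun_prop : Measurable fun s : ℝ => (s, y))) (fun s => hC (s, y)) t), ?_⟩
    rw [← integral_congr_ae he, vmild, back]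

end FactorModel

/-! ### Continuous curves in `L¹` -/

theorem euclideanNorm_le {ι : Type*} [Fintype ι] {v : EuclideanSpace ℝ ι} {c : ℝ}
    (h : ∀ i, |v i| ≤ c) : ‖v‖ ≤ Fintype.card ι * c := by
  rcases isEmpty_or_nonempty ι with h0 | h0
  · simp [EuclideanSpace.norm_eq]
  have hc0 : 0 ≤ c := (abs_nonneg _).trans (h (Classical.arbitrary ι))
  rw [EuclideanSpace.norm_eq]
  refine Real.sqrt_le_iff.2 ⟨by positivity, ?_⟩
  calc ∑ i, ‖v i‖ ^ 2 ≤ ∑ _i : ι, c ^ 2 :=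
        Finset.sum_le_sum fun i _ => pow_le_pow_left₀ (norm_nonneg _) (h i) 2
    _ = Fintype.card ι * c ^ 2 := by simp
    _ ≤ (Fintype.card ι * c) ^ 2 := by
        have : (1 : ℝ) ≤ Fintype.card ι := by exact_mod_cast Fintype.card_pos
        rw [mul_pow]
        exact mul_le_mul_of_nonneg_right (by nlinarith) (sq_nonneg c)

/-- A jointly dominated family of functions that is pointwise continuous in time is a continuous
curve in `L¹`. -/
theorem exists_continuousMap_L1 {X ι : Type*} [MeasurableSpace X] {ρ : Measure X} [Fintype ι]
    {T : ℝ} {f : ℝ → X → ι → ℝ} {g : X → ℝ} (hf : ∀ t i, Measurable fun x => f t x i)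
    (hg : Integrable g ρ) (hb : ∀ t ∈ Icc 0 T, ∀ x i, |f t x i| ≤ g x)
    (hc : ∀ x i, ContinuousOn (fun t => f t x i) (Icc 0 T)) :
    ∃ Γ : C(Icc (0 : ℝ) T, Lp (EuclideanSpace ℝ ι) 1 ρ), ∀ t, ∀ᵐ x ∂ρ, ∀ i, Γ t x i = f t x i := by
  let F : Icc (0 : ℝ) T → X → EuclideanSpace ℝ ι := fun t x => WithLp.toLp 2 (f t x)
  have hFm : ∀ t, Measurable (F t) := fun t =>
    (PiLp.continuous_toLp 2 fun _ : ι => ℝ).measurable.comp (measurable_pi_lambda _ fun i => hf t i)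
  have hFb : ∀ t x, ‖F t x‖ ≤ Fintype.card ι * g x := fun t x => euclideanNorm_le fun i => hb t t.2 x i
  have hFi : ∀ t, Integrable (F t) ρ := fun t =>
    (hg.const_mul _).mono' (hFm t).aestronglyMeasurable (ae_of_all _ (hFb t))
  refine ⟨⟨fun t => (hFi t).toL1 (F t), continuous_iff_continuousAt.2 fun t => ?_⟩, fun t =>
    (hFi t).coeFn_toL1.mono fun x hx i => ?_⟩
  · rw [ContinuousAt, tendsto_iff_norm_sub_tendsto_zero]
    simp_rw [← Integrable.toL1_sub _ _ (hFi _) (hFi t), L1.norm_of_fun_eq_integral_norm]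
    rw [show 𝓝 (0 : ℝ) = 𝓝 (∫ _ : X, (0 : ℝ) ∂ρ) by simp]
    refine tendsto_integral_filter_of_dominated_convergence
      (fun x => Fintype.card ι * g x + Fintype.card ι * g x)
      (Eventually.of_forall fun s => ((hFm s).sub (hFm t)).norm.aestronglyMeasurable)
      (Eventually.of_forall fun s => ae_of_all _ fun x => ?_)
      ((hg.const_mul _).add (hg.const_mul _)) (ae_of_all _ fun x => ?_)
    · rw [norm_norm]
      exact (norm_sub_le _ _).trans (add_le_add (hFb s x) (hFb t x))
    · have hcF : Continuous fun s => F s x := (PiLp.continuous_toLp 2 fun _ : ι => ℝ).comp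
        (continuous_pi fun i => continuousOn_iff_continuous_domRestrict.1 (hc x i))
      have := ((hcF.sub continuous_const).norm (E := EuclideanSpace ℝ ι)).tendsto t
        (f := fun s => ‖F s x - F t x‖)
      simpa using this
  · change ((hFi t).toL1 (F t)) x i = _
    rw [hx]

/-! ### Nonnegative kernels -/

namespace MatrixMeasure

variable {d d' : ℕ} {μ : MatrixMeasure d d'}
  (hμ : Integrable (wt (fun θ : ℝ≥0 => (θ : ℝ)) 1) μ.totalVar)
  {G : ℝ≥0 → ℝ≥0 → Matrix (Fin d) (Fin d) ℝ} {Γ : ℝ≥0 × ℝ≥0 → FrobMatrix d d}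

theorem pairing_congr (hμ : Integrable (wt (fun θ : ℝ≥0 => (θ : ℝ)) 1) μ.totalVar)
    {f f' : ℝ≥0 → Fin d → ℝ} (h : ∀ᵐ θ ∂μ.totalVar, ∀ l, f θ l = f' θ l) (φ : ℝ≥0 → Fin d' → ℝ) :
    μ.pairing f φ = μ.pairing f' φ := by
  have := sigmaFinite_totalVar hμ
  exact Finset.sum_congr rfl fun l _ => Finset.sum_congr rfl fun i _ =>
    entryIntegral_congr l i (h.mono fun θ hθ => by dsimp only; rw [hθ l])

theorem integrable_dotProduct_σ {φ : ℝ≥0 → Fin d' → ℝ} (hφ : Integrable φ μ.totalVar) :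
    Integrable (fun y => (μ.factorModel hμ).σ y ⬝ᵥ φ y.1) (μ.factorModel hμ).ν :=
  integrable_finsetSum _ fun i _ => FactorModel.integrable_σ_mul_vec
    (f := fun y : ℝ≥0 × Fin d => φ y.1 i) (integrable_copies.2 fun _ => hφ.eval i) i

theorem ae_flat_of_ae {p : ℝ → Prop} [SigmaFinite μ.totalVar]
    (h : ∀ᵐ q ∂μ.totalVar.prod μ.totalVar, ∀ i j, p (G q.1 q.2 i j)) :
    ∀ᵐ x ∂(μ.factorModel hμ).ν.prod (μ.factorModel hμ).ν, p (flat G x) :=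
  ae_prod_copies.2 h

/-- The quadratic form of a bounded matrix kernel, an iterated integral with respect to the matrix
measure, is the quadratic form of the flattened kernel. -/
theorem pairing_pairing_eq_bil (hG : Measurable (flat G))
    (hΓ : ∀ᵐ q ∂μ.totalVar.prod μ.totalVar, ∀ i j, Γ q (i, j) = G q.1 q.2 i j) {C : ℝ}
    (hC : ∀ᵐ q ∂μ.totalVar.prod μ.totalVar, ∀ i j, |G q.1 q.2 i j| ≤ C)
    {φ : ℝ≥0 → Fin d' → ℝ} (hφ : Integrable φ μ.totalVar) :
    μ.pairing (fun θ l => μ.pairing (fun τ j => Γ (θ, τ) (l, j)) φ) φ =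
      bil (μ.factorModel hμ).ν (flat G) (fun y => (μ.factorModel hμ).σ y ⬝ᵥ φ y.1)
        fun y => (μ.factorModel hμ).σ y ⬝ᵥ φ y.1 := by
  have := sigmaFinite_totalVar hμ
  set M := μ.factorModel hμ with hM
  set f : ℝ≥0 × Fin d → ℝ := fun y => M.σ y ⬝ᵥ φ y.1 with hf
  have hfi : Integrable f M.ν := integrable_dotProduct_σ hμ hφ
  have hCf : ∀ᵐ p ∂M.ν.prod M.ν, |flat G p| ≤ C := ae_flat_of_ae hμ (p := fun x => |x| ≤ C) hC
  have hbf : Integrable (fun p : (ℝ≥0 × Fin d) × ℝ≥0 × Fin d => f p.1 * flat G p * f p.2)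
      (M.ν.prod M.ν) := by
    refine ((hfi.mul_prod hfi).bdd_mul (c := C) hG.aestronglyMeasurable hCf).congr
      (ae_of_all _ fun p => ?_)
    dsimp only
    ring
  set H : ℝ≥0 × Fin d → ℝ := fun y => ∫ y', flat G (y, y') * f y' ∂M.ν with hH
  have hHm : AEStronglyMeasurable H M.ν :=
    (hG.aestronglyMeasurable.mul hfi.1.comp_snd).integral_prod_right'
  have hHb : ∀ᵐ y ∂M.ν, ‖H y‖ ≤ C * ∫ y', |f y'| ∂M.ν := by
    filter_upwards [Measure.ae_ae_of_ae_prod hCf] with y hy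
    rw [← integral_const_mul]
    refine norm_integral_le_of_norm_le (hfi.abs.const_mul C) (hy.mono fun y' h => ?_)
    rw [norm_mul]
    exact mul_le_mul_of_nonneg_right h (norm_nonneg _)
  have hin : ∀ᵐ θ ∂μ.totalVar, ∀ l, μ.pairing (fun τ j => Γ (θ, τ) (l, j)) φ = H (θ, l) := by
    have hGm : ∀ θ i j, Measurable fun τ => G θ τ i j := fun θ i j =>
      hG.comp (by fun_prop : Measurable fun τ : ℝ≥0 => ((θ, i), (τ, j)))
    filter_upwards [Measure.ae_ae_of_ae_prod hΓ, Measure.ae_ae_of_ae_prod hC] with θ h1 h2 l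
    rw [pairing_congr hμ (h1.mono fun τ h j => h l j), pairing_eq_integral hμ fun j i =>
      (hφ.eval i).bdd_mul (c := C) (hGm θ l j).aestronglyMeasurable (h2.mono fun τ h => h l j)]
    rfl
  rw [pairing_congr hμ hin, pairing_eq_integral hμ (f := fun θ l => H (θ, l)) fun l i => ?_]
  · rw [bil, integral_prod _ hbf]
    refine integral_congr_ae (ae_of_all _ fun y => ?_)
    dsimp only
    rw [hH, mul_comm, ← integral_const_mul]
    exact integral_congr_ae (ae_of_all _ fun y' => by dsimp only; ring)
  · exact (integrable_copies.1 ((integrable_copies.2 fun _ => hφ.eval i :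
      Integrable (fun y : ℝ≥0 × Fin d => φ y.1 i) M.ν).bdd_mul hHm hHb)) l

/-- Decay and nonnegativity in the factor model give membership in `S₊ᵈ(μ ⊗ μ)`; the weights are at
most one, so that decay implies essential boundedness. -/
theorem isSymmNonneg_of_decay {C : ℝ} (hd : (μ.factorModel hμ).Decay (flat G) 1 C)
    (hp : (μ.factorModel hμ).PSD (flat G))
    (hm : AEStronglyMeasurable Γ (μ.totalVar.prod μ.totalVar))
    (hΓ : ∀ᵐ q ∂μ.totalVar.prod μ.totalVar, ∀ i j, Γ q (i, j) = G q.1 q.2 i j) :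
    μ.IsSymmNonneg Γ := by
  have := sigmaFinite_totalVar hμ
  refine ⟨memLp_top_of_bound hm (Fintype.card (Fin d × Fin d) * C) ?_, ?_, fun φ hφ => ?_⟩
  · filter_upwards [hΓ] with q h
    exact euclideanNorm_le fun ij => by
      rw [h ij.1 ij.2]; exact hd.abs_le ((q.1, ij.1), (q.2, ij.2))
  · have h' := (Measure.measurePreserving_swap (μ := μ.totalVar) (ν := μ.totalVar)).quasiMeasurePreserving.ae
      hΓ
    filter_upwards [hΓ, h'] with q h1 h2 i j
    rw [h1 i j]
    exact (hp.symm ((q.2, j), (q.1, i))).trans (h2 j i).symm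
  · rw [pairing_pairing_eq_bil hμ hd.meas hΓ
      (ae_of_all _ fun q i j => hd.abs_le ((q.1, i), (q.2, j))) hφ]
    exact hp.nonneg _ (FactorModel.test_of_integrable (integrable_dotProduct_σ hμ hφ))

theorem integrable_indicator_const
    (hμ : Integrable (wt (fun θ : ℝ≥0 => (θ : ℝ)) 1) μ.totalVar) (w : Fin d' → ℝ) (n : ℝ≥0) :
    Integrable ((Iic n).indicator fun _ => w) μ.totalVar :=
  (integrable_indicator_iff measurableSet_Iic).2
    (integrableOn_const (totalVar_Iic_lt_top hμ n).ne)

/-- Nonnegativity of `Γ` on `L¹(μ)` passes to the matrix `I(Γ)`, and thus makes `N̂(Γ)` coercive. -/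
theorem IsSymmNonneg.imat_nonneg (h : μ.IsSymmNonneg Γ) (hG : Measurable (flat G))
    (hΓ : ∀ᵐ q ∂μ.totalVar.prod μ.totalVar, ∀ i j, Γ q (i, j) = G q.1 q.2 i j)
    (hi : Integrable (flat G) ((μ.factorModel hμ).ν.prod (μ.factorModel hμ).ν))
    (w : Fin d' → ℝ) : 0 ≤ w ⬝ᵥ ((μ.factorModel hμ).imat (flat G) *ᵥ w) := by
  set M := μ.factorModel hμ with hM
  rw [FactorModel.dotProduct_imat (FactorModel.integrable_σ_mul hi)]
  obtain ⟨C, hC⟩ : ∃ C : ℝ, ∀ᵐ q ∂μ.totalVar.prod μ.totalVar, ∀ i j, |G q.1 q.2 i j| ≤ C := by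
    refine ⟨(eLpNormEssSup Γ (μ.totalVar.prod μ.totalVar)).toReal, ?_⟩
    filter_upwards [hΓ, ae_le_eLpNormEssSup (f := Γ) (μ := μ.totalVar.prod μ.totalVar)]
      with q h1 h2 i j
    rw [← h1 i j]
    refine (PiLp.norm_apply_le (Γ q) (i, j)).trans ?_
    rw [← toReal_enorm]
    refine ENNReal.toReal_mono ?_ h2
    simpa using h.memLp_top.2.ne
  -- the constant vector `w` is not integrable in general, but its truncations are
  let f : ℕ → ℝ≥0 × Fin d → ℝ := fun n y => M.σ y ⬝ᵥ (Iic (n : ℝ≥0)).indicator (fun _ => w) y.1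
  have hfn : ∀ n, 0 ≤ bil M.ν (flat G) (f n) (f n) := fun n => by
    rw [← pairing_pairing_eq_bil hμ hG hΓ hC (integrable_indicator_const hμ w n)]
    exact h.nonneg _ (integrable_indicator_const hμ w n)
  have hfm : ∀ n, Measurable (f n) := fun n => measurable_dotProduct M.measurable_σ
    ((measurable_const.indicator measurableSet_Iic).comp measurable_fst)
  have hfb : ∀ n y, |f n y| ≤ d' * ‖w‖ := fun n y => by
    refine (FactorModel.abs_dotProduct_σ_le _ y).trans (mul_le_mul_of_nonneg_left ?_ (by positivity))
    by_cases hy : y.1 ∈ Iic (n : ℝ≥0)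
    · rw [indicator_of_mem hy]
    · rw [indicator_of_notMem hy, norm_zero]; exact norm_nonneg _
  have hev : ∀ y, ∀ᶠ n in atTop, f n y = M.σ y ⬝ᵥ w := fun y => by
    obtain ⟨N, hN⟩ := exists_nat_ge y.1
    filter_upwards [eventually_ge_atTop N] with n hn
    have : y.1 ∈ Iic (n : ℝ≥0) := hN.trans (Nat.cast_le.2 hn)
    simp only [f]
    rw [indicator_of_mem this]
  refine ge_of_tendsto (x := atTop) (f := fun n => bil M.ν (flat G) (f n) (f n)) ?_
    (Eventually.of_forall hfn)
  refine tendsto_integral_of_dominated_convergence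
    (fun p => d' * ‖w‖ * ‖flat G p‖ * (d' * ‖w‖)) (fun n => ?_)
    ((hi.norm.const_mul _).mul_const _) (fun n => ae_of_all _ fun p => ?_) (ae_of_all _ fun p => ?_)
  · exact ((((hfm n).comp measurable_fst).mul hG).mul
      ((hfm n).comp measurable_snd)).aestronglyMeasurable
  · rw [norm_mul, norm_mul]
    exact mul_le_mul (mul_le_mul_of_nonneg_right (hfb n _) (norm_nonneg _)) (hfb n _)
      (norm_nonneg _) (by positivity)
  · refine tendsto_const_nhds.congr' ?_
    filter_upwards [hev p.1, hev p.2] with n h1 h2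
    rw [h1, h2]

theorem lintegral_flat_le (hΓ : ∀ᵐ q ∂μ.totalVar.prod μ.totalVar, ∀ i j,
    Γ q (i, j) = G q.1 q.2 i j) :
    ∫⁻ p, ‖flat G p‖ₑ ∂(μ.factorModel hμ).ν.prod (μ.factorModel hμ).ν ≤
      d * d * ∫⁻ q, ‖Γ q‖ₑ ∂μ.totalVar.prod μ.totalVar := by
  have := sigmaFinite_totalVar hμ
  refine (lintegral_prod_copies _).trans_le ?_
  refine (Finset.sum_le_sum fun i _ => Finset.sum_le_sum fun j _ =>
    lintegral_mono_ae (g := fun q => ‖Γ q‖ₑ) (hΓ.mono fun q h => ?_)).trans_eq ?_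
  · change ‖G q.1 q.2 i j‖ₑ ≤ _
    rw [← h i j, ← ofReal_norm, ← ofReal_norm]
    exact ENNReal.ofReal_le_ofReal (PiLp.norm_apply_le (Γ q) (i, j))
  · simp [mul_assoc]

theorem lintegral_copies_le {f : ℝ≥0 → Fin d → ℝ} {Λ : ℝ≥0 → EuclideanSpace ℝ (Fin d)}
    (hΛ : ∀ᵐ θ ∂μ.totalVar, ∀ i, Λ θ i = f θ i) :
    ∫⁻ y, ‖f y.1 y.2‖ₑ ∂(μ.factorModel hμ).ν ≤ d * ∫⁻ θ, ‖Λ θ‖ₑ ∂μ.totalVar := by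
  refine (lintegral_copies _).trans_le ?_
  refine (Finset.sum_le_sum fun i _ =>
    lintegral_mono_ae (g := fun θ => ‖Λ θ‖ₑ) (hΛ.mono fun θ h => ?_)).trans_eq ?_
  · dsimp only
    rw [← h i, ← ofReal_norm, ← ofReal_norm]
    exact ENNReal.ofReal_le_ofReal (PiLp.norm_apply_le (Λ θ) i)
  · simp

theorem ae_flat_swap (h : μ.IsSymmNonneg Γ)
    (hΓ : ∀ᵐ q ∂μ.totalVar.prod μ.totalVar, ∀ i j, Γ q (i, j) = G q.1 q.2 i j) :
    ∀ᵐ p ∂(μ.factorModel hμ).ν.prod (μ.factorModel hμ).ν, flat G p.swap = flat G p := by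
  have := sigmaFinite_totalVar hμ
  have h' := (Measure.measurePreserving_swap (μ := μ.totalVar) (ν := μ.totalVar)).quasiMeasurePreserving.ae
    hΓ
  refine ae_prod_copies.2 ?_
  filter_upwards [h.symm, hΓ, h'] with q h1 h2 h3 i j
  exact (h3 j i).symm.trans ((h1 i j).symm.trans (h2 i j))

end MatrixMeasure

theorem lintegral_enorm_le_norm {X E : Type*} [MeasurableSpace X] {ρ : Measure X}
    [NormedAddCommGroup E] {T : ℝ} (Γ : C(Icc (0 : ℝ) T, Lp E 1 ρ)) (t : Icc (0 : ℝ) T) :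
    ∫⁻ x, ‖Γ t x‖ₑ ∂ρ ≤ ENNReal.ofReal ‖Γ‖ := by
  rw [← eLpNorm_one_eq_lintegral_enorm, ← Lp.enorm_def, ← ofReal_norm]
  exact ENNReal.ofReal_le_ofReal (Γ.norm_coe_le_norm t)

namespace FactorModel

/-- The linear equation depends on the kernel only through its class modulo null sets. -/
theorem L1LinSolution.congr_kernel {d d' m : ℕ} {Y : Type*} [MeasurableSpace Y]
    {M : FactorModel d d' Y} {P : LQData d d' m} {T : ℝ} {K K' : ℝ × Y × Y → ℝ}
    {w : ℝ → (Fin d → ℝ) × (Fin d' → ℝ) × (Fin d' → ℝ)} {f : ℝ × Y → ℝ} (hK : Measurable K)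
    (hK' : Measurable K') (h : ∀ s ∈ Icc 0 T, ∀ᵐ p ∂M.ν.prod M.ν, K (s, p) = K' (s, p))
    (hf : M.L1LinSolution P T K w f) : M.L1LinSolution P T K' w f := by
  have hI : ∀ s ∈ Icc 0 T, (M.imat fun p => K (s, p)) = M.imat fun p => K' (s, p) := fun s hs => by
    ext i j
    exact integral_congr_ae ((h s hs).mono fun p hp => by dsimp only; rw [hp])
  have ha : ∀ᵐ y ∂M.ν, ∀ᵐ s ∂volume.restrict (Icc 0 T),
      M.avec (fun p => K (s, p)) y = M.avec (fun p => K' (s, p)) y := by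
    refine (Measure.ae_ae_comm (p := fun s y => M.avec (fun p => K (s, p)) y =
      M.avec (fun p => K' (s, p)) y)
      (measurableSet_eq_fun (measurable_avec hK) (measurable_avec hK'))).1 ?_
    exact (ae_restrict_iff' measurableSet_Icc).2
      (ae_of_all _ fun s hs => avec_congr_ae (h s hs))
  refine ⟨hf.meas, hf.bdd, fun t ht => ?_⟩
  filter_upwards [hf.eq t ht, ha] with y h1 h2
  have hsub : Ioc t T ⊆ Icc 0 T := fun s hs => ⟨ht.1.trans hs.1.le, hs.2⟩
  have he : (fun s => Real.exp (-M.ϑ y * (s - t)) * M.linRhs P K w f s y) =ᵐ[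
      volume.restrict (Ioc t T)] fun s => Real.exp (-M.ϑ y * (s - t)) * M.linRhs P K' w f s y := by
    refine ae_restrict_of_ae_restrict_of_subset hsub ?_
    filter_upwards [h2, ae_restrict_mem measurableSet_Icc] with s g1 hs
    rw [linRhs, linRhs, g1, hI s hs]
  exact ⟨(integrable_congr he).1 h1.1, h1.2.trans (integral_congr_ae he)⟩

end FactorModel

/-! ### Existence in the factor model -/

namespace FactorModel

variable {d d' m : ℕ} {Y : Type*} [MeasurableSpace Y]

/-- Existence for the system of the Riccati and the linear equation, with the bounds and the
pointwise continuity that turn the solutions into continuous curves in `L¹`. -/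
theorem exists_solution (M : FactorModel d d' Y) (P : LQData d d' m) (T : ℝ) {lam : ℝ}
    (hlam : 0 < lam) (hQ : P.Q.PosSemidef)
    (hN : (P.N - lam • (1 : Matrix (Fin m) (Fin m) ℝ)).PosSemidef)
    {w : ℝ → (Fin d → ℝ) × (Fin d' → ℝ) × (Fin d' → ℝ)} (hw : Measurable w) {c : ℝ}
    (hwc : ∀ s, ‖w s‖ ≤ c) :
    ∃ (K : ℝ × Y × Y → ℝ) (f : ℝ × Y → ℝ) (C : ℝ), 0 ≤ C ∧
      M.L1Solution P lam T K ∧ M.L1LinSolution P T K w f ∧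
      (∀ t ∈ Icc 0 T, M.Decay (fun p => K (t, p)) 1 C ∧ M.PSD (fun p => K (t, p)) ∧
        ∀ y, |f (t, y)| ≤ C * wt M.ϑ 1 y) ∧
      (∀ p, ContinuousOn (fun t => K (t, p)) (Icc 0 T)) ∧
      ∀ y, ContinuousOn (fun t => f (t, y)) (Icc 0 T) := by
  obtain ⟨A, R, hA, hR, ⟨C, hC⟩, hfix, hprop⟩ := M.exists_riccati P T hlam hQ hN
  have hm := measurable_mild (T := T) (κ := 0) M.measurable_ϑ hR
  have hdec := fun t => decay_mild (M := M) (T := T) le_rfl hR hC t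
  have hK := l1Solution_mild hN hR hC hfix (fun s hs => (hprop s hs).1) fun s hs => (hprop s hs).2.2
  obtain ⟨r, hr, ⟨C', hC'⟩, hrfix⟩ := M.exists_linear P hlam hA hm
    (fun s hs => (hprop s hs).2.1) hK.coercive hw hwc
  have hf := l1LinSolution_vmild hm (fun s hs => (hprop s hs).2.2) hr hC' hrfix
  have hexp : ∀ (a : ℝ) {b t : ℝ}, 0 ≤ b → t ∈ Icc 0 T →
      a * Real.exp (b * (T - t)) ≤ |a| * Real.exp (b * T) := fun a b t hb ht =>
    mul_le_mul (le_abs_self a) (Real.exp_le_exp.2 (mul_le_mul_of_nonneg_left (by linarith [ht.1]) hb))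
      (Real.exp_pos _).le (abs_nonneg _)
  have hC1 : 0 ≤ |C| * Real.exp (2 * T) := by positivity
  have hC2 : 0 ≤ |C'| * Real.exp (1 * T) := by positivity
  have hsub : Icc 0 T ⊆ Iic T := fun t ht => ht.2
  refine ⟨mild M.ϑ T 0 R, M.vmild T r, |C| * Real.exp (2 * T) + |C'| * Real.exp (1 * T),
    by positivity, hK, hf, fun t ht => ⟨⟨(hdec t).meas, le_rfl, fun p => ?_⟩, (hprop t ht).1,
    fun y => ?_⟩, fun p => ?_, fun y => ?_⟩
  · refine ((hdec t).bound p).trans (mul_le_mul_of_nonneg_right ?_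
      (mul_nonneg (wt_nonneg le_rfl _) (wt_nonneg le_rfl _)))
    linarith [hexp C (zero_le_two) ht]
  · refine (abs_vmild_le_of_bounded hC' (t, y)).trans
      (mul_le_mul_of_nonneg_right ?_ (wt_nonneg le_rfl _))
    have := hexp C' zero_le_one ht
    rw [one_mul] at this
    linarith
  · exact (continuousOn_back (c := M.ϑ p.1 + M.ϑ p.2 + 0) (r := fun s => R (s, p))
      (hR.comp (by fun_prop)) fun s => hC (s, p)).mono hsub
  · exact (continuousOn_back (c := M.ϑ y) (r := fun s => r (s, y))
      (hr.comp (by fun_prop)) fun s => hC' (s, y)).mono hsub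

end FactorModel

/-! ### Mild solutions and their counterparts in the factor model -/

namespace LQData

variable {d d' m : ℕ} {P : LQData d d' m} {T lam : ℝ}
  (hμ : Integrable (wt (fun θ : ℝ≥0 => (θ : ℝ)) 1) P.μ.totalVar)
  {G : ℝ → ℝ≥0 → ℝ≥0 → Matrix (Fin d) (Fin d) ℝ} {l : ℝ → ℝ≥0 → Fin d → ℝ}
  {w : ℝ → (Fin d → ℝ) × (Fin d' → ℝ) × (Fin d' → ℝ)}

/-- The Riccati equation of matrix kernels is the one of the flattened kernels. -/
theorem riccati_iff (hG : ∀ i j, Measurable fun q : ℝ × ℝ≥0 × ℝ≥0 => G q.1 q.2.1 q.2.2 i j)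
    (hint : ∀ s ∈ Icc 0 T, Integrable (MatrixMeasure.flat (G s))
      ((P.μ.factorModel hμ).ν.prod (P.μ.factorModel hμ).ν))
    (hsym : ∀ s ∈ Icc 0 T, ∀ᵐ p ∂(P.μ.factorModel hμ).ν.prod (P.μ.factorModel hμ).ν,
      MatrixMeasure.flat (G s) p.swap = MatrixMeasure.flat (G s) p)
    {t : ℝ} (ht : t ∈ Icc 0 T) {Γ : ℝ≥0 × ℝ≥0 → FrobMatrix d d}
    (hΓ : ∀ᵐ q ∂P.μ.totalVar.prod P.μ.totalVar, ∀ i j, Γ q (i, j) = G t q.1 q.2 i j) :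
    (∀ᵐ q ∂(P.μ.totalVar.prod P.μ.totalVar), ∀ i j,
      IntervalIntegrable
        (fun s => Real.exp (-((q.1 : ℝ) + q.2) * (s - t)) * P.R₁ (G s) q.1 q.2 i j) volume t T ∧
      Γ q (i, j) =
        ∫ s in (t : ℝ)..T, Real.exp (-((q.1 : ℝ) + q.2) * (s - t)) * P.R₁ (G s) q.1 q.2 i j) ↔
    ∀ᵐ p ∂(P.μ.factorModel hμ).ν.prod (P.μ.factorModel hμ).ν,
      IntegrableOn (fun s => Real.exp (-((P.μ.factorModel hμ).ϑ p.1 + (P.μ.factorModel hμ).ϑ p.2) *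
        (s - t)) * (P.μ.factorModel hμ).ricc P (fun x => MatrixMeasure.flat (G x.1) x.2) s p)
        (Ioc t T) ∧
      MatrixMeasure.flat (G t) p = ∫ s in Ioc t T,
        Real.exp (-((P.μ.factorModel hμ).ϑ p.1 + (P.μ.factorModel hμ).ϑ p.2) * (s - t)) *
        (P.μ.factorModel hμ).ricc P (fun x => MatrixMeasure.flat (G x.1) x.2) s p := by
  have := MatrixMeasure.sigmaFinite_totalVar hμ
  refine Iff.trans (Filter.eventually_congr ?_) ae_prod_copies.symm
  filter_upwards [ae_ae_R₁_eq hμ hG hint hsym, hΓ] with q h1 h2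
  refine forall_congr' fun i => forall_congr' fun j => ?_
  rw [h2 i j]
  exact intervalIntegrable_and_eq_iff ht (h1 i j)

/-- The linear equation of vector functions is the one of the flattened functions. -/
theorem linear_iff (hG : ∀ i j, Measurable fun q : ℝ × ℝ≥0 × ℝ≥0 => G q.1 q.2.1 q.2.2 i j)
    (hint : ∀ s ∈ Icc 0 T, Integrable (MatrixMeasure.flat (G s))
      ((P.μ.factorModel hμ).ν.prod (P.μ.factorModel hμ).ν))
    (hsym : ∀ s ∈ Icc 0 T, ∀ᵐ p ∂(P.μ.factorModel hμ).ν.prod (P.μ.factorModel hμ).ν,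
      MatrixMeasure.flat (G s) p.swap = MatrixMeasure.flat (G s) p)
    (hl : ∀ s ∈ Icc 0 T, ∀ i, Integrable (fun θ => l s θ i) P.μ.totalVar)
    (hw : ∀ s ∈ Icc 0 T, w s = (P.g₀ s, P.βt s, P.γt s))
    {t : ℝ} (ht : t ∈ Icc 0 T) {Λ : ℝ≥0 → EuclideanSpace ℝ (Fin d)}
    (hΛ : ∀ᵐ θ ∂P.μ.totalVar, ∀ i, Λ θ i = l t θ i) :
    (∀ᵐ θ : ℝ≥0 ∂P.μ.totalVar, ∀ i,
      IntervalIntegrable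
        (fun s => Real.exp (-(θ : ℝ) * (s - t)) * P.R₂ s (G s) (l s) θ i) volume t T ∧
      Λ θ i = ∫ s in (t : ℝ)..T, Real.exp (-(θ : ℝ) * (s - t)) * P.R₂ s (G s) (l s) θ i) ↔
    ∀ᵐ y ∂(P.μ.factorModel hμ).ν,
      IntegrableOn (fun s => Real.exp (-(P.μ.factorModel hμ).ϑ y * (s - t)) *
        (P.μ.factorModel hμ).linRhs P (fun x => MatrixMeasure.flat (G x.1) x.2) w
          (fun x => l x.1 x.2.1 x.2.2) s y) (Ioc t T) ∧
      l t y.1 y.2 = ∫ s in Ioc t T, Real.exp (-(P.μ.factorModel hμ).ϑ y * (s - t)) *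
        (P.μ.factorModel hμ).linRhs P (fun x => MatrixMeasure.flat (G x.1) x.2) w
          (fun x => l x.1 x.2.1 x.2.2) s y := by
  refine Iff.trans (Filter.eventually_congr ?_) (ae_all_iff.trans ae_copies.symm)
  filter_upwards [ae_ae_R₂_eq hμ hG hint hsym hl hw, hΛ] with θ h1 h2
  refine forall_congr' fun i => ?_
  rw [h2 i]
  exact intervalIntegrable_and_eq_iff ht (h1 i)

/-- The first component of a nonnegative mild solution, in the factor model. -/
theorem l1Solution_of_isSymmNonneg
    (hN : (P.N - lam • (1 : Matrix (Fin m) (Fin m) ℝ)).PosSemidef)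
    (hG : ∀ i j, Measurable fun q : ℝ × ℝ≥0 × ℝ≥0 => G q.1 q.2.1 q.2.2 i j)
    {Γ : C(Icc (0 : ℝ) T, P.μ.KernelL1)} (hS : ∀ t, P.μ.IsSymmNonneg (Γ t))
    (hΓ : ∀ t : Icc (0 : ℝ) T, ∀ᵐ q ∂(P.μ.totalVar.prod P.μ.totalVar), ∀ i j,
      Γ t q (i, j) = G t q.1 q.2 i j)
    (heq : ∀ t : Icc (0 : ℝ) T, ∀ᵐ q ∂(P.μ.totalVar.prod P.μ.totalVar), ∀ i j,
      IntervalIntegrable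
        (fun s => Real.exp (-((q.1 : ℝ) + q.2) * (s - t)) * P.R₁ (G s) q.1 q.2 i j) volume t T ∧
      Γ t q (i, j) =
        ∫ s in (t : ℝ)..T, Real.exp (-((q.1 : ℝ) + q.2) * (s - t)) * P.R₁ (G s) q.1 q.2 i j) :
    (P.μ.factorModel hμ).L1Solution P lam T (fun x => MatrixMeasure.flat (G x.1) x.2) ∧
    ∀ s ∈ Icc 0 T, ∀ᵐ p ∂(P.μ.factorModel hμ).ν.prod (P.μ.factorModel hμ).ν,
      MatrixMeasure.flat (G s) p.swap = MatrixMeasure.flat (G s) p := by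
  have hm := MatrixMeasure.measurable_flat hG
  have hmt : ∀ t, Measurable (MatrixMeasure.flat (G t)) := fun t =>
    hm.comp (by fun_prop : Measurable fun p : (ℝ≥0 × Fin d) × ℝ≥0 × Fin d => (t, p))
  have hb : ∀ t ∈ Icc 0 T, ∫⁻ p, ‖MatrixMeasure.flat (G t) p‖ₑ
      ∂(P.μ.factorModel hμ).ν.prod (P.μ.factorModel hμ).ν ≤ ENNReal.ofReal (d * d * ‖Γ‖) := by
    intro t ht
    refine (MatrixMeasure.lintegral_flat_le hμ (hΓ ⟨t, ht⟩)).trans ?_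
    rw [ENNReal.ofReal_mul (by positivity), ENNReal.ofReal_mul (by positivity),
      ENNReal.ofReal_natCast]
    gcongr
    exact lintegral_enorm_le_norm Γ ⟨t, ht⟩
  have hint : ∀ s ∈ Icc 0 T, Integrable (MatrixMeasure.flat (G s))
      ((P.μ.factorModel hμ).ν.prod (P.μ.factorModel hμ).ν) := fun t ht =>
    FactorModel.integrable_of_lintegral_le (hmt t) (hb t ht)
  have hsym : ∀ s ∈ Icc 0 T, ∀ᵐ p ∂(P.μ.factorModel hμ).ν.prod (P.μ.factorModel hμ).ν,
      MatrixMeasure.flat (G s) p.swap = MatrixMeasure.flat (G s) p := fun s hs =>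
    MatrixMeasure.ae_flat_swap hμ (hS ⟨s, hs⟩) (hΓ ⟨s, hs⟩)
  refine ⟨⟨hm, ⟨_, hb⟩, fun t ht => LQData.coercive_Nh le_rfl hN ?_, fun t ht => ?_⟩, hsym⟩
  · have h1 := hΓ ⟨t, ht⟩
    exact (hS ⟨t, ht⟩).imat_nonneg (G := G t) hμ (hmt t) h1 (hint t ht)
  · have h1 := hΓ ⟨t, ht⟩
    have h2 := heq ⟨t, ht⟩
    exact (riccati_iff hμ hG hint hsym ht h1).1 h2

theorem measurable_uncurry_vec (hl : ∀ i, Measurable fun q : ℝ × ℝ≥0 => l q.1 q.2 i) :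
    Measurable fun x : ℝ × ℝ≥0 × Fin d => l x.1 x.2.1 x.2.2 := by
  have h : Measurable fun x : (ℝ × ℝ≥0) × Fin d => l x.1.1 x.1.2 x.2 :=
    measurable_from_prod_countable_left hl
  exact h.comp (by fun_prop : Measurable fun x : ℝ × ℝ≥0 × Fin d => ((x.1, x.2.1), x.2.2))

theorem lintegral_vec_le {Λ : C(Icc (0 : ℝ) T, P.μ.VecL1)}
    (hΛ : ∀ t : Icc (0 : ℝ) T, ∀ᵐ θ ∂P.μ.totalVar, ∀ i, Λ t θ i = l t θ i) :
    ∀ t ∈ Icc 0 T, ∫⁻ y, ‖l t y.1 y.2‖ₑ ∂(P.μ.factorModel hμ).ν ≤ ENNReal.ofReal (d * ‖Λ‖) := by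
  intro t ht
  refine (MatrixMeasure.lintegral_copies_le hμ (hΛ ⟨t, ht⟩)).trans ?_
  rw [ENNReal.ofReal_mul (by positivity), ENNReal.ofReal_natCast]
  gcongr
  exact lintegral_enorm_le_norm Λ ⟨t, ht⟩

/-- The coefficients `(g₀, β̃, γ̃)` on `[0, T]`, extended by zero. -/
def coeff (P : LQData d d' m) (T : ℝ) : ℝ → (Fin d → ℝ) × (Fin d' → ℝ) × (Fin d' → ℝ) :=
  (Icc 0 T).indicator fun s => (P.g₀ s, P.βt s, P.γt s)

theorem coeff_of_mem {s : ℝ} (hs : s ∈ Icc 0 T) : P.coeff T s = (P.g₀ s, P.βt s, P.γt s) :=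
  indicator_of_mem hs _

theorem measurable_coeff (hg : Measurable ((Icc (0 : ℝ) T).domRestrict P.g₀))
    (hβ : Measurable ((Icc (0 : ℝ) T).domRestrict P.β))
    (hγ : Measurable ((Icc (0 : ℝ) T).domRestrict P.γ)) : Measurable (P.coeff T) := by
  refine measurable_of_restrict_of_restrict_compl (s := Icc 0 T) measurableSet_Icc ?_ ?_
  · have h : (Icc 0 T).domRestrict (P.coeff T) = fun s => ((Icc (0 : ℝ) T).domRestrict P.g₀ s,
        (Icc (0 : ℝ) T).domRestrict P.β s + P.B *ᵥ (Icc (0 : ℝ) T).domRestrict P.g₀ s,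
        (Icc (0 : ℝ) T).domRestrict P.γ s + P.D *ᵥ (Icc (0 : ℝ) T).domRestrict P.g₀ s) := by
      ext1 s
      exact coeff_of_mem s.2
    rw [h]
    exact hg.prodMk ((hβ.add (measurable_const_mulVec _ hg)).prodMk
      (hγ.add (measurable_const_mulVec _ hg)))
  · have h : (Icc 0 T)ᶜ.domRestrict (P.coeff T) = fun _ => 0 := by
      ext1 s
      exact indicator_of_notMem (s := Icc 0 T) s.2 fun s => (P.g₀ s, P.βt s, P.γt s)
    rw [h]
    exact measurable_const

theorem exists_norm_coeff_le (hg : ∃ c : ℝ, ∀ t ∈ Icc (0 : ℝ) T, ‖P.g₀ t‖ ≤ c)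
    (hβ : ∃ c : ℝ, ∀ t ∈ Icc (0 : ℝ) T, ‖P.β t‖ ≤ c)
    (hγ : ∃ c : ℝ, ∀ t ∈ Icc (0 : ℝ) T, ‖P.γ t‖ ≤ c) : ∃ c : ℝ, ∀ s, ‖P.coeff T s‖ ≤ c := by
  obtain ⟨c₁, h₁⟩ := hg
  obtain ⟨c₂, h₂⟩ := hβ
  obtain ⟨c₃, h₃⟩ := hγ
  refine ⟨max 0 (max c₁ (max (c₂ + ‖P.B‖ * c₁) (c₃ + ‖P.D‖ * c₁))), fun s => ?_⟩
  by_cases hs : s ∈ Icc 0 T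
  · rw [coeff_of_mem hs]
    refine le_max_of_le_right (max_le_max (h₁ s hs) (max_le_max ?_ ?_))
    · exact (norm_add_le _ _).trans (add_le_add (h₂ s hs) (norm_mulVec_le le_rfl (h₁ s hs)))
    · exact (norm_add_le _ _).trans (add_le_add (h₃ s hs) (norm_mulVec_le le_rfl (h₁ s hs)))
  · rw [coeff, indicator_of_notMem hs, norm_zero]
    exact le_max_left _ _

end LQData

/-! ### Existence and uniqueness of the mild solution -/

namespace LQData

variable {d d' m : ℕ} {P : LQData d d' m} {T lam C c : ℝ}
  {hμ : Integrable (wt (fun θ : ℝ≥0 => (θ : ℝ)) 1) P.μ.totalVar}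
  {K : ℝ × (ℝ≥0 × Fin d) × ℝ≥0 × Fin d → ℝ} {f : ℝ × ℝ≥0 × Fin d → ℝ}
  {Γ : C(Icc (0 : ℝ) T, P.μ.KernelL1)} {Λ : C(Icc (0 : ℝ) T, P.μ.VecL1)}
  {χ : C(Icc (0 : ℝ) T, ℝ)}

/-- Every nonnegative mild solution is given by one fixed pair of solutions in the factor model;
this contains uniqueness. -/
theorem IsMildSolution.ae_eq (h : P.IsMildSolution T Γ Λ χ) (hS : ∀ t, P.μ.IsSymmNonneg (Γ t))
    (hlam : 0 < lam) (hN : (P.N - lam • (1 : Matrix (Fin m) (Fin m) ℝ)).PosSemidef)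
    (hc : ∀ s, ‖P.coeff T s‖ ≤ c) (hK : (P.μ.factorModel hμ).L1Solution P lam T K)
    (hf : (P.μ.factorModel hμ).L1LinSolution P T K (P.coeff T) f) :
    (∀ t : Icc (0 : ℝ) T, ∀ᵐ q ∂P.μ.totalVar.prod P.μ.totalVar, ∀ i j,
      Γ t q (i, j) = K (t, (q.1, i), (q.2, j))) ∧
    (∀ t : Icc (0 : ℝ) T, ∀ᵐ θ ∂P.μ.totalVar, ∀ i, Λ t θ i = f (t, θ, i)) ∧
    ∀ t : Icc (0 : ℝ) T, χ t = ∫ s in (t : ℝ)..T,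
      P.Scal ((P.μ.factorModel hμ).imat fun p => K (s, p)) (P.coeff T s)
        ((P.μ.factorModel hμ).bvec fun y => f (s, y)) := by
  have := MatrixMeasure.sigmaFinite_totalVar hμ
  set M := P.μ.factorModel hμ with hM
  obtain ⟨G, l, hG, hl, hΓ, hΛ, -, h1, h2, h3⟩ := h
  obtain ⟨hK', hsym⟩ := l1Solution_of_isSymmNonneg hμ hN hG hS hΓ h1
  have hint : ∀ s ∈ Icc 0 T, Integrable (MatrixMeasure.flat (G s)) (M.ν.prod M.ν) := fun s hs =>
    hK'.integrable hs
  have hlm := measurable_uncurry_vec hl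
  have hlb := lintegral_vec_le hμ hΛ
  have hli : ∀ s ∈ Icc 0 T, Integrable (fun y : ℝ≥0 × Fin d => l s y.1 y.2) M.ν := fun s hs =>
    FactorModel.integrable_of_lintegral_le (hlm.comp (by fun_prop : Measurable
      fun y : ℝ≥0 × Fin d => (s, y))) (hlb s hs)
  have hli' : ∀ s ∈ Icc 0 T, ∀ i, Integrable (fun θ => l s θ i) P.μ.totalVar := fun s hs =>
    integrable_copies.1 (hli s hs)
  have hf' : M.L1LinSolution P T (fun x => MatrixMeasure.flat (G x.1) x.2) (P.coeff T)
      fun x => l x.1 x.2.1 x.2.2 := by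
    refine ⟨hlm, ⟨_, hlb⟩, fun t ht => ?_⟩
    have g1 := hΛ ⟨t, ht⟩
    have g2 := h2 ⟨t, ht⟩
    exact (linear_iff hμ hG hint hsym hli' (fun s hs => coeff_of_mem hs) ht g1).1 g2
  have eK := hK.ae_eq hlam hK'
  have ef := (hf.congr_kernel hK.meas hK'.meas eK).ae_eq hlam hK' hc hf'
  refine ⟨fun t => ?_, fun t => ?_, fun t => ?_⟩
  · filter_upwards [hΓ t, ae_prod_copies.1 (eK t t.2)] with q g1 g2 i j
    exact (g1 i j).trans (g2 i j).symm
  · filter_upwards [hΛ t, ae_all_iff.2 (ae_copies.1 (ef t t.2))] with θ g1 g2 i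
    exact (g1 i).trans (g2 i).symm
  · rw [(h3 t).2]
    refine intervalIntegral.integral_congr fun s hs => ?_
    rw [uIcc_of_le t.2.2] at hs
    have hs' : s ∈ Icc 0 T := ⟨t.2.1.trans hs.1, hs.2⟩
    rw [R₃_eq hμ hs' hint hli' fun s hs => coeff_of_mem hs]
    congr 1
    · ext i j
      exact integral_congr_ae ((eK s hs').mono fun p hp => by dsimp only at hp ⊢; rw [hp])
    · ext i
      exact integral_congr_ae ((ef s hs').mono fun y hy => by dsimp only at hy ⊢; rw [hy])

/-- Solutions in the factor model with decay, nonnegativity and pointwise continuity give a mild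
solution in `S₊ᵈ(μ ⊗ μ)` with the uniform bound on the partial integrals of `Γ`. -/
theorem exists_isMildSolution (hlam : 0 < lam)
    (hw : Measurable (P.coeff T)) (hc : ∀ s, ‖P.coeff T s‖ ≤ c) (hC : 0 ≤ C)
    (hK : (P.μ.factorModel hμ).L1Solution P lam T K)
    (hf : (P.μ.factorModel hμ).L1LinSolution P T K (P.coeff T) f)
    (hb : ∀ t ∈ Icc 0 T, (P.μ.factorModel hμ).Decay (fun p => K (t, p)) 1 C ∧
      (P.μ.factorModel hμ).PSD (fun p => K (t, p)) ∧
      ∀ y, |f (t, y)| ≤ C * wt (P.μ.factorModel hμ).ϑ 1 y)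
    (hKc : ∀ p, ContinuousOn (fun t => K (t, p)) (Icc 0 T))
    (hfc : ∀ y, ContinuousOn (fun t => f (t, y)) (Icc 0 T)) :
    ∃ (Γ : C(Icc (0 : ℝ) T, P.μ.KernelL1)) (Λ : C(Icc (0 : ℝ) T, P.μ.VecL1))
      (χ : C(Icc (0 : ℝ) T, ℝ)), P.IsMildSolution T Γ Λ χ ∧ (∀ t, P.μ.IsSymmNonneg (Γ t)) ∧
      ∃ M : ℝ, 0 < M ∧ ∀ t, ∀ᵐ θ ∂P.μ.totalVar,
        ∫⁻ τ, ‖Γ t (θ, τ)‖ₑ ∂P.μ.totalVar ≤ ENNReal.ofReal M := by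
  have := MatrixMeasure.sigmaFinite_totalVar hμ
  set M := P.μ.factorModel hμ with hM
  set ω : ℝ≥0 → ℝ := wt (fun θ : ℝ≥0 => (θ : ℝ)) 1 with hω
  have hω0 : ∀ θ, 0 ≤ ω θ := fun θ => (wt_pos (fun θ : ℝ≥0 => θ.2) le_rfl θ).le
  have hω1 : ∀ θ, ω θ ≤ 1 := fun θ => wt_le_one (fun θ : ℝ≥0 => θ.2) le_rfl θ
  obtain ⟨Γ, hΓ⟩ := exists_continuousMap_L1 (ρ := P.μ.totalVar.prod P.μ.totalVar) (T := T)
    (f := fun t q (ij : Fin d × Fin d) => K (t, (q.1, ij.1), (q.2, ij.2)))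
    (g := fun q => C * (ω q.1 * ω q.2))
    (fun t ij => hK.meas.comp (by fun_prop)) ((hμ.mul_prod hμ).const_mul C)
    (fun t ht q ij => (hb t ht).1.bound ((q.1, ij.1), (q.2, ij.2))) fun q ij => hKc _
  obtain ⟨Λ, hΛ⟩ := exists_continuousMap_L1 (ρ := P.μ.totalVar) (T := T)
    (f := fun t θ (i : Fin d) => f (t, θ, i)) (g := fun θ => C * ω θ)
    (fun t i => hf.meas.comp (by fun_prop)) (hμ.const_mul C)
    (fun t ht θ i => (hb t ht).2.2 (θ, i)) fun θ i => hfc _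
  let G : ℝ → ℝ≥0 → ℝ≥0 → Matrix (Fin d) (Fin d) ℝ := fun t θ τ =>
    Matrix.of fun i j => K (t, (θ, i), (τ, j))
  let l : ℝ → ℝ≥0 → Fin d → ℝ := fun t θ i => f (t, θ, i)
  have hG : ∀ i j, Measurable fun q : ℝ × ℝ≥0 × ℝ≥0 => G q.1 q.2.1 q.2.2 i j := fun i j =>
    hK.meas.comp (by fun_prop : Measurable fun q : ℝ × ℝ≥0 × ℝ≥0 => (q.1, (q.2.1, i), (q.2.2, j)))
  have hl : ∀ i, Measurable fun q : ℝ × ℝ≥0 => l q.1 q.2 i := fun i =>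
    hf.meas.comp (by fun_prop : Measurable fun q : ℝ × ℝ≥0 => (q.1, q.2, i))
  have hint : ∀ s ∈ Icc 0 T, Integrable (MatrixMeasure.flat (G s)) (M.ν.prod M.ν) := fun s hs =>
    hK.integrable hs
  have hsym : ∀ s ∈ Icc 0 T, ∀ᵐ p ∂M.ν.prod M.ν,
      MatrixMeasure.flat (G s) p.swap = MatrixMeasure.flat (G s) p := fun s hs =>
    ae_of_all _ (hb s hs).2.1.symm
  have hli : ∀ s ∈ Icc 0 T, ∀ i, Integrable (fun θ => l s θ i) P.μ.totalVar := fun s hs =>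
    integrable_copies.1 (hf.integrable hs)
  have hΓ' : ∀ t : Icc (0 : ℝ) T, ∀ᵐ q ∂(P.μ.totalVar.prod P.μ.totalVar), ∀ i j,
      Γ t q (i, j) = G t q.1 q.2 i j := fun t => (hΓ t).mono fun q h i j => h (i, j)
  -- the integrand of the third equation, extended by zero
  set r : ℝ → ℝ := (Icc 0 T).indicator fun s =>
    P.Scal (M.imat fun p => K (s, p)) (P.coeff T s) (M.bvec fun y => f (s, y)) with hr
  have hrm : Measurable r := (LQData.measurable_Scal (FactorModel.measurable_imat hK.meas) hw
    (FactorModel.measurable_bvec hf.meas)).indicator measurableSet_Icc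
  obtain ⟨L, hL⟩ := P.exists_abs_Scal_le (d' * (C * M.kap 1 ^ 2)) c (C * M.kap 1) hlam
  have hrb : ∀ s, |r s| ≤ |L| := fun s => by
    by_cases hs : s ∈ Icc 0 T
    · rw [hr, indicator_of_mem hs]
      exact (hL _ _ _ ((hb s hs).1.norm_imat_le hC) (hK.coercive s hs) (hc s)
        (FactorModel.norm_bvec_le le_rfl hC (hb s hs).2.2)).trans (le_abs_self L)
    · rw [hr, indicator_of_notMem hs, abs_zero]
      exact abs_nonneg L
  have hrR : ∀ᵐ s ∂volume.restrict (Icc 0 T), P.R₃ s (G s) (l s) = r s := by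
    filter_upwards [ae_restrict_mem measurableSet_Icc] with s hs
    rw [R₃_eq hμ hs hint hli fun s hs => coeff_of_mem hs, hr, indicator_of_mem hs]
    rfl
  let χ : C(Icc (0 : ℝ) T, ℝ) := ⟨fun t => back T 0 r t, continuousOn_iff_continuous_domRestrict.1
    ((continuousOn_back hrm hrb).mono fun t ht => ht.2)⟩
  refine ⟨Γ, Λ, χ, ⟨G, l, hG, hl, hΓ', hΛ, fun t => ?_, fun t => ?_, fun t => ?_, fun t => ?_⟩,
    fun t => ?_, Fintype.card (Fin d × Fin d) * C * (∫ θ, ω θ ∂P.μ.totalVar) + 1, ?_, fun t => ?_⟩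
  · rw [Nhat_eq (MatrixMeasure.doubleIntegral_eq_imat hμ (hint t t.2))]
    exact (hK.coercive t t.2).isUnit hlam
  · have h1 := hΓ' t
    exact (riccati_iff hμ hG hint hsym t.2 h1).2 (hK.eq t t.2)
  · have h1 := hΛ t
    exact (linear_iff hμ hG hint hsym hli (fun s hs => coeff_of_mem hs) t.2 h1).2 (hf.eq t t.2)
  · have h1 := (intervalIntegrable_and_eq_iff (c := -0) (x := χ t) t.2 hrR).2
      ⟨integrableOn_exp_mul hrm hrb t, rfl⟩
    simpa using h1
  · exact MatrixMeasure.isSymmNonneg_of_decay (G := G t) hμ (hb t t.2).1 (hb t t.2).2.1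
      (Lp.aestronglyMeasurable _) (hΓ' t)
  · have : 0 ≤ ∫ θ, ω θ ∂P.μ.totalVar := integral_nonneg hω0
    positivity
  · filter_upwards [Measure.ae_ae_of_ae_prod (hΓ t)] with θ hθ
    have h1 : Integrable (fun τ => Fintype.card (Fin d × Fin d) * C * ω τ) P.μ.totalVar :=
      hμ.const_mul _
    calc ∫⁻ τ, ‖Γ t (θ, τ)‖ₑ ∂P.μ.totalVar
        ≤ ∫⁻ τ, ENNReal.ofReal (Fintype.card (Fin d × Fin d) * C * ω τ) ∂P.μ.totalVar := by
          refine lintegral_mono_ae (hθ.mono fun τ hτ => ?_)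
          rw [← ofReal_norm, mul_assoc]
          refine ENNReal.ofReal_le_ofReal (euclideanNorm_le fun ij => ?_)
          rw [hτ ij]
          refine ((hb t t.2).1.bound ((θ, ij.1), (τ, ij.2))).trans ?_
          exact mul_le_mul_of_nonneg_left (mul_le_of_le_one_left (hω0 τ) (hω1 θ)) hC
      _ = ENNReal.ofReal (Fintype.card (Fin d × Fin d) * C * ∫ τ, ω τ ∂P.μ.totalVar) := by
          rw [← integral_const_mul, ofReal_integral_eq_lintegral_ofReal h1
            (ae_of_all _ fun τ => mul_nonneg (by positivity) (hω0 τ))]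
      _ ≤ _ := ENNReal.ofReal_le_ofReal (le_add_of_nonneg_right zero_le_one)

end LQData

end

theorem theorem3p2 {d d' m : ℕ} (P : LQData d d' m) (T : ℝ) (hT : 0 < T)
    (hμ : ∫⁻ θ : ℝ≥0, min 1 ((θ : ℝ≥0∞) ^ (-(1 / 2) : ℝ)) ∂P.μ.totalVar < ∞)
    (hg₀_meas : Measurable ((Icc (0 : ℝ) T).domRestrict P.g₀))
    (hβ_meas : Measurable ((Icc (0 : ℝ) T).domRestrict P.β))
    (hγ_meas : Measurable ((Icc (0 : ℝ) T).domRestrict P.γ))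
    (hg₀ : ∃ c : ℝ, ∀ t ∈ Icc (0 : ℝ) T, ‖P.g₀ t‖ ≤ c)
    (hβ : ∃ c : ℝ, ∀ t ∈ Icc (0 : ℝ) T, ‖P.β t‖ ≤ c)
    (hγ : ∃ c : ℝ, ∀ t ∈ Icc (0 : ℝ) T, ‖P.γ t‖ ≤ c)
    (hQ : P.Q.PosSemidef)
    (hN : ∃ lam : ℝ, 0 < lam ∧
      (P.N - lam • (1 : Matrix (Fin m) (Fin m) ℝ)).PosSemidef) :
    ∃ (Γ : C(Icc (0 : ℝ) T, P.μ.KernelL1)) (Λ : C(Icc (0 : ℝ) T, P.μ.VecL1))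
      (χ : C(Icc (0 : ℝ) T, ℝ)),
      (P.IsMildSolution T Γ Λ χ ∧ ∀ t, P.μ.IsSymmNonneg (Γ t)) ∧
      (∀ (Γ' : C(Icc (0 : ℝ) T, P.μ.KernelL1)) (Λ' : C(Icc (0 : ℝ) T, P.μ.VecL1))
        (χ' : C(Icc (0 : ℝ) T, ℝ)),
        P.IsMildSolution T Γ' Λ' χ' → (∀ t, P.μ.IsSymmNonneg (Γ' t)) →
          Γ' = Γ ∧ Λ' = Λ ∧ χ' = χ) ∧
      ∃ M : ℝ, 0 < M ∧ ∀ t, ∀ᵐ θ ∂P.μ.totalVar,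
        ∫⁻ τ, ‖Γ t (θ, τ)‖ₑ ∂P.μ.totalVar ≤ ENNReal.ofReal M := by
  obtain ⟨lam, hlam, hN⟩ := hN
  have hμ' := P.μ.integrable_wt_totalVar hμ
  obtain ⟨c, hc⟩ := LQData.exists_norm_coeff_le hg₀ hβ hγ
  have hw := LQData.measurable_coeff hg₀_meas hβ_meas hγ_meas
  obtain ⟨K, f, C, hC, hK, hf, hb, hKc, hfc⟩ :=
    (P.μ.factorModel hμ').exists_solution P T hlam hQ hN hw hc
  obtain ⟨Γ, Λ, χ, hsol, hS, hM⟩ := LQData.exists_isMildSolution hlam hw hc hC hK hf hb hKc hfc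
  refine ⟨Γ, Λ, χ, ⟨hsol, hS⟩, fun Γ' Λ' χ' hsol' hS' => ?_, hM⟩
  obtain ⟨h1, h2, h3⟩ := hsol.ae_eq hS hlam hN hc hK hf
  obtain ⟨h1', h2', h3'⟩ := hsol'.ae_eq hS' hlam hN hc hK hf
  refine ⟨?_, ?_, ?_⟩
  · ext1 t
    refine Lp.ext ?_
    filter_upwards [h1 t, h1' t] with q g g'
    ext ij
    rw [g ij.1 ij.2, g' ij.1 ij.2]
  · ext1 t
    refine Lp.ext ?_
    filter_upwards [h2 t, h2' t] with θ g g'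
    ext i
    rw [g i, g' i]
  · ext1 t
    rw [h3 t, h3' t]
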